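/- **Setting.** Let $M$ be a complete, non-compact (connected, smooth) $N$-dimensional Riemannian manifold with Riemannian measure $\mu$, let $S=M\times(0,\infty)$, fix $x_0\in M$ and put $r(x)=\operatorname{dist}(x_0,x)$. Let $p>1$, $m\ge 1$, $q>\max(p+m-2,1)$; let $V\in L^1_{\mathrm{loc}}(S)$ with $V>0$ a.e. in $S$; let $f:[0,\infty)\to\mathbb R$ be Borel with $0\le f\le K$ for some $K>0$; let $a\in\mathrm{Lip}_{\mathrm{loc}}(M)$ with $a>0$ a.e. in $M$, and put $\mu_a=a\,\mu$. Consider the differential inequality $$\partial_t u\ \ge\ \frac1{a(x)}\,\mathrm{div}\Big(a(x)\,u^{m-1}|\nabla u|^{p-2}f(|\nabla u|)\nabla u\Big)+V(x,t)\,u^q\qquad\text{in } M\times(0,\infty). \tag{1}$$ **Weak solutions.** A measurable function $u$ on $S$ is a global nonnegative weak solution of (1) if $u\ge0$ a.e., $u\in L^q_{\mathrm{loc}}(S;V\,d\mu_a dt)$, $u$ has weak derivatives $\nabla u$, $\partial_t u$ such that $u^{p+m-1}$, $|\nabla u|^pu^{m-1}$ and $u\,\partial_tu$ belong to $L^1_{\mathrm{loc}}(S;d\mu_a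 dt)$, and for every nonnegative $\psi\in\mathrm{Lip}_{\mathrm{loc}}(S)$ with compact support in $S$ $$\int_0^\infty\!\!\int_M\psi u^qV\,d\mu_adt\ \le\ \int_0^\infty\!\!\int_M\langle\nabla\psi,\nabla u\rangle u^{m-1}|\nabla u|^{p-2}f(|\nabla u|)\,d\mu_adt-\int_0^\infty\!\!\int_M(\partial_t\psi)\,u\,d\mu_adt .$$ Here the weak derivatives are understood as follows. For every $\delta>0$ the truncation $\max(u,\delta)$ is weakly differentiable, with spatial gradient $\mathbf 1_{\{u>\delta\}}\nabla u$ on $\{a>0\}\times(0,\infty)$ and with time derivative $\mathbf 1_{\{u>\delta\}}\partial_tu$ with respect to $d\mu_a dt$ on $S$; moreover $\nabla u=0$ a.e. on $\{u=0\}$ (this is the case if $u$ itself has locally integrable weak derivatives $\nabla u$, $\partial_tu$). At points where $a$ vanishes, if there are any, the derivatives are taken in the weighted Sobolev sense: each $(x,t)\in S$ with $a(x)=0$ has a neighbourhood $O$ and locally Lipschitz functions $w_k$ with $$\int_O\Big(|w_k-u|^{p+m-1}+|\nabla w_k-\nabla u|^p\,u^{m-1}+u\,|\partial_tw_k-\partial_tu|\Big)d\mu_adt\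 \longrightarrow\ 0 .$$ **Condition HP2.** For $\theta_1,\theta_2\ge1$ and $R>0$ let $E_R=\{(x,t)\in S: r(x)^{\theta_2}+t^{\theta_1}\le R^{\theta_2}\}$ and $$\bar s_1=\tfrac{q}{q-1}\theta_2,\quad \bar s_2=\tfrac1{q-1},\quad \bar s_3=\tfrac{pq}{q-p-m+2}\theta_2,\quad \bar s_4=\tfrac{p+m-2}{q-p-m+2}.$$ There are constants $\theta_1\ge1$, $\theta_2\ge1$, $C_0>0$, $C>0$, $R_0>1$, $\epsilon_0>0$ such that for all $R>R_0$ and all $0<\epsilon<\epsilon_0$ (i) $\displaystyle\iint_{E_{2R}\setminus E_R}t^{(\theta_1-1)\left(\frac q{q-1}-\epsilon\right)}V^{-\frac1{q-1}+\epsilon}\,d\mu_adt\le C R^{\bar s_1+C_0\epsilon}(\log R)^{\bar s_2}$, (ii) $\displaystyle\iint_{E_{2R}\setminus E_R}r(x)^{(\theta_2-1)p\left(\frac q{q-p-m+2}-\epsilon\right)}V^{-\frac{p+m-2}{q-p-m+2}+\epsilon}\,d\mu_adt\le C R^{\bar s_3+C_0\epsilon}(\log R)^{\bar s_4}$, (iii)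 $\displaystyle\iint_{E_{2R}\setminus E_R}r(x)^{(\theta_2-1)p\left(\frac q{q-p-m+2}+\epsilon\right)}V^{-\frac{p+m-2}{q-p-m+2}-\epsilon}\,d\mu_adt\le C R^{\bar s_3+C_0\epsilon}(\log R)^{\bar s_4}$. **Theorem 2.** If condition HP2 holds and $u$ is a global nonnegative weak solution of (1), then $u=0$ a.e. in $M\times(0,\infty)$. -/

import Mathlib

open MeasureTheory Set Filter Topology Bundle
open scoped Manifold ContDiff ENNReal

noncomputable section

/-- `g` is the weak derivative of `w` in the direction `v` on the open set `U`. -/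
structure HasWeakDirDeriv {F : Type*} [NormedAddCommGroup F] [NormedSpace ℝ F]
    [MeasureSpace F] (U : Set F) (w g : F → ℝ) (v : F) : Prop where
  locInt : LocallyIntegrableOn w U volume
  locInt_deriv : LocallyIntegrableOn g U volume
  integral_eq : ∀ η : F → ℝ, ContDiff ℝ ∞ η → HasCompactSupport η → tsupport η ⊆ U →
    ∫ y, w y * fderiv ℝ η y v = - ∫ y, g y * η y

namespace RiemannianParabolic

/-! ### Riemannian measure and gradient -/

/-- The image at `φ⁻¹ y` of the constant vector `v` under the differential of the inverse of the
chart `φ` at `x₀`; for the basis vector `v = eᵢ` this is the coordinate vector field `∂ᵢ`. -/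
def coordVec (N : ℕ) {M : Type*} [MetricSpace M] [ChartedSpace (EuclideanSpace ℝ (Fin N)) M]
    (x₀ : M) (v y : EuclideanSpace ℝ (Fin N)) :
    TangentSpace (𝓡 N) ((extChartAt (𝓡 N) x₀).symm y) :=
  mfderiv 𝓘(ℝ, EuclideanSpace ℝ (Fin N)) (𝓡 N) (extChartAt (𝓡 N) x₀).symm y v

/-- `√(det gᵢⱼ)` in the chart at `x₀`. -/
def volDensity (N : ℕ) {M : Type*} [MetricSpace M] [ChartedSpace (EuclideanSpace ℝ (Fin N)) M]
    [RiemannianBundle (fun x : M ↦ TangentSpace (𝓡 N) x)]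
    (x₀ : M) (y : EuclideanSpace ℝ (Fin N)) : ℝ :=
  √(Matrix.det (Matrix.of fun i j : Fin N ↦
    (inner ℝ (coordVec N x₀ (EuclideanSpace.single i 1) y)
      (coordVec N x₀ (EuclideanSpace.single j 1) y) : ℝ)))

/-- The Riemannian measure of the part of `M` covered by the chart at `x₀`: the image of
`√(det gᵢⱼ) dy` under the inverse chart. -/
def chartVolume (N : ℕ) {M : Type*} [MetricSpace M] [ChartedSpace (EuclideanSpace ℝ (Fin N)) M]
    [RiemannianBundle (fun x : M ↦ TangentSpace (𝓡 N) x)]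
    [MeasurableSpace M] (x₀ : M) : Measure M :=
  ((volume.restrict (extChartAt (𝓡 N) x₀).target).withDensity
    (fun y ↦ ENNReal.ofReal (volDensity N x₀ y))).map (extChartAt (𝓡 N) x₀).symm

/-- The Riemannian measure `μ` of `M`. By the change of variables formula the measures
`chartVolume N x₀` agree on overlaps of charts, so their least upper bound is the measure on `M`
which coincides with `chartVolume N x₀` on the domain of the chart at `x₀`, for every `x₀`. -/
def riemannianVolume (N : ℕ) (M : Type*) [MetricSpace M]
    [ChartedSpace (EuclideanSpace ℝ (Fin N)) M]
    [RiemannianBundle (fun x : M ↦ TangentSpace (𝓡 N) x)]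
    [MeasurableSpace M] : Measure M :=
  ⨆ x₀ : M, chartVolume N x₀

/-- The Riemannian gradient of `h` at `x`, i.e. the vector representing the differential of `h`
(zero if `h` is not differentiable at `x`). -/
def rgrad (N : ℕ) {M : Type*} [MetricSpace M] [ChartedSpace (EuclideanSpace ℝ (Fin N)) M]
    [RiemannianBundle (fun x : M ↦ TangentSpace (𝓡 N) x)]
    (h : M → ℝ) (x : M) : TangentSpace (𝓡 N) x :=
  haveI : FiniteDimensional ℝ (TangentSpace (𝓡 N) x) :=
    inferInstanceAs (FiniteDimensional ℝ (EuclideanSpace ℝ (Fin N)))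
  haveI : CompleteSpace (TangentSpace (𝓡 N) x) := FiniteDimensional.complete ℝ _
  (InnerProductSpace.toDual ℝ (TangentSpace (𝓡 N) x)).symm
    (mfderiv (𝓡 N) 𝓘(ℝ, ℝ) h x)

/-! ### Space-time -/

/-- `S = M × (0, ∞)`, as a subset of `M × ℝ`. -/
def spaceTime (M : Type*) : Set (M × ℝ) := univ ×ˢ Ioi (0 : ℝ)

/-- The measure `dμ dt` on `S`. -/
def stMeasure (N : ℕ) (M : Type*) [MetricSpace M] [ChartedSpace (EuclideanSpace ℝ (Fin N)) M]
    [RiemannianBundle (fun x : M ↦ TangentSpace (𝓡 N) x)]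
    [MeasurableSpace M] : Measure (M × ℝ) :=
  (riemannianVolume N M).prod (volume.restrict (Ioi 0))

/-- The measure `dμ_a dt` on `S`, where `μ_a = a μ`. -/
def wstMeasure (N : ℕ) {M : Type*} [MetricSpace M] [ChartedSpace (EuclideanSpace ℝ (Fin N)) M]
    [RiemannianBundle (fun x : M ↦ TangentSpace (𝓡 N) x)]
    [MeasurableSpace M] (a : M → ℝ) : Measure (M × ℝ) :=
  ((riemannianVolume N M).withDensity fun x ↦ ENNReal.ofReal (a x)).prod (volume.restrict (Ioi 0))

/-- Locally Lipschitz functions with compact support in `S` (extended by zero to `M × ℝ`). -/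
structure IsTestFunction {M : Type*} [MetricSpace M] (ψ : M × ℝ → ℝ) : Prop where
  locallyLipschitz : LocallyLipschitz ψ
  hasCompactSupport : HasCompactSupport ψ
  tsupport_subset : tsupport ψ ⊆ spaceTime M

/-! ### Weak derivatives of `u` -/

section

variable (N : ℕ) {M : Type*} [MetricSpace M] [ChartedSpace (EuclideanSpace ℝ (Fin N)) M]
    [RiemannianBundle (fun x : M ↦ TangentSpace (𝓡 N) x)] [MeasurableSpace M]

/-- `Z` is the weak (spatial) gradient of `u ≥ 0` on the open set `{a > 0} × (0, ∞)`.

Only the truncations `max u δ`, `δ > 0`, are required to be weakly differentiable, with gradient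
`Z` on `{u > δ}` and `0` elsewhere, and `Z = 0` on `{u = 0}`. If `u` itself has a locally integrable
weak gradient, then that gradient is such a `Z`; but no integrability of `Z` near `{u = 0}` is
imposed here. In the chart `φ` at `x₀`, `Z` being the gradient of `w` means that the derivative of
`w ∘ φ⁻¹` in the direction `v` is the inner product of `Z` with the coordinate field of `v`. -/
structure IsWeakGradient (a : M → ℝ) (u : M × ℝ → ℝ)
    (Z : (z : M × ℝ) → TangentSpace (𝓡 N) z.1) : Prop where
  truncation : ∀ δ : ℝ, 0 < δ → ∀ (x₀ : M) (v : EuclideanSpace ℝ (Fin N)),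
    HasWeakDirDeriv
      {y : EuclideanSpace ℝ (Fin N) × ℝ | y.1 ∈ (extChartAt (𝓡 N) x₀).target ∧
        0 < a ((extChartAt (𝓡 N) x₀).symm y.1) ∧ 0 < y.2}
      (fun y ↦ max (u ((extChartAt (𝓡 N) x₀).symm y.1, y.2)) δ)
      (fun y ↦ {y : EuclideanSpace ℝ (Fin N) × ℝ |
          δ < u ((extChartAt (𝓡 N) x₀).symm y.1, y.2)}.indicator
        (fun y ↦ (inner ℝ (Z ((extChartAt (𝓡 N) x₀).symm y.1, y.2))
          (coordVec N x₀ v y.1) : ℝ)) y)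
      (v, 0)
  eq_zero : ∀ᵐ z ∂(stMeasure N M), u z = 0 → Z z = 0

/-- `D` is the weak time derivative of `u ≥ 0` on `S` with respect to `dμ_a dt`. As for the
gradient, only the truncations `max u δ`, `δ > 0`, are required to be weakly differentiable, with
derivative `D` on `{u > δ}` and `0` elsewhere. -/
def IsWeakTimeDeriv (a : M → ℝ) (u D : M × ℝ → ℝ) : Prop :=
  ∀ δ : ℝ, 0 < δ →
    LocallyIntegrableOn ({z | δ < u z}.indicator D) (spaceTime M) (wstMeasure N a) ∧
    ∀ η : M × ℝ → ℝ, IsTestFunction η →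
      ∫ z, max (u z) δ * deriv (fun t ↦ η (z.1, t)) z.2 ∂(wstMeasure N a) =
        - ∫ z, {z | δ < u z}.indicator D z * η z ∂(wstMeasure N a)

/-- At the points where the weight `a` vanishes (a null set), the derivatives of `u` are understood
in the sense of weighted Sobolev spaces: near such a point, `u` together with its derivatives
`Z`, `D` is a limit of locally Lipschitz functions with respect to `dμ_a dt`, in the sense of the
local quantities `u ^ (p + m - 1)`, `|∇u| ^ p u ^ (m - 1)` and `u ∂ₜu`.
This says nothing if `a` is positive everywhere. -/
def IsWeightedLimitAtZeros (a : M → ℝ) (p m : ℝ) (u : M × ℝ → ℝ)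
    (Z : (z : M × ℝ) → TangentSpace (𝓡 N) z.1) (D : M × ℝ → ℝ) : Prop :=
  ∀ z₀ ∈ spaceTime M, a z₀.1 = 0 → ∃ O ∈ 𝓝 z₀, ∃ w : ℕ → M × ℝ → ℝ,
    (∀ k, LocallyLipschitz (w k)) ∧
    Tendsto (fun k ↦ ∫⁻ z in O, ENNReal.ofReal
        (|w k z - u z| ^ (p + m - 1)
          + ‖rgrad N (fun x ↦ w k (x, z.2)) z.1 - Z z‖ ^ p * u z ^ (m - 1)
          + u z * |deriv (fun t ↦ w k (z.1, t)) z.2 - D z|) ∂(wstMeasure N a))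
      atTop (𝓝 0)

/-! ### Weak solutions -/

/-- `u` is a (global, nonnegative) weak solution of
`∂ₜu ≥ a⁻¹ div (a u^(m-1) |∇u|^(p-2) f(|∇u|) ∇u) + V u^q` in `M × (0, ∞)`,
with weak gradient `Z = ∇u` and weak time derivative `D = ∂ₜu`. -/
structure IsWeakSolutionWith (a : M → ℝ) (V : M × ℝ → ℝ) (f : ℝ → ℝ) (p q m : ℝ)
    (u : M × ℝ → ℝ) (Z : (z : M × ℝ) → TangentSpace (𝓡 N) z.1) (D : M × ℝ → ℝ) : Prop where
  aemeasurable : AEMeasurable u (stMeasure N M)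
  nonneg : ∀ᵐ z ∂(stMeasure N M), 0 ≤ u z
  isWeakGradient : IsWeakGradient N a u Z
  isWeakTimeDeriv : IsWeakTimeDeriv N a u D
  isWeightedLimit : IsWeightedLimitAtZeros N a p m u Z D
  locInt_potential : LocallyIntegrableOn (fun z ↦ u z ^ q * V z) (spaceTime M) (wstMeasure N a)
  locInt_pow : LocallyIntegrableOn (fun z ↦ u z ^ (p + m - 1)) (spaceTime M) (wstMeasure N a)
  locInt_gradient : LocallyIntegrableOn (fun z ↦ ‖Z z‖ ^ p * u z ^ (m - 1))
    (spaceTime M) (wstMeasure N a)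
  locInt_time : LocallyIntegrableOn (fun z ↦ u z * D z) (spaceTime M) (wstMeasure N a)
  inequality : ∀ ψ : M × ℝ → ℝ, IsTestFunction ψ → (∀ z, 0 ≤ ψ z) →
    ∫ z, ψ z * u z ^ q * V z ∂(wstMeasure N a) ≤
      (∫ z, (inner ℝ (rgrad N (fun x ↦ ψ (x, z.2)) z.1) (Z z) : ℝ) * u z ^ (m - 1)
        * ‖Z z‖ ^ (p - 2) * f ‖Z z‖ ∂(wstMeasure N a))
      - ∫ z, deriv (fun t ↦ ψ (z.1, t)) z.2 * u z ∂(wstMeasure N a)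

/-- `u` is a (global, nonnegative) weak solution. -/
def IsWeakSolution (a : M → ℝ) (V : M × ℝ → ℝ) (f : ℝ → ℝ) (p q m : ℝ) (u : M × ℝ → ℝ) : Prop :=
  ∃ (Z : (z : M × ℝ) → TangentSpace (𝓡 N) z.1) (D : M × ℝ → ℝ),
    IsWeakSolutionWith N a V f p q m u Z D

end

/-! ### The growth condition -/

/-- `E_R = {(x, t) ∈ S : r(x)^θ₂ + t^θ₁ ≤ R^θ₂}`, where `r(x) = dist(x₀, x)`. -/
def parabolicBall {M : Type*} [MetricSpace M] (x₀ : M) (θ₁ θ₂ R : ℝ) : Set (M × ℝ) :=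
  {z | z ∈ spaceTime M ∧ dist x₀ z.1 ^ θ₂ + z.2 ^ θ₁ ≤ R ^ θ₂}

/-- The borderline growth condition HP2 on `V` and `μ_a`. The integrals are those of nonnegative functions, with values in
`[0, ∞]`. -/
def HP2 (N : ℕ) {M : Type*} [MetricSpace M] [ChartedSpace (EuclideanSpace ℝ (Fin N)) M]
    [RiemannianBundle (fun x : M ↦ TangentSpace (𝓡 N) x)] [MeasurableSpace M]
    (x₀ : M) (a : M → ℝ) (V : M × ℝ → ℝ) (p q m : ℝ) : Prop :=
  ∃ θ₁ θ₂ C₀ C R₀ ε₀ : ℝ, 1 ≤ θ₁ ∧ 1 ≤ θ₂ ∧ 0 < C₀ ∧ 0 < C ∧ 1 < R₀ ∧ 0 < ε₀ ∧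
    ∀ R, R₀ < R → ∀ ε, 0 < ε → ε < ε₀ →
      (∫⁻ z in parabolicBall x₀ θ₁ θ₂ (2 * R) \ parabolicBall x₀ θ₁ θ₂ R,
          ENNReal.ofReal (z.2 ^ ((θ₁ - 1) * (q / (q - 1) - ε))
            * V z ^ (-(1 / (q - 1)) + ε)) ∂(wstMeasure N a)
        ≤ ENNReal.ofReal (C * R ^ (q / (q - 1) * θ₂ + C₀ * ε) * Real.log R ^ (1 / (q - 1)))) ∧
      (∫⁻ z in parabolicBall x₀ θ₁ θ₂ (2 * R) \ parabolicBall x₀ θ₁ θ₂ R,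
          ENNReal.ofReal (dist x₀ z.1 ^ ((θ₂ - 1) * p * (q / (q - p - m + 2) - ε))
            * V z ^ (-((p + m - 2) / (q - p - m + 2)) + ε)) ∂(wstMeasure N a)
        ≤ ENNReal.ofReal (C * R ^ (p * q / (q - p - m + 2) * θ₂ + C₀ * ε)
            * Real.log R ^ ((p + m - 2) / (q - p - m + 2)))) ∧
      (∫⁻ z in parabolicBall x₀ θ₁ θ₂ (2 * R) \ parabolicBall x₀ θ₁ θ₂ R,
          ENNReal.ofReal (dist x₀ z.1 ^ ((θ₂ - 1) * p * (q / (q - p - m + 2) + ε))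
            * V z ^ (-((p + m - 2) / (q - p - m + 2)) - ε)) ∂(wstMeasure N a)
        ≤ ENNReal.ofReal (C * R ^ (p * q / (q - p - m + 2) * θ₂ + C₀ * ε)
            * Real.log R ^ ((p + m - 2) / (q - p - m + 2))))

end RiemannianParabolic

end

open MeasureTheory Set Filter Topology Bundle
open scoped Manifold ContDiff ENNReal

noncomputable section

namespace RiemannianParabolic

set_option linter.unusedSectionVars false

open ENNReal (ofReal ofReal_le_ofReal ofReal_ne_top ofReal_mul ofReal_rpow_of_nonneg mul_ne_top
  rpow_ne_top_of_nonneg zero_rpow_of_pos tendsto_ofReal mul_rpow_of_nonneg ofReal_lt_ofReal_iff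
  ofReal_one ofReal_add ofReal_lt_top lintegral_mul_norm_pow_le)
open intervalIntegral (integral_eq_sub_of_hasDerivAt integral_congr integral_of_le
  norm_integral_le_of_norm_le_const tendsto_integral_filter_of_dominated_convergence
  integral_add_adjacent_intervals)
open Finset (sum_congr sum_mul)
open MeasureTheory.Measure (restrict_mono restrict_restrict restrict_univ)
open ContinuousLinearMap (lsmul)
open Function (comp_apply)
open Real Metric

variable (N : ℕ)

local notation "Ξ" => EuclideanSpace ℝ (Fin N)
local notation "ϰ" => extChartAt (𝓡 N)
local notation "Τ" => TangentSpace (𝓡 N)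

variable {M : Type*} [MetricSpace M] [ChartedSpace (EuclideanSpace ℝ (Fin N)) M]

/-- The change of coordinates from the chart at `o` to the chart at `x1`. -/
def transition (o x1 : M) : Ξ → Ξ := ϰ x1 ∘ (ϰ o).symm

/-- The map `(y, t) => (φ⁻¹ y, t)`, for the chart `φ` at `o`. -/
def chartPoint (o : M) (y : Ξ × ℝ) : M × ℝ := ((ϰ o).symm y.1, y.2)

/-- The map `(x, t) => (φ x, t)`, for the chart `φ` at `o`. -/
def pointChart (o : M) (z : M × ℝ) : Ξ × ℝ := (ϰ o z.1, z.2)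

/-- The domain of `chartPoint`. -/
def chartDom (o : M) : Set (Ξ × ℝ) := (ϰ o).target ×ˢ Ioi 0

/-- The range of `chartPoint`. -/
def chartRng (o : M) : Set (M × ℝ) := (ϰ o).source ×ˢ Ioi 0

variable [RiemannianBundle (fun x : M => TangentSpace (𝓡 N) x)]

local notation "ϗ" i:max => EuclideanSpace.single i (1 : ℝ)
local notation "∇" ψ:max z:max => rgrad N (fun x => ψ (x, Prod.snd z)) (Prod.fst z)
local notation "∂ₜ" ψ:max z:max => deriv (fun t => ψ (Prod.fst z, t)) (Prod.snd z)

/-- The Gram matrix `gᵢⱼ` in the chart at `o`. -/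
def gram (o : M) (y : Ξ) : Matrix (Fin N) (Fin N) ℝ :=
  Matrix.of fun i j : Fin N => (inner ℝ (coordVec N o (ϗ i) y) (coordVec N o (ϗ j) y) : ℝ)

/-- The Riemannian scalar product at `x`, on vectors of the model space. -/
def fiberInner (x : M) (v w : Ξ) : ℝ := inner ℝ (show Τ x from v) (show Τ x from w)

/-- The measure `dμ_a dt` in the chart at `o`. -/
def chartMeasure (a : M → ℝ) (o : M) : Measure (Ξ × ℝ) :=
  (volume.restrict (chartDom N o)).withDensity fun y =>
    ofReal (a ((ϰ o).symm y.1) * volDensity N o y.1)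

/-- The density of `dμ_a dt` in the chart at `o`. -/
def chartDensity (a : M → ℝ) (o : M) (y : Ξ × ℝ) : ℝ := a ((ϰ o).symm y.1) * volDensity N o y.1

/-- The integrand of the weak inequality tested with `ζ H(u)`, after integration by parts in
time. -/
def testIntegrand (V : M × ℝ → ℝ) (f : ℝ → ℝ) (p q m : ℝ) (u : M × ℝ → ℝ) (Z : (z : M × ℝ) → Τ z.1)
  (H H' : ℝ → ℝ) (ζ : M × ℝ → ℝ) (z : M × ℝ) : ℝ :=
  H (u z) * ((inner ℝ (∇ ζ z) (Z z) : ℝ) * u z ^ (m - 1) * ‖Z z‖ ^ (p - 2) * f ‖Z z‖)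
    + H' (u z) * (ζ z * (‖Z z‖ ^ p * u z ^ (m - 1) * f ‖Z z‖))
    - (∫ x in (0 : ℝ)..u z, H x) * ∂ₜ ζ z
    - H (u z) * (ζ z * (u z ^ q * V z))

/-- The components of the vector field `X` in all charts are measurable on `O`. -/
def IsChartMeasurable (O : Set (M × ℝ)) (X : (z : M × ℝ) → Τ z.1) : Prop :=
  ∀ (o : M) (v : Ξ), AEStronglyMeasurable (fun y : Ξ × ℝ =>
      (inner ℝ (X (chartPoint N o y)) (coordVec N o v y.1) : ℝ))
    (volume.restrict (chartDom N o ∩ chartPoint N o ⁻¹' O))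

variable [MeasurableSpace M]

/-- Locally Lipschitz approximations `ψ k` of `H(u)` on `O`. -/
structure LocalApprox (a : M → ℝ) (p m : ℝ) (u D : M × ℝ → ℝ) (Z : (z : M × ℝ) → Τ z.1)
  (H H' : ℝ → ℝ) (B : ℝ) (O : Set (M × ℝ)) (ψ : ℕ → M × ℝ → ℝ) : Prop where
  lip : ∀ k, LocallyLipschitzOn O (ψ k)
  nonneg : ∀ k z, 0 ≤ ψ k z
  le : ∀ k z, ψ k z ≤ B
  tendsto : ∀ᵐ z ∂((wstMeasure N a).restrict O), Tendsto (fun k => ψ k z) atTop (𝓝 (H (u z)))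
  grad : Tendsto (fun k => ∫⁻ z in O, ofReal
    (‖∇ (ψ k) z - H' (u z) • Z z‖ ^ p * u z ^ (m - 1)) ∂(wstMeasure N a))
    atTop (𝓝 0)
  time : Tendsto (fun k => ∫⁻ z in O, ofReal
    (min (u z) 1 * |∂ₜ (ψ k) z - H' (u z) * D z|) ∂(wstMeasure N a))
    atTop (𝓝 0)

/-- A nonnegative weak solution together with the standing assumptions on the coefficients. -/
structure RegularSolution (a : M → ℝ) (V : M × ℝ → ℝ) (f : ℝ → ℝ) (p q m K : ℝ)
  (u : M × ℝ → ℝ) (Z : (z : M × ℝ) → Τ z.1) (D : M × ℝ → ℝ) : Prop where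
  sol : IsWeakSolutionWith N a V f p q m u Z D
  nonneg : ∀ z, 0 ≤ u z
  lip : LocallyLipschitz a
  weight_pos : ∀ᵐ x ∂(riemannianVolume N M), 0 < a x
  p_gt : 1 < p
  m_ge : 1 ≤ m
  q_gt : p + m - 2 < q
  q_gt_one : 1 < q
  measurable_flux : Measurable f
  flux_nonneg : ∀ s, 0 ≤ s → 0 ≤ f s
  flux_le : ∀ s, 0 ≤ s → f s ≤ K
  V_pos : ∀ᵐ z ∂(wstMeasure N a), 0 < V z

/-- A test function `ζ` with values in `[0, 1]`, whose derivatives are controlled by the weights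
`X` and `T` times the power `1 - (1 - b) / p` of `ζ`. -/
structure IsControlled (p b : ℝ) (ζ X T : M × ℝ → ℝ) : Prop where
  test : IsTestFunction ζ
  nonneg : ∀ z, 0 ≤ ζ z
  le_one : ∀ z, ζ z ≤ 1
  X_nonneg : ∀ z, 0 ≤ X z
  T_nonneg : ∀ z, 0 ≤ T z
  X_meas : Measurable X
  T_meas : Measurable T
  bound : ∃ B, ∀ z, ζ z ≠ 0 → X z ≤ B ∧ T z ≤ B
  grad : ∀ z, ‖∇ ζ z‖ ≤ X z * ζ z ^ (1 - (1 - b) / p)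
  time : ∀ z, -∂ₜ ζ z ≤ T z * ζ z ^ (1 - (1 - b) / p)

variable {N} [IsManifold (𝓡 N) ∞ M]
  [IsContMDiffRiemannianBundle (𝓡 N) ∞ (EuclideanSpace ℝ (Fin N)) (fun x : M => TangentSpace (𝓡 N) x)]
  [IsRiemannianManifold (𝓡 N) M] [BorelSpace M] [SecondCountableTopology M]
  {a : M → ℝ} {V : M × ℝ → ℝ} {f : ℝ → ℝ} {p q m K : ℝ} {u D : M × ℝ → ℝ}
  {Z : (z : M × ℝ) → TangentSpace (𝓡 N) z.1}

local notation "Ϝ" => M × ℝ → ℝ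
local notation "Φ" => chartPoint N
local notation "ϖ" => wstMeasure N a
local notation "Ϟ" => RegularSolution N a V f p q m K u Z D
local notation "𝔣" ψ:max z:max => inner ℝ (∇ ψ z) (Z z) * u z ^ (m - 1) * ‖Z z‖ ^ (p - 2) * f ‖Z z‖
local notation "ϵ" z:max => ‖Z z‖ ^ p * u z ^ (m - 1) * f ‖Z z‖

lemma isOpen_chartTarget (o : M) : IsOpen (ϰ o).target := isOpen_extChartAt_target o

lemma contMDiffOn_coordVec (o : M) (v : Ξ) : ContMDiffOn 𝓘(ℝ, Ξ) (𝓡 N).tangent ∞ (fun y => (⟨(ϰ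
  o).symm y, coordVec N o v y⟩ : TangentBundle (𝓡 N) M)) (ϰ o).target := by
  have h1 := contMDiffOn_extChartAt_symm (I := 𝓡 N) (n := ∞) o
  have hu : UniqueMDiffOn 𝓘(ℝ, Ξ) (ϰ o).target := (isOpen_chartTarget o).uniqueMDiffOn
  have h2 := h1.contMDiffOn_tangentMapWithin (m := ∞) (by simp) hu
  have h3 : ContMDiff 𝓘(ℝ, Ξ) 𝓘(ℝ, Ξ).tangent ∞ (fun y : Ξ => (⟨y, v⟩ : TangentBundle 𝓘(ℝ, Ξ)
        Ξ)) := by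
    exact (contMDiff_vectorSpace_iff_contDiff (V := fun _ => v)).2 contDiff_const
  have h4 := h2.comp h3.contMDiffOn (s := (ϰ o).target) (fun y hy => hy)
  refine h4.congr fun y hy => ?_; simp only [comp_apply, tangentMapWithin, coordVec]
  rw [mfderivWithin_of_isOpen (isOpen_chartTarget o) hy]

lemma contDiffOn_inner_coordVec (o : M) (v w : Ξ) :
  ContDiffOn ℝ ∞ (fun y => (inner ℝ (coordVec N o v y) (coordVec N o w y) : ℝ)) (ϰ o).target := by
  rw [← contMDiffOn_iff_contDiffOn]
  exact (contMDiffOn_coordVec o v).inner_bundle (contMDiffOn_coordVec o w)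

lemma coordVec_smul (o : M) (c : ℝ) (v y : Ξ) : coordVec N o (c • v) y = c • coordVec N o v y := by
  unfold coordVec; exact map_smul _ _ _

lemma coordVec_eq_sum (o : M) (v y : Ξ) : coordVec N o v y = ∑ i, v i • coordVec N o (ϗ i) y := by
  have h : v = ∑ i, v i • EuclideanSpace.single i (1 : ℝ) := by
    ext j; simp [Finset.sum_apply, Pi.single_apply]
  let L : Ξ →L[ℝ] Τ ((ϰ o).symm y) := mfderiv 𝓘(ℝ, Ξ) (𝓡 N) (ϰ o).symm y
  change L v = ∑ i, v i • L (ϗ i)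
  conv_lhs => rw [h]
  simp only [map_sum, map_smul]

lemma mfderiv_chart_coordVec (o : M) (v : Ξ) {y : Ξ} (hy : y ∈ (ϰ o).target) :
  mfderiv (𝓡 N) 𝓘(ℝ, Ξ) (ϰ o) ((ϰ o).symm y) (coordVec N o v y) = v := by
  have hs : (ϰ o).symm y ∈ (chartAt Ξ o).source := by
    have := (ϰ o).map_target hy; rwa [extChartAt_source] at this
  have h1 : MDifferentiableAt (𝓡 N) 𝓘(ℝ, Ξ) (ϰ o) ((ϰ o).symm y) := mdifferentiableAt_extChartAt hs
  have h2 : MDifferentiableAt 𝓘(ℝ, Ξ) (𝓡 N) (ϰ o).symm y :=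
    ((contMDiffOn_extChartAt_symm (I := 𝓡 N) (n := ∞) o).contMDiffAt
      ((isOpen_chartTarget o).mem_nhds hy)).mdifferentiableAt (by simp)
  have h3 := mfderiv_comp y h1 h2; have h4 : ((ϰ o) ∘ (ϰ o).symm) =ᶠ[𝓝 y] id := by
    filter_upwards [(isOpen_chartTarget o).mem_nhds hy] with z hz; exact (ϰ o).right_inv hz
  rw [h4.mfderiv_eq, mfderiv_id] at h3; exact (congrArg (fun L => L v) h3).symm

lemma exists_coordVec_eq (o : M) {y : Ξ} (hy : y ∈ (ϰ o).target)
  (w : Τ ((ϰ o).symm y)) : ∃ v, coordVec N o v y = w := by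
  let L : Ξ →ₗ[ℝ] Ξ := (mfderiv 𝓘(ℝ, Ξ) (𝓡 N) (ϰ o).symm y).toLinearMap
  have hL : Function.Injective L := fun v v' h => by
    have h1 := mfderiv_chart_coordVec o v hy; have h2 := mfderiv_chart_coordVec o v' hy
    have h3 : coordVec N o v y = coordVec N o v' y := h; rw [h3] at h1; exact h1.symm.trans h2
  exact (LinearMap.surjective_of_injective hL) w

lemma inner_rgrad (h : M → ℝ) (x : M) (w : Τ x) :
  (inner ℝ (rgrad N h x) w : ℝ) = mfderiv (𝓡 N) 𝓘(ℝ, ℝ) h x w := by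
  have : FiniteDimensional ℝ (Τ x) := inferInstanceAs (FiniteDimensional ℝ Ξ)
  have : CompleteSpace (Τ x) := FiniteDimensional.complete ℝ _; unfold rgrad
  exact InnerProductSpace.toDual_symm_apply

lemma inner_rgrad_coordVec (h : M → ℝ) (o : M) (v : Ξ) {y : Ξ} (hy : y ∈ (ϰ o).target) :
  (inner ℝ (rgrad N h ((ϰ o).symm y)) (coordVec N o v y) : ℝ) = fderiv ℝ (h ∘ (ϰ o).symm) y v := by
  rw [inner_rgrad]; have h2 : MDifferentiableAt 𝓘(ℝ, Ξ) (𝓡 N) (ϰ o).symm y :=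
    ((contMDiffOn_extChartAt_symm (I := 𝓡 N) (n := ∞) o).contMDiffAt
      ((isOpen_chartTarget o).mem_nhds hy)).mdifferentiableAt (by simp)
  by_cases hd : MDifferentiableAt (𝓡 N) 𝓘(ℝ, ℝ) h ((ϰ o).symm y)
  · rw [← mfderiv_eq_fderiv, mfderiv_comp y hd h2]
    rfl
  · rw [mfderiv_zero_of_not_mdifferentiableAt hd, fderiv_zero_of_not_differentiableAt]
    · rfl
    · intro hc; apply hd; have h1 : MDifferentiableAt (𝓡 N) 𝓘(ℝ, Ξ) (ϰ o) ((ϰ o).symm y) := by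
        apply mdifferentiableAt_extChartAt; have := (ϰ o).map_target hy
        rwa [extChartAt_source] at this
      have e := (ϰ o).right_inv hy
      have h3 : MDifferentiableAt 𝓘(ℝ, Ξ) 𝓘(ℝ, ℝ) (h ∘ (ϰ o).symm) ((ϰ o) ((ϰ o).symm y)) := by
        rw [e]; exact hc.mdifferentiableAt
      refine (h3.comp _ h1).congr_of_eventuallyEq ?_
      filter_upwards [(isOpen_extChartAt_source (I := 𝓡 N) o).mem_nhds
        ((ϰ o).map_target hy)] with z hz
      simp only [comp_apply]; rw [(ϰ o).left_inv hz]

lemma inner_coordVec_eq_gram (o : M) (v w y : Ξ) :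
  (inner ℝ (coordVec N o v y) (coordVec N o w y) : ℝ) = ∑ i, ∑ j, v i * w j * gram N o y i j := by
  rw [coordVec_eq_sum o v, coordVec_eq_sum o w, sum_inner]
  refine sum_congr rfl fun i _ => ?_; rw [inner_sum]; refine sum_congr rfl fun j _ => ?_
  rw [real_inner_smul_left, real_inner_smul_right, gram, Matrix.of_apply]; ring

lemma contDiffOn_gram (o : M) (i j : Fin N) :
  ContDiffOn ℝ ∞ (fun y => gram N o y i j) (ϰ o).target :=
  contDiffOn_inner_coordVec o _ _

lemma continuousOn_norm_coordVec (o : M) : ContinuousOn (fun z : Ξ × Ξ =>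
    ‖coordVec N o z.2 z.1‖) ((ϰ o).target ×ˢ univ) := by
  have h : ContinuousOn (fun z : Ξ × Ξ =>
      √(∑ i, ∑ j, z.2 i * z.2 j * gram N o z.1 i j))
      ((ϰ o).target ×ˢ univ) := by
    refine ContinuousOn.sqrt ?_
    refine continuousOn_finsetSum _ fun i _ => continuousOn_finsetSum _ fun j _ => ?_
    refine ContinuousOn.mul (by fun_prop) ?_
    exact (contDiffOn_gram o i j).continuousOn.comp continuousOn_fst fun z hz => hz.1
  refine h.congr fun z _ => ?_; beta_reduce
  rw [← inner_coordVec_eq_gram, real_inner_self_eq_norm_sq, sqrt_sq (norm_nonneg _)]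

lemma coordVec_ne_zero (o : M) {v y : Ξ}
  (hy : y ∈ (ϰ o).target) (hv : v ≠ 0) : coordVec N o v y ≠ 0 := by
  intro h; apply hv; have h1 := mfderiv_chart_coordVec o v hy; rw [h] at h1
  exact h1.symm.trans (map_zero _)

lemma exists_norm_coordVec_bounds (o : M) {K : Set Ξ} (hK : IsCompact K) (hKt : K ⊆ (ϰ o).target) :
  ∃ C : ℝ, 0 < C ∧ ∀ y ∈ K, ∀ v, ‖coordVec N o v y‖ ≤ C * ‖v‖ ∧ ‖v‖ ≤ C * ‖coordVec N o v y‖ := by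
  have hS : IsCompact (K ×ˢ sphere (0 : Ξ) 1) := hK.prod (isCompact_sphere _ _)
  have hc := (continuousOn_norm_coordVec o).mono (prod_mono hKt (subset_univ (sphere (0 : Ξ) 1)))
  have hne : ∀ z ∈ K ×ˢ sphere (0 : Ξ) 1, ‖coordVec N o z.2 z.1‖ ≠ 0 := fun z hz => by
    rw [norm_ne_zero_iff]; exact coordVec_ne_zero o (hKt hz.1) (ne_of_mem_sphere hz.2 one_ne_zero)
  obtain ⟨C1, h1⟩ := hS.exists_bound_of_continuousOn hc
  obtain ⟨C2, h2⟩ := hS.exists_bound_of_continuousOn (hc.inv₀ hne)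
  have key : ∀ y ∈ K, ∀ v : Ξ, v ≠ 0 →
      ‖coordVec N o v y‖ = ‖v‖ * ‖coordVec N o (‖v‖⁻¹ • v) y‖ := fun y hy v hv => by
    rw [coordVec_smul, norm_smul, norm_inv, norm_norm, ← mul_assoc,
      mul_inv_cancel₀ (norm_ne_zero_iff.2 hv), one_mul]
  refine ⟨max (max C1 C2) 1, by positivity, fun y hy v => ?_⟩; by_cases hv : v = 0
  · have h0 : coordVec N o (0 : Ξ) y = 0 := by
      have := coordVec_smul o 0 (0 : Ξ) y; rwa [zero_smul, zero_smul] at this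
    rw [hv, norm_eq_zero.2 h0, norm_zero]; simp
  have hz : (y, ‖v‖⁻¹ • v) ∈ K ×ˢ sphere (0 : Ξ) 1 := by
    refine ⟨hy, ?_⟩; simp [norm_smul, inv_mul_cancel₀ (norm_ne_zero_iff.2 hv)]
  have e1 := h1 _ hz; have e2 := h2 _ hz; have e3 := hne _ hz
  simp only [norm_norm, norm_inv, Pi.inv_apply] at e1 e2 e3; rw [key y hy v hv]
  have p0 : 0 < ‖v‖ := norm_pos_iff.2 hv
  have p1 : 0 < ‖coordVec N o (‖v‖⁻¹ • v) y‖ := lt_of_le_of_ne (norm_nonneg _) (Ne.symm e3)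
  constructor
  · rw [mul_comm]; gcongr; exact e1.trans ((le_max_left _ _).trans (le_max_left _ _))
  · have : 1 ≤ max (max C1 C2) 1 * ‖coordVec N o (‖v‖⁻¹ • v) y‖ := by
      refine (inv_mul_cancel₀ e3).symm.le.trans ?_; gcongr
      exact e2.trans ((le_max_right _ _).trans (le_max_left _ _))
    calc ‖v‖ = ‖v‖ * 1 := (mul_one _).symm
      _ ≤ ‖v‖ * (max (max C1 C2) 1 * ‖coordVec N o (‖v‖⁻¹ • v) y‖) := by gcongr
      _ = _ := by ring

lemma posDef_gram (o : M) {y : Ξ} (hy : y ∈ (ϰ o).target) : (gram N o y).PosDef := by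
  refine Matrix.PosDef.of_dotProduct_mulVec_pos ?_ fun v hv => ?_
  · ext i j; simp only [gram, Matrix.conjTranspose_apply, Matrix.of_apply, star_trivial]
    exact real_inner_comm _ _
  · have h := inner_coordVec_eq_gram o (WithLp.toLp 2 v) (WithLp.toLp 2 v) y
    have hp : 0 < (inner ℝ (coordVec N o (WithLp.toLp 2 v) y)
        (coordVec N o (WithLp.toLp 2 v) y) : ℝ) := by
      rw [real_inner_self_eq_norm_sq]
      have := coordVec_ne_zero o hy (v := WithLp.toLp 2 v) (by simpa using hv); positivity
    rw [h] at hp; refine hp.trans_eq ?_; unfold dotProduct Matrix.mulVec dotProduct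
    simp only [star_trivial, Finset.mul_sum]
    refine sum_congr rfl fun i _ => sum_congr rfl fun j _ => ?_; ring

lemma volDensity_pos (o : M) {y : Ξ} (hy : y ∈ (ϰ o).target) : 0 < volDensity N o y :=
  sqrt_pos.2 (posDef_gram o hy).det_pos

lemma contDiffOn_det_gram (o : M) : ContDiffOn ℝ ∞ (fun y => (gram N o y).det) (ϰ o).target := by
  simp only [Matrix.det_apply']; refine ContDiffOn.sum fun σ _ => contDiffOn_const.mul ?_
  exact contDiffOn_prod fun i _ => contDiffOn_gram o _ _

lemma contDiffOn_volDensity (o : M) : ContDiffOn ℝ ∞ (volDensity N o) (ϰ o).target :=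
  (contDiffOn_det_gram o).sqrt fun _ hy => (posDef_gram o hy).det_pos.ne'

lemma edist_chart_symm_le (o : M) {y y' : Ξ} (h : segment ℝ y y' ⊆ (ϰ o).target) {C : ℝ≥0∞}
  (hC : ∀ z ∈ segment ℝ y y', ‖coordVec N o (y' - y) z‖ₑ ≤ C) :
  edist ((ϰ o).symm y) ((ϰ o).symm y') ≤ C := by
  let η := ContinuousAffineMap.lineMap (R := ℝ) y y'
  set γ := (ϰ o).symm ∘ η; have hη' : ∀ t ∈ Icc (0 : ℝ) 1, η t ∈ segment ℝ y y' := fun t ht => by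
    rw [segment_eq_image_lineMap]; exact ⟨t, ht, rfl⟩
  have hη : Icc (0 : ℝ) 1 ⊆ ⇑η ⁻¹' (ϰ o).target := fun t ht => h (hη' t ht)
  have η_smooth : ContMDiffOn 𝓘(ℝ, ℝ) 𝓘(ℝ, Ξ) 1 η (Icc 0 1) := by
    apply ContMDiff.contMDiffOn; rw [contMDiff_iff_contDiff]; exact ContinuousAffineMap.contDiff _
  rw [IsRiemannianManifold.out (I := 𝓡 N)]; have h1 : Manifold.riemannianEDist (𝓡 N) ((ϰ o).symm y)
      ((ϰ o).symm y') ≤ Manifold.pathELength (𝓡 N) γ 0 1 := by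
    apply Manifold.riemannianEDist_le_pathELength _ _ _ zero_le_one
    · exact ((contMDiffOn_extChartAt_symm (I := 𝓡 N) (n := ∞) o).of_le (by simp)).comp η_smooth hη
    · simp [γ, η, ContinuousAffineMap.coe_lineMap_eq]
    · simp [γ, η, ContinuousAffineMap.coe_lineMap_eq]
  refine h1.trans ?_; rw [Manifold.pathELength_eq_lintegral_mfderiv_Icc]
  calc _ ≤ ∫⁻ _ in Icc (0 : ℝ) 1, C := by
        apply setLIntegral_mono' measurableSet_Icc fun t ht => ?_
        have h2 : MDifferentiableAt 𝓘(ℝ, Ξ) (𝓡 N) (ϰ o).symm (η t) :=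
          ((contMDiffOn_extChartAt_symm (I := 𝓡 N) (n := ∞) o).contMDiffAt
            ((isOpen_chartTarget o).mem_nhds (hη ht))).mdifferentiableAt (by simp)
        have hd : HasDerivAt η (y' - y) t := by
          have := (AffineMap.hasDerivAt_lineMap (a := y) (b := y') (x := t))
          exact this
        have h3 : MDifferentiableAt 𝓘(ℝ, ℝ) 𝓘(ℝ, Ξ) η t := hd.differentiableAt.mdifferentiableAt
        have h4 := mfderiv_comp t h2 h3
        have h5 : mfderiv 𝓘(ℝ, ℝ) (𝓡 N) γ t 1 = coordVec N o (y' - y) (η t) := by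
          have h6 := congrArg (fun L => L 1) h4; refine h6.trans ?_
          have h7 : mfderiv 𝓘(ℝ, ℝ) 𝓘(ℝ, Ξ) η t (1 : ℝ) = y' - y := by
            rw [mfderiv_eq_fderiv]; have := hd.hasFDerivAt.fderiv
            rw [this]; exact one_smul ℝ (y' - y)
          exact congrArg _ h7
        rw [h5]; exact hC _ (hη' t ht)
    _ = C := by simp

/-- The inverse of a chart is locally Lipschitz for the Riemannian distance. -/
lemma locallyLipschitzOn_chart_symm (o : M) : LocallyLipschitzOn (ϰ o).target (ϰ o).symm := by
  intro y hy
  obtain ⟨r, hr, hrt⟩ := nhds_basis_closedBall.mem_iff.1 ((isOpen_chartTarget o).mem_nhds hy)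
  obtain ⟨C, hC, hb⟩ := exists_norm_coordVec_bounds o (isCompact_closedBall y r) hrt
  refine ⟨C.toNNReal, closedBall y r,
    mem_nhdsWithin_of_mem_nhds (closedBall_mem_nhds y hr), fun z hz z' hz' => ?_⟩
  have hseg : segment ℝ z z' ⊆ closedBall y r := (convex_closedBall y r).segment_subset hz hz'
  refine edist_chart_symm_le o (hseg.trans hrt) fun w hw => ?_
  rw [edist_comm, edist_dist, dist_eq_norm, ← ofReal_norm]
  have : ((C.toNNReal : NNReal) : ℝ≥0∞) = ofReal C := rfl; rw [this, ← ofReal_mul hC.le]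
  exact ofReal_le_ofReal (hb w (hseg hw) _).1

/-- The Riemannian gradient is bounded by any local Lipschitz constant. -/
lemma norm_rgrad_le {h : M → ℝ} {x : M} {C : ℝ} (hC : 0 ≤ C)
  (hh : ∀ C' > C, ∀ᶠ y in 𝓝 x, |h y - h x| ≤ C' * dist y x) : ‖rgrad N h x‖ ≤ C := by
  set y := ϰ x x with hy_def; have hy : y ∈ (ϰ x).target := mem_extChartAt_target x
  have hyx : (ϰ x).symm y = x := extChartAt_to_inv x
  have key : ∀ v : Ξ, fderiv ℝ (h ∘ (ϰ x).symm) y v ≤ C * ‖coordVec N x v y‖ := by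
    intro v; by_cases hd : DifferentiableAt ℝ (h ∘ (ϰ x).symm) y
    swap
    · rw [fderiv_zero_of_not_differentiableAt hd]; exact mul_nonneg hC (norm_nonneg _)
    have hbound : ∀ C' > C, ∀ B > ‖coordVec N x v y‖, fderiv ℝ (h ∘ (ϰ x).symm) y v ≤ C' * B := by
      intro C' hC' B hB; have hlim : Tendsto (fun t : ℝ => t⁻¹ • ((h ∘ (ϰ x).symm) (y + t • v)
          - (h ∘ (ϰ x).symm) y)) (𝓝[>] 0)
          (𝓝 (fderiv ℝ (h ∘ (ϰ x).symm) y v)) :=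
        (hd.hasFDerivAt.hasLineDerivAt v).tendsto_slope_zero_right
      refine le_of_tendsto hlim ?_; have hcont : ContinuousAt (fun z => ‖coordVec N x v z‖) y := by
        have h1 := (continuousOn_norm_coordVec x).continuousAt (x := (y, v))
          (prod_mem_nhds ((isOpen_chartTarget x).mem_nhds hy) univ_mem)
        exact h1.comp (f := fun z : Ξ => (z, v)) (by fun_prop)
      obtain ⟨r, hr, hrt⟩ := nhds_basis_ball.mem_iff.1
        (inter_mem ((isOpen_chartTarget x).mem_nhds hy) (hcont.eventually_lt_const hB))
      have hline : ContinuousAt (fun t : ℝ => y + t • v) 0 := by fun_prop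
      have e1 : ∀ᶠ t : ℝ in 𝓝[>] 0, y + t • v ∈ ball y r :=
        nhdsWithin_le_nhds (hline.preimage_mem_nhds (by simpa using ball_mem_nhds y hr))
      have hcs : ContinuousAt (fun t : ℝ => (ϰ x).symm (y + t • v)) 0 := by
        refine ContinuousAt.comp (g := (ϰ x).symm) ?_ hline
        have := continuousAt_extChartAt_symm (I := 𝓡 N) x
        simpa only [zero_smul, add_zero] using this
      have e2 : ∀ᶠ t : ℝ in 𝓝[>] 0, |h ((ϰ x).symm (y + t • v)) - h x| ≤
          C' * dist ((ϰ x).symm (y + t • v)) x := by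
        have hcs' : Tendsto (fun t : ℝ => (ϰ x).symm (y + t • v)) (𝓝 0) (𝓝 x) := by
          have h0 := hcs.tendsto; rwa [zero_smul, add_zero, hyx] at h0
        exact (hcs'.eventually (hh C' hC')).filter_mono nhdsWithin_le_nhds
      filter_upwards [e1, e2, self_mem_nhdsWithin] with t ht1 ht2 (ht : 0 < t)
      simp only [comp_apply, hyx, smul_eq_mul]
      have hdist : dist x ((ϰ x).symm (y + t • v)) ≤ t * B := by
        have hseg : segment ℝ y (y + t • v) ⊆ ball y r :=
          (convex_ball y r).segment_subset (mem_ball_self hr) ht1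
        have hB0 : 0 ≤ B := (norm_nonneg _).trans hB.le
        have := edist_chart_symm_le x (y := y) (y' := y + t • v) (C := ofReal (t * B))
          (fun z hz => (hrt (hseg hz)).1) (fun z hz => by
            rw [add_sub_cancel_left, coordVec_smul, ← ofReal_norm]; refine ofReal_le_ofReal ?_
            rw [norm_smul, norm_of_nonneg ht.le]; have := (hrt (hseg hz)).2
            simp only [mem_ofPred_eq] at this; gcongr)
        rw [hyx, edist_dist] at this; exact (ENNReal.ofReal_le_ofReal_iff (by positivity)).1 this
      have hC0 : 0 ≤ C' := hC.trans hC'.le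
      calc t⁻¹ * (h ((ϰ x).symm (y + t • v)) - h x) ≤ t⁻¹ * (C' * (t * B)) := by
            gcongr; refine (le_abs_self _).trans (ht2.trans ?_); rw [dist_comm]; gcongr
        _ = C' * B := by field_simp
    have hb2 : ∀ C' > C, fderiv ℝ (h ∘ (ϰ x).symm) y v ≤ C' * ‖coordVec N x v y‖ := fun C' hC' => by
      refine ge_of_tendsto (f := fun B => C' * B) (x := 𝓝[>] ‖coordVec N x v y‖) ?_ ?_
      · exact ((continuous_const_mul C').tendsto _).mono_left nhdsWithin_le_nhds
      · filter_upwards [self_mem_nhdsWithin] with B hB using hbound C' hC' B hB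
    refine ge_of_tendsto (f := fun C' => C' * ‖coordVec N x v y‖) (x := 𝓝[>] C) ?_ ?_
    · exact ((continuous_mul_const _).tendsto _).mono_left nhdsWithin_le_nhds
    · filter_upwards [self_mem_nhdsWithin] with C' hC' using hb2 C' hC'
  have h2 : ‖rgrad N h ((ϰ x).symm y)‖ ≤ C := by
    obtain ⟨v, hv⟩ := exists_coordVec_eq x hy (rgrad N h ((ϰ x).symm y)); have h3 := key v
    rw [← inner_rgrad_coordVec h x v hy, hv, real_inner_self_eq_norm_sq] at h3
    by_contra hlt
    push Not at hlt
    nlinarith [norm_nonneg (rgrad N h ((ϰ x).symm y))]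
  rwa [hyx] at h2

lemma exists_enorm_mfderiv_chart_le (o : M) {K : Set Ξ} (hK : IsCompact K) (hKt : K ⊆ (ϰ o).target)
  : ∃ C : NNReal, ∀ x ∈ (ϰ o).source, ϰ o x ∈ K → ∀ w : Τ x, ∀ v : Ξ, v = mfderiv (𝓡 N) 𝓘(ℝ, Ξ) (ϰ
  o) x w → ‖v‖ₑ ≤ C * ‖w‖ₑ := by
  obtain ⟨C, hC, hb⟩ := exists_norm_coordVec_bounds o hK hKt
  refine ⟨C.toNNReal, fun x hx hxK w v hv => ?_⟩
  obtain ⟨y, hy, rfl⟩ : ∃ y ∈ (ϰ o).target, (ϰ o).symm y = x :=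
    ⟨_, (ϰ o).map_source hx, (ϰ o).left_inv hx⟩
  rw [(ϰ o).right_inv hy] at hxK; obtain ⟨v', rfl⟩ := exists_coordVec_eq o hy w
  have hvv : v = v' := hv.trans (mfderiv_chart_coordVec o v' hy); subst hvv
  rw [← ofReal_norm, ← ofReal_norm]; have : ((C.toNNReal : NNReal) : ℝ≥0∞) = ofReal C := rfl
  rw [this, ← ofReal_mul hC.le]; exact ofReal_le_ofReal (hb y hxK v).2

lemma edist_le_pathELength {γ : ℝ → M} (hγ : ContMDiff 𝓘(ℝ, ℝ) (𝓡 N) 1 γ) {s t : ℝ}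
  (hst : s ≤ t) : edist (γ s) (γ t) ≤ Manifold.pathELength (𝓡 N) γ s t := by
  rw [IsRiemannianManifold.out (I := 𝓡 N)]
  exact Manifold.riemannianEDist_le_pathELength hγ.contMDiffOn rfl rfl hst

lemma exists_path_length_lt {x y : M} {r : ℝ≥0∞} (h : edist x y < r) : ∃ γ : ℝ → M, γ 0 = x ∧ γ 1 =
  y ∧ ContMDiff 𝓘(ℝ, ℝ) (𝓡 N) 1 γ ∧ Manifold.pathELength (𝓡 N) γ 0 1 < r := by
  rw [IsRiemannianManifold.out (I := 𝓡 N)] at h; obtain ⟨γ, h0, h1, h2, h3, -⟩ :=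
    Manifold.exists_lt_locally_constant_of_riemannianEDist_lt h zero_lt_one
  exact ⟨γ, h0, h1, h2, h3⟩

/-- A chart is locally Lipschitz for the Riemannian distance. -/
lemma locallyLipschitzOn_chart (o : M) : LocallyLipschitzOn (ϰ o).source (ϰ o) := by
  intro x hx; obtain ⟨r, hr, hrt⟩ := nhds_basis_closedBall.mem_iff.1
    ((isOpen_chartTarget o).mem_nhds ((ϰ o).map_source hx))
  obtain ⟨C, hC⟩ := exists_enorm_mfderiv_chart_le o (isCompact_closedBall _ r) hrt
  have hcont : ContinuousAt (ϰ o) x := continuousAt_extChartAt' hx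
  obtain ⟨ρ, hρ, hρU⟩ := nhds_basis_ball.mem_iff.1 (inter_mem
    ((isOpen_extChartAt_source (I := 𝓡 N) o).mem_nhds hx)
    (hcont.preimage_mem_nhds (closedBall_mem_nhds _ hr)))
  refine ⟨C, ball x (ρ / 3), mem_nhdsWithin_of_mem_nhds (ball_mem_nhds _ (by positivity)),
    fun z hz z' hz' => ?_⟩
  have hzz : edist z z' < ofReal (2 * (ρ / 3)) := by
    rw [edist_dist]; refine (ofReal_lt_ofReal_iff (by positivity)).2 ?_
    calc dist z z' ≤ dist z x + dist z' x := dist_triangle_right _ _ _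
      _ < 2 * (ρ / 3) := by
        have := mem_ball.1 hz; have := mem_ball.1 hz'; linarith
  have main : ∀ d : ℝ≥0∞, edist z z' < d → d ≤ ofReal (2 * (ρ / 3)) →
      edist (ϰ o z) (ϰ o z') ≤ C * d := by
    intro d hd hdρ; obtain ⟨γ, h0, h1, γ_smooth, hl⟩ := exists_path_length_lt (N := N) hd
    have hmem : ∀ t ∈ Icc (0 : ℝ) 1, γ t ∈ ball x ρ := by
      intro t ht; have h2 : edist (γ 0) (γ t) < ofReal (2 * (ρ / 3)) :=
        ((edist_le_pathELength γ_smooth ht.1).trans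
          (Manifold.pathELength_mono le_rfl ht.2)).trans_lt (hl.trans_le hdρ)
      rw [h0, edist_dist, ofReal_lt_ofReal_iff (by positivity)] at h2; rw [mem_ball]
      have h3 := dist_triangle (γ t) z x; rw [dist_comm (γ t) z] at h3; have := mem_ball.1 hz
      linarith
    let γ' := ϰ o ∘ γ
    have hsrc : ∀ t ∈ Icc (0 : ℝ) 1, γ t ∈ (chartAt Ξ o).source := fun t ht => by
        have := (hρU (hmem t ht)).1; rwa [extChartAt_source] at this
    have hC1 : ContMDiffOn 𝓘(ℝ, ℝ) 𝓘(ℝ, Ξ) 1 γ' (Icc 0 1) :=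
      ((contMDiffOn_extChartAt (I := 𝓡 N) (n := ∞) (x := o)).of_le (by simp)).comp
        γ_smooth.contMDiffOn hsrc
    rw [edist_comm, edist_eq_enorm_sub]
    calc ‖ϰ o z' - ϰ o z‖ₑ = ‖γ' 1 - γ' 0‖ₑ := by simp [γ', h0, h1]
      _ ≤ ∫⁻ t' in Icc 0 1, ‖derivWithin γ' (Icc 0 1) t'‖ₑ := by
          apply enorm_sub_le_lintegral_derivWithin_Icc_of_contDiffOn_Icc _ zero_le_one
          rwa [← contMDiffOn_iff_contDiffOn]
      _ ≤ ∫⁻ t' in Icc 0 1, C * ‖mfderivWithin 𝓘(ℝ, ℝ) (𝓡 N) γ (Icc 0 1) t' 1‖ₑ := by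
          apply setLIntegral_mono' measurableSet_Icc (fun t' ht' => ?_)
          refine hC _ (hρU (hmem t' ht')).1 (hρU (hmem t' ht')).2 _ _ ?_
          have h2 : mfderivWithin 𝓘(ℝ, ℝ) 𝓘(ℝ, Ξ) γ' (Icc 0 1) t' =
              (mfderiv (𝓡 N) 𝓘(ℝ, Ξ) (ϰ o) (γ t')) ∘L
                (mfderivWithin 𝓘(ℝ, ℝ) (𝓡 N) γ (Icc 0 1) t') := by
            apply mfderiv_comp_mfderivWithin
            · exact mdifferentiableAt_extChartAt (hsrc t' ht')
            · exact (γ_smooth.mdifferentiable one_ne_zero).mdifferentiableOn _ ht'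
            · rw [uniqueMDiffWithinAt_iff_uniqueDiffWithinAt]
              exact uniqueDiffOn_Icc zero_lt_one _ ht'
          have h3 := congrArg (fun L => L (1 : ℝ)) h2; refine Eq.trans ?_ h3
          rw [mfderivWithin_eq_fderivWithin, ← fderivWithin_derivWithin]
          rfl
      _ = C * Manifold.pathELength (𝓡 N) γ 0 1 := by
          rw [lintegral_const_mul' _ _ ENNReal.coe_ne_top,
            Manifold.pathELength_eq_lintegral_mfderivWithin_Icc]
      _ ≤ C * d := by gcongr
  have hne : (𝓝[>] (edist z z')).NeBot := nhdsGT_neBot_of_exists_gt ⟨_, hzz⟩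
  refine ge_of_tendsto (f := fun d : ℝ≥0∞ => (C : ℝ≥0∞) * d) (x := 𝓝[>] (edist z z')) ?_ ?_
  · exact (ENNReal.Tendsto.const_mul tendsto_id (Or.inr ENNReal.coe_ne_top)).mono_left
      nhdsWithin_le_nhds
  · filter_upwards [Ioo_mem_nhdsGT hzz] with d hd using main d hd.1 hd.2.le

lemma exists_dist_le_of_le_dist [IsRiemannianManifold (𝓡 N) M] (x y : M) {s ε : ℝ} (hs : 0 ≤ s) (hsd : s ≤ dist x y)
  (hε : 0 < ε) : ∃ z, dist x z ≤ s ∧ dist z y ≤ dist x y - s + ε := by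
  have h : edist x y < ofReal (dist x y + ε) := by
    rw [edist_dist]; exact (ofReal_lt_ofReal_iff (by positivity)).2 (by linarith)
  obtain ⟨γ, h0, h1, γ_smooth, hl⟩ := exists_path_length_lt (N := N) h
  have hc : ContinuousOn (fun t => dist x (γ t)) (Icc 0 1) :=
    (continuous_const.dist γ_smooth.continuous).continuousOn
  obtain ⟨t, ht, hts⟩ := intermediate_value_Icc zero_le_one hc
    (show s ∈ Icc (dist x (γ 0)) (dist x (γ 1)) by simp [h0, h1, hs, hsd])
  refine ⟨γ t, hts.le, ?_⟩; have e := Manifold.pathELength_add (I := 𝓡 N) (γ := γ) ht.1 ht.2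
  have h2 : edist x (γ t) + edist (γ t) y < ofReal (dist x y + ε) := by
    refine lt_of_le_of_lt ?_ hl; rw [← e]
    conv_lhs => rw [← h0, ← h1]
    exact add_le_add (edist_le_pathELength γ_smooth ht.1) (edist_le_pathELength γ_smooth ht.2)
  rw [edist_dist, edist_dist, ← ofReal_add dist_nonneg dist_nonneg,
    ofReal_lt_ofReal_iff (by positivity)] at h2
  simp only at hts; linarith

/-- Closed balls of a complete Riemannian manifold are compact. -/
lemma isCompact_closedBall_of_complete [IsRiemannianManifold (𝓡 N) M] [CompleteSpace M] (x : M)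
  (r : ℝ) : IsCompact (closedBall x r) := by
  have : LocallyCompactSpace M := Manifold.locallyCompact_of_finiteDimensional (𝓡 N)
  by_contra hr
  set S := {s : ℝ | 0 ≤ s ∧ IsCompact (closedBall x s)} with hS
  have h0 : (0 : ℝ) ∈ S := ⟨le_rfl, by simp⟩
  have hub : ∀ s ∈ S, s ≤ r := fun s hs => by
    by_contra hlt
    exact hr (hs.2.of_isClosed_subset isClosed_closedBall
      (closedBall_subset_closedBall (not_le.1 hlt).le))
  have hbdd : BddAbove S := ⟨r, hub⟩
  set R := sSup S with hR; have hR0 : 0 ≤ R := le_csSup hbdd h0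
  have hcpt : IsCompact (closedBall x R) := by
    refine TotallyBounded.isCompact_of_isClosed ?_ isClosed_closedBall
    refine totallyBounded_iff.2 fun ε hε => ?_
    obtain ⟨s, hs, hsR⟩ := exists_lt_of_lt_csSup ⟨0, h0⟩ (show R - ε / 4 < sSup S by linarith)
    obtain ⟨t, ht, hcov⟩ := totallyBounded_iff.1 hs.2.totallyBounded (ε / 2) (by positivity)
    refine ⟨t, ht, fun y hy => ?_⟩; have hz : ∃ z ∈ closedBall x s, dist z y ≤ ε / 2 := by
      rw [mem_closedBall, dist_comm] at hy; rcases le_total (dist x y) s with h | h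
      · exact ⟨y, by rwa [mem_closedBall, dist_comm], by simp; positivity⟩
      · obtain ⟨z, hz1, hz2⟩ := exists_dist_le_of_le_dist (N := N) x y hs.1 h
          (show 0 < ε / 4 by positivity)
        exact ⟨z, by rwa [mem_closedBall, dist_comm], by linarith⟩
    obtain ⟨z, hz, hzy⟩ := hz; obtain ⟨c, hc, hzc⟩ := mem_iUnion₂.1 (hcov hz)
    refine mem_iUnion₂.2 ⟨c, hc, ?_⟩; rw [mem_ball] at hzc ⊢; have := dist_triangle y z c
    rw [dist_comm y z] at this; linarith
  obtain ⟨K', hK', hKK'⟩ := exists_compact_superset hcpt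
  obtain ⟨δ, hδ, hδK⟩ := hcpt.exists_cthickening_subset_open isOpen_interior hKK'
  have hmem : R + δ / 2 ∈ S := by
    refine ⟨by positivity, hK'.of_isClosed_subset isClosed_closedBall fun y hy => ?_⟩
    refine interior_subset (hδK ?_); rw [mem_closedBall, dist_comm] at hy
    rcases le_total (dist x y) R with h | h
    · exact self_subset_cthickening _ (by rwa [mem_closedBall, dist_comm])
    · obtain ⟨z, hz1, hz2⟩ := exists_dist_le_of_le_dist (N := N) x y hR0 h (show 0 < δ / 2 by positivity)
      refine mem_cthickening_of_dist_le y z δ _ (by rwa [mem_closedBall, dist_comm]) ?_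
      rw [dist_comm]; linarith
  have := le_csSup hbdd hmem; linarith

lemma differentiableAt_transition (o x1 : M) {y : Ξ} (hy : y ∈ (ϰ o).target) (hy1 : (ϰ o).symm y ∈
  (ϰ x1).source) : DifferentiableAt ℝ (transition N o x1) y := by
  rw [← mdifferentiableAt_iff_differentiableAt]
  have h2 : MDifferentiableAt 𝓘(ℝ, Ξ) (𝓡 N) (ϰ o).symm y :=
    ((contMDiffOn_extChartAt_symm (I := 𝓡 N) (n := ∞) o).contMDiffAt
      ((isOpen_chartTarget o).mem_nhds hy)).mdifferentiableAt (by simp)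
  have h1 : MDifferentiableAt (𝓡 N) 𝓘(ℝ, Ξ) (ϰ x1) ((ϰ o).symm y) :=
    mdifferentiableAt_extChartAt (by rwa [extChartAt_source] at hy1)
  exact h1.comp y h2

lemma inner_coordVec_transition (o x1 : M) {y : Ξ} (hy : y ∈ (ϰ o).target) (hy1 : (ϰ o).symm y ∈ (ϰ
  x1).source) (v w : Ξ) : (inner ℝ (coordVec N o v y) (coordVec N o w y) : ℝ) = inner ℝ (coordVec N
  x1 (fderiv ℝ (transition N o x1) y v) (transition N o x1 y)) (coordVec N x1 (fderiv ℝ (transition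
  N o x1) y w) (transition N o x1 y)) := by
  have hτ : transition N o x1 y ∈ (ϰ x1).target := (ϰ x1).map_source hy1
  have h2 : MDifferentiableAt 𝓘(ℝ, Ξ) (𝓡 N) (ϰ x1).symm (transition N o x1 y) :=
    ((contMDiffOn_extChartAt_symm (I := 𝓡 N) (n := ∞) x1).contMDiffAt
      ((isOpen_chartTarget x1).mem_nhds hτ)).mdifferentiableAt (by simp)
  have hd := (differentiableAt_transition o x1 hy hy1).mdifferentiableAt
  have h3 := mfderiv_comp y h2 hd; have hcont : ContinuousAt (ϰ o).symm y :=
    (continuousOn_extChartAt_symm o).continuousAt ((isOpen_chartTarget o).mem_nhds hy)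
  have h4 : ((ϰ x1).symm ∘ transition N o x1) =ᶠ[𝓝 y] (ϰ o).symm := by
    filter_upwards [hcont.preimage_mem_nhds
      ((isOpen_extChartAt_source (I := 𝓡 N) x1).mem_nhds hy1)] with z hz
    exact (ϰ x1).left_inv hz
  have h5 := h4.mfderiv_eq (I := 𝓘(ℝ, Ξ)) (I' := 𝓡 N); have h6 : ∀ v : Ξ, (coordVec N o v y : Ξ) =
      coordVec N x1 (fderiv ℝ (transition N o x1) y v) (transition N o x1 y) := by
    intro v; have h7 := congrArg (fun L => L v) (h5.symm.trans h3); refine h7.trans ?_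
    rw [mfderiv_eq_fderiv]
    rfl
  change fiberInner N ((ϰ o).symm y) (coordVec N o v y) (coordVec N o w y) =
    fiberInner N ((ϰ x1).symm (transition N o x1 y))
      (coordVec N x1 (fderiv ℝ (transition N o x1) y v) (transition N o x1 y))
        (coordVec N x1 (fderiv ℝ (transition N o x1) y w) (transition N o x1 y))
  rw [← h6 v, ← h6 w]; congr 1; exact h4.eq_of_nhds.symm

lemma volDensity_transition (o x1 : M) {y : Ξ} (hy : y ∈ (ϰ o).target) (hy1 : (ϰ o).symm y ∈ (ϰ
  x1).source) : |(fderiv ℝ (transition N o x1) y).det| * volDensity N x1 (transition N o x1 y) =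
  volDensity N o y := by
  set J : Matrix (Fin N) (Fin N) ℝ := Matrix.of fun i j =>
    (fderiv ℝ (transition N o x1) y (ϗ j)) i with hJ
  have hdet : (fderiv ℝ (transition N o x1) y).det = J.det := by
    have h1 : LinearMap.toMatrix (EuclideanSpace.basisFun (Fin N) ℝ).toBasis
        (EuclideanSpace.basisFun (Fin N) ℝ).toBasis
        (fderiv ℝ (transition N o x1) y).toLinearMap = J := by
      ext i j; simp [LinearMap.toMatrix_apply, hJ]
    rw [← h1, LinearMap.det_toMatrix]
  have hG : gram N o y = J.transpose * gram N x1 (transition N o x1 y) * J := by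
    ext i j; have h1 : gram N o y i j = _ := inner_coordVec_transition o x1 hy hy1 (ϗ i) (ϗ j)
    rw [h1, inner_coordVec_eq_gram]
    simp only [Matrix.mul_apply, Matrix.transpose_apply, sum_mul, hJ, Matrix.of_apply]
    rw [Finset.sum_comm]; refine sum_congr rfl fun k _ => sum_congr rfl fun l _ => ?_; ring
  have hv : ∀ (x : M) (z : Ξ), volDensity N x z = √((gram N x z).det) := fun _ _ => rfl
  rw [hv, hv, hG, hdet, Matrix.det_mul, Matrix.det_mul, Matrix.det_transpose,
    show J.det * (gram N x1 (transition N o x1 y)).det * J.det =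
      J.det ^ 2 * (gram N x1 (transition N o x1 y)).det by ring,
    sqrt_mul (sq_nonneg _), sqrt_sq_eq_abs]

lemma _root_.ContinuousOn.measurableSet_inter_preimage {X Y : Type*} [TopologicalSpace X]
  [MeasurableSpace X] [OpensMeasurableSpace X] [TopologicalSpace Y] [MeasurableSpace Y]
  [BorelSpace Y] {f : X → Y} {s : Set X} (hf : ContinuousOn f s) (hs : MeasurableSet s)
  {t : Set Y} (ht : MeasurableSet t) : MeasurableSet (s ∩ f ⁻¹' t) := by
  have h1 : Measurable (s.domRestrict f) := (continuousOn_iff_continuous_domRestrict.1 hf).measurable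
  have h2 := (hs.subtype_image (h1 ht))
  convert h2 using 1; ext x; simp [and_comm]

lemma measurableSet_chartTarget (o : M) : MeasurableSet (ϰ o).target :=
  (isOpen_chartTarget o).measurableSet

lemma chartVolume_apply (o : M) {s : Set M} (hs : MeasurableSet s) :
  chartVolume N o s = ∫⁻ y in (ϰ o).target ∩ (ϰ o).symm ⁻¹' s, ofReal (volDensity N o y) := by
  have hm := measurableSet_chartTarget (N := N) o
  have hae : AEMeasurable (ϰ o).symm ((volume.restrict (ϰ o).target).withDensity
        (fun y => ofReal (volDensity N o y))) :=
    ((continuousOn_extChartAt_symm o).aemeasurable hm).mono_ac (withDensity_absolutelyContinuous _ _)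
  have hms := (continuousOn_extChartAt_symm (I := 𝓡 N) o).measurableSet_inter_preimage hm hs
  rw [chartVolume, Measure.map_apply_of_aemeasurable hae hs, withDensity_apply',
    Measure.restrict_restrict' hm, inter_comm]

lemma chartVolume_eq_of_subset (o x1 : M) {s : Set M} (hs : MeasurableSet s) (h0 : s ⊆ (ϰ o).source)
  (h1 : s ⊆ (ϰ x1).source) : chartVolume N x1 s = chartVolume N o s := by
  rw [chartVolume_apply x1 hs, chartVolume_apply o hs]
  set A0 := (ϰ o).target ∩ (ϰ o).symm ⁻¹' s with hA0
  set A1 := (ϰ x1).target ∩ (ϰ x1).symm ⁻¹' s with hA1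
  have hm0 : MeasurableSet A0 := (continuousOn_extChartAt_symm o).measurableSet_inter_preimage
    (measurableSet_chartTarget o) hs
  have himg : transition N o x1 '' A0 = A1 := by
    ext z; constructor
    · rintro ⟨y, ⟨hy, hys⟩, rfl⟩; refine ⟨(ϰ x1).map_source (h1 hys), ?_⟩
      change (ϰ x1).symm (ϰ x1 ((ϰ o).symm y)) ∈ s; rw [(ϰ x1).left_inv (h1 hys)]; exact hys
    · rintro ⟨hz, hzs⟩; refine ⟨ϰ o ((ϰ x1).symm z), ⟨(ϰ o).map_source (h0 hzs), ?_⟩, ?_⟩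
      · change (ϰ o).symm (ϰ o ((ϰ x1).symm z)) ∈ s; rw [(ϰ o).left_inv (h0 hzs)]; exact hzs
      · change ϰ x1 ((ϰ o).symm (ϰ o ((ϰ x1).symm z))) = z
        rw [(ϰ o).left_inv (h0 hzs), (ϰ x1).right_inv hz]
  have hinj : InjOn (transition N o x1) A0 := by
    intro y hy y' hy' h; have h2 := (ϰ x1).injOn (h1 hy.2) (h1 hy'.2) h
    exact (ϰ o).symm.injOn hy.1 hy'.1 h2
  rw [← himg, lintegral_image_eq_lintegral_abs_det_fderiv_mul volume hm0
    (fun y hy => (differentiableAt_transition o x1 hy.1 (h1 hy.2)).hasFDerivAt.hasFDerivWithinAt)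
    hinj]
  refine setLIntegral_congr_fun hm0 fun y hy => ?_; beta_reduce
  rw [← ofReal_mul (abs_nonneg _), volDensity_transition o x1 hy.1 (h1 hy.2)]

lemma chartVolume_source_compl (o : M) : chartVolume N o (ϰ o).sourceᶜ = 0 := by
  rw [chartVolume_apply o (isOpen_extChartAt_source o).measurableSet.compl]
  have : (ϰ o).target ∩ (ϰ o).symm ⁻¹' (ϰ o).sourceᶜ = ∅ := by
    ext y
    simp only [mem_inter_iff, mem_preimage, mem_compl_iff, mem_empty_iff_false, iff_false, not_and,
      not_not]
    exact fun hy => (ϰ o).map_target hy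
  rw [this]; simp

lemma riemannianVolume_restrict (o : M) :
  (riemannianVolume N M).restrict (ϰ o).source = chartVolume N o := by
  have hm : MeasurableSet (ϰ o).source := (isOpen_extChartAt_source o).measurableSet
  have hself : (chartVolume N o).restrict (ϰ o).source = chartVolume N o :=
    Measure.restrict_eq_self_of_ae_mem (by rw [ae_iff]; exact chartVolume_source_compl o)
  refine le_antisymm ?_ ?_
  · have hle : riemannianVolume N M ≤ chartVolume N o + (⊤ : Measure M).restrict (ϰ o).sourceᶜ := by
      refine iSup_le fun x1 => Measure.le_iff.2 fun s hs => ?_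
      have hm1 : MeasurableSet (ϰ x1).source := (isOpen_extChartAt_source x1).measurableSet
      rw [← measure_inter_add_sdiff s hm, Measure.add_apply]; refine add_le_add ?_ ?_
      · have h1 : chartVolume N x1 (s ∩ (ϰ o).source) ≤
            chartVolume N x1 (s ∩ (ϰ o).source ∩ (ϰ x1).source) := by
          rw [← measure_inter_add_sdiff (s ∩ (ϰ o).source) hm1]
          have : chartVolume N x1 ((s ∩ (ϰ o).source) \ (ϰ x1).source) = 0 :=
            measure_mono_null (fun x hx => hx.2) (chartVolume_source_compl x1)
          rw [this, add_zero]
        refine h1.trans ?_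
        rw [chartVolume_eq_of_subset o x1 ((hs.inter hm).inter hm1) (fun x hx => hx.1.2)
          (fun x hx => hx.2)]
        exact measure_mono fun x hx => hx.1.1
      · rw [Measure.restrict_apply hs]; exact (Measure.le_iff'.1 le_top _)
    calc (riemannianVolume N M).restrict (ϰ o).source
        ≤ (chartVolume N o + (⊤ : Measure M).restrict (ϰ o).sourceᶜ).restrict
          (ϰ o).source := restrict_mono le_rfl hle
      _ = chartVolume N o := by rw [Measure.restrict_add, hself, restrict_restrict hm]; simp
  · conv_lhs => rw [← hself]
    exact restrict_mono le_rfl (le_iSup (fun x1 => chartVolume N x1) o)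

instance instIsLocallyFiniteMeasure_riemannianVolume :
  IsLocallyFiniteMeasure (riemannianVolume N M) := by
  refine ⟨fun x => ?_⟩; obtain ⟨r, hr, hrt⟩ := nhds_basis_closedBall.mem_iff.1
    ((isOpen_chartTarget x).mem_nhds (mem_extChartAt_target (I := 𝓡 N) x))
  set U := (ϰ x).source ∩ (ϰ x) ⁻¹' closedBall (ϰ x x) r with hU
  have hms : MeasurableSet (ϰ x).source := (isOpen_extChartAt_source x).measurableSet
  have hUm : MeasurableSet U := (continuousOn_extChartAt x).measurableSet_inter_preimage hms
    isClosed_closedBall.measurableSet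
  refine ⟨U, inter_mem (extChartAt_source_mem_nhds x)
    ((continuousAt_extChartAt x).preimage_mem_nhds (closedBall_mem_nhds _ hr)), ?_⟩
  have h1 : riemannianVolume N M U = chartVolume N x U := by
    rw [← riemannianVolume_restrict x, Measure.restrict_apply hUm,
      inter_eq_left.2 (inter_subset_left : U ⊆ _)]
  rw [h1, chartVolume_apply x hUm]
  have hsub : (ϰ x).target ∩ (ϰ x).symm ⁻¹' U ⊆ closedBall (ϰ x x) r := fun y hy => by
    have h2 : ϰ x ((ϰ x).symm y) ∈ closedBall (ϰ x x) r := hy.2.2; rwa [(ϰ x).right_inv hy.1] at h2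
  refine (lintegral_mono_set hsub).trans_lt ?_
  have hvi : IntegrableOn (volDensity N x) (closedBall (ϰ x x) r) :=
    ((contDiffOn_volDensity x).continuousOn.mono hrt).integrableOn_compact
      (isCompact_closedBall _ _)
  refine lt_of_le_of_lt (lintegral_mono fun y => ?_) hvi.2; exact ofReal_le_enorm _

lemma isOpen_chartDom (o : M) : IsOpen (chartDom N o) := (isOpen_chartTarget o).prod isOpen_Ioi

lemma isOpen_chartRng (o : M) : IsOpen (chartRng N o) :=
  (isOpen_extChartAt_source o).prod isOpen_Ioi

lemma chartPoint_mem {o : M} {y : Ξ × ℝ} (hy : y ∈ chartDom N o) :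
  Φ o y ∈ chartRng N o := ⟨(ϰ o).map_target hy.1, hy.2⟩

lemma pointChart_mem {o : M} {z : M × ℝ} (hz : z ∈ chartRng N o) :
  pointChart N o z ∈ chartDom N o := ⟨(ϰ o).map_source hz.1, hz.2⟩

lemma chartPoint_pointChart {o : M} {z : M × ℝ} (hz : z ∈ chartRng N o) :
  Φ o (pointChart N o z) = z :=
  Prod.ext ((ϰ o).left_inv hz.1) rfl

lemma pointChart_chartPoint {o : M} {y : Ξ × ℝ}
  (hy : y ∈ chartDom N o) : pointChart N o (Φ o y) = y :=
  Prod.ext ((ϰ o).right_inv hy.1) rfl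

lemma continuousOn_chartPoint (o : M) : ContinuousOn (Φ o) (chartDom N o) :=
  ((continuousOn_extChartAt_symm o).comp continuousOn_fst fun _ hy => hy.1).prodMk continuousOn_snd

lemma continuousOn_pointChart (o : M) : ContinuousOn (pointChart N o) (chartRng N o) :=
  ((continuousOn_extChartAt o).comp continuousOn_fst fun _ hz => hz.1).prodMk continuousOn_snd

lemma aemeasurable_chartPoint (a : M → ℝ) (o : M) : AEMeasurable (Φ o) (chartMeasure N a o) :=
  ((continuousOn_chartPoint o).aemeasurable (isOpen_chartDom o).measurableSet).mono_ac
    (withDensity_absolutelyContinuous _ _)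

lemma stMeasure_eq_wstMeasure : stMeasure N M = wstMeasure N (fun _ : M => (1 : ℝ)) := by
  simp only [stMeasure, wstMeasure, ofReal_one]
  rw [show (fun _ : M => (1 : ℝ≥0∞)) = 1 from rfl, withDensity_one]

lemma isLocallyFiniteMeasure_weighted (ha : Continuous a) :
  IsLocallyFiniteMeasure ((riemannianVolume N M).withDensity fun x => ofReal (a x)) :=
  IsLocallyFiniteMeasure.withDensity_ofReal ha

lemma wstMeasure_restrict (ha : Continuous a) (o : M) : (ϖ).restrict (chartRng N o) =
    (chartMeasure N a o).map (Φ o) := by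
  have hms : MeasurableSet (ϰ o).source := (isOpen_extChartAt_source o).measurableSet
  have hmt := measurableSet_chartTarget (N := N) o
  have hloc := isLocallyFiniteMeasure_weighted (N := N) ha
  classical
  set g : Ξ → M := (ϰ o).target.piecewise (ϰ o).symm (fun _ => o) with hg
  have hgm : Measurable g := by
    refine measurable_of_restrict_of_restrict_compl hmt ?_ ?_
    · have : (ϰ o).target.domRestrict g = (ϰ o).target.domRestrict (ϰ o).symm := by
        ext y; simp only [hg, domRestrict_apply]; exact piecewise_eq_of_mem _ _ _ y.2
      rw [this]
      exact (continuousOn_iff_continuous_domRestrict.1 (continuousOn_extChartAt_symm o)).measurable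
    · have : (ϰ o).targetᶜ.domRestrict g = fun _ => o := by
        ext y; have := y.2; simp only [mem_compl_iff] at this; simp only [hg, domRestrict_apply]
        exact piecewise_eq_of_notMem _ _ _ this
      rw [this]; exact measurable_const
  set κ : Measure Ξ := (volume.restrict (ϰ o).target).withDensity
      (fun y => ofReal (a (g y) * volDensity N o y)) with hκ
  have hvd : AEMeasurable (fun y => ofReal (volDensity N o y)) (volume.restrict (ϰ o).target) :=
    ((contDiffOn_volDensity o).continuousOn.aemeasurable hmt).ennreal_ofReal
  have hvda : AEMeasurable (fun y => ofReal (a (g y) * volDensity N o y))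
      (volume.restrict (ϰ o).target) :=
    ((ha.measurable.comp hgm).aemeasurable.mul
      ((contDiffOn_volDensity o).continuousOn.aemeasurable hmt)).ennreal_ofReal
  have hgeq : ∀ y ∈ (ϰ o).target, g y = (ϰ o).symm y := fun y hy => piecewise_eq_of_mem _ _ _ hy
  have hae : ∀ᵐ y ∂(volume.restrict (ϰ o).target), g y = (ϰ o).symm y :=
    (ae_restrict_iff' hmt).2 (ae_of_all _ hgeq)
  have h1 : ((riemannianVolume N M).withDensity fun x => ofReal (a x)).restrict
      (ϰ o).source = κ.map g := by
    rw [restrict_withDensity hms, riemannianVolume_restrict, chartVolume,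
      ← Measure.map_congr (withDensity_absolutelyContinuous _ _ hae)]
    ext s hs
    rw [withDensity_apply _ hs, Measure.map_apply hgm hs, hκ, withDensity_apply _ (hgm hs),
      setLIntegral_map hs (by fun_prop) hgm,
      setLIntegral_withDensity_eq_setLIntegral_mul_non_measurable₀ _ hvd.restrict _ (hgm hs)]
    · refine lintegral_congr fun y => ?_; simp only [Pi.mul_apply]
      rw [mul_comm, ENNReal.ofReal_mul' (show 0 ≤ volDensity N o y from sqrt_nonneg _)]
    · exact ae_of_all _ fun y => ofReal_lt_top
  have hsf : SFinite κ := by infer_instance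
  have h2 : (ϖ).restrict (chartRng N o) = (κ.map g).prod (volume.restrict (Ioi 0)) := by
    rw [← h1, wstMeasure, chartRng, ← Measure.prod_restrict, restrict_restrict
      measurableSet_Ioi, inter_self]
  rw [h2]; have h3 : (κ.map g).prod (volume.restrict (Ioi (0 : ℝ))) =
      (κ.prod (volume.restrict (Ioi 0))).map (Prod.map g id) := by
    rw [← Measure.map_prod_map _ _ hgm measurable_id, Measure.map_id]
  rw [h3, hκ, prod_withDensity_left₀ hvda, Measure.prod_restrict]
  have hden : chartMeasure N a o = (volume.restrict (chartDom N o)).withDensity fun y =>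
      ofReal (a (g y.1) * volDensity N o y.1) := by
    refine withDensity_congr_ae ?_
    refine (ae_restrict_iff' (isOpen_chartDom o).measurableSet).2 (ae_of_all _ fun y hy => ?_)
    simp only [hgeq y.1 hy.1]
  rw [hden]; refine Measure.map_congr (withDensity_absolutelyContinuous _ _ ?_)
  refine (ae_restrict_iff' (isOpen_chartDom o).measurableSet).2 (ae_of_all _ fun y hy => ?_)
  simp only [Prod.map, chartPoint, hgeq y.1 hy.1, id]

lemma aemeasurable_pointChart (o : M) (ν : Measure (M × ℝ)) :
  AEMeasurable (pointChart N o) (ν.restrict (chartRng N o)) :=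
  (continuousOn_pointChart o).aemeasurable (isOpen_chartRng o).measurableSet

lemma ae_mem_chartDom (a : M → ℝ) (o : M) : ∀ᵐ y ∂(chartMeasure N a o), y ∈ chartDom N o :=
  withDensity_absolutelyContinuous _ _ (ae_restrict_mem (isOpen_chartDom o).measurableSet)

lemma chartMeasure_eq_map (ha : Continuous a) (o : M) : chartMeasure N a o =
    ((ϖ).restrict (chartRng N o)).map (pointChart N o) := by
  have h := aemeasurable_pointChart (N := N) o ϖ; rw [wstMeasure_restrict ha] at h ⊢
  rw [AEMeasurable.map_map_of_aemeasurable h (aemeasurable_chartPoint a o)]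
  conv_lhs => rw [← Measure.map_id (μ := chartMeasure N a o)]
  refine Measure.map_congr ?_; filter_upwards [ae_mem_chartDom a o] with y hy
  simp [pointChart_chartPoint hy]

lemma isLocallyFiniteMeasure_wstMeasure (ha : Continuous a) : IsLocallyFiniteMeasure ϖ := by
  have hloc := isLocallyFiniteMeasure_weighted (N := N) ha; unfold wstMeasure; infer_instance

/-- Rademacher's theorem for locally Lipschitz functions on an open set. -/
lemma _root_.LocallyLipschitzOn.ae_differentiableAt {F G : Type*} [NormedAddCommGroup F]
  [NormedSpace ℝ F] [FiniteDimensional ℝ F] [MeasurableSpace F] [BorelSpace F] [NormedAddCommGroup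
  G] [NormedSpace ℝ G] [FiniteDimensional ℝ G] (μ : Measure F) [μ.IsAddHaarMeasure] {f : F → G} {W :
  Set F} (hW : IsOpen W) (hf : LocallyLipschitzOn W f) : ∀ᵐ y ∂(μ.restrict W), DifferentiableAt ℝ f
  y := by
  rw [ae_restrict_iff' hW.measurableSet, ae_iff]
  refine measure_null_of_locally_null _ fun y hy => ?_
  simp only [mem_ofPred_eq, Classical.not_imp] at hy; obtain ⟨K, t, ht, hK⟩ := hf hy.1
  rw [hW.nhdsWithin_eq hy.1] at ht; obtain ⟨r, hr, hrt⟩ := nhds_basis_ball.mem_iff.1 ht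
  have h1 := (hK.mono hrt).ae_differentiableWithinAt_of_mem (μ := μ)
  refine ⟨_, inter_mem_nhdsWithin _ (ball_mem_nhds y hr), ?_⟩; rw [ae_iff] at h1
  refine measure_mono_null (fun z hz => ?_) h1
  simp only [mem_ofPred_eq, Classical.not_imp, mem_inter_iff] at hz ⊢
  exact ⟨hz.2, fun h => hz.1.2 (h.differentiableAt (isOpen_ball.mem_nhds hz.2))⟩

lemma _root_.LocallyLipschitzOn.comp_of_mapsTo {X Y Z : Type*} [PseudoEMetricSpace X]
  [PseudoEMetricSpace Y] [PseudoEMetricSpace Z] {g : Y → Z} {f : X → Y} {s : Set X} {t : Set Y}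
  (hg : LocallyLipschitzOn t g) (hf : LocallyLipschitzOn s f) (h : MapsTo f s t) :
  LocallyLipschitzOn s (g ∘ f) := by
  intro x hx; obtain ⟨K, v, hv, hK⟩ := hg (h hx); obtain ⟨K', w, hw, hK'⟩ := hf hx
  refine ⟨K * K', w ∩ (f ⁻¹' v), inter_mem hw ?_, ?_⟩
  · exact (hf.continuousOn x hx).tendsto_nhdsWithin h hv
  · exact hK.comp (hK'.mono inter_subset_left) fun z hz => hz.2

lemma _root_.LocallyLipschitzOn.prodMk' {X Y Z : Type*} [PseudoEMetricSpace X] [PseudoEMetricSpace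
  Y] [PseudoEMetricSpace Z] {f : X → Y} {g : X → Z} {s : Set X} (hf : LocallyLipschitzOn s f) (hg :
  LocallyLipschitzOn s g) : LocallyLipschitzOn s (fun x => (f x, g x)) := by
  intro x hx; obtain ⟨K, v, hv, hK⟩ := hf hx; obtain ⟨K', w, hw, hK'⟩ := hg hx
  refine ⟨max K K', v ∩ w, inter_mem hv hw, fun y hy z hz => ?_⟩
  rw [Prod.edist_eq, ENNReal.coe_max]
  refine max_le ((hK hy.1 hz.1).trans ?_) ((hK' hy.2 hz.2).trans ?_)
  · gcongr; exact le_max_left _ _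
  · gcongr; exact le_max_right _ _

lemma mdifferentiableAt_of_chart {h : M → ℝ} {o : M} {y : Ξ} (hy : y ∈ (ϰ o).target) (hc :
  DifferentiableAt ℝ (h ∘ (ϰ o).symm) y) : MDifferentiableAt (𝓡 N) 𝓘(ℝ, ℝ) h ((ϰ o).symm y) := by
  have h1 : MDifferentiableAt (𝓡 N) 𝓘(ℝ, Ξ) (ϰ o) ((ϰ o).symm y) := by
    apply mdifferentiableAt_extChartAt; have := (ϰ o).map_target hy; rwa [extChartAt_source] at this
  have e := (ϰ o).right_inv hy
  have h3 : MDifferentiableAt 𝓘(ℝ, Ξ) 𝓘(ℝ, ℝ) (h ∘ (ϰ o).symm) ((ϰ o) ((ϰ o).symm y)) := by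
    rw [e]; exact hc.mdifferentiableAt
  refine (h3.comp _ h1).congr_of_eventuallyEq ?_
  filter_upwards [(isOpen_extChartAt_source (I := 𝓡 N) o).mem_nhds ((ϰ o).map_target hy)] with z hz
  simp only [comp_apply]; rw [(ϰ o).left_inv hz]

lemma locallyLipschitzOn_chartPoint (o : M) : LocallyLipschitzOn (chartDom N o) (Φ o) :=
  ((locallyLipschitzOn_chart_symm o).comp_of_mapsTo
    LipschitzWith.prod_fst.locallyLipschitz.locallyLipschitzOn fun _ hy => hy.1).prodMk'
    LipschitzWith.prod_snd.locallyLipschitz.locallyLipschitzOn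

lemma locallyLipschitzOn_pointChart (o : M) : LocallyLipschitzOn (chartRng N o) (pointChart N o) :=
  ((locallyLipschitzOn_chart o).comp_of_mapsTo
    LipschitzWith.prod_fst.locallyLipschitz.locallyLipschitzOn fun _ hy => hy.1).prodMk'
    LipschitzWith.prod_snd.locallyLipschitz.locallyLipschitzOn

lemma wstMeasure_absolutelyContinuous (ha : Continuous a) : ϖ ≪ stMeasure N M := by
  have hloc := isLocallyFiniteMeasure_weighted (N := N) ha
  exact (withDensity_absolutelyContinuous _ _).prod Measure.AbsolutelyContinuous.rfl

lemma stMeasure_absolutelyContinuous (ha : Continuous a)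
  (ha_pos : ∀ᵐ x ∂(riemannianVolume N M), 0 < a x) : stMeasure N M ≪ ϖ := by
  have hloc := isLocallyFiniteMeasure_weighted (N := N) ha
  refine (withDensity_absolutelyContinuous' ?_ ?_).prod Measure.AbsolutelyContinuous.rfl
  · exact ha.measurable.ennreal_ofReal.aemeasurable
  · filter_upwards [ha_pos] with x hx; simpa using hx

lemma volume_restrict_absolutelyContinuous_chartMeasure (ha : Continuous a) (o : M) {s : Set (Ξ ×
  ℝ)} (hs : MeasurableSet s) (hsd : s ⊆ chartDom N o) (hpos : ∀ y ∈ s, 0 < a ((ϰ o).symm y.1)) :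
  volume.restrict s ≪ (chartMeasure N a o).restrict s := by
  rw [chartMeasure, restrict_withDensity hs, restrict_restrict hs, inter_eq_left.2 hsd]
  refine withDensity_absolutelyContinuous' ?_ ?_
  · refine ((ContinuousOn.aemeasurable ?_ hs)).ennreal_ofReal; refine ContinuousOn.mul ?_ ?_
    · exact ha.comp_continuousOn ((continuousOn_extChartAt_symm o).comp continuousOn_fst
        fun y hy => (hsd hy).1)
    · exact (contDiffOn_volDensity o).continuousOn.comp continuousOn_fst fun y hy => (hsd hy).1
  · refine (ae_restrict_iff' hs).2 (ae_of_all _ fun y hy => ?_)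
    have := mul_pos (hpos y hy) (volDensity_pos o (hsd hy).1); simpa using this

lemma ae_chart_of_ae {P : M × ℝ → Prop} (h : ∀ᵐ z ∂(stMeasure N M), P z) (o : M) :
  ∀ᵐ y ∂(volume.restrict (chartDom N o)), P (Φ o y) := by
  have h1 : ∀ᵐ z ∂((chartMeasure N (fun _ : M => (1 : ℝ)) o).map (Φ o)), P z := by
    rw [← wstMeasure_restrict continuous_const, ← stMeasure_eq_wstMeasure]
    exact ae_restrict_of_ae h
  have h2 := ae_of_ae_map (aemeasurable_chartPoint _ o) h1
  have h3 := volume_restrict_absolutelyContinuous_chartMeasure (N := N)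
    (a := fun _ : M => (1 : ℝ)) continuous_const o (isOpen_chartDom o).measurableSet
    subset_rfl fun _ _ => one_pos
  exact h3 (ae_restrict_of_ae h2)

lemma ae_restrict_of_ae_chart (ha : Continuous a) {o : M} {P : M × ℝ → Prop} (h : ∀ᵐ y
  ∂(volume.restrict (chartDom N o)), P (Φ o y)) : ∀ᵐ z ∂((ϖ).restrict (chartRng N o)), P z := by
  have h1 : ∀ᵐ y ∂(chartMeasure N a o), P (Φ o y) := withDensity_absolutelyContinuous _ _ h
  rw [chartMeasure_eq_map ha] at h1; have h2 := ae_of_ae_map (aemeasurable_pointChart o _) h1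
  filter_upwards [h2, ae_restrict_mem (isOpen_chartRng o).measurableSet] with z hz hz'
  rwa [chartPoint_pointChart hz'] at hz

lemma measurableSet_spaceTime : MeasurableSet (spaceTime M) :=
  MeasurableSet.univ.prod measurableSet_Ioi

lemma wstMeasure_restrict_spaceTime (a : M → ℝ) :
  (wstMeasure N a).restrict (spaceTime M) = wstMeasure N a := by
  refine Measure.restrict_eq_self_of_ae_mem ?_; rw [wstMeasure]
  have h : ∀ᵐ t : ℝ ∂(volume.restrict (Ioi (0 : ℝ))), t ∈ Ioi (0 : ℝ) :=
    ae_restrict_mem measurableSet_Ioi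
  have h2 := (Measure.quasiMeasurePreserving_snd (μ := (riemannianVolume N M).withDensity
    fun x => ofReal (a x)) (ν := volume.restrict (Ioi (0 : ℝ)))).ae h
  filter_upwards [h2] with z hz using ⟨mem_univ _, hz⟩

lemma chartRng_mem_nhds {z : M × ℝ} (hz : z ∈ spaceTime M) : chartRng N z.1 ∈ 𝓝 z :=
  (isOpen_chartRng z.1).mem_nhds ⟨mem_extChartAt_source z.1, hz.2⟩

lemma ae_of_forall_ae_chart (ha : Continuous a) {P : M × ℝ → Prop} (h : ∀ o : M, ∀ᵐ y
  ∂(volume.restrict (chartDom N o)), P (Φ o y)) : ∀ᵐ z ∂ϖ, P z := by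
  rw [← wstMeasure_restrict_spaceTime, ae_restrict_iff' measurableSet_spaceTime, ae_iff]
  refine measure_null_of_locally_null _ fun z hz => ?_
  simp only [mem_ofPred_eq, Classical.not_imp] at hz
  refine ⟨_, inter_mem_nhdsWithin _ (chartRng_mem_nhds (N := N) hz.1), ?_⟩
  have h1 := ae_restrict_of_ae_chart ha (h z.1)
  rw [ae_restrict_iff' (isOpen_chartRng z.1).measurableSet, ae_iff] at h1
  refine measure_mono_null (fun w hw => ?_) h1
  simp only [mem_ofPred_eq, Classical.not_imp, mem_inter_iff] at hw ⊢; exact ⟨hw.2, hw.1.2⟩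

lemma aestronglyMeasurable_chart {g : Ϝ} (hg : AEStronglyMeasurable g (stMeasure N M)) (o : M) :
  AEStronglyMeasurable (fun y => g (Φ o y)) (volume.restrict (chartDom N o)) := by
  have h1 : AEStronglyMeasurable g ((chartMeasure N (fun _ : M => (1 : ℝ)) o).map (Φ o)) := by
    rw [← wstMeasure_restrict continuous_const, ← stMeasure_eq_wstMeasure]; exact hg.restrict
  have h2 := h1.comp_aemeasurable (aemeasurable_chartPoint _ o)
  have h3 := volume_restrict_absolutelyContinuous_chartMeasure (N := N)
    (a := fun _ : M => (1 : ℝ)) continuous_const o (isOpen_chartDom o).measurableSet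
    subset_rfl fun _ _ => one_pos
  exact (h2.mono_ac (h3.trans Measure.absolutelyContinuous_restrict))

lemma aestronglyMeasurable_restrict_of_chart (ha : Continuous a) {g : Ϝ} {O : Set (M × ℝ)} (hO :
  IsOpen O) {o : M} (hg : AEStronglyMeasurable (fun y => g (Φ o y)) (volume.restrict (chartDom N o ∩
  Φ o ⁻¹' O))) : AEStronglyMeasurable g ((ϖ).restrict (O ∩ chartRng N o)) := by
  have hD := (isOpen_chartDom (N := N) o).measurableSet
  have hms : MeasurableSet (chartDom N o ∩ Φ o ⁻¹' O) :=
    (continuousOn_chartPoint o).measurableSet_inter_preimage hD hO.measurableSet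
  have hR := (isOpen_chartRng (N := N) o).measurableSet
  have h1 : AEStronglyMeasurable ((chartDom N o ∩ Φ o ⁻¹' O).indicator
      fun y => g (Φ o y)) (chartMeasure N a o) := by
    rw [aestronglyMeasurable_indicator_iff hms]; refine hg.mono_ac ?_
    rw [chartMeasure, restrict_withDensity hms, restrict_restrict hms,
      inter_eq_left.2 inter_subset_left]
    exact withDensity_absolutelyContinuous _ _
  rw [chartMeasure_eq_map ha] at h1
  have h2 := (h1.comp_aemeasurable (aemeasurable_pointChart o _)).mono_measure
    (restrict_mono (inter_subset_right : O ∩ chartRng N o ⊆ _) le_rfl)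
  refine h2.congr ?_; filter_upwards [ae_restrict_mem (hO.measurableSet.inter hR)] with z hz
  have e := chartPoint_pointChart (N := N) hz.2; simp only [comp_apply]
  rw [indicator_of_mem, e]; exact ⟨pointChart_mem hz.2, by rw [mem_preimage, e]; exact hz.1⟩

lemma aestronglyMeasurable_of_chart (ha : Continuous a) {g : Ϝ} {O : Set (M × ℝ)} (hO : IsOpen O)
  (hg : ∀ o : M, AEStronglyMeasurable (fun y => g (Φ o y)) (volume.restrict (chartDom N o ∩ Φ o ⁻¹'
  O))) : AEStronglyMeasurable g ((ϖ).restrict O) := by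
  obtain ⟨s, hs, hsu⟩ := TopologicalSpace.countable_cover_nhds
    (fun x : M => extChartAt_source_mem_nhds (I := 𝓡 N) x)
  have hcov : (ϖ).restrict O ≤ (ϖ).restrict (⋃ x : s, O ∩ chartRng N (x : M)) := by
    conv_lhs => rw [← wstMeasure_restrict_spaceTime, restrict_restrict hO.measurableSet]
    refine restrict_mono (fun z hz => ?_) le_rfl
    obtain ⟨x, hx, hzx⟩ := mem_iUnion₂.1 (hsu ▸ mem_univ z.1 : z.1 ∈ ⋃ x ∈ s, _)
    exact mem_iUnion.2 ⟨⟨x, hx⟩, hz.1, hzx, hz.2.2⟩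
  have : Countable s := hs; refine AEStronglyMeasurable.mono_measure ?_ hcov
  rw [aestronglyMeasurable_iUnion_iff]
  exact fun x => aestronglyMeasurable_restrict_of_chart ha hO (hg x)

lemma rgrad_mul {g h : M → ℝ} {x : M} (hg : MDifferentiableAt (𝓡 N) 𝓘(ℝ, ℝ) g x)
  (hh : MDifferentiableAt (𝓡 N) 𝓘(ℝ, ℝ) h x) :
  rgrad N (fun x => g x * h x) x = h x • rgrad N g x + g x • rgrad N h x := by
  refine ext_inner_right ℝ fun w => ?_
  rw [inner_add_left, real_inner_smul_left, real_inner_smul_left, inner_rgrad, inner_rgrad,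
    inner_rgrad]
  have h1 := (hg.hasMFDerivAt.mul hh.hasMFDerivAt).mfderiv
  have h2 : mfderiv (𝓡 N) 𝓘(ℝ, ℝ) (fun x => g x * h x) x w = _ := congrArg (fun L => L w) h1
  rw [h2]; exact add_comm _ _

lemma rgrad_comp {H : ℝ → ℝ} {H' : ℝ} {h : M → ℝ} {x : M} (hh : MDifferentiableAt (𝓡 N) 𝓘(ℝ, ℝ) h x)
  (hH : HasDerivAt H H' (h x)) : rgrad N (fun x => H (h x)) x = H' • rgrad N h x := by
  refine ext_inner_right ℝ fun w => ?_; rw [real_inner_smul_left, inner_rgrad, inner_rgrad]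
  have h1 := (hH.hasFDerivAt.hasMFDerivAt.comp x hh.hasMFDerivAt).mfderiv
  have h2 : mfderiv (𝓡 N) 𝓘(ℝ, ℝ) (fun x => H (h x)) x w = _ := congrArg (fun L => L w) h1; rw [h2]
  exact mul_comm _ _

lemma inner_rgrad_slice {ψ : Ϝ} {o : M} {y : Ξ × ℝ} (hy : y ∈ chartDom N o) (hd : DifferentiableAt ℝ
  (fun y => ψ (Φ o y)) y) (v : Ξ) : (inner ℝ (rgrad N (fun x => ψ (x, (Φ o y).2)) (Φ o y).1)
  (coordVec N o v y.1) : ℝ) = fderiv ℝ (fun y => ψ (Φ o y)) y (v, 0) := by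
  refine (inner_rgrad_coordVec (fun x => ψ (x, y.2)) o v hy.1).trans ?_
  have h1 : HasFDerivAt (fun w : Ξ => (w, y.2)) (ContinuousLinearMap.inl ℝ Ξ ℝ) y.1 :=
    hasFDerivAt_prodMk_left y.1 y.2
  have h2 : HasFDerivAt ((fun y => ψ (Φ o y)) ∘ (fun w : Ξ => (w, y.2))) _ y.1 :=
    HasFDerivAt.comp y.1 (f := fun w : Ξ => (w, y.2)) hd.hasFDerivAt h1
  have h3 := h2.fderiv; have h4 := congrArg (fun L => L v) h3; exact h4

lemma deriv_slice {ψ : Ϝ} {o : M} {y : Ξ × ℝ} (hd : DifferentiableAt ℝ (fun y => ψ (Φ o y)) y) :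
  HasDerivAt (fun t => ψ ((Φ o y).1, t)) (fderiv ℝ (fun y => ψ (Φ o y)) y (0, 1)) (Φ o y).2 := by
  have h1 : HasFDerivAt (fun t : ℝ => (y.1, t)) (ContinuousLinearMap.inr ℝ Ξ ℝ) y.2 :=
    hasFDerivAt_prodMk_right y.1 y.2
  have h2 : HasFDerivAt ((fun y => ψ (Φ o y)) ∘ (fun t : ℝ => (y.1, t))) _ y.2 :=
    HasFDerivAt.comp y.2 (f := fun t : ℝ => (y.1, t)) hd.hasFDerivAt h1
  have h3 := h2.hasDerivAt; exact h3

lemma mdifferentiableAt_slice {ψ : Ϝ} {o : M} {y : Ξ × ℝ}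
  (hy : y ∈ chartDom N o) (hd : DifferentiableAt ℝ (fun y => ψ (Φ o y)) y) :
  MDifferentiableAt (𝓡 N) 𝓘(ℝ, ℝ) (fun x => ψ (x, (Φ o y).2)) (Φ o y).1 := by
  refine mdifferentiableAt_of_chart hy.1 ?_
  have h1 : DifferentiableAt ℝ (fun w : Ξ => (w, y.2)) y.1 := by fun_prop
  exact DifferentiableAt.comp y.1 (g := fun y => ψ (Φ o y)) (f := fun w : Ξ => (w, y.2)) hd h1

lemma isOpen_chartDom_inter_preimage (o : M) {O : Set (M × ℝ)} (hO : IsOpen O) :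
  IsOpen (chartDom N o ∩ Φ o ⁻¹' O) :=
  (continuousOn_chartPoint o).isOpen_inter_preimage (isOpen_chartDom o) hO

lemma ae_differentiableAt_chart {ψ : Ϝ} {O : Set (M × ℝ)} (hO : IsOpen O) (hψ : LocallyLipschitzOn O
  ψ) (o : M) : ∀ᵐ y ∂(volume.restrict (chartDom N o ∩ Φ o ⁻¹' O)), DifferentiableAt ℝ (fun y => ψ (Φ
  o y)) y := by
  have : (volume : Measure (Ξ × ℝ)).IsAddHaarMeasure :=
    inferInstanceAs ((volume.prod volume : Measure (Ξ × ℝ)).IsAddHaarMeasure)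
  refine LocallyLipschitzOn.ae_differentiableAt volume (isOpen_chartDom_inter_preimage o hO) ?_
  exact hψ.comp_of_mapsTo ((locallyLipschitzOn_chartPoint o).mono inter_subset_left)
    fun y hy => hy.2

lemma ae_differentiable_slices (ha : Continuous a) {ψ : Ϝ} {O : Set (M × ℝ)} (hO : IsOpen O) (hψ :
  LocallyLipschitzOn O ψ) : ∀ᵐ z ∂ϖ, z ∈ O → MDifferentiableAt (𝓡 N) 𝓘(ℝ, ℝ) (fun x => ψ (x, z.2))
  z.1 ∧ DifferentiableAt ℝ (fun t => ψ (z.1, t)) z.2 := by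
  refine ae_of_forall_ae_chart ha fun o => ?_; have h1 := ae_differentiableAt_chart (N := N) hO hψ o
  rw [ae_restrict_iff' (isOpen_chartDom_inter_preimage o hO).measurableSet] at h1
  rw [ae_restrict_iff' (isOpen_chartDom o).measurableSet]; filter_upwards [h1] with y hy hyd hyO
  have hd := hy ⟨hyd, hyO⟩
  exact ⟨mdifferentiableAt_slice hyd hd, (deriv_slice hd).differentiableAt⟩

lemma inner_eq_gram_inv (o : M) {y : Ξ} (hy : y ∈ (ϰ o).target) (X Y : Τ ((ϰ o).symm y)) :
  (inner ℝ X Y : ℝ) = ∑ i, ∑ j, (gram N o y)⁻¹ i j * inner ℝ X (coordVec N o (ϗ i) y) *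
    inner ℝ Y (coordVec N o (ϗ j) y) := by
  obtain ⟨v, rfl⟩ := exists_coordVec_eq o hy X; obtain ⟨w, rfl⟩ := exists_coordVec_eq o hy Y
  set G := gram N o y with hG; have hdet : IsUnit G.det := (posDef_gram o hy).det_pos.ne'.isUnit
  have hsymm : ∀ i j, G i j = G j i := fun i j => real_inner_comm (coordVec N o (ϗ j) y)
      (coordVec N o (ϗ i) y)
  have hcomp : ∀ (v : Ξ) (i : Fin N), (inner ℝ (coordVec N o v y) (coordVec N o (ϗ i) y) : ℝ) =
        (G.mulVec v.ofLp) i := by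
    intro v i; rw [inner_coordVec_eq_gram]; unfold Matrix.mulVec dotProduct
    refine sum_congr rfl fun k _ => ?_; rw [Finset.sum_eq_single i]
    · simp only [PiLp.single_apply, if_true, mul_one]; rw [hsymm i k, mul_comm]
    · intro b _ hb; simp [hb]
    · simp
  simp only [hcomp]; have h1 : ∑ i, ∑ j, G⁻¹ i j * (G.mulVec v.ofLp) i * (G.mulVec w.ofLp) j =
      dotProduct (G.mulVec v.ofLp) (G⁻¹.mulVec (G.mulVec w.ofLp)) := by
    unfold dotProduct; refine sum_congr rfl fun i _ => ?_
    have e : G⁻¹.mulVec (G.mulVec w.ofLp) i = ∑ j, G⁻¹ i j * G.mulVec w.ofLp j := rfl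
    rw [e, Finset.mul_sum]; refine sum_congr rfl fun j _ => ?_; ring
  rw [h1, Matrix.mulVec_mulVec, Matrix.nonsing_inv_mul G hdet, Matrix.one_mulVec,
    inner_coordVec_eq_gram]
  have h2 : dotProduct (G.mulVec v.ofLp) w.ofLp = ∑ i, (∑ k, G i k * v.ofLp k) * w.ofLp i := rfl
  rw [h2, Finset.sum_comm]; refine sum_congr rfl fun i _ => ?_; rw [sum_mul]
  refine sum_congr rfl fun k _ => ?_; rw [hsymm i k, hG]; ring

lemma aestronglyMeasurable_gram_inv (o : M) (i j : Fin N)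
  {s : Set (Ξ × ℝ)} (hs : MeasurableSet s) (hsd : s ⊆ chartDom N o) :
  AEStronglyMeasurable (fun y : Ξ × ℝ => (gram N o y.1)⁻¹ i j) (volume.restrict s) := by
  have h : ContinuousOn (fun y : Ξ => (gram N o y)⁻¹ i j) (ϰ o).target := by
    have hc : ContinuousOn (fun y : Ξ => gram N o y) (ϰ o).target :=
      continuousOn_pi.2 fun i => continuousOn_pi.2 fun j => (contDiffOn_gram o i j).continuousOn
    have e : ∀ y, (gram N o y)⁻¹ i j =
        ((gram N o y).det)⁻¹ * (gram N o y).adjugate i j := fun y => by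
      rw [Matrix.inv_def, Matrix.smul_apply, Ring.inverse_eq_inv', smul_eq_mul]
    simp only [e]; refine ContinuousOn.mul ?_ ?_
    · exact (contDiffOn_det_gram o).continuousOn.inv₀ fun y hy => (posDef_gram o hy).det_pos.ne'
    · have hadj : Continuous fun A : Matrix (Fin N) (Fin N) ℝ => A.adjugate i j :=
        (Continuous.matrix_adjugate continuous_id).matrix_elem i j
      exact hadj.comp_continuousOn hc
  exact (h.comp continuousOn_fst fun y hy => (hsd hy).1).aestronglyMeasurable hs

lemma IsChartMeasurable.inner (ha : Continuous a) {O : Set (M × ℝ)} (hO : IsOpen O) {X Y : (z : M ×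
  ℝ) → Τ z.1} (hX : IsChartMeasurable N O X) (hY : IsChartMeasurable N O Y) : AEStronglyMeasurable
  (fun z => (Inner.inner ℝ (X z) (Y z) : ℝ)) ((ϖ).restrict O) := by
  refine aestronglyMeasurable_of_chart ha hO fun o => ?_
  have hms := (isOpen_chartDom_inter_preimage (N := N) o hO).measurableSet
  have h1 : AEStronglyMeasurable (fun y : Ξ × ℝ =>
      ∑ i, ∑ j, (gram N o y.1)⁻¹ i j *
      Inner.inner ℝ (X (Φ o y)) (coordVec N o (ϗ i) y.1) *
      Inner.inner ℝ (Y (Φ o y)) (coordVec N o (ϗ j) y.1))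
      (volume.restrict (chartDom N o ∩ Φ o ⁻¹' O)) := by
    refine Finset.aestronglyMeasurable_fun_sum _ fun i _ =>
      Finset.aestronglyMeasurable_fun_sum _ fun j _ => ?_
    exact ((aestronglyMeasurable_gram_inv o i j hms inter_subset_left).mul (hX o _)).mul (hY o _)
  refine h1.congr ?_; filter_upwards [ae_restrict_mem hms] with y hy
  exact (inner_eq_gram_inv o hy.1.1 _ _).symm

lemma IsChartMeasurable.norm (ha : Continuous a) {O : Set (M × ℝ)} (hO : IsOpen O)
  {X : (z : M × ℝ) → Τ z.1} (hX : IsChartMeasurable N O X) :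
  AEStronglyMeasurable (fun z => ‖X z‖) ((ϖ).restrict O) := by
  have h := (hX.inner ha hO hX).aemeasurable.sqrt.aestronglyMeasurable
  refine h.congr (ae_of_all _ fun z => ?_); beta_reduce
  rw [real_inner_self_eq_norm_sq, sqrt_sq (norm_nonneg _)]

lemma IsChartMeasurable.sub {O : Set (M × ℝ)} {X Y : (z : M × ℝ) → Τ z.1} (hX : IsChartMeasurable N
  O X) (hY : IsChartMeasurable N O Y) : IsChartMeasurable N O (fun z => X z - Y z) := by
  intro o v; exact ((hX o v).sub (hY o v)).congr (ae_of_all _ fun y => (inner_sub_left _ _ _).symm)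

lemma IsChartMeasurable.smul {O : Set (M × ℝ)} {c : Ϝ} (hc : AEStronglyMeasurable c (stMeasure N M))
  {X : (z : M × ℝ) → Τ z.1} (hX : IsChartMeasurable N O X) :
  IsChartMeasurable N O (fun z => c z • X z) := by
  intro o v; have h := ((aestronglyMeasurable_chart hc o).mono_measure
    (restrict_mono inter_subset_left le_rfl)).mul (hX o v)
  exact h.congr (ae_of_all _ fun y => (real_inner_smul_left _ _ _).symm)

lemma IsChartMeasurable.mono {O O' : Set (M × ℝ)} (h : O' ⊆ O)
  {X : (z : M × ℝ) → Τ z.1} (hX : IsChartMeasurable N O X) :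
  IsChartMeasurable N O' X := fun o v =>
  (hX o v).mono_measure (restrict_mono (inter_subset_inter_right _ (preimage_mono h)) le_rfl)

lemma isChartMeasurable_rgrad {ψ : Ϝ} {O : Set (M × ℝ)} (hO : IsOpen O) (hψ : LocallyLipschitzOn O
  ψ) : IsChartMeasurable N O (fun z => ∇ ψ z) := by
  intro o v; have h1 : AEStronglyMeasurable (fun y => fderiv ℝ (fun y => ψ (Φ o y)) y (v, 0))
      (volume.restrict (chartDom N o ∩ Φ o ⁻¹' O)) :=
    (measurable_fderiv_apply_const ℝ _ _).aestronglyMeasurable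
  refine h1.congr ?_; filter_upwards [ae_differentiableAt_chart (N := N) hO hψ o, ae_restrict_mem
    (isOpen_chartDom_inter_preimage (N := N) o hO).measurableSet] with y hy hyd
  exact (inner_rgrad_slice hyd.1 hy v).symm

lemma aestronglyMeasurable_deriv_slice (ha : Continuous a) {ψ : Ϝ} {O : Set (M × ℝ)} (hO : IsOpen O)
  (hψ : LocallyLipschitzOn O ψ) : AEStronglyMeasurable (fun z => ∂ₜ ψ z) ((ϖ).restrict O) := by
  refine aestronglyMeasurable_of_chart ha hO fun o => ?_
  have h1 : AEStronglyMeasurable (fun y => fderiv ℝ (fun y => ψ (Φ o y)) y (0, 1))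
      (volume.restrict (chartDom N o ∩ Φ o ⁻¹' O)) :=
    (measurable_fderiv_apply_const ℝ _ _).aestronglyMeasurable
  refine h1.congr ?_; filter_upwards [ae_differentiableAt_chart (N := N) hO hψ o] with y hy
  exact (deriv_slice hy).deriv.symm

lemma IsWeakGradient.isChartMeasurable (ha_pos : ∀ᵐ x ∂(riemannianVolume N M), 0 < a x) {u : Ϝ}
  {Z : (z : M × ℝ) → Τ z.1} (hZ : IsWeakGradient N a u Z)
  (hu : ∀ᵐ z ∂(stMeasure N M), 0 ≤ u z) : IsChartMeasurable N univ Z := by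
  intro o v; rw [preimage_univ, inter_univ]
  set Ω := {y : Ξ × ℝ | y.1 ∈ (ϰ o).target ∧ 0 < a ((ϰ o).symm y.1) ∧ 0 < y.2} with hΩ
  have hst : ∀ᵐ z ∂(stMeasure N M), 0 < a z.1 :=
    (Measure.quasiMeasurePreserving_fst (μ := riemannianVolume N M)
      (ν := volume.restrict (Ioi (0 : ℝ)))).ae ha_pos
  have h1 := ae_chart_of_ae hst o; have hD := (isOpen_chartDom (N := N) o).measurableSet
  have hrestr : volume.restrict (chartDom N o) = volume.restrict Ω := by
    refine Measure.restrict_congr_set ?_; rw [ae_restrict_iff' hD] at h1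
    filter_upwards [h1] with y hy; refine propext ⟨fun h => ⟨h.1, hy h, h.2⟩, fun h => ⟨h.1, h.2.2⟩⟩
  have hu' := ae_chart_of_ae hu o; have hZ0 := ae_chart_of_ae hZ.eq_zero o; rw [hrestr] at hu' hZ0 ⊢
  refine aestronglyMeasurable_of_tendsto_ae atTop (fun n : ℕ =>
    (hZ.truncation (1 / ((n : ℝ) + 1)) (by positivity) o v).locInt_deriv.aestronglyMeasurable) ?_
  filter_upwards [hu', hZ0] with y hy hy0; refine tendsto_const_nhds.congr' ?_
  rcases hy.eq_or_lt with h | h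
  · have hz : Z (Φ o y) = 0 := hy0 h.symm; refine Eventually.of_forall fun n => ?_
    have h0 : (inner ℝ (Z (Φ o y)) (coordVec N o v y.1) : ℝ) = 0 := by
      rw [hz]; exact inner_zero_left _
    rw [h0]; symm; by_cases hm : y ∈ {y : Ξ × ℝ | 1 / ((n : ℝ) + 1) < u ((ϰ o).symm y.1, y.2)}
    · beta_reduce; rw [indicator_of_mem hm]; exact h0
    · beta_reduce; rw [indicator_of_notMem hm]
  · obtain ⟨n0, hn0⟩ := exists_nat_one_div_lt h; filter_upwards [eventually_ge_atTop n0] with n hn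
    rw [indicator_of_mem]
    · rfl
    · refine lt_of_le_of_lt ?_ hn0; apply one_div_le_one_div_of_le (by positivity); gcongr

section ChainRule

/-- Step function equal to `g (i / n)` on `(i / n, (i + 1) / n]` for `i < n ^ 2`. -/
def leftStep (g : ℝ → ℝ) (n : ℕ) (s : ℝ) : ℝ :=
  ∑ i ∈ Finset.range (n ^ 2), g (i / n) * (Ioc ((i : ℝ) / n) ((i + 1) / n)).indicator 1 s

lemma leftStep_eq (g : ℝ → ℝ) {n : ℕ} {s : ℝ} (hs : 0 < s) (hsn : s ≤ n) :
  leftStep g n s = g (((⌈n * s⌉₊ - 1 : ℕ) : ℝ) / n) := by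
  have hn : (0 : ℝ) < n := hs.trans_le hsn; have hc : 0 < ⌈n * s⌉₊ := Nat.ceil_pos.2 (by positivity)
  have h1 : ((⌈n * s⌉₊ - 1 : ℕ) : ℝ) < n * s := by
    have := Nat.ceil_lt_add_one (by positivity : 0 ≤ n * s)
    rw [Nat.cast_sub hc]; push_cast; linarith
  have h2 : n * s ≤ ((⌈n * s⌉₊ - 1 : ℕ) : ℝ) + 1 := by
    have := Nat.le_ceil (n * s); rw [Nat.cast_sub hc]; push_cast; linarith
  unfold leftStep; rw [Finset.sum_eq_single (⌈n * s⌉₊ - 1)]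
  · rw [indicator_of_mem, Pi.one_apply, mul_one]
    exact ⟨by rw [div_lt_iff₀ hn]; linarith, by rw [le_div_iff₀ hn]; linarith⟩
  · intro i _ hi; rw [indicator_of_notMem, mul_zero]; rintro ⟨h3, h4⟩; rw [div_lt_iff₀ hn] at h3
    rw [le_div_iff₀ hn] at h4; apply hi
    have h5 : (i : ℝ) < ((⌈n * s⌉₊ - 1 : ℕ) : ℝ) + 1 := by linarith
    have h6 : ((⌈n * s⌉₊ - 1 : ℕ) : ℝ) < (i : ℝ) + 1 := by linarith
    norm_cast at h5 h6
    omega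
  · intro h
    exfalso; apply h
    rw [Finset.mem_range]; have : ((⌈n * s⌉₊ - 1 : ℕ) : ℝ) < (n : ℝ) ^ 2 := by nlinarith
    exact_mod_cast this

lemma leftStep_eq_zero (g : ℝ → ℝ) {n : ℕ} {s : ℝ} (hs : s ≤ 0 ∨ (n : ℝ) < s) :
  leftStep g n s = 0 := by
  refine Finset.sum_eq_zero fun i hi => ?_; rw [indicator_of_notMem, mul_zero]; rintro ⟨h3, h4⟩
  rw [Finset.mem_range] at hi; have hn : (0 : ℝ) < n := by
    rcases Nat.eq_zero_or_pos n with h | h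
    · simp [h] at hi
    · exact_mod_cast h
  rw [div_lt_iff₀ hn] at h3; rw [le_div_iff₀ hn] at h4; rcases hs with h | h
  · have : (0 : ℝ) ≤ i := by positivity
    nlinarith
  · have : (i : ℝ) + 1 ≤ (n : ℝ) ^ 2 := by exact_mod_cast hi
    nlinarith

lemma abs_leftStep_le {g : ℝ → ℝ} {s C : ℝ} (hC : ∀ x ≤ s, |g x| ≤ C) (n : ℕ) :
  |leftStep g n s| ≤ C := by
  have hΓ0 : 0 ≤ C := (abs_nonneg _).trans (hC s le_rfl); rcases le_or_gt s 0 with h | h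
  · rwa [leftStep_eq_zero g (Or.inl h), abs_zero]
  rcases lt_or_ge (n : ℝ) s with h' | h'
  · rwa [leftStep_eq_zero g (Or.inr h'), abs_zero]
  rw [leftStep_eq g h h']; apply hC; have hn : (0 : ℝ) < n := h.trans_le h'; rw [div_le_iff₀ hn]
  have hc : 0 < ⌈n * s⌉₊ := Nat.ceil_pos.2 (by positivity)
  have := Nat.ceil_lt_add_one (by positivity : 0 ≤ n * s); rw [Nat.cast_sub hc]; push_cast; linarith

lemma tendsto_leftStep {g : ℝ → ℝ} {s : ℝ} (hs : 0 < s) (hg : ContinuousWithinAt g (Iic s) s) :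
  Tendsto (fun n => leftStep g n s) atTop (𝓝 (g s)) := by
  have h1 : Tendsto (fun n : ℕ => ((⌈n * s⌉₊ - 1 : ℕ) : ℝ) / n) atTop (𝓝[Iic s] s) := by
    rw [tendsto_nhdsWithin_iff]; constructor
    · refine tendsto_of_tendsto_of_tendsto_of_le_of_le' (g := fun n : ℕ => s - 1 / (n : ℝ))
        (h := fun _ => s) ?_ tendsto_const_nhds ?_ ?_
      · simpa using tendsto_const_nhds.sub (tendsto_one_div_atTop_nhds_zero_nat (𝕜 := ℝ))
      all_goals
        filter_upwards [eventually_gt_atTop 0] with n hn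
        have hn : (0 : ℝ) < n := by exact_mod_cast hn
        have hc : 0 < ⌈n * s⌉₊ := Nat.ceil_pos.2 (by positivity); rw [Nat.cast_sub hc]; push_cast
        have h3 := Nat.le_ceil (n * s); have h4 := Nat.ceil_lt_add_one (by positivity : 0 ≤ n * s)
      · rw [le_div_iff₀ hn, sub_mul, one_div_mul_cancel hn.ne']; linarith
      · rw [div_le_iff₀ hn]; linarith
    · filter_upwards [eventually_gt_atTop 0] with n hn
      have hn : (0 : ℝ) < n := by exact_mod_cast hn
      have hc : 0 < ⌈n * s⌉₊ := Nat.ceil_pos.2 (by positivity)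
      rw [mem_Iic, div_le_iff₀ hn, Nat.cast_sub hc]; push_cast
      have h4 := Nat.ceil_lt_add_one (by positivity : 0 ≤ n * s); linarith
  refine (hg.tendsto.comp h1).congr' ?_; filter_upwards [eventually_ge_atTop ⌈s⌉₊] with n hn
  rw [leftStep_eq g hs ((Nat.le_ceil s).trans (by exact_mod_cast hn))]
  rfl

lemma measurable_leftStep (g : ℝ → ℝ) (n : ℕ) : Measurable (leftStep g n) :=
  Finset.measurable_fun_sum _ fun _ _ => measurable_const.mul
    (measurable_one.indicator measurableSet_Ioc)

lemma integral_indicator_Ioc_one {a b s : ℝ} (ha : 0 ≤ a) (hab : a ≤ b) (hs : 0 ≤ s) :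
  ∫ x in (0 : ℝ)..s, (Ioc a b).indicator (1 : ℝ → ℝ) x = min (max s a) b - a := by
  rw [integral_of_le hs, integral_indicator measurableSet_Ioc,
    restrict_restrict measurableSet_Ioc, Ioc_inter_Ioc]
  simp only [Pi.one_apply, integral_const, smul_eq_mul, mul_one, measureReal_restrict_apply_univ,
    volume_real_Ioc]
  rw [sup_eq_left.2 ha]; rcases le_total s a with h | h
  · rw [max_eq_right h, min_eq_left hab, inf_eq_right.2 (h.trans hab)]; simp [h]
  · rw [max_eq_left h, max_eq_left, min_comm]; rw [sub_nonneg]; exact le_min hab h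

lemma integral_leftStep (g : ℝ → ℝ) (n : ℕ) {s : ℝ} (hs : 0 ≤ s) : ∫ x in (0 : ℝ)..s, leftStep g n x
  = ∑ i ∈ Finset.range (n ^ 2), g (i / n) * (min (max s (i / n)) ((i + 1) / n) - i / n) := by
  unfold leftStep; rw [intervalIntegral.integral_finsetSum]
  · refine sum_congr rfl fun i _ => ?_
    rw [intervalIntegral.integral_const_mul, integral_indicator_Ioc_one (by positivity) _ hs]
    gcongr; linarith
  · intro i _; refine IntervalIntegrable.const_mul ?_ _; rw [intervalIntegrable_iff, uIoc_of_le hs]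
    exact IntegrableOn.integrable ((integrable_indicator_iff measurableSet_Ioc).2
      (integrable_const 1).integrableOn)

lemma abs_integral_le_mul {g Γ : ℝ → ℝ} (hΓ : ∀ s t, s ≤ t → |g s| ≤ Γ t) {s : ℝ} (hs : 0 ≤ s) :
  |∫ x in (0 : ℝ)..s, g x| ≤ s * Γ s := by
  have := norm_integral_le_of_norm_le_const (a := 0) (b := s) (f := g)
    (C := Γ s) (fun x hx => by rw [uIoc_of_le hs] at hx; exact hΓ x s hx.2)
  rwa [sub_zero, abs_of_nonneg hs, mul_comm, norm_eq_abs] at this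

lemma integral_eq_zero_of_truncation {X : Type*} [MeasurableSpace X] {ν : Measure X} {u k1 k2 : X →
  ℝ} (hu : AEMeasurable u ν) (hu0 : ∀ᵐ z ∂ν, 0 ≤ u z) {ε : ℝ} (hk1 : Integrable k1 ν) (huk1 :
  Integrable (fun z => u z * k1 z) ν) (hk2 : Integrable ({z | ε < u z}.indicator k2) ν) (h : ∀ δ :
  ℝ, 0 < δ → ∫ z, max (u z) δ * k1 z ∂ν = - ∫ z, {z | δ < u z}.indicator k2 z ∂ν) : ∫ z, k1 z ∂ν = 0
  := by
  have hnm : ∀ δ : ℝ, NullMeasurableSet {z | δ < u z} ν := fun δ =>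
    nullMeasurableSet_lt aemeasurable_const hu
  have hk2' : ∀ δ, ε ≤ δ → Integrable ({z | δ < u z}.indicator k2) ν := fun δ hδ => by
    have := hk2.indicator₀ (hnm δ); refine this.congr (ae_of_all _ fun z => ?_)
    rw [indicator_indicator]; congr 1; ext z
    exact ⟨fun h => h.1, fun h => ⟨h, lt_of_le_of_lt hδ h⟩⟩
  have t1 : Tendsto (fun n : ℕ => ∫ z, max (u z) n * k1 z / n ∂ν) atTop (𝓝 (∫ z, k1 z ∂ν)) := by
    refine tendsto_integral_filter_of_dominated_convergence
      (fun z => ‖u z * k1 z‖ + ‖k1 z‖) ?_ ?_ (huk1.norm.add hk1.norm) ?_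
    · exact Eventually.of_forall fun n => ((hu.max aemeasurable_const).mul
        hk1.aemeasurable).div_const _ |>.aestronglyMeasurable
    · filter_upwards [eventually_ge_atTop 1] with n hn
      have hn1 : (1 : ℝ) ≤ n := by exact_mod_cast hn
      filter_upwards [hu0] with z hz; simp only [norm_mul, norm_div, norm_eq_abs, Nat.abs_cast]
      rw [abs_of_nonneg hz, abs_of_nonneg (hz.trans (le_max_left _ _)), div_le_iff₀ (by linarith)]
      have : max (u z) n ≤ u z + n := max_le (by linarith) (by linarith)
      calc max (u z) n * |k1 z| ≤ (u z + n) * |k1 z| := by gcongr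
        _ ≤ (u z * |k1 z| + |k1 z|) * n := by
          nlinarith [mul_nonneg hz (abs_nonneg (k1 z)), abs_nonneg (k1 z)]
    · refine ae_of_all _ fun z => tendsto_const_nhds.congr' ?_
      filter_upwards [eventually_ge_atTop (max ⌈u z⌉₊ 1)] with n hn
      have h1 : u z ≤ n := (Nat.le_ceil _).trans (by exact_mod_cast (le_max_left _ _).trans hn)
      have h2 : (0 : ℝ) < n := by exact_mod_cast (le_max_right _ _).trans hn
      rw [max_eq_right h1]; field_simp
  have t2 : Tendsto (fun n : ℕ => ∫ z, max (u z) n * k1 z / n ∂ν) atTop (𝓝 0) := by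
    refine squeeze_zero_norm' (a := fun n : ℕ => (∫ z, ‖{z | ε < u z}.indicator k2 z‖ ∂ν) / n)
      ?_ (tendsto_const_div_atTop_nhds_zero_nat _)
    filter_upwards [eventually_ge_atTop ⌈ε⌉₊, eventually_gt_atTop 0] with n hn hn0
    have h2 : (0 : ℝ) < n := by exact_mod_cast hn0
    have h3 : ε ≤ n := (Nat.le_ceil _).trans (by exact_mod_cast hn)
    rw [integral_div, h _ h2, norm_div, norm_neg, norm_natCast]; gcongr
    refine (norm_integral_le_integral_norm _).trans ?_
    refine integral_mono (hk2' n h3).norm hk2.norm fun z => ?_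
    exact norm_indicator_le_of_subset (fun z hz => lt_of_le_of_lt h3 hz) _ _
  exact tendsto_nhds_unique t1 t2

/-- Chain rule for a function all of whose truncations satisfy an integration by parts formula. -/
theorem integral_comp_mul_eq_of_truncation {X : Type*} [MeasurableSpace X] {ν : Measure X} {u k1 k2
  : X → ℝ} (hu : AEMeasurable u ν) (hu0 : ∀ᵐ z ∂ν, 0 ≤ u z) {ε : ℝ} (hε : 0 < ε) (hk1 : Integrable
  k1 ν) (huk1 : Integrable (fun z => u z * k1 z) ν) (hk2 : Integrable ({z | ε < u z}.indicator k2)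
  ν) (h : ∀ δ : ℝ, 0 < δ → ∫ z, max (u z) δ * k1 z ∂ν = - ∫ z, {z | δ < u z}.indicator k2 z ∂ν) {g Γ
  : ℝ → ℝ} (hg0 : ∀ s ≤ ε, g s = 0) (hg : ∀ s, ε < s → ContinuousWithinAt g (Iic s) s) (hΓ : ∀ s t,
  s ≤ t → |g s| ≤ Γ t) (hΓ1 : Integrable (fun z => u z * Γ (u z) * k1 z) ν) (hΓ2 : Integrable ({z |
  ε < u z}.indicator fun z => Γ (u z) * k2 z) ν) : ∫ z, (∫ x in (0 : ℝ)..u z, g x) * k1 z ∂ν = - ∫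
  z, g (u z) * k2 z ∂ν := by
  have hnm : ∀ δ : ℝ, NullMeasurableSet {z | δ < u z} ν := fun δ =>
    nullMeasurableSet_lt aemeasurable_const hu
  have hk2' : ∀ δ, ε ≤ δ → Integrable ({z | δ < u z}.indicator k2) ν := fun δ hδ => by
    have := hk2.indicator₀ (hnm δ); refine this.congr (ae_of_all _ fun z => ?_)
    rw [indicator_indicator]; congr 1; ext z
    exact ⟨fun h => h.1, fun h => ⟨h, lt_of_le_of_lt hδ h⟩⟩
  have hmax : ∀ δ, 0 < δ → Integrable (fun z => max (u z) δ * k1 z) ν := fun δ hδ => by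
    refine (huk1.norm.add (hk1.norm.const_mul δ)).mono'
      ((hu.max aemeasurable_const).aestronglyMeasurable.mul hk1.aestronglyMeasurable) ?_
    filter_upwards [hu0] with z hz; simp only [Pi.add_apply, norm_mul, norm_eq_abs]
    rw [abs_of_nonneg hz, abs_of_nonneg (hz.trans (le_max_left _ _)), ← add_mul]; gcongr
    exact max_le (by linarith) (by linarith)
  have hmean : ∫ z, k1 z ∂ν = 0 := integral_eq_zero_of_truncation hu hu0 hk1 huk1 hk2 h
  have hstep : ∀ n, ∫ z, (∫ x in (0 : ℝ)..u z, leftStep g n x) * k1 z ∂ν =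
      - ∫ z, leftStep g n (u z) * k2 z ∂ν := by
    intro n; have hclamp : ∀ a b : ℝ, ε ≤ a → a ≤ b →
        Integrable (fun z => (min (max (u z) a) b - a) * k1 z) ν ∧
        Integrable (fun z => (Ioc a b).indicator (1 : ℝ → ℝ) (u z) * k2 z) ν ∧
        ∫ z, (min (max (u z) a) b - a) * k1 z ∂ν =
          - ∫ z, (Ioc a b).indicator (1 : ℝ → ℝ) (u z) * k2 z ∂ν := by
      intro a b ha hab; have e1 : ∀ z, (min (max (u z) a) b - a) * k1 z =
          max (u z) a * k1 z - max (u z) b * k1 z + (b - a) * k1 z := fun z => by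
        have : min (max (u z) a) b = max (u z) a - max (u z) b + b := by
          rcases le_total (u z) a with h1 | h1 <;> rcases le_total (u z) b with h2 | h2 <;>
            simp [h1, h2, hab] <;> linarith
        rw [this]; ring
      have e2 : ∀ z, (Ioc a b).indicator (1 : ℝ → ℝ) (u z) * k2 z =
          {z | a < u z}.indicator k2 z - {z | b < u z}.indicator k2 z := fun z => by
        simp only [indicator_apply, mem_Ioc, mem_ofPred_eq, Pi.one_apply]
        by_cases h1 : a < u z <;> by_cases h2 : b < u z <;>
          simp only [h1, h2, if_true, if_false, true_and, false_and, not_le.2] <;>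
          first
            | (rw [if_pos (not_lt.1 h2)]; simp)
            | (exfalso; linarith)
            | simp
      have ia := hmax a (hε.trans_le ha); have ib := hmax b (hε.trans_le (ha.trans hab))
      have ja := hk2' a ha; have jb := hk2' b (ha.trans hab); simp only [e1, e2]
      refine ⟨(ia.sub ib).add (hk1.const_mul _), ja.sub jb, ?_⟩
      have e3 : ∫ z, max (u z) a * k1 z - max (u z) b * k1 z + (b - a) * k1 z ∂ν =
          ∫ z, max (u z) a * k1 z ∂ν - ∫ z, max (u z) b * k1 z ∂ν + ∫ z, (b - a) * k1 z ∂ν := by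
        rw [← integral_sub ia ib]; exact integral_add (ia.sub ib) (hk1.const_mul _)
      rw [e3, integral_sub ja jb, integral_const_mul, hmean, h a (hε.trans_le ha), h b (hε.trans_le (ha.trans hab))]
      ring
    have e1 : ∫ z, (∫ x in (0 : ℝ)..u z, leftStep g n x) * k1 z ∂ν =
        ∫ z, ∑ i ∈ Finset.range (n ^ 2),
          g (i / n) * ((min (max (u z) (i / n)) ((i + 1) / n) - i / n) * k1 z) ∂ν := by
      refine integral_congr_ae ?_; filter_upwards [hu0] with z hz
      rw [integral_leftStep g n hz, sum_mul]; exact sum_congr rfl fun i _ => by ring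
    have e2 : ∫ z, leftStep g n (u z) * k2 z ∂ν = ∫ z, ∑ i ∈ Finset.range (n ^ 2), g (i / n) *
          ((Ioc ((i : ℝ) / n) ((i + 1) / n)).indicator (1 : ℝ → ℝ) (u z) * k2 z) ∂ν := by
      refine integral_congr_ae (ae_of_all _ fun z => ?_); beta_reduce; rw [leftStep, sum_mul]
      exact sum_congr rfl fun i _ => by ring
    have hle : ∀ i : ℕ, (i : ℝ) / n ≤ (i + 1) / n := fun i => by gcongr; linarith
    rw [e1, e2, integral_finsetSum, integral_finsetSum, ← Finset.sum_neg_distrib]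
    · refine sum_congr rfl fun i _ => ?_; rw [integral_const_mul, integral_const_mul]
      rcases le_total ((i : ℝ) / n) ε with hi | hi
      · rw [hg0 _ hi]; simp
      · rw [(hclamp _ _ hi (hle i)).2.2]; ring
    · intro i _; rcases le_total ((i : ℝ) / n) ε with hi | hi
      · rw [hg0 _ hi]; simp
      · exact (hclamp _ _ hi (hle i)).2.1.const_mul _
    · intro i _; rcases le_total ((i : ℝ) / n) ε with hi | hi
      · rw [hg0 _ hi]; simp
      · exact (hclamp _ _ hi (hle i)).1.const_mul _
  have hgc : ∀ s, 0 < s → ContinuousWithinAt g (Iic s) s := fun s hs => by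
    rcases le_or_gt s ε with h1 | h1
    · exact continuousWithinAt_const.congr (fun y hy => hg0 y (le_trans hy h1)) (hg0 s h1)
    · exact hg s h1
  have hstepz : ∀ n s, s ≤ ε → leftStep g n s = 0 := by
    intro n s hs
    exact abs_nonpos_iff.1 (abs_leftStep_le (fun x hx => by rw [hg0 x (hx.trans hs), abs_zero]) n)
  have hlim1 : Tendsto (fun n => ∫ z, (∫ x in (0 : ℝ)..u z, leftStep g n x) * k1 z ∂ν) atTop
      (𝓝 (∫ z, (∫ x in (0 : ℝ)..u z, g x) * k1 z ∂ν)) := by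
    refine tendsto_integral_of_dominated_convergence (fun z => ‖u z * Γ (u z) * k1 z‖) ?_
      hΓ1.norm ?_ ?_
    · intro n; have : AEStronglyMeasurable (fun z => ∑ i ∈ Finset.range (n ^ 2),
          g (i / n) * ((min (max (u z) (i / n)) ((i + 1) / n) - i / n) * k1 z)) ν :=
        Finset.aestronglyMeasurable_fun_sum _ fun i _ => (((((hu.max aemeasurable_const).min
          aemeasurable_const).sub_const _).aestronglyMeasurable).mul
            hk1.aestronglyMeasurable).const_mul _
      refine this.congr ?_; filter_upwards [hu0] with z hz
      rw [integral_leftStep g n hz, sum_mul]; exact sum_congr rfl fun i _ => by ring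
    · intro n; filter_upwards [hu0] with z hz; rw [norm_mul, norm_mul (u z * Γ (u z))]; gcongr
      refine (abs_integral_le_mul (g := leftStep g n) (Γ := Γ) (fun s t hst =>
        abs_leftStep_le (fun x hx => hΓ x t (hx.trans hst)) n) hz).trans (le_abs_self _)
    · filter_upwards [hu0] with z hz; refine Tendsto.mul_const _ ?_
      refine tendsto_integral_filter_of_dominated_convergence (fun _ => Γ (u z))
        (Eventually.of_forall fun n => (measurable_leftStep g n).aestronglyMeasurable)
        (Eventually.of_forall fun n => ae_of_all _ fun x hx => ?_) (by simp)
        (ae_of_all _ fun x hx => ?_)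
      · rw [uIoc_of_le hz] at hx; exact abs_leftStep_le (fun y hy => hΓ y _ (hy.trans hx.2)) n
      · rw [uIoc_of_le hz] at hx; exact tendsto_leftStep hx.1 (hgc x hx.1)
  have hlim2 : Tendsto (fun n => ∫ z, leftStep g n (u z) * k2 z ∂ν) atTop
      (𝓝 (∫ z, g (u z) * k2 z ∂ν)) := by
    refine tendsto_integral_of_dominated_convergence
      (fun z => ‖{z | ε < u z}.indicator (fun z => Γ (u z) * k2 z) z‖) ?_ hΓ2.norm ?_ ?_
    · intro n
      have : AEStronglyMeasurable (fun z => leftStep g n (u z) * {z | ε < u z}.indicator k2 z) ν :=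
        ((measurable_leftStep g n).comp_aemeasurable hu).aestronglyMeasurable.mul
          hk2.aestronglyMeasurable
      refine this.congr (ae_of_all _ fun z => ?_); by_cases hz : ε < u z
      · simp [hz]
      · simp [hstepz n _ (not_lt.1 hz)]
    · intro n; refine ae_of_all _ fun z => ?_; by_cases hz : ε < u z
      · rw [indicator_of_mem (show z ∈ {z | ε < u z} from hz), norm_mul, norm_mul]; gcongr
        exact (abs_leftStep_le (fun x hx => hΓ x _ hx) n).trans (le_abs_self _)
      · rw [hstepz n _ (not_lt.1 hz)]; simp
    · filter_upwards [hu0] with z hz; refine Tendsto.mul_const _ ?_; rcases hz.eq_or_lt with h0 | h0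
      · rw [← h0, hg0 0 hε.le]; simp [hstepz _ 0 hε.le]
      · exact tendsto_leftStep h0 (hgc _ h0)
  have := hlim2.neg; exact tendsto_nhds_unique hlim1 (this.congr fun n => (hstep n).symm)

end ChainRule

lemma zero_off {X E : Type*} [TopologicalSpace X] [Zero E] {f : X → E} {x : X} (h : x ∉ tsupport f) :
  f x = 0 := image_eq_zero_of_notMem_tsupport h

lemma squeeze_ennreal {f g : ℕ → ℝ≥0∞} (hg : Tendsto g atTop (𝓝 0)) (h : ∀ n, f n ≤ g n) :
  Tendsto f atTop (𝓝 0) :=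
  tendsto_of_tendsto_of_tendsto_of_le_of_le tendsto_const_nhds hg (fun _ => zero_le) h

section Mollification

lemma rpow_lintegral_le {α : Type*} [MeasurableSpace α] {μ : Measure α} {f : α → ℝ≥0∞}
  (hf : AEMeasurable f μ) {p : ℝ} (hp : 1 ≤ p) :
  (∫⁻ x, f x ∂μ) ^ p ≤ μ univ ^ (p - 1) * ∫⁻ x, f x ^ p ∂μ := by
  have hp0 : 0 < p := by linarith
  have h := lintegral_mul_norm_pow_le (μ := μ) (f := fun x => f x ^ p) (g := fun _ => 1)
    (hf.pow_const p) aemeasurable_const (p := 1 / p) (q := 1 - 1 / p) (by positivity)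
    (by rw [sub_nonneg, div_le_one hp0]; exact hp) (by ring)
  simp only [← ENNReal.rpow_mul, mul_one_div_cancel hp0.ne', ENNReal.rpow_one, ENNReal.one_rpow,
    mul_one, lintegral_const, one_mul] at h
  calc (∫⁻ x, f x ∂μ) ^ p ≤ ((∫⁻ x, f x ^ p ∂μ) ^ (1 / p) * μ univ ^ (1 - 1 / p)) ^ p := by gcongr
    _ = _ := by
      rw [mul_rpow_of_nonneg _ _ hp0.le, ← ENNReal.rpow_mul, ← ENNReal.rpow_mul,
        one_div_mul_cancel hp0.ne', ENNReal.rpow_one, sub_mul, one_div_mul_cancel hp0.ne', one_mul,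
        mul_comm]

variable {F : Type*} [NormedAddCommGroup F] [NormedSpace ℝ F] [FiniteDimensional ℝ F]
  [MeasurableSpace F] [BorelSpace F] {μ : Measure F} [μ.IsAddHaarMeasure]

lemma lintegral_rpow_lintegral_sub_le (κ : Measure F) [IsFiniteMeasure κ] {f : F → ℝ} (hf :
  Measurable f) {p : ℝ} (hp : 1 ≤ p) (s : Set F) {A : ℝ≥0∞} (hA : ∀ᵐ ξ ∂κ, ∫⁻ y in s, ‖f y - f (y -
  ξ)‖ₑ ^ p ∂μ ≤ A) : ∫⁻ y in s, (∫⁻ ξ, ‖f y - f (y - ξ)‖ₑ ∂κ) ^ p ∂μ ≤ κ univ ^ p * A := by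
  have hm : Measurable (fun z : F × F => ‖f z.1 - f (z.1 - z.2)‖ₑ) := by fun_prop
  calc ∫⁻ y in s, (∫⁻ ξ, ‖f y - f (y - ξ)‖ₑ ∂κ) ^ p ∂μ
      ≤ ∫⁻ y in s, κ univ ^ (p - 1) * ∫⁻ ξ, ‖f y - f (y - ξ)‖ₑ ^ p ∂κ ∂μ := by
        gcongr with y; exact rpow_lintegral_le (hm.comp measurable_prodMk_left).aemeasurable hp
    _ = κ univ ^ (p - 1) * ∫⁻ y in s, ∫⁻ ξ, ‖f y - f (y - ξ)‖ₑ ^ p ∂κ ∂μ := by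
        rw [lintegral_const_mul]; exact (hm.pow_const p).lintegral_prod_right'
    _ = κ univ ^ (p - 1) * ∫⁻ ξ, ∫⁻ y in s, ‖f y - f (y - ξ)‖ₑ ^ p ∂μ ∂κ := by
        rw [lintegral_lintegral_swap]; exact (hm.pow_const p).aemeasurable
    _ ≤ κ univ ^ (p - 1) * (A * κ univ) := by
        gcongr; refine (lintegral_mono_ae hA).trans ?_; rw [lintegral_const]
    _ = κ univ ^ p * A := by
        rcases eq_or_ne (κ univ) 0 with h0 | h0
        · rw [h0, mul_zero, mul_zero, zero_rpow_of_pos (by linarith), zero_mul]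
        · conv_rhs => rw [show p = (p - 1) + 1 by ring,
            ENNReal.rpow_add _ _ h0 (measure_ne_top _ _), ENNReal.rpow_one]
          ring

lemma tendsto_lintegral_sub_translate {f : F → ℝ} {p : ℝ} (hp : 1 ≤ p) (hf : MemLp f (ofReal p) μ) :
  Tendsto (fun ξ => ∫⁻ y, ‖f y - f (y - ξ)‖ₑ ^ p ∂μ) (𝓝 0) (𝓝 0) := by
  have : Fact (1 ≤ ofReal p) := ⟨by rwa [ENNReal.one_le_ofReal]⟩
  have hp0 : 0 < p := by linarith
  have hptop : ofReal p ≠ ⊤ := ofReal_ne_top; have : Fact (ofReal p ≠ ⊤) := ⟨hptop⟩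
  set g := hf.toLp f with hg; have hc : Continuous fun ξ : F => DomAddAct.mk (-ξ) +ᵥ g :=
    (DomAddAct.continuous_mk.comp continuous_neg).vadd continuous_const
  have h1 : Tendsto (fun ξ : F => edist g (DomAddAct.mk (-ξ) +ᵥ g) ^ p) (𝓝 0) (𝓝 0) := by
    have h2 : Continuous fun ξ : F => edist g (DomAddAct.mk (-ξ) +ᵥ g) := continuous_const.edist hc
    have h4 := ((ENNReal.continuous_rpow_const (y := p)).comp h2).tendsto (0 : F)
    have h5 : edist g (DomAddAct.mk (-(0 : F)) +ᵥ g) = 0 := by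
      rw [neg_zero, show DomAddAct.mk (0 : F) = 0 from rfl, zero_vadd, edist_self]
    simp only [comp_apply, h5, zero_rpow_of_pos hp0] at h4; exact h4
  refine h1.congr fun ξ => ?_
  rw [hg, DomAddAct.mk_vadd_toLp, Lp.edist_toLp_toLp, eLpNorm_eq_lintegral_rpow_enorm_toReal
    (by simpa using hp0) hptop, ENNReal.toReal_ofReal hp0.le, ← ENNReal.rpow_mul,
    one_div_mul_cancel hp0.ne', ENNReal.rpow_one]
  refine lintegral_congr fun y => ?_; simp only [Pi.sub_apply, vadd_eq_add, neg_add_eq_sub]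

lemma integral_translate_fderiv {f g η : F → ℝ} {e : F} {U : Set F} (hfg : ∀ η : F → ℝ, ContDiff ℝ ∞
  η → HasCompactSupport η → tsupport η ⊆ U → ∫ y, f y * fderiv ℝ η y e ∂μ = - ∫ y, g y * η y ∂μ) (hη
  : ContDiff ℝ ∞ η) (hηc : HasCompactSupport η) {ξ : F} (hU : ∀ y ∈ tsupport η, y - ξ ∈ U) : ∫ y, f
  y * fderiv ℝ η (y + ξ) e ∂μ = - ∫ y, g y * η (y + ξ) ∂μ := by
  have h1 : tsupport (fun y => η (y + ξ)) = (fun y => y + ξ) ⁻¹' tsupport η :=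
    tsupport_comp_eq_preimage η (Homeomorph.addRight ξ)
  have h2 := hfg (fun y => η (y + ξ)) (hη.comp (contDiff_id.add contDiff_const))
    (hηc.comp_homeomorph (Homeomorph.addRight ξ)) ?_
  · rw [← h2]; refine integral_congr_ae (ae_of_all _ fun y => ?_); beta_reduce
    rw [fderiv_comp_add_right]
  · rw [h1]; intro y hy; simpa using hU _ hy

/-- A function with an integrable weak derivative is recovered from it along segments. -/
lemma ae_sub_translate_eq_integral {f g : F → ℝ} (hf : Integrable f μ) (hg : Integrable g μ) {e : F}
  {U W : Set F} (hfg : ∀ η : F → ℝ, ContDiff ℝ ∞ η → HasCompactSupport η → tsupport η ⊆ U → ∫ y, f y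
  * fderiv ℝ η y e ∂μ = - ∫ y, g y * η y ∂μ) (hW : IsOpen W) (hWU : ∀ y ∈ W, ∀ s ∈ Icc (0 : ℝ) 1, y
  - s • e ∈ U) : ∀ᵐ y ∂μ, y ∈ W → f y - f (y - e) = ∫ s in (0 : ℝ)..1, g (y - s • e) := by
  have hν : IsFiniteMeasure (volume.restrict (Ioc (0 : ℝ) 1)) := by infer_instance
  -- the shear is measure preserving
  have hshear : MeasurePreserving (fun z : ℝ × F => (z.1, z.2 - z.1 • e))
      ((volume.restrict (Ioc (0 : ℝ) 1)).prod μ) ((volume.restrict (Ioc (0 : ℝ) 1)).prod μ) := by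
    refine (MeasurePreserving.id _).skew_product (g := fun s y => y - s • e) (by fun_prop) ?_
    exact ae_of_all _ fun s => by
      simpa [sub_eq_add_neg] using (measurePreserving_add_right μ (-(s • e))).map_eq
  have hgs : Integrable (fun z : ℝ × F => g (z.2 - z.1 • e))
      ((volume.restrict (Ioc (0 : ℝ) 1)).prod μ) :=
    hshear.integrable_comp_of_integrable (g := fun z : ℝ × F => g z.2) (hg.comp_snd _)
  have hsub : Integrable (fun y => f (y - e)) μ := hf.comp_sub_right e
  have hgi : Integrable (fun y => ∫ s in (0 : ℝ)..1, g (y - s • e)) μ := by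
    simp only [integral_of_le zero_le_one]; exact hgs.integral_prod_right
  have key := hW.ae_eq_zero_of_integral_contDiff_smul_eq_zero (μ := μ)
    (f := fun y => f y - f (y - e) - ∫ s in (0 : ℝ)..1, g (y - s • e))
    (LocallyIntegrable.locallyIntegrableOn (Integrable.locallyIntegrable
      ((hf.sub hsub).sub hgi)) W) ?_
  · filter_upwards [key] with y hy hyW; exact sub_eq_zero.1 (hy hyW)
  intro η hη hηc hηW; have hηcont := hη.continuous
  obtain ⟨B, hB⟩ := hηc.exists_bound_of_continuous hηcont
  have hdc : Continuous fun y => fderiv ℝ η y e :=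
    (hη.continuous_fderiv (by simp)).clm_apply continuous_const
  obtain ⟨B', hB'⟩ := (hηc.fderiv_apply ℝ e).exists_bound_of_continuous hdc
  have hmul : ∀ {w : F → ℝ}, Integrable w μ → Integrable (fun y => η y * w y) μ := fun hw =>
    hw.bdd_mul hηcont.aestronglyMeasurable (ae_of_all _ hB)
  -- difference quotient of the test function
  have e1 : ∫ y, η y * (f y - f (y - e)) ∂μ =
      - ∫ y, f y * (∫ s in (0 : ℝ)..1, fderiv ℝ η (y + s • e) e) ∂μ := by
    have hd : ∀ y, ∫ s in (0 : ℝ)..1, fderiv ℝ η (y + s • e) e = η (y + e) - η y := fun y => by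
      have h1 : ∀ s : ℝ, HasDerivAt (fun s : ℝ => η (y + s • e)) (fderiv ℝ η (y + s • e) e) s := by
        intro s; have h2 := (hη.differentiable (by simp) (y + s • e)).hasFDerivAt
        have h3 : HasDerivAt (fun s : ℝ => y + s • e) e s := by
          simpa using ((hasDerivAt_id s).smul_const e).const_add y
        exact h2.comp_hasDerivAt s h3
      rw [integral_eq_sub_of_hasDerivAt (fun s _ => h1 s)]
      · simp
      · exact (hdc.comp (by fun_prop)).intervalIntegrable _ _
    simp only [hd]; have h3 : ∫ y, η y * f (y - e) ∂μ = ∫ y, η (y + e) * f y ∂μ := by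
      rw [← integral_add_right_eq_self (fun y => η y * f (y - e)) e]; simp
    have h4 : Integrable (fun y => η (y + e) * f y) μ :=
      hf.bdd_mul (hηcont.comp (by fun_prop)).aestronglyMeasurable (ae_of_all _ fun y => hB _)
    calc ∫ y, η y * (f y - f (y - e)) ∂μ = ∫ y, η y * f y - η y * f (y - e) ∂μ := by
          simp only [mul_sub]
      _ = ∫ y, η y * f y ∂μ - ∫ y, η (y + e) * f y ∂μ := by
          rw [integral_sub (hmul hf) (hmul hsub), h3]
      _ = _ := by rw [← integral_sub (hmul hf) h4, ← integral_neg]; congr 1; ext y; ring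
  have e2 : ∫ y, f y * (∫ s in (0 : ℝ)..1, fderiv ℝ η (y + s • e) e) ∂μ =
      ∫ s in (0 : ℝ)..1, ∫ y, f y * fderiv ℝ η (y + s • e) e ∂μ := by
    simp only [integral_of_le zero_le_one, ← integral_const_mul]; refine integral_integral_swap ?_
    refine (hf.comp_fst _).mul_bdd (c := B') ?_ (ae_of_all _ fun z => hB' _)
    exact (hdc.comp (by fun_prop)).aestronglyMeasurable
  have e3 : ∫ s in (0 : ℝ)..1, ∫ y, f y * fderiv ℝ η (y + s • e) e ∂μ =
      - ∫ s in (0 : ℝ)..1, ∫ y, η y * g (y - s • e) ∂μ := by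
    rw [← intervalIntegral.integral_neg]; refine integral_congr fun s hs => ?_
    rw [uIcc_of_le zero_le_one] at hs
    rw [integral_translate_fderiv hfg hη hηc fun y hy => hWU y (hηW hy) s hs]; congr 1
    rw [← integral_sub_right_eq_self (fun y => g y * η (y + s • e)) (s • e)]; simp [mul_comm]
  have e4 : ∫ s in (0 : ℝ)..1, ∫ y, η y * g (y - s • e) ∂μ =
      ∫ y, η y * (∫ s in (0 : ℝ)..1, g (y - s • e)) ∂μ := by
    simp only [integral_of_le zero_le_one, ← integral_const_mul]; refine integral_integral_swap ?_
    exact hgs.bdd_mul (hηcont.comp continuous_snd).aestronglyMeasurable (ae_of_all _ fun z => hB _)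
  simp only [smul_eq_mul, mul_sub (η _) (f _ - f _)]
  have hd : Integrable (fun y => f y - f (y - e)) μ := hf.sub hsub
  rw [integral_sub (hmul hd) (hmul hgi), e1, e2, e3, e4]; ring

lemma lintegral_sub_translate_le {f g : F → ℝ} (hf : Integrable f μ) (hg : Integrable g μ) {e : F}
  {U W : Set F} (hfg : ∀ η : F → ℝ, ContDiff ℝ ∞ η → HasCompactSupport η → tsupport η ⊆ U → ∫ y, f y
  * fderiv ℝ η y e ∂μ = - ∫ y, g y * η y ∂μ) (hW : IsOpen W) (hWU : ∀ y ∈ W, ∀ s ∈ Icc (0 : ℝ) 1, y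
  - s • e ∈ U) (hgm : Measurable g) {p : ℝ} (hp : 1 ≤ p) : ∫⁻ y in W, ‖f y - f (y - e)‖ₑ ^ p ∂μ ≤ ∫⁻
  y, ‖g y‖ₑ ^ p ∂μ := by
  have hm : Measurable (fun z : F × ℝ => ‖g (z.1 - z.2 • e)‖ₑ ^ p) := by fun_prop
  calc ∫⁻ y in W, ‖f y - f (y - e)‖ₑ ^ p ∂μ
      ≤ ∫⁻ y in W, ∫⁻ s in Ioc (0 : ℝ) 1, ‖g (y - s • e)‖ₑ ^ p ∂volume ∂μ := by
        refine lintegral_mono_ae ?_; rw [ae_restrict_iff' hW.measurableSet]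
        filter_upwards [ae_sub_translate_eq_integral hf hg hfg hW hWU] with y hy hyW
        rw [hy hyW, integral_of_le zero_le_one]
        have h1 := rpow_lintegral_le (μ := volume.restrict (Ioc (0 : ℝ) 1))
          (f := fun s => ‖g (y - s • e)‖ₑ) (by fun_prop) hp
        simp only [Measure.restrict_apply_univ, volume_Ioc, sub_zero, ofReal_one,
          ENNReal.one_rpow, one_mul] at h1
        refine le_trans ?_ h1; gcongr; exact enorm_integral_le_lintegral_enorm _
    _ ≤ ∫⁻ y, ∫⁻ s in Ioc (0 : ℝ) 1, ‖g (y - s • e)‖ₑ ^ p ∂volume ∂μ := setLIntegral_le_lintegral _ _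
    _ = ∫⁻ s in Ioc (0 : ℝ) 1, ∫⁻ y, ‖g (y - s • e)‖ₑ ^ p ∂μ := by
        rw [lintegral_lintegral_swap]; exact hm.aemeasurable
    _ = ∫⁻ s in Ioc (0 : ℝ) 1, ∫⁻ y, ‖g y‖ₑ ^ p ∂μ := by
        refine lintegral_congr fun s => ?_
        exact lintegral_sub_right_eq_self (fun y => ‖g y‖ₑ ^ p) (s • e)
    _ = _ := by simp

open scoped Convolution in
lemma fderiv_convolution_apply {k f : F → ℝ} (hk : ContDiff ℝ ∞ k) (hkc : HasCompactSupport k)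
  (hf : LocallyIntegrable f μ) (y e : F) :
  fderiv ℝ (k ⋆[lsmul ℝ ℝ, μ] f) y e = ∫ ξ, fderiv ℝ k ξ e * f (y - ξ) ∂μ := by
  have hk1 : ContDiff ℝ 1 k := hk.of_le (by simp)
  rw [(hkc.hasFDerivAt_convolution_left (lsmul ℝ ℝ) hk1 hf y).fderiv]
  have hex := (hkc.fderiv ℝ).convolutionExists_left
    ((lsmul ℝ ℝ : ℝ →L[ℝ] ℝ →L[ℝ] ℝ).precompL F) (hk1.continuous_fderiv (by simp)) hf y
  unfold convolution; rw [ContinuousLinearMap.integral_apply hex]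
  rfl

open scoped Convolution in
lemma fderiv_convolution_eq_of_weak {k f g : F → ℝ} (hk : ContDiff ℝ ∞ k) (hkc : HasCompactSupport
  k) (hf : LocallyIntegrable f μ) {y e : F} {U : Set F} (hfg : ∀ η : F → ℝ, ContDiff ℝ ∞ η →
  HasCompactSupport η → tsupport η ⊆ U → ∫ y, f y * fderiv ℝ η y e ∂μ = - ∫ y, g y * η y ∂μ) (hU : ∀
  ξ ∈ tsupport k, y - ξ ∈ U) : fderiv ℝ (k ⋆[lsmul ℝ ℝ, μ] f) y e = ∫ ξ, k ξ * g (y - ξ) ∂μ := by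
  rw [fderiv_convolution_apply hk hkc hf]
  have h1 : tsupport (fun ξ => k (y - ξ)) = (fun ξ => y - ξ) ⁻¹' tsupport k :=
    tsupport_comp_eq_preimage k (Homeomorph.subLeft y)
  have h2 := hfg (fun ξ => k (y - ξ)) (hk.comp (contDiff_const.sub contDiff_id))
    (hkc.comp_homeomorph (Homeomorph.subLeft y)) (by rw [h1]; intro ξ hξ; simpa using hU _ hξ)
  have h3 : ∀ ξ, fderiv ℝ (fun ξ => k (y - ξ)) ξ e = - fderiv ℝ k (y - ξ) e := fun ξ => by
    have h4 : HasFDerivAt (fun ξ : F => y - ξ) (-ContinuousLinearMap.id ℝ F) ξ := by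
      simpa using (hasFDerivAt_id ξ).const_sub y
    have h5 := ((hk.differentiable (by simp) (y - ξ)).hasFDerivAt.comp ξ h4).fderiv
    have h6 := congrArg (fun L => L e) h5; refine Eq.trans ?_ (h6.trans ?_)
    · rfl
    · simp
  simp only [h3, mul_neg, integral_neg, neg_inj] at h2
  rw [← integral_sub_left_eq_self (fun ξ => fderiv ℝ k ξ e * f (y - ξ)) μ y,
    ← integral_sub_left_eq_self (fun ξ => k ξ * g (y - ξ)) μ y]
  simp only [sub_sub_cancel]; simpa [mul_comm] using h2

end Mollification

section Kernel

/-- Anisotropic mollification kernels on `E × ℝ`. -/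
structure IsMollifier (C r τ : ℝ) (k : Ξ × ℝ → ℝ) : Prop where
  contDiff : ContDiff ℝ ∞ k
  hasCompactSupport : HasCompactSupport k
  nonneg : ∀ ξ, 0 ≤ k ξ
  norm_le : ∀ ξ ∈ tsupport k, ‖ξ.1‖ ≤ r ∧ |ξ.2| ≤ τ
  integral_eq_one : ∫ ξ, k ξ = 1
  integral_deriv_le : ∀ v : Ξ, ∫ ξ, |fderiv ℝ k ξ (v, 0)| ≤ C * ‖v‖ / r

variable (N) in
lemma exists_isMollifier : ∃ C : ℝ, 0 ≤ C ∧ ∀ r τ : ℝ, 0 < r → 0 < τ →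
  ∃ k : Ξ × ℝ → ℝ, IsMollifier C r τ k := by
  let b : ContDiffBump (0 : Ξ) := ⟨1 / 2, 1, by norm_num, by norm_num⟩
  let ρ : Ξ → ℝ := b.normed volume
  have hρ : ContDiff ℝ ∞ ρ := b.contDiff_normed
  have hρc : HasCompactSupport ρ := b.hasCompactSupport_normed
  have hρi : ∫ x, ρ x = 1 := b.integral_normed; have hdi : Integrable (fun x => ‖fderiv ℝ ρ x‖) :=
    ((hρ.continuous_fderiv (by simp)).norm).integrable_of_hasCompactSupport (hρc.fderiv ℝ).norm
  refine ⟨∫ x, ‖fderiv ℝ ρ x‖, integral_nonneg fun _ => norm_nonneg _, fun r τ hr hτ => ?_⟩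
  let c : ContDiffBump (0 : ℝ) := ⟨τ / 2, τ, by positivity, by linarith⟩
  let χ : ℝ → ℝ := c.normed volume
  have hχ : ContDiff ℝ ∞ χ := c.contDiff_normed; have hχi : ∫ t, χ t = 1 := c.integral_normed
  let φ : Ξ → ℝ := fun x => (r ^ N)⁻¹ * ρ (r⁻¹ • x)
  have hφ : ContDiff ℝ ∞ φ := contDiff_const.mul (hρ.comp (contDiff_const_smul _))
  have hscale : ∀ w : Ξ → ℝ, ∫ x, (r ^ N)⁻¹ * w (r⁻¹ • x) = ∫ x, w x := fun w => by
    rw [integral_const_mul, Measure.integral_comp_inv_smul_of_nonneg volume w hr.le,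
      finrank_euclideanSpace_fin, smul_eq_mul, inv_mul_cancel_left₀ (by positivity)]
  have hφi : ∫ x, φ x = 1 := (hscale ρ).trans hρi
  have hsuppρ : tsupport ρ = closedBall 0 1 := b.tsupport_normed_eq
  have hsuppχ : tsupport χ = closedBall 0 τ := c.tsupport_normed_eq
  have hsub : tsupport (fun ξ : Ξ × ℝ => φ ξ.1 * χ ξ.2) ⊆
      closedBall (0 : Ξ) r ×ˢ closedBall (0 : ℝ) τ := by
    refine closure_minimal ?_ (isClosed_closedBall.prod isClosed_closedBall)
    intro ξ hξ; rw [Function.mem_support] at hξ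
    have h1 : ρ (r⁻¹ • ξ.1) ≠ 0 := fun h => hξ (by simp [φ, h])
    have h2 : χ ξ.2 ≠ 0 := fun h => hξ (by simp [h])
    have h3 : r⁻¹ • ξ.1 ∈ closedBall (0 : Ξ) 1 := hsuppρ ▸ subset_tsupport _ h1
    have h4 : ξ.2 ∈ closedBall (0 : ℝ) τ := hsuppχ ▸ subset_tsupport _ h2; refine ⟨?_, h4⟩
    rw [mem_closedBall_zero_iff, norm_smul, norm_inv, norm_of_nonneg hr.le,
      inv_mul_le_iff₀ hr, mul_one] at h3
    rwa [mem_closedBall_zero_iff]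
  have hcomp : IsCompact (closedBall (0 : Ξ) r ×ˢ closedBall (0 : ℝ) τ) :=
    (isCompact_closedBall _ _).prod (isCompact_closedBall _ _)
  refine ⟨fun ξ => φ ξ.1 * χ ξ.2, ?_, ?_, ?_, ?_, ?_, ?_⟩
  · exact (hφ.comp contDiff_fst).mul (hχ.comp contDiff_snd)
  · exact hcomp.of_isClosed_subset (isClosed_tsupport _) hsub
  · intro ξ; exact mul_nonneg (mul_nonneg (by positivity) (b.nonneg_normed _)) (c.nonneg_normed _)
  · intro ξ hξ; have := hsub hξ
    exact ⟨mem_closedBall_zero_iff.1 this.1, mem_closedBall_zero_iff.1 this.2⟩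
  · rw [Measure.volume_eq_prod, integral_prod_mul φ χ, hφi, hχi, mul_one]
  · intro v; have hd : ∀ ξ : Ξ × ℝ, fderiv ℝ (fun ξ : Ξ × ℝ => φ ξ.1 * χ ξ.2) ξ (v, 0) =
        fderiv ℝ φ ξ.1 v * χ ξ.2 := fun ξ => by
      have h1 : HasFDerivAt (fun ξ : Ξ × ℝ => φ ξ.1) _ ξ :=
        (hφ.differentiable (by simp) ξ.1).hasFDerivAt.comp ξ hasFDerivAt_fst
      have h2 : HasFDerivAt (fun ξ : Ξ × ℝ => χ ξ.2) _ ξ :=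
        (hχ.differentiable (by simp) ξ.2).hasFDerivAt.comp ξ hasFDerivAt_snd
      have h3 := congrArg (fun L => L (v, (0 : ℝ))) (h1.mul h2).fderiv; refine Eq.trans h3 ?_
      simp [mul_comm]
    have hdφ : ∀ x, fderiv ℝ φ x v = (r ^ N)⁻¹ * (fderiv ℝ ρ (r⁻¹ • x) v / r) := fun x => by
      have h1 : HasFDerivAt (fun x : Ξ => r⁻¹ • x) (r⁻¹ • ContinuousLinearMap.id ℝ Ξ) x :=
        (hasFDerivAt_id x).const_smul r⁻¹
      have h2 := ((hρ.differentiable (by simp) (r⁻¹ • x)).hasFDerivAt.comp x h1).const_mul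
        ((r ^ N)⁻¹)
      have h3 := congrArg (fun L => L v) h2.fderiv; refine Eq.trans h3 ?_
      change (r ^ N)⁻¹ * fderiv ℝ ρ (r⁻¹ • x) (r⁻¹ • v) = _; rw [map_smul, smul_eq_mul]; ring
    simp only [hd, abs_mul]
    have hχabs : ∀ t, |χ t| = χ t := fun t => abs_of_nonneg (c.nonneg_normed t); simp only [hχabs]
    rw [Measure.volume_eq_prod, integral_prod_mul (fun x => |fderiv ℝ φ x v|) χ, hχi, mul_one]
    simp only [hdφ, abs_mul, abs_of_pos (inv_pos.2 (pow_pos hr N))]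
    rw [hscale (fun x => |fderiv ℝ ρ x v / r|)]; simp only [abs_div, abs_of_pos hr]
    rw [integral_div]; gcongr; rw [← integral_mul_const]
    refine integral_mono_of_nonneg (ae_of_all _ fun _ => abs_nonneg _) (hdi.mul_const _)
      (ae_of_all _ fun x => ?_)
    exact (fderiv ℝ ρ x).le_opNorm v

end Kernel

section WeakDeriv

lemma exists_measurable_rep {X : Type*} [MeasurableSpace X] {μ : Measure X} {f : X → ℝ}
  {K : Set X} (hK : MeasurableSet K) (hf : IntegrableOn f K μ) :
  ∃ g : X → ℝ, Measurable g ∧ Integrable g μ ∧ (∀ᵐ y ∂μ, y ∈ K → g y = f y) ∧ ∀ y ∉ K, g y = 0 := by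
  have h1 : K.indicator (hf.aestronglyMeasurable.mk f) =ᵐ[μ] K.indicator f := by
    have h2 := (ae_restrict_iff' hK).1 hf.aestronglyMeasurable.ae_eq_mk
    filter_upwards [h2] with y hy; by_cases hyK : y ∈ K
    · rw [indicator_of_mem hyK, indicator_of_mem hyK, hy hyK]
    · rw [indicator_of_notMem hyK, indicator_of_notMem hyK]
  refine ⟨K.indicator (hf.aestronglyMeasurable.mk f),
    hf.aestronglyMeasurable.stronglyMeasurable_mk.measurable.indicator hK,
    (hf.integrable_indicator hK).congr h1.symm, ?_, fun y hy => indicator_of_notMem hy _⟩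
  filter_upwards [h1] with y hy hyK; rw [hy, indicator_of_mem hyK]

lemma integral_mul_congr_of_tsupport {X : Type*} [TopologicalSpace X] [MeasurableSpace X] {μ :
  Measure X} {f g η : X → ℝ} {K : Set X} (hη : tsupport η ⊆ K) (hfg : ∀ᵐ y ∂μ, y ∈ K → g y = f y) :
  ∫ y, g y * η y ∂μ = ∫ y, f y * η y ∂μ := by
  refine integral_congr_ae ?_; filter_upwards [hfg] with y hy; by_cases hyK : y ∈ tsupport η
  · rw [hy (hη hyK)]
  · rw [zero_off hyK, mul_zero, mul_zero]

lemma _root_.MeasureTheory.LocallyIntegrableOn.integrable_mul {X : Type*} [TopologicalSpace X] [T2Space X]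
  [MeasurableSpace X] [BorelSpace X] {μ : Measure X} {f η : X → ℝ} {U : Set X}
  (hf : LocallyIntegrableOn f U μ) (hη : Continuous η) (hηc : HasCompactSupport η)
  (hηU : tsupport η ⊆ U) : Integrable (fun y => f y * η y) μ := by
  have h1 : IntegrableOn f (tsupport η) μ := hf.integrableOn_compact_subset hηU hηc
  have h2 : IntegrableOn (fun y => f y * η y) (tsupport η) μ :=
    h1.mul_continuousOn hη.continuousOn hηc
  refine (integrableOn_iff_integrable_of_support_subset fun y hy => ?_).1 h2
  by_contra h
  exact hy (by simp [zero_off h])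

variable {F : Type*} [NormedAddCommGroup F] [NormedSpace ℝ F] [FiniteDimensional ℝ F]
  [MeasureSpace F] [BorelSpace F]

lemma _root_.HasWeakDirDeriv.truncation_restrict {U : Set F} {u G : F → ℝ} {e : F} {δ : ℝ} (h :
  HasWeakDirDeriv U (fun y => max (u y) δ) ({y | δ < u y}.indicator G) e) {η : F → ℝ} (hη : ContDiff
  ℝ ∞ η) (hηc : HasCompactSupport η) (hηU : tsupport η ⊆ U) : ∫ y in U, max (u y) δ * fderiv ℝ η y e
  = - ∫ y in U, {y | δ < u y}.indicator (fun y => G y * η y) y := by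
  have h1 := h.integral_eq η hη hηc hηU; rw [setIntegral_eq_integral_of_forall_compl_eq_zero, h1,
    setIntegral_eq_integral_of_forall_compl_eq_zero]
  · congr 1; refine integral_congr_ae (ae_of_all _ fun y => ?_); by_cases hy : δ < u y <;> simp [hy]
  · intro y hy; have : η y = 0 := zero_off fun h => hy (hηU h); simp [indicator_apply, this]
  · intro y hy; have : fderiv ℝ η y = 0 := zero_off fun h => hy (hηU (tsupport_fderiv_subset ℝ h))
    simp [this]

/-- The data of the chain rule for a function whose truncations are weakly differentiable. -/
structure TruncWeakDeriv (U : Set F) (u G : F → ℝ) (e : F) : Prop where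
  aemeasurable : AEMeasurable u (volume.restrict U)
  nonneg : ∀ᵐ y ∂(volume.restrict U), 0 ≤ u y
  truncation : ∀ δ : ℝ, 0 < δ →
    HasWeakDirDeriv U (fun y => max (u y) δ) ({y | δ < u y}.indicator G) e

section
variable {U : Set F} {u G : F → ℝ} {e : F}

lemma continuous_fderiv_apply_const {η : F → ℝ} (hη : ContDiff ℝ ∞ η) (e : F) :
  Continuous fun y => fderiv ℝ η y e :=
  (hη.continuous_fderiv (by simp)).clm_apply continuous_const

lemma tsupport_fderiv_apply_subset (η : F → ℝ) (e : F) :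
  tsupport (fun y => fderiv ℝ η y e) ⊆ tsupport η :=
  closure_minimal (fun y hy => tsupport_fderiv_subset ℝ (subset_tsupport _ (fun h0 => hy (by
    simp [h0])))) (isClosed_tsupport _)

lemma TruncWeakDeriv.integrable_mul_fderiv (h : TruncWeakDeriv U u G e)
  {η : F → ℝ} (hη : ContDiff ℝ ∞ η) (hηc : HasCompactSupport η) (hηU : tsupport η ⊆ U) :
  Integrable (fun y => u y * fderiv ℝ η y e) (volume.restrict U) := by
  have hk1 : Continuous fun y => fderiv ℝ η y e := continuous_fderiv_apply_const hη e
  have h1 := ((h.truncation 1 one_pos).locInt.integrable_mul hk1 (hηc.fderiv_apply ℝ e)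
    ((tsupport_fderiv_apply_subset η e).trans hηU)).restrict (s := U)
  refine h1.mono (h.aemeasurable.aestronglyMeasurable.mul hk1.aestronglyMeasurable) ?_
  filter_upwards [h.nonneg] with y hy; rw [norm_mul, norm_mul]; gcongr; rw [norm_of_nonneg hy]
  exact (le_max_left _ _).trans (le_abs_self _)

lemma TruncWeakDeriv.integrable_indicator (h : TruncWeakDeriv U u G e) {ε : ℝ} (hε : 0 < ε)
  {η : F → ℝ} (hη : ContDiff ℝ ∞ η) (hηc : HasCompactSupport η) (hηU : tsupport η ⊆ U) :
  Integrable ({y | ε < u y}.indicator fun y => G y * η y) (volume.restrict U) := by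
  refine (((h.truncation ε hε).locInt_deriv.integrable_mul hη.continuous hηc hηU).restrict
    (s := U)).congr (ae_of_all _ fun y => ?_)
  by_cases hy : ε < u y <;> simp [hy]

lemma TruncWeakDeriv.integral_fderiv_eq_zero [IsLocallyFiniteMeasure (volume : Measure F)] (h :
  TruncWeakDeriv U u G e) {η : F → ℝ} (hη : ContDiff ℝ ∞ η) (hηc : HasCompactSupport η) (hηU :
  tsupport η ⊆ U) : ∫ y in U, fderiv ℝ η y e = 0 :=
  integral_eq_zero_of_truncation h.aemeasurable h.nonneg
    ((continuous_fderiv_apply_const hη e).integrable_of_hasCompactSupport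
      (hηc.fderiv_apply ℝ e)).restrict
    (h.integrable_mul_fderiv hη hηc hηU) (h.integrable_indicator one_pos hη hηc hηU)
    fun δ hδ => (h.truncation δ hδ).truncation_restrict hη hηc hηU

lemma TruncWeakDeriv.chain [IsLocallyFiniteMeasure (volume : Measure F)] (h : TruncWeakDeriv U u G
  e) {ε : ℝ} (hε : 0 < ε) {g Γ : ℝ → ℝ} (hg0 : ∀ s ≤ ε, g s = 0) (hg : ∀ s, ε < s →
  ContinuousWithinAt g (Iic s) s) (hΓ : ∀ s t, s ≤ t → |g s| ≤ Γ t) (hΓ1 : LocallyIntegrableOn (fun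
  y => u y * Γ (u y)) U) (hΓ2 : LocallyIntegrableOn ({y | ε < u y}.indicator fun y => Γ (u y) * G y)
  U) {η : F → ℝ} (hη : ContDiff ℝ ∞ η) (hηc : HasCompactSupport η) (hηU : tsupport η ⊆ U) (c : ℝ) :
  ∫ y, (c + ∫ x in (0 : ℝ)..u y, g x) * fderiv ℝ η y e = - ∫ y, g (u y) * G y * η y := by
  have hk1 : Continuous fun y => fderiv ℝ η y e := continuous_fderiv_apply_const hη e
  have hk1i : IntegrableOn (fun y => fderiv ℝ η y e) U :=
    (hk1.integrable_of_hasCompactSupport (hηc.fderiv_apply ℝ e)).restrict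
  have hsupp := (tsupport_fderiv_apply_subset η e).trans hηU
  have hΓi : Integrable (fun y => u y * Γ (u y) * fderiv ℝ η y e) (volume.restrict U) :=
    (hΓ1.integrable_mul hk1 (hηc.fderiv_apply ℝ e) hsupp).restrict
  have main := integral_comp_mul_eq_of_truncation h.aemeasurable h.nonneg hε hk1i
    (h.integrable_mul_fderiv hη hηc hηU) (h.integrable_indicator hε hη hηc hηU)
    (fun δ hδ => (h.truncation δ hδ).truncation_restrict hη hηc hηU) hg0 hg hΓ hΓi (by
      refine ((hΓ2.integrable_mul hη.continuous hηc hηU).restrict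
        (s := U)).congr (ae_of_all _ fun y => ?_)
      by_cases hy : ε < u y <;> simp [hy, mul_assoc])
  have e1 : ∫ y, (c + ∫ x in (0 : ℝ)..u y, g x) * fderiv ℝ η y e =
      ∫ y in U, (c + ∫ x in (0 : ℝ)..u y, g x) * fderiv ℝ η y e := by
    rw [setIntegral_eq_integral_of_forall_compl_eq_zero]; intro y hy
    rw [zero_off (f := fun y => fderiv ℝ η y e) fun h => hy (hsupp h), mul_zero]
  have e2 : ∫ y, g (u y) * G y * η y = ∫ y in U, g (u y) * (G y * η y) := by
    rw [setIntegral_eq_integral_of_forall_compl_eq_zero]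
    · simp only [mul_assoc]
    intro y hy; rw [zero_off fun h => hy (hηU h), mul_zero, mul_zero]
  rw [e1, e2, ← main]; simp only [add_mul]
  have hi : Integrable (fun y => (∫ x in (0 : ℝ)..u y, g x) * fderiv ℝ η y e)
      (volume.restrict U) := by
    have hgi : ∀ s, 0 ≤ s → IntervalIntegrable g volume 0 s := fun s hs => by
      rw [intervalIntegrable_iff, uIoc_of_le hs]; refine (integrable_const (Γ s)).mono' ?_ ?_
      · refine aestronglyMeasurable_of_tendsto_ae atTop
          (fun n => (measurable_leftStep g n).aestronglyMeasurable) ?_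
        filter_upwards [ae_restrict_mem measurableSet_Ioc] with x hx
        refine tendsto_leftStep hx.1 ?_; rcases le_or_gt x ε with h1 | h1
        · exact continuousWithinAt_const.congr (fun y hy => hg0 y (le_trans hy h1)) (hg0 x h1)
        · exact hg x h1
      · filter_upwards [ae_restrict_mem measurableSet_Ioc] with x hx; exact hΓ x s hx.2
    have hcont : ContinuousOn (fun s => ∫ x in (0 : ℝ)..s, g x) (Ici 0) := by
      intro s hs; have h1 := intervalIntegral.continuousOn_primitive_interval' (hgi (s + 1) (by
        have : 0 ≤ s := hs; linarith)) left_mem_uIcc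
      rw [uIcc_of_le (by have : 0 ≤ s := hs; linarith)] at h1
      refine (h1 s ⟨hs, by linarith⟩).mono_of_mem_nhdsWithin ?_
      have : Ici (0 : ℝ) ∩ Iio (s + 1) ⊆ Icc 0 (s + 1) := fun x hx => ⟨hx.1, hx.2.le⟩
      exact Filter.mem_of_superset (inter_mem_nhdsWithin _ (Iio_mem_nhds (by linarith))) this
    have hmeas : AEStronglyMeasurable (fun y => ∫ x in (0 : ℝ)..u y, g x) (volume.restrict U) := by
      have h1 : Continuous fun s : ℝ => ∫ x in (0 : ℝ)..max s 0, g x :=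
        hcont.comp_continuous (by fun_prop) fun s => mem_Ici.2 (le_max_right _ _)
      refine (h1.measurable.comp_aemeasurable h.aemeasurable).aestronglyMeasurable.congr ?_
      filter_upwards [h.nonneg] with y hy; simp only [comp_apply, max_eq_left hy]
    refine hΓi.mono (hmeas.mul hk1.aestronglyMeasurable) ?_; filter_upwards [h.nonneg] with y hy
    rw [norm_mul, norm_mul (u y * Γ (u y))]; gcongr
    exact (abs_integral_le_mul hΓ hy).trans (le_abs_self _)
  rw [integral_add (hk1i.const_mul c) hi, integral_const_mul,
    h.integral_fderiv_eq_zero hη hηc hηU, mul_zero, zero_add]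

end

lemma _root_.MeasureTheory.LocallyIntegrableOn.mono_of_restrict {X : Type*} [TopologicalSpace X]
  [MeasurableSpace X] {μ : Measure X} {f g : X → ℝ} {U : Set X}
  (hf : LocallyIntegrableOn f U μ) (hg : AEStronglyMeasurable g (μ.restrict U))
  (h : ∀ᵐ y ∂(μ.restrict U), ‖g y‖ ≤ ‖f y‖) : LocallyIntegrableOn g U μ := by
  intro x hx; obtain ⟨s, hs, hfs⟩ := hf x hx; refine ⟨s ∩ U, inter_mem hs self_mem_nhdsWithin, ?_⟩
  have hle : μ.restrict (s ∩ U) ≤ μ.restrict U := restrict_mono inter_subset_right le_rfl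
  exact Integrable.mono (hfs.mono_set inter_subset_left) (hg.mono_measure hle) (ae_mono hle h)

lemma _root_.MeasureTheory.LocallyIntegrableOn.congr_const_mul {X : Type*} [TopologicalSpace X]
  [MeasurableSpace X] {μ : Measure X} {f g : X → ℝ} {U : Set X} (hf : LocallyIntegrableOn f U μ) (c
  : ℝ) (h : ∀ᵐ y ∂(μ.restrict U), c * f y = g y) : LocallyIntegrableOn g U μ := by
  intro x hx; obtain ⟨s, hs, hfs⟩ := hf x hx; refine ⟨s ∩ U, inter_mem hs self_mem_nhdsWithin, ?_⟩
  have hle : μ.restrict (s ∩ U) ≤ μ.restrict U := restrict_mono inter_subset_right le_rfl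
  exact (Integrable.const_mul (hfs.mono_set inter_subset_left) c).congr (ae_mono hle h)

section
variable {F : Type*} [NormedAddCommGroup F] [NormedSpace ℝ F] [FiniteDimensional ℝ F]
  [MeasureSpace F] [BorelSpace F] [IsLocallyFiniteMeasure (volume : Measure F)] {U : Set F}
  {u G : F → ℝ} {e : F}

lemma TruncWeakDeriv.locallyIntegrableOn (h : TruncWeakDeriv U u G e) :
  LocallyIntegrableOn u U := by
  refine (h.truncation 1 one_pos).locInt.mono_of_restrict h.aemeasurable.aestronglyMeasurable ?_
  filter_upwards [h.nonneg] with y hy; rw [norm_of_nonneg hy]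
  exact (le_max_left _ _).trans (le_abs_self _)

lemma TruncWeakDeriv.comp (h : TruncWeakDeriv U u G e) {H H' : ℝ → ℝ} (hH : ∀ s, HasDerivAt H (H' s)
  s) (hH' : Continuous H') {ε B : ℝ} (hε : 0 < ε) (hH0 : ∀ s ≤ ε, H' s = 0) (hB : ∀ s, |H' s| ≤ B)
  (c : ℝ) {η : F → ℝ} (hη : ContDiff ℝ ∞ η) (hηc : HasCompactSupport η) (hηU : tsupport η ⊆ U) : ∫
  y, (H (u y) - c) * fderiv ℝ η y e = - ∫ y, H' (u y) * G y * η y := by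
  have h1 := h.chain hε (g := H') (Γ := fun _ => B) hH0
    (fun s _ => hH'.continuousWithinAt) (fun s t _ => hB s)
    (h.locallyIntegrableOn.congr_const_mul B (ae_of_all _ fun y => mul_comm _ _))
    (by
      refine (h.truncation ε hε).locInt_deriv.congr_const_mul B (ae_of_all _ fun y => ?_)
      by_cases hy : ε < u y <;> simp [hy]) hη hηc hηU (H 0 - c)
  rw [← h1]; refine integral_congr_ae (ae_of_all _ fun y => ?_); beta_reduce
  rw [integral_eq_sub_of_hasDerivAt (fun s _ => hH s) (hH'.intervalIntegrable _ _)]; ring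

lemma integral_truncated_rpow {σ ε : ℝ} (hσ : 1 ≤ σ) (hε : 0 < ε) {s : ℝ} (hs : 0 ≤ s) :
  ε ^ σ + ∫ x in (0 : ℝ)..s, (if x ≤ ε then 0 else σ * x ^ (σ - 1)) = max s ε ^ σ := by
  rcases le_total s ε with h | h
  · rw [max_eq_right h, integral_congr (g := fun _ => 0)]
    · simp
    · intro x hx; rw [uIcc_of_le hs] at hx; simp [hx.2.trans h]
  · have hi : IntervalIntegrable (fun x => σ * x ^ (σ - 1)) volume ε s :=
      (continuous_const.mul (continuous_rpow_const (by linarith))).intervalIntegrable _ _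
    have e1 : ∫ x in ε..s, (if x ≤ ε then 0 else σ * x ^ (σ - 1)) =
        ∫ x in ε..s, σ * x ^ (σ - 1) := by
      refine intervalIntegral.integral_congr_ae (ae_of_all _ fun x hx => ?_)
      rw [uIoc_of_le h] at hx; rw [if_neg (not_le.2 hx.1)]
    have e2 : ∫ x in ε..s, σ * x ^ (σ - 1) = s ^ σ - ε ^ σ := by
      refine integral_eq_sub_of_hasDerivAt (f := fun x => x ^ σ) (fun x hx => ?_) hi
      exact hasDerivAt_rpow_const (Or.inr hσ)
    have e3 : ∫ x in (0 : ℝ)..ε, (if x ≤ ε then 0 else σ * x ^ (σ - 1)) = 0 := by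
      rw [integral_congr (g := fun _ => 0)]
      · simp
      · intro x hx; rw [uIcc_of_le hε.le] at hx; simp [hx.2]
    rw [← integral_add_adjacent_intervals (b := ε), e1, e2, e3, max_eq_left h]
    · ring
    · refine (intervalIntegrable_const (c := (0 : ℝ))).congr_ae ?_
      filter_upwards [ae_restrict_mem measurableSet_uIoc] with x hx; rw [uIoc_of_le hε.le] at hx
      simp [hx.2]
    · refine hi.congr_ae ?_; filter_upwards [ae_restrict_mem measurableSet_uIoc] with x hx
      rw [uIoc_of_le h] at hx; rw [if_neg (not_le.2 hx.1)]

lemma TruncWeakDeriv.rpow (h : TruncWeakDeriv U u G e) {σ ε : ℝ} (hσ : 1 ≤ σ) (hε : 0 < ε) (h1 :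
  LocallyIntegrableOn (fun y => u y ^ σ) U) (h2 : LocallyIntegrableOn ({y | ε < u y}.indicator fun y
  => u y ^ (σ - 1) * G y) U) {η : F → ℝ} (hη : ContDiff ℝ ∞ η) (hηc : HasCompactSupport η) (hηU :
  tsupport η ⊆ U) : ∫ y, max (u y) ε ^ σ * fderiv ℝ η y e = - ∫ y, σ * {y | ε < u y}.indicator (fun
  y => u y ^ (σ - 1) * G y) y * η y := by
  have hσ1 : 0 ≤ σ - 1 := by linarith
  have key := h.chain hε (g := fun x => if x ≤ ε then 0 else σ * x ^ (σ - 1))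
    (Γ := fun t => σ * (max t 0) ^ (σ - 1)) (fun s hs => if_pos hs) ?_ ?_ ?_ ?_ hη hηc hηU (ε ^ σ)
  · have e2 : ∫ y, (ε ^ σ + ∫ x in (0 : ℝ)..u y, (if x ≤ ε then 0 else σ * x ^ (σ - 1))) *
        fderiv ℝ η y e = ∫ y, max (u y) ε ^ σ * fderiv ℝ η y e := by
      rw [← setIntegral_eq_integral_of_forall_compl_eq_zero (s := U), ←
        setIntegral_eq_integral_of_forall_compl_eq_zero (s := U)
          (f := fun y => max (u y) ε ^ σ * fderiv ℝ η y e)]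
      · refine integral_congr_ae ?_; filter_upwards [h.nonneg] with y hy
        rw [integral_truncated_rpow hσ hε hy]
      all_goals
        intro y hy; rw [zero_off (f := fun y : F => fderiv ℝ η y e)
          fun h => hy (hηU (tsupport_fderiv_apply_subset η e h)), mul_zero]
    rw [← e2, key]; congr 1; refine integral_congr_ae (ae_of_all _ fun y => ?_)
    by_cases hy : ε < u y
    · simp only [if_neg (not_le.2 hy), indicator_of_mem (show y ∈ {y | ε < u y} from hy)]; ring
    · simp [hy, not_lt.1 hy]
  · intro s hs; have : ContinuousAt (fun x => if x ≤ ε then 0 else σ * x ^ (σ - 1)) s := by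
      have h3 : Continuous fun x : ℝ => σ * x ^ (σ - 1) :=
        continuous_const.mul (continuous_rpow_const hσ1)
      refine h3.continuousAt.congr ?_; filter_upwards [Ioi_mem_nhds hs] with x hx
      rw [if_neg (not_le.2 hx)]
    exact this.continuousWithinAt
  · intro s t hst; split_ifs with hs
    · rw [abs_zero]; positivity
    · have hs : ε < s := not_le.1 hs; have hs0 : 0 < s := hε.trans hs
      rw [abs_of_nonneg (by positivity)]; gcongr; exact hst.trans (le_max_left _ _)
  · refine h1.congr_const_mul σ ?_; filter_upwards [h.nonneg] with y hy; rw [max_eq_left hy]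
    rcases hy.eq_or_lt with h0 | h0
    · rw [← h0, zero_rpow (by linarith)]; simp
    · have : u y ^ σ = u y * u y ^ (σ - 1) := by rw [rpow_sub_one h0.ne']; field_simp
      rw [this]; ring
  · refine h2.congr_const_mul σ (ae_of_all _ fun y => ?_); by_cases hy : ε < u y
    · have : max (u y) 0 = u y := max_eq_left (hε.trans hy).le; simp [hy, this]; ring
    · simp [hy]

end

section
variable {F : Type*} [NormedAddCommGroup F] [NormedSpace ℝ F] [FiniteDimensional ℝ F]
  [MeasurableSpace F] [BorelSpace F] {μ : Measure F} [μ.IsAddHaarMeasure]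

lemma ae_comp_sub_left {P : F → Prop} (h : ∀ᵐ z ∂μ, P z) (y : F) : ∀ᵐ ξ ∂μ, P (y - ξ) :=
  (Measure.measurePreserving_sub_left μ y).quasiMeasurePreserving.ae h

lemma integrable_mul_comp_sub {k f : F → ℝ} (hk : Continuous k) (hkc : HasCompactSupport k)
  (hf : Integrable f μ) (y : F) : Integrable (fun ξ => k ξ * f (y - ξ)) μ := by
  obtain ⟨B, hB⟩ := hkc.exists_bound_of_continuous hk
  exact (hf.comp_sub_left y).bdd_mul hk.aestronglyMeasurable (ae_of_all _ hB)

lemma tendsto_mollify {f : F → ℝ} (hf : Measurable f) (hfi : Integrable f μ) {p : ℝ} (hp : 1 ≤ p)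
  (hfp : MemLp f (ofReal p) μ) {k : ℕ → F → ℝ} (hk : ∀ n, Continuous (k n))
  (hkc : ∀ n, HasCompactSupport (k n)) (hk0 : ∀ n ξ, 0 ≤ k n ξ) (hk1 : ∀ n, ∫ ξ, k n ξ ∂μ = 1)
  {δ : ℕ → ℝ} (hδ : Tendsto δ atTop (𝓝 0)) (hsupp : ∀ n, ∀ ξ ∈ tsupport (k n), ‖ξ‖ ≤ δ n) :
  Tendsto (fun n => ∫⁻ y, ‖(∫ ξ, k n ξ * f (y - ξ) ∂μ) - f y‖ₑ ^ p ∂μ) atTop (𝓝 0) := by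
  have hki : ∀ n, Integrable (k n) μ := fun n => (hk n).integrable_of_hasCompactSupport (hkc n)
  rw [ENNReal.tendsto_nhds_zero]; intro A hA
  have h1 := (ENNReal.tendsto_nhds_zero.1 (tendsto_lintegral_sub_translate hp hfp)) A hA
  obtain ⟨d, hd, hdA⟩ := Metric.eventually_nhds_iff.1 h1
  filter_upwards [hδ.eventually (Iio_mem_nhds hd)] with n hn
  set κ := μ.withDensity fun ξ => ofReal (k n ξ) with hκ; have hκ1 : κ univ = 1 := by
    rw [hκ, withDensity_apply _ MeasurableSet.univ, restrict_univ,
      ← ofReal_integral_eq_lintegral_ofReal (hki n) (ae_of_all _ (hk0 n)), hk1,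
      ofReal_one]
  have : IsFiniteMeasure κ := ⟨by rw [hκ1]; exact ENNReal.one_lt_top⟩
  have h2 := lintegral_rpow_lintegral_sub_le (μ := μ) κ hf hp univ (A := A) ?_
  · rw [hκ1, ENNReal.one_rpow, one_mul, restrict_univ] at h2; refine le_trans ?_ h2; gcongr with y
    have e1 : (∫ ξ, k n ξ * f (y - ξ) ∂μ) - f y = ∫ ξ, k n ξ * (f (y - ξ) - f y) ∂μ := by
      simp only [mul_sub]
      rw [integral_sub (integrable_mul_comp_sub (hk n) (hkc n) hfi y) ((hki n).mul_const _),
        integral_mul_const, hk1, one_mul]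
    rw [e1]; refine (enorm_integral_le_lintegral_enorm _).trans (le_of_eq ?_)
    rw [hκ, lintegral_withDensity_eq_lintegral_mul _ (hk n).measurable.ennreal_ofReal (by fun_prop)]
    refine lintegral_congr fun ξ => ?_
    rw [Pi.mul_apply, enorm_mul, enorm_of_nonneg (hk0 n ξ), enorm_sub_rev]
  · rw [hκ, ae_withDensity_iff (hk n).measurable.ennreal_ofReal]; refine ae_of_all _ fun ξ hξ => ?_
    rw [restrict_univ]; apply hdA; rw [dist_zero_right]
    refine (hsupp n ξ (subset_tsupport _ fun h => hξ (by rw [h, ENNReal.ofReal_zero]))).trans_lt hn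

end

end WeakDeriv

section Euclidean

instance instIsAddHaarMeasure_volume_prod : (volume : Measure (Ξ × ℝ)).IsAddHaarMeasure :=
  inferInstanceAs ((volume.prod volume : Measure (Ξ × ℝ)).IsAddHaarMeasure)

/-- The local properties of a weak solution in a chart. -/
structure ChartSolution (Ω : Set (Ξ × ℝ)) (p m : ℝ) (u D : Ξ × ℝ → ℝ) (G : Ξ → Ξ × ℝ → ℝ)
  (A : Ξ × ℝ → ℝ) : Prop where
  space : ∀ w, TruncWeakDeriv Ω u (G w) (w, 0)
  time : TruncWeakDeriv Ω u D (0, 1)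
  nonneg : ∀ y, 0 ≤ A y
  bound : ∀ w, ∀ᵐ y ∂(volume.restrict Ω), |G w y| ≤ ‖w‖ * A y
  pow : LocallyIntegrableOn (fun y => u y ^ (p + m - 1)) Ω
  grad : LocallyIntegrableOn (fun y => A y ^ p * u y ^ (m - 1)) Ω

variable {Ω : Set (EuclideanSpace ℝ (Fin N) × ℝ)}
  {u D : EuclideanSpace ℝ (Fin N) × ℝ → ℝ}
  {G : EuclideanSpace ℝ (Fin N) → EuclideanSpace ℝ (Fin N) × ℝ → ℝ}
  {A : EuclideanSpace ℝ (Fin N) × ℝ → ℝ}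

lemma le_one_add_rpow {x p : ℝ} (hx : 0 ≤ x) (hp : 1 ≤ p) : x ≤ 1 + x ^ p := by
  rcases le_total x 1 with h | h
  · have := rpow_nonneg hx p; linarith
  · have := self_le_rpow_of_one_le h hp; linarith

lemma locallyIntegrableOn_one_add {X : Type*} [TopologicalSpace X] [MeasurableSpace X]
  {μ : Measure X} [IsLocallyFiniteMeasure μ] {f : X → ℝ} {U : Set X}
  (hf : LocallyIntegrableOn f U μ) : LocallyIntegrableOn (fun x => 1 + f x) U μ :=
  LocallyIntegrableOn.add (f := fun _ => (1 : ℝ))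
    ((locallyIntegrable_const (1 : ℝ)).locallyIntegrableOn U) hf

lemma sigma_bounds (hp : 1 < p) (hm : 1 ≤ m) : 1 ≤ (p + m - 1) / p ∧
  ((p + m - 1) / p - 1) * p = m - 1 ∧ (p + m - 1) / p * p = p + m - 1 := by
  have hp0 : 0 < p := by linarith
  refine ⟨?_, ?_, ?_⟩
  · rw [le_div_iff₀ hp0]; linarith
  · field_simp; ring
  · field_simp

lemma ChartSolution.locallyIntegrableOn_rpow (h : ChartSolution Ω p m u D G A) (hp : 1 < p)
  (hm : 1 ≤ m) : LocallyIntegrableOn (fun y => u y ^ ((p + m - 1) / p)) Ω := by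
  obtain ⟨h1, h2, h3⟩ := sigma_bounds hp hm
  refine (locallyIntegrableOn_one_add h.pow).mono_of_restrict
    (h.time.aemeasurable.pow_const _).aestronglyMeasurable ?_
  filter_upwards [h.time.nonneg] with y hy
  rw [norm_of_nonneg (by positivity), norm_of_nonneg (by positivity)]
  refine (le_one_add_rpow (by positivity) hp.le).trans (le_of_eq ?_); rw [← rpow_mul hy, h3]

lemma ChartSolution.abs_grad_rpow_le (h : ChartSolution Ω p m u D G A) (hp : 1 < p) (hm : 1 ≤ m) (ε
  : ℝ) (w : Ξ) : ∀ᵐ y ∂(volume.restrict Ω), |{y | ε < u y}.indicator (fun y => u y ^ ((p + m - 1) /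
  p - 1) * G w y) y| ^ p ≤ ‖w‖ ^ p * (A y ^ p * u y ^ (m - 1)) := by
  obtain ⟨h1, h2, h3⟩ := sigma_bounds hp hm; filter_upwards [h.time.nonneg, h.bound w] with y hy hb
  have hA := h.nonneg y; by_cases hε : ε < u y
  · rw [indicator_of_mem (show y ∈ {y | ε < u y} from hε), abs_mul, abs_of_nonneg (by positivity),
      mul_rpow (by positivity) (abs_nonneg _), ← rpow_mul hy, h2]
    calc u y ^ (m - 1) * |G w y| ^ p ≤ u y ^ (m - 1) * (‖w‖ * A y) ^ p := by gcongr
      _ = _ := by rw [mul_rpow (norm_nonneg _) hA]; ring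
  · rw [indicator_of_notMem (show y ∉ {y | ε < u y} from hε), abs_zero, zero_rpow (by linarith)]
    positivity

lemma ChartSolution.locallyIntegrableOn_grad (h : ChartSolution Ω p m u D G A) (hp : 1 < p)
  (hm : 1 ≤ m) {ε : ℝ} (hε : 0 < ε) (w : Ξ) :
  LocallyIntegrableOn ({y | ε < u y}.indicator fun y => u y ^ ((p + m - 1) / p - 1) * G w y) Ω := by
  refine (locallyIntegrableOn_one_add (h.grad.congr_const_mul (‖w‖ ^ p)
    (ae_of_all _ fun y => rfl))).mono_of_restrict ?_ ?_
  · have := (h.time.aemeasurable.pow_const ((p + m - 1) / p - 1)).aestronglyMeasurable.mul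
      ((h.space w).truncation ε hε).locInt_deriv.aestronglyMeasurable
    refine this.congr (ae_of_all _ fun y => ?_); by_cases hy : ε < u y <;> simp [hy]
  · filter_upwards [h.abs_grad_rpow_le hp hm ε w, h.time.nonneg] with y hy hu; have hA := h.nonneg y
    rw [norm_eq_abs, norm_of_nonneg (by positivity)]
    exact (le_one_add_rpow (abs_nonneg _) hp.le).trans (by linarith)

lemma setLIntegral_rpow_congr {X : Type*} [MeasurableSpace X] {μ : Measure X} {g f : X → ℝ}
  {K : Set X} (hK : MeasurableSet K) (h1 : ∀ᵐ y ∂μ, y ∈ K → g y = f y) (h2 : ∀ y ∉ K, g y = 0)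
  {p : ℝ} (hp : 0 < p) : ∫⁻ y, ‖g y‖ₑ ^ p ∂μ = ∫⁻ y in K, ofReal (|f y| ^ p) ∂μ := by
  rw [← lintegral_indicator hK]; refine lintegral_congr_ae ?_; filter_upwards [h1] with y hy
  by_cases hyK : y ∈ K
  · rw [indicator_of_mem hyK, hy hyK, ← ofReal_rpow_of_nonneg (abs_nonneg _) hp.le,
      enorm_eq_ofReal_abs]
  · rw [indicator_of_notMem hyK, h2 y hyK, enorm_zero, zero_rpow_of_pos hp]

/-- Spatial translations of the power of `u` in whose terms the gradient energy is unweighted. -/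
lemma ChartSolution.exists_translate_le (h : ChartSolution Ω p m u D G A) (hp : 1 < p) (hm : 1 ≤ m)
  {ε : ℝ} (hε : 0 < ε) {K1 : Set (Ξ × ℝ)} (hK1 : IsCompact K1) (hK1Ω : K1 ⊆ Ω) {v : Ξ × ℝ → ℝ} (hvi
  : Integrable v) (hv : ∀ᵐ y, y ∈ K1 → v y = max (u y) ε ^ ((p + m - 1) / p)) : ∃ C : ℝ≥0∞, C ≠ ⊤ ∧
  ∀ (w : Ξ) (W : Set (Ξ × ℝ)), IsOpen W → (∀ y ∈ W, ∀ s ∈ Icc (0 : ℝ) 1, y - s • ((w, 0) : Ξ × ℝ) ∈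
  K1) → ∫⁻ y in W, ‖v y - v (y - (w, 0))‖ₑ ^ p ≤ ofReal (‖w‖ ^ p) * C := by
  set σ := (p + m - 1) / p with hσ; obtain ⟨h1, h2, h3⟩ := sigma_bounds hp hm
  have hp0 : 0 < p := by linarith
  have hgi : IntegrableOn (fun y => A y ^ p * u y ^ (m - 1)) K1 :=
    h.grad.integrableOn_compact_subset hK1Ω hK1
  refine ⟨ofReal (σ ^ p) * ∫⁻ y in K1, ofReal (A y ^ p * u y ^ (m - 1)),
    mul_ne_top ofReal_ne_top hgi.lintegral_lt_top.ne, fun w W hW hWK => ?_⟩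
  have hloc := (h.locallyIntegrableOn_grad hp hm hε w).congr_const_mul σ (ae_of_all _ fun y => rfl)
  obtain ⟨g, hgm, hgI, hgK, hg0⟩ := exists_measurable_rep hK1.measurableSet
    (hloc.integrableOn_compact_subset hK1Ω hK1)
  have hfg : ∀ η : Ξ × ℝ → ℝ, ContDiff ℝ ∞ η → HasCompactSupport η →
      tsupport η ⊆ K1 → ∫ y, v y * fderiv ℝ η y (w, 0) = - ∫ y, g y * η y := by
    intro η hη hηc hηK; rw [integral_mul_congr_of_tsupport hηK hgK,
      integral_mul_congr_of_tsupport (η := fun y => fderiv ℝ η y (w, 0))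
        ((tsupport_fderiv_apply_subset η (w, 0)).trans hηK) hv]
    exact (h.space w).rpow h1 hε (h.locallyIntegrableOn_rpow hp hm)
      (h.locallyIntegrableOn_grad hp hm hε w) hη hηc (hηK.trans hK1Ω)
  refine (lintegral_sub_translate_le hvi hgI hfg hW hWK hgm hp.le).trans ?_
  rw [setLIntegral_rpow_congr hK1.measurableSet hgK hg0 hp0, ← mul_assoc,
    ← ofReal_mul (by positivity), ← lintegral_const_mul' _ _ ofReal_ne_top]
  refine lintegral_mono_ae ?_
  have hle : volume.restrict K1 ≤ volume.restrict Ω := restrict_mono hK1Ω le_rfl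
  filter_upwards [ae_mono hle (h.abs_grad_rpow_le hp hm ε w)] with y hy
  rw [← ofReal_mul (by positivity)]; refine ofReal_le_ofReal ?_; have hσ0 : 0 ≤ σ := by linarith
  rw [abs_mul, abs_of_nonneg hσ0, mul_rpow hσ0 (abs_nonneg _), mul_comm (‖w‖ ^ p), mul_assoc]
  gcongr

lemma ChartSolution.lintegral_rpow_lt_top (h : ChartSolution Ω p m u D G A) (hp : 1 < p) (hm : 1 ≤
  m) {ε : ℝ} (hε : 0 < ε) {K1 : Set (Ξ × ℝ)} (hK1 : IsCompact K1) (hK1Ω : K1 ⊆ Ω) : ∫⁻ y in K1,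
  ofReal (|max (u y) ε ^ ((p + m - 1) / p)| ^ p) < ⊤ := by
  obtain ⟨h1, h2, h3⟩ := sigma_bounds hp hm
  have hi : IntegrableOn (fun y => ε ^ (p + m - 1) + u y ^ (p + m - 1)) K1 :=
    (integrableOn_const hK1.measure_lt_top.ne).add (h.pow.integrableOn_compact_subset hK1Ω hK1)
  refine lt_of_le_of_lt (lintegral_mono_ae ?_) hi.lintegral_lt_top
  have hle : volume.restrict K1 ≤ volume.restrict Ω := restrict_mono hK1Ω le_rfl
  filter_upwards [ae_mono hle h.time.nonneg] with y hy; refine ofReal_le_ofReal ?_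
  have hmx : 0 ≤ max (u y) ε := hy.trans (le_max_left _ _)
  rw [abs_of_nonneg (by positivity), ← rpow_mul hmx, h3]; rcases le_total (u y) ε with hle | hle
  · rw [max_eq_right hle]; have : 0 ≤ u y ^ (p + m - 1) := by positivity
    linarith
  · rw [max_eq_left hle]; have : 0 ≤ ε ^ (p + m - 1) := by positivity
    linarith

/-- Smooth functions approximating `H (u)`, with `H` constant near `0` and near `∞`. -/
structure IsCutoff (ε L B : ℝ) (H H' : ℝ → ℝ) : Prop where
  pos : 0 < ε
  lt : ε < L
  hasDerivAt : ∀ s, HasDerivAt H (H' s) s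
  continuous : Continuous H'
  eq_zero_of_le : ∀ s ≤ ε, H' s = 0
  eq_zero_of_ge : ∀ s, L ≤ s → H' s = 0
  const : ∀ s, L ≤ s → H s = H L
  nonneg : ∀ s, 0 ≤ H s
  le : ∀ s, H s ≤ B
  abs_le : ∀ s, |H' s| ≤ B

variable {F : Type*} [NormedAddCommGroup F] [NormedSpace ℝ F]
  [FiniteDimensional ℝ F] [MeasurableSpace F] [BorelSpace F] {μ : Measure F}
  [μ.IsAddHaarMeasure]

lemma lintegral_translate_add_le {v : F → ℝ} (hv : Measurable v) {p : ℝ} (hp : 1 ≤ p) {K W : Set F}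
  (hK : MeasurableSet K) (hW : MeasurableSet W) {ξ ζ : F} (hKW : ∀ y ∈ K, y - ζ ∈ W) :
  ∫⁻ y in K, ‖v y - v (y - (ξ + ζ))‖ₑ ^ p ∂μ ≤
    2 ^ (p - 1) * (∫⁻ y, ‖v y - v (y - ζ)‖ₑ ^ p ∂μ + ∫⁻ y in W, ‖v y - v (y - ξ)‖ₑ ^ p ∂μ) := by
  have hp0 : 0 ≤ p := by linarith
  have h1 : ∫⁻ y in K, ‖v (y - ζ) - v (y - ζ - ξ)‖ₑ ^ p ∂μ ≤
      ∫⁻ y in W, ‖v y - v (y - ξ)‖ₑ ^ p ∂μ := by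
    rw [← lintegral_indicator hW, ← lintegral_indicator hK,
      ← lintegral_sub_right_eq_self (W.indicator fun y => ‖v y - v (y - ξ)‖ₑ ^ p) ζ]
    refine lintegral_mono fun y => ?_; by_cases hy : y ∈ K
    · rw [indicator_of_mem hy, indicator_of_mem (hKW y hy)]
    · rw [indicator_of_notMem hy]; exact zero_le
  calc ∫⁻ y in K, ‖v y - v (y - (ξ + ζ))‖ₑ ^ p ∂μ
      ≤ ∫⁻ y in K, 2 ^ (p - 1) * (‖v y - v (y - ζ)‖ₑ ^ p + ‖v (y - ζ) - v (y - ζ - ξ)‖ₑ ^ p) ∂μ := by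
        gcongr with y; refine le_trans ?_ (ENNReal.rpow_add_le_mul_rpow_add_rpow _ _ hp); gcongr
        refine le_trans (le_of_eq ?_) (enorm_add_le _ _); congr 1
        rw [show y - (ξ + ζ) = y - ζ - ξ by abel]; ring
    _ = 2 ^ (p - 1) * (∫⁻ y in K, ‖v y - v (y - ζ)‖ₑ ^ p ∂μ +
          ∫⁻ y in K, ‖v (y - ζ) - v (y - ζ - ξ)‖ₑ ^ p ∂μ) := by
        rw [lintegral_const_mul _ (by fun_prop), lintegral_add_left (by fun_prop)]
    _ ≤ _ := by gcongr; exact Measure.restrict_le_self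

lemma enorm_integral_mul_le {b v k : F → ℝ} {B l : ℝ} (hv : Measurable v) (hk : Measurable k)
  (hgood : ∀ᵐ z ∂μ, b z ≠ 0 → |b z| ≤ B ∧ v z ≤ l) {y : F} (hy : 2 * l < v y) (hvy : 0 ≤ v y) :
  ‖∫ ξ, k ξ * b (y - ξ) ∂μ‖ₑ * ‖v y‖ₑ ≤
    ofReal (2 * B) * ∫⁻ ξ, ‖v y - v (y - ξ)‖ₑ ∂(μ.withDensity fun ξ => ‖k ξ‖ₑ) := by
  rw [lintegral_withDensity_eq_lintegral_mul _ hk.enorm (by fun_prop)]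
  calc ‖∫ ξ, k ξ * b (y - ξ) ∂μ‖ₑ * ‖v y‖ₑ ≤ (∫⁻ ξ, ‖k ξ * b (y - ξ)‖ₑ ∂μ) * ‖v y‖ₑ := by
        gcongr; exact enorm_integral_le_lintegral_enorm _
    _ = ∫⁻ ξ, ‖k ξ * b (y - ξ)‖ₑ * ‖v y‖ₑ ∂μ := by rw [lintegral_mul_const' _ _ (by simp)]
    _ ≤ ∫⁻ ξ, ofReal (2 * B) * ((fun ξ => ‖k ξ‖ₑ) * fun ξ => ‖v y - v (y - ξ)‖ₑ) ξ ∂μ := by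
        refine lintegral_mono_ae ?_; filter_upwards [ae_comp_sub_left hgood y] with ξ hξ
        rw [Pi.mul_apply, enorm_mul, mul_assoc, mul_left_comm (ofReal _)]; gcongr _ * ?_
        by_cases hb : b (y - ξ) = 0
        · rw [hb, enorm_zero, zero_mul]; exact zero_le
        · obtain ⟨h1, h2⟩ := hξ hb; have hB : 0 ≤ B := (abs_nonneg _).trans h1
          rw [enorm_eq_ofReal_abs, enorm_eq_ofReal_abs, enorm_eq_ofReal_abs,
            ← ofReal_mul (abs_nonneg _), ← ofReal_mul (by positivity)]
          refine ofReal_le_ofReal ?_; rw [abs_of_nonneg hvy]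
          have h3 : v y ≤ 2 * |v y - v (y - ξ)| := by
            have := le_abs_self (v y - v (y - ξ)); linarith
          calc |b (y - ξ)| * v y ≤ B * (2 * |v y - v (y - ξ)|) := by gcongr
            _ = _ := by ring
    _ = _ := by rw [lintegral_const_mul' _ _ ofReal_ne_top]

/-- Interpolation: unweighted convergence and a bound with a stronger weight. -/
lemma lintegral_weighted_le {X : Type*} [MeasurableSpace X] {μ : Measure X} {x T : X → ℝ≥0∞} (hx :
  AEMeasurable x μ) (hT : AEMeasurable T μ) {p κ : ℝ} (hκ0 : 0 ≤ κ) (hκ1 : κ ≤ 1) {c : ℝ≥0∞} (hc : c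
  ≠ ⊤) {W : X → ℝ≥0∞} (hW : ∀ᵐ y ∂μ, W y ≤ c * x y ^ p + (x y ^ p) ^ (1 - κ) * (T y ^ p) ^ κ) : ∫⁻
  y, W y ∂μ ≤ c * ∫⁻ y, x y ^ p ∂μ + (∫⁻ y, x y ^ p ∂μ) ^ (1 - κ) * (∫⁻ y, T y ^ p ∂μ) ^ κ := by
  refine (lintegral_mono_ae hW).trans ?_
  rw [lintegral_add_left' ((hx.pow_const p).const_mul c), lintegral_const_mul' _ _ hc]; gcongr
  exact lintegral_mul_norm_pow_le (hx.pow_const p) (hT.pow_const p) (by linarith) hκ0 (by ring)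

lemma rpow_interpolation {x v : ℝ≥0∞} {p κ : ℝ} (hp : 0 ≤ p) (hκ0 : 0 ≤ κ) (hκ1 : κ ≤ 1) :
  (x ^ p) ^ (1 - κ) * ((x * v) ^ p) ^ κ = x ^ p * v ^ (p * κ) := by
  rw [mul_rpow_of_nonneg _ _ hp, mul_rpow_of_nonneg _ _ hκ0, ← mul_assoc,
    ← ENNReal.rpow_add_of_nonneg _ _ (by linarith) hκ0, sub_add_cancel, ENNReal.rpow_one,
    ← ENNReal.rpow_mul]

lemma integrableOn_comp_of_bdd {U K : Set (Ξ × ℝ)} {g : Ξ × ℝ → ℝ} {e : Ξ × ℝ}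
  (h : TruncWeakDeriv U u g e) (hK : IsCompact K) (hKU : K ⊆ U) {ε L B : ℝ} {H H' : ℝ → ℝ}
  (hH : IsCutoff ε L B H H') : IntegrableOn (fun y => H' (u y) * g y) K := by
  have h1 := (h.truncation ε hH.pos).locInt_deriv.integrableOn_compact_subset hKU hK
  have hle : volume.restrict K ≤ volume.restrict U := restrict_mono hKU le_rfl
  have h2 : IntegrableOn (fun y => H' (u y) * {y | ε < u y}.indicator g y) K :=
    Integrable.bdd_mul h1 (c := B) ((hH.continuous.measurable.comp_aemeasurable
      (h.aemeasurable.mono_measure hle)).aestronglyMeasurable) (ae_of_all _ fun y => hH.abs_le _)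
  refine h2.congr (ae_of_all _ fun y => ?_); by_cases hy : ε < u y
  · simp [hy]
  · simp [hH.eq_zero_of_le _ (not_lt.1 hy)]

lemma memLp_of_lintegral_rpow {X : Type*} [MeasurableSpace X] {μ : Measure X} {f : X → ℝ} (hf :
  Measurable f) {p : ℝ} (hp : 0 < p) (h : ∫⁻ y, ‖f y‖ₑ ^ p ∂μ < ⊤) : MemLp f (ofReal p) μ := by
  refine ⟨hf.aestronglyMeasurable, ?_⟩
  rw [eLpNorm_lt_top_iff_lintegral_rpow_enorm_lt_top (by simpa using hp) ofReal_ne_top,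
    ENNReal.toReal_ofReal hp.le]
  exact h

lemma ChartSolution.lintegral_deriv_lt_top (h : ChartSolution Ω p m u D G A) (hp : 1 < p) (hm : 1 ≤
  m) {ε L B : ℝ} {H H' : ℝ → ℝ} (hH : IsCutoff ε L B H H') {K1 : Set (Ξ × ℝ)} (hK1 : IsCompact K1)
  (hK1Ω : K1 ⊆ Ω) (w : Ξ) : ∫⁻ y in K1, ofReal (|H' (u y) * G w y| ^ p) < ⊤ := by
  have hi : IntegrableOn (fun y => B ^ p * ‖w‖ ^ p * (ε ^ (m - 1))⁻¹ * (A y ^ p * u y ^ (m - 1)))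
      K1 := (h.grad.integrableOn_compact_subset hK1Ω hK1).const_mul _
  have hε := hH.pos; have hB : 0 ≤ B := (hH.nonneg 0).trans (hH.le 0)
  refine lt_of_le_of_lt (lintegral_mono_ae ?_) hi.lintegral_lt_top
  have hle : volume.restrict K1 ≤ volume.restrict Ω := restrict_mono hK1Ω le_rfl
  filter_upwards [ae_mono hle h.time.nonneg, ae_mono hle (h.bound w)] with y hy hb
  refine ofReal_le_ofReal ?_; have hA := h.nonneg y; by_cases hu : ε < u y
  · rw [abs_mul, mul_rpow (abs_nonneg _) (abs_nonneg _)]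
    have h1 : |H' (u y)| ^ p ≤ B ^ p := by gcongr; exact hH.abs_le _
    have h2 : |G w y| ^ p ≤ ‖w‖ ^ p * A y ^ p := by rw [← mul_rpow (norm_nonneg _) hA]; gcongr
    have h3 : 1 ≤ (ε ^ (m - 1))⁻¹ * u y ^ (m - 1) := by
      rw [← div_eq_inv_mul, one_le_div (by positivity)]; gcongr
    calc |H' (u y)| ^ p * |G w y| ^ p ≤ B ^ p * (‖w‖ ^ p * A y ^ p) := by gcongr
      _ ≤ B ^ p * (‖w‖ ^ p * A y ^ p) * ((ε ^ (m - 1))⁻¹ * u y ^ (m - 1)) :=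
        le_mul_of_one_le_right (by positivity) h3
      _ = _ := by ring
  · rw [hH.eq_zero_of_le _ (not_lt.1 hu), zero_mul, abs_zero, zero_rpow (by linarith)]; positivity

open scoped Convolution in
lemma mollify_bounds {k b : Ξ × ℝ → ℝ} {C r τ c B : ℝ} (hk : IsMollifier C r τ k) (hb : Integrable
  b) (hbB : ∀ᵐ z, -c ≤ b z ∧ b z ≤ B - c) (y : Ξ × ℝ) : 0 ≤ c + (k ⋆[lsmul ℝ ℝ, volume] b) y ∧ c +
  (k ⋆[lsmul ℝ ℝ, volume] b) y ≤ B := by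
  have e1 : (k ⋆[lsmul ℝ ℝ, volume] b) y = ∫ ξ, k ξ * b (y - ξ) := rfl
  have hi := integrable_mul_comp_sub hk.contDiff.continuous hk.hasCompactSupport hb y
  have hki := hk.contDiff.continuous.integrable_of_hasCompactSupport hk.hasCompactSupport
    (μ := volume)
  have h1 : ∫ ξ, k ξ * (-c) ≤ ∫ ξ, k ξ * b (y - ξ) := by
    refine integral_mono_ae (hki.mul_const _) hi ?_
    filter_upwards [ae_comp_sub_left hbB y] with ξ hξ
    exact mul_le_mul_of_nonneg_left hξ.1 (hk.nonneg ξ)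
  have h2 : ∫ ξ, k ξ * b (y - ξ) ≤ ∫ ξ, k ξ * (B - c) := by
    refine integral_mono_ae hi (hki.mul_const _) ?_
    filter_upwards [ae_comp_sub_left hbB y] with ξ hξ
    exact mul_le_mul_of_nonneg_left hξ.2 (hk.nonneg ξ)
  rw [integral_mul_const, hk.integral_eq_one] at h1 h2; rw [e1]; constructor <;> linarith

/-- Mollifiers at scales `r n → 0` for which the translates of `v` are controlled. -/
lemma exists_mollifiers {K K1 : Set (Ξ × ℝ)} {δ : ℝ} (hδ : 0 < δ) (hK : IsCompact K) (hK1 :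
  cthickening δ K ⊆ K1) {v : Ξ × ℝ → ℝ} (hv : Measurable v) (hp : 1 < p) (hvp : MemLp v (ofReal p))
  {C : ℝ≥0∞} (hC : ∀ (w : Ξ) (W : Set (Ξ × ℝ)), IsOpen W → (∀ y ∈ W, ∀ s ∈ Icc (0 : ℝ) 1, y - s •
  ((w, 0) : Ξ × ℝ) ∈ K1) → ∫⁻ y in W, ‖v y - v (y - (w, 0))‖ₑ ^ p ≤ ofReal (‖w‖ ^ p) * C) : ∃ (C1 :
  ℝ) (r : ℕ → ℝ) (k : ℕ → Ξ × ℝ → ℝ), 0 ≤ C1 ∧ (∀ n, 0 < r n) ∧ (∀ n, r n ≤ δ / 4) ∧ Tendsto r atTop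
  (𝓝 0) ∧ (∀ n, ∃ τ ≤ r n, IsMollifier C1 (r n) τ (k n)) ∧ ∀ n, ∀ ξ ∈ tsupport (k n), ∫⁻ y in K, ‖v
  y - v (y - ξ)‖ₑ ^ p ≤ 2 ^ (p - 1) * (ofReal (r n ^ p) * (1 + C)) := by
  obtain ⟨C1, hC1, hmol⟩ := exists_isMollifier N
  have hτ : ∀ r : ℝ, 0 < r → ∃ τ, 0 < τ ∧ τ ≤ r ∧ ∀ θ : ℝ, |θ| ≤ τ →
      ∫⁻ y, ‖v y - v (y - ((0 : Ξ), θ))‖ₑ ^ p ≤ ofReal (r ^ p) := by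
    intro r hr; have h1 := (ENNReal.tendsto_nhds_zero.1 (tendsto_lintegral_sub_translate hp.le hvp))
      (ofReal (r ^ p)) (by positivity)
    obtain ⟨d, hd, hdA⟩ := Metric.eventually_nhds_iff.1 h1
    refine ⟨min r (d / 2), by positivity, min_le_left _ _, fun θ hθ => hdA ?_⟩
    rw [dist_zero_right, Prod.norm_mk, norm_zero, max_eq_right (norm_nonneg _), norm_eq_abs]
    have := hθ.trans (min_le_right _ _); linarith
  set r : ℕ → ℝ := fun n => δ / 4 * (1 / ((n : ℝ) + 1)) with hr
  have hr0 : ∀ n, 0 < r n := fun n => by positivity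
  have hrδ : ∀ n, r n ≤ δ / 4 := fun n => by
    refine mul_le_of_le_one_right (by positivity) ?_; rw [div_le_one (by positivity)]
    have : (0 : ℝ) ≤ n := by positivity
    linarith
  choose τ hτ0 hτr hτv using fun n => hτ (r n) (hr0 n)
  choose k hk using fun n => hmol (r n) (τ n) (hr0 n) (hτ0 n)
  refine ⟨C1, r, k, hC1, hr0, hrδ, ?_, fun n => ⟨τ n, hτr n, hk n⟩, fun n ξ hξ => ?_⟩
  · have := (tendsto_one_div_add_atTop_nhds_zero_nat (𝕜 := ℝ)).const_mul (δ / 4)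
    rwa [mul_zero] at this
  · obtain ⟨hξ1, hξ2⟩ := (hk n).norm_le ξ hξ
    have hsum : ξ = ((ξ.1, 0) : Ξ × ℝ) + (0, ξ.2) := by ext <;> simp
    have hWo : IsOpen (thickening (δ / 2) K) := isOpen_thickening
    have h1 := lintegral_translate_add_le (μ := volume) hv hp.le hK.measurableSet
      hWo.measurableSet (ξ := ((ξ.1, 0) : Ξ × ℝ)) (ζ := (0, ξ.2)) (by
        intro y hy; rw [mem_thickening_iff]; refine ⟨y, hy, ?_⟩
        rw [dist_eq_norm, sub_sub_cancel_left, norm_neg, Prod.norm_mk, norm_zero,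
          max_eq_right (norm_nonneg _), norm_eq_abs]
        have := hτr n; have := hrδ n; linarith)
    rw [← hsum] at h1; refine h1.trans ?_; gcongr; rw [mul_add, mul_one]; gcongr
    · exact hτv n _ hξ2
    · refine (hC ξ.1 _ hWo ?_).trans ?_
      · intro y hy s hs; rw [mem_thickening_iff] at hy; obtain ⟨x, hx, hxy⟩ := hy; apply hK1
        refine mem_cthickening_of_dist_le _ x _ _ hx ?_
        have h2 : dist (y - s • ((ξ.1, 0) : Ξ × ℝ)) y ≤ δ / 4 := by
          rw [dist_eq_norm, sub_sub_cancel_left, norm_neg, norm_smul, Prod.norm_mk, norm_zero,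
            max_eq_left (norm_nonneg _), norm_of_nonneg hs.1]
          calc s * ‖ξ.1‖ ≤ 1 * ‖ξ.1‖ := by gcongr; exact hs.2
            _ ≤ δ / 4 := by rw [one_mul]; exact hξ1.trans (hrδ n)
        have := dist_triangle (y - s • ((ξ.1, 0) : Ξ × ℝ)) y x; linarith
      · gcongr

open scoped Convolution in
theorem ChartSolution.exists_approx (h : ChartSolution Ω p m u D G A) (hp : 1 < p) (hm : 1 ≤ m) (hΩ
  : IsOpen Ω) {K : Set (Ξ × ℝ)} (hK : IsCompact K) (hKΩ : K ⊆ Ω) {ε L B : ℝ} {H H' : ℝ → ℝ} (hH :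
  IsCutoff ε L B H H') : ∃ b : ℕ → Ξ × ℝ → ℝ, (∀ n, ContDiff ℝ ∞ (b n)) ∧ (∀ n y, 0 ≤ b n y ∧ b n y
  ≤ B) ∧ (∀ᵐ y ∂(volume.restrict K), Tendsto (fun n => b n y) atTop (𝓝 (H (u y)))) ∧ (∀ w, Tendsto
  (fun n => ∫⁻ y in K, ofReal (|fderiv ℝ (b n) y (w, 0) - H' (u y) * G w y| ^ p * u y ^ (m - 1)))
  atTop (𝓝 0)) ∧ Tendsto (fun n => ∫⁻ y in K, ofReal |fderiv ℝ (b n) y (0, 1) - H' (u y) * D y|)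
  atTop (𝓝 0) := by
  have hp0 : 0 < p := by linarith
  have hε := hH.pos; have hL : 0 < L := hε.trans hH.lt
  have hB : 0 ≤ B := (hH.nonneg 0).trans (hH.le 0); set σ := (p + m - 1) / p with hσ
  obtain ⟨hσ1, hσ2, hσ3⟩ := sigma_bounds hp hm
  obtain ⟨δ, hδ, hδΩ⟩ := hK.exists_cthickening_subset_open hΩ hKΩ
  set K1 := cthickening δ K with hK1def; have hK1 : IsCompact K1 := hK.cthickening
  have hKK1 : K ⊆ K1 := self_subset_cthickening _; have hms := hK1.measurableSet
  have : IsFiniteMeasure (volume.restrict K1) := ⟨by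
    rw [Measure.restrict_apply_univ]; exact hK1.measure_lt_top⟩
  have hle : volume.restrict K1 ≤ volume.restrict Ω := restrict_mono hδΩ le_rfl
  have hHm : Measurable H :=
    (continuous_iff_continuousAt.2 fun s => (hH.hasDerivAt s).continuousAt).measurable
  have hum : AEMeasurable u (volume.restrict K1) := h.time.aemeasurable.mono_measure hle
  have hu0 : ∀ᵐ y, y ∈ K1 → 0 ≤ u y := (ae_restrict_iff' hms).1 (ae_mono hle h.time.nonneg)
  -- measurable representatives
  obtain ⟨v, hvm, hvi, hvK, hv0⟩ := exists_measurable_rep (f := fun y => max (u y) ε ^ σ) hms (by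
    refine (integrable_const (ε ^ σ)).add
      ((h.locallyIntegrableOn_rpow hp hm).integrableOn_compact_subset hδΩ hK1) |>.mono'
      ((hum.max aemeasurable_const).pow_const _).aestronglyMeasurable ?_
    filter_upwards [ae_mono hle h.time.nonneg] with y hy; have h1 : 0 ≤ u y ^ σ := by positivity
    have h2 : 0 ≤ ε ^ σ := by positivity
    have hmx : 0 ≤ max (u y) ε := hy.trans (le_max_left _ _); rw [norm_of_nonneg (by positivity)]
    rcases le_total (u y) ε with hle | hle
    · rw [max_eq_right hle]; exact le_add_of_nonneg_right h1
    · rw [max_eq_left hle]; exact le_add_of_nonneg_left h2)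
  obtain ⟨b, hbm, hbi, hbK, hb0⟩ := exists_measurable_rep (f := fun y => H (u y) - H L) hms (by
    refine (integrable_const B).mono'
      ((hHm.comp_aemeasurable hum).sub_const _).aestronglyMeasurable (ae_of_all _ fun y => ?_)
    rw [norm_eq_abs, abs_le]
    have := hH.nonneg (u y); have := hH.le (u y); have := hH.nonneg L; have := hH.le L
    constructor <;> linarith)
  obtain ⟨d, hdm, hdi, hdK, hd0⟩ := exists_measurable_rep hms
    (integrableOn_comp_of_bdd h.time hK1 hδΩ hH)
  choose g hgm hgi hgK hg0 using fun w => exists_measurable_rep hms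
    (integrableOn_comp_of_bdd (h.space w) hK1 hδΩ hH)
  have hweak : ∀ {g' : Ξ × ℝ → ℝ} {G' : Ξ × ℝ → ℝ} {e : Ξ × ℝ}, TruncWeakDeriv Ω u G' e →
      (∀ᵐ y, y ∈ K1 → g' y = H' (u y) * G' y) → ∀ η : Ξ × ℝ → ℝ,
      ContDiff ℝ ∞ η → HasCompactSupport η → tsupport η ⊆ K1 →
      ∫ y, b y * fderiv ℝ η y e = - ∫ y, g' y * η y := by
    intro g' G' e hT hg' η hη hηc hηK; rw [integral_mul_congr_of_tsupport hηK hg',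
      integral_mul_congr_of_tsupport (η := fun y => fderiv ℝ η y e)
        ((tsupport_fderiv_apply_subset η e).trans hηK) hbK]
    exact hT.comp hH.hasDerivAt hH.continuous hε hH.eq_zero_of_le hH.abs_le (H L) hη hηc
      (hηK.trans hδΩ)
  have hvp : MemLp v (ofReal p) := memLp_of_lintegral_rpow hvm hp0 (by
    rw [setLIntegral_rpow_congr hms hvK hv0 hp0]; exact h.lintegral_rpow_lt_top hp hm hε hK1 hδΩ)
  have hgp : ∀ w, MemLp (g w) (ofReal p) := fun w => memLp_of_lintegral_rpow (hgm w) hp0 (by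
      rw [setLIntegral_rpow_congr hms (hgK w) (hg0 w) hp0]
      exact h.lintegral_deriv_lt_top hp hm hH hK1 hδΩ w)
  obtain ⟨C, hCtop, hC⟩ := h.exists_translate_le hp hm hε hK1 hδΩ hvi hvK
  obtain ⟨C1, r, k, hC1, hr0, hrδ, hrlim, hk, hkv⟩ := exists_mollifiers hδ hK le_rfl hvm hp hvp hC
  choose τ hτr hmol using hk
  have hkc : ∀ n, Continuous (k n) := fun n => (hmol n).contDiff.continuous
  have hks : ∀ n, HasCompactSupport (k n) := fun n => (hmol n).hasCompactSupport
  have hsupp : ∀ n, ∀ ξ ∈ tsupport (k n), ‖ξ‖ ≤ r n := fun n ξ hξ => by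
    obtain ⟨h1, h2⟩ := (hmol n).norm_le ξ hξ; rw [Prod.norm_def]; exact max_le h1 (h2.trans (hτr n))
  have hyK1 : ∀ n, ∀ y ∈ K, ∀ ξ ∈ tsupport (k n), y - ξ ∈ K1 := fun n y hy ξ hξ => by
    refine mem_cthickening_of_dist_le _ y _ _ hy ?_
    rw [dist_eq_norm, sub_sub_cancel_left, norm_neg]; have := hsupp n ξ hξ; have := hrδ n; linarith
  set bn : ℕ → Ξ × ℝ → ℝ := fun n y => H L + (k n ⋆[lsmul ℝ ℝ, volume] b) y with hbn
  have hbnC : ∀ n, ContDiff ℝ ∞ (bn n) := fun n => contDiff_const.add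
    ((hks n).contDiff_convolution_left _ (hmol n).contDiff hbi.locallyIntegrable)
  have hbnB : ∀ n y, 0 ≤ bn n y ∧ bn n y ≤ B := fun n y => by
    refine mollify_bounds (hmol n) hbi ?_ y; filter_upwards [hbK] with z hz; by_cases hzK : z ∈ K1
    · rw [hz hzK]; have := hH.nonneg (u z); have := hH.le (u z); constructor <;> linarith
    · rw [hb0 z hzK]; have := hH.nonneg L; have := hH.le L; constructor <;> linarith
  have hfd : ∀ n y e, fderiv ℝ (bn n) y e =
      fderiv ℝ (k n ⋆[lsmul ℝ ℝ, volume] b) y e := fun n y e => by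
    rw [hbn]; beta_reduce; rw [fderiv_const_add]
  have hfd1 : ∀ n, ∀ y ∈ K, ∀ w, fderiv ℝ (bn n) y (w, 0) = ∫ ξ, k n ξ * g w (y - ξ) :=
    fun n y hy w => (hfd n y _).trans (fderiv_convolution_eq_of_weak (hmol n).contDiff (hks n)
      hbi.locallyIntegrable (hweak (h.space w) (hgK w)) (hyK1 n y hy))
  have hfd2 : ∀ n, ∀ y ∈ K, fderiv ℝ (bn n) y (0, 1) = ∫ ξ, k n ξ * d (y - ξ) :=
    fun n y hy => (hfd n y _).trans (fderiv_convolution_eq_of_weak (hmol n).contDiff (hks n)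
      hbi.locallyIntegrable (hweak h.time hdK) (hyK1 n y hy))
  -- convergence of the space derivatives
  have hspace : ∀ w, Tendsto (fun n => ∫⁻ y in K, ofReal
        (|fderiv ℝ (bn n) y (w, 0) - H' (u y) * G w y| ^ p * u y ^ (m - 1))) atTop (𝓝 0) := by
    intro w; set J : ℕ → ℝ≥0∞ := fun n => ∫⁻ y, ‖(∫ ξ, k n ξ * g w (y - ξ)) - g w y‖ₑ ^ p with hJ
    have hJlim : Tendsto J atTop (𝓝 0) := tendsto_mollify (hgm w) (hgi w) hp.le (hgp w) hkc hks
      (fun n => (hmol n).nonneg) (fun n => (hmol n).integral_eq_one) hrlim hsupp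
    set κ := (m - 1) / (p + m - 1) with hκ; have hpm : 0 < p + m - 1 := by linarith
    have hκ0 : 0 ≤ κ := div_nonneg (by linarith) hpm.le
    have hκ1 : κ < 1 := by rw [hκ, div_lt_one hpm]; linarith
    have hσκ : σ * (p * κ) = m - 1 := by rw [hσ, hκ]; field_simp
    set L2 := ((2 : ℝ) * L ^ σ) ^ (1 / σ) with hL2
    have hL2σ : ∀ s, 0 ≤ s → L2 < s → 2 * L ^ σ < s ^ σ := fun s hs hLs => by
      have h1 : L2 ^ σ = 2 * L ^ σ := by
        rw [hL2, ← rpow_mul (by positivity), one_div_mul_cancel (by linarith), rpow_one]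
      rw [← h1]; exact rpow_lt_rpow (by positivity) hLs (by linarith)
    have hLL2 : L ≤ L2 := by
      have h1 : (L ^ σ) ^ (1 / σ) = L := by
        rw [← rpow_mul hL.le, mul_one_div_cancel (by linarith), rpow_one]
      rw [← h1, hL2]; have : 0 < L ^ σ := by positivity
      have : 0 ≤ 1 / σ := by positivity
      gcongr; linarith
    have hgood : ∀ᵐ z, b z ≠ 0 → |b z| ≤ B ∧ v z ≤ L ^ σ := by
      filter_upwards [hbK, hvK, hu0] with z h1 h2 h3 hz
      have hzK : z ∈ K1 := by by_contra hzK; exact hz (hb0 z hzK)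
      rw [h1 hzK, h2 hzK] at *
      have huL : u z < L := by
        by_contra hcon
        exact hz (by rw [hH.const _ (not_lt.1 hcon), sub_self])
      refine ⟨?_, ?_⟩
      · rw [abs_le]
        have := hH.nonneg (u z); have := hH.le (u z); have := hH.nonneg L; have := hH.le L
        constructor <;> linarith
      · have := h3 hzK; have hmx : 0 ≤ max (u z) ε := this.trans (le_max_left _ _); gcongr
        exact max_le huL.le hH.lt.le
    have hdc : ∀ n, Continuous fun ξ => fderiv ℝ (k n) ξ (w, 0) := fun n =>
      continuous_fderiv_apply_const (hmol n).contDiff _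
    set T : ℕ → Ξ × ℝ → ℝ≥0∞ := fun n y => ofReal (2 * B) *
      ∫⁻ ξ, ‖v y - v (y - ξ)‖ₑ ∂(volume.withDensity fun ξ => ‖fderiv ℝ (k n) ξ (w, 0)‖ₑ) with hT
    have hκmass : ∀ n, (volume.withDensity fun ξ => ‖fderiv ℝ (k n) ξ (w, 0)‖ₑ) univ ≤
        ofReal (C1 * ‖w‖ / r n) := fun n => by
      rw [withDensity_apply _ MeasurableSet.univ, restrict_univ]
      have hi : Integrable fun ξ => fderiv ℝ (k n) ξ (w, 0) :=
        (hdc n).integrable_of_hasCompactSupport ((hks n).fderiv_apply ℝ _)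
      rw [← ofReal_integral_norm_eq_lintegral_enorm hi]
      exact ofReal_le_ofReal ((hmol n).integral_deriv_le w)
    have hfin : ∀ n, IsFiniteMeasure
        (volume.withDensity fun ξ => ‖fderiv ℝ (k n) ξ (w, 0)‖ₑ) := fun n =>
      ⟨(hκmass n).trans_lt ofReal_lt_top⟩
    have hTm : ∀ n, Measurable (T n) := fun n => by
      have := hfin n
      have hm2 : Measurable (fun z : (Ξ × ℝ) × (Ξ × ℝ) => ‖v z.1 - v (z.1 - z.2)‖ₑ) := by fun_prop
      exact hm2.lintegral_prod_right'.const_mul _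
    set Q : ℝ≥0∞ := ofReal (2 * B) ^ p * (ofReal ((C1 * ‖w‖) ^ p) * (2 ^ (p - 1) * (1 + C))) with hQ
    have hQtop : Q ≠ ⊤ := by
      refine mul_ne_top (rpow_ne_top_of_nonneg hp0.le ofReal_ne_top)
        (mul_ne_top ofReal_ne_top (mul_ne_top ?_ ?_))
      · exact rpow_ne_top_of_nonneg (by linarith) (by simp)
      · exact ENNReal.add_ne_top.2 ⟨ENNReal.one_ne_top, hCtop⟩
    have hTQ : ∀ n, ∫⁻ y in K, T n y ^ p ≤ Q := fun n => by
      have := hfin n; have hr := hr0 n; simp only [hT, mul_rpow_of_nonneg _ _ hp0.le]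
      rw [lintegral_const_mul' _ _ (rpow_ne_top_of_nonneg hp0.le ofReal_ne_top), hQ]; gcongr
      refine (lintegral_rpow_lintegral_sub_le _ hvm hp.le K
        (A := 2 ^ (p - 1) * (ofReal (r n ^ p) * (1 + C))) ?_).trans ?_
      · rw [ae_withDensity_iff (hdc n).measurable.enorm]; refine ae_of_all _ fun ξ hξ => hkv n ξ ?_
        by_contra hcon
        exact hξ (by
          have : fderiv ℝ (k n) ξ = 0 := zero_off fun h => hcon (tsupport_fderiv_subset ℝ h)
          simp [this])
      · calc _ ≤ ofReal (C1 * ‖w‖ / r n) ^ p * (2 ^ (p - 1) * (ofReal (r n ^ p) * (1 + C))) := by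
              gcongr; exact hκmass n
          _ = (ofReal (C1 * ‖w‖ / r n) ^ p * ofReal (r n ^ p)) * (2 ^ (p - 1) * (1 + C)) := by ring
          _ = _ := by
            rw [ofReal_rpow_of_nonneg (by positivity) hp0.le,
              ← ofReal_mul (by positivity), ← mul_rpow (by positivity) hr.le,
              div_mul_cancel₀ _ hr.ne']
    have hbound : ∀ n, ∫⁻ y in K, ofReal
        (|fderiv ℝ (bn n) y (w, 0) - H' (u y) * G w y| ^ p * u y ^ (m - 1)) ≤
        ofReal (L2 ^ (m - 1)) * J n + J n ^ (1 - κ) * Q ^ κ := by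
      intro n; have hcd : Continuous fun y => fderiv ℝ (bn n) y (w, 0) :=
        continuous_fderiv_apply_const (hbnC n) _
      have hJle : ∫⁻ y in K, ‖fderiv ℝ (bn n) y (w, 0) - g w y‖ₑ ^ p ≤ J n := by
        refine (setLIntegral_mono_ae' hK.measurableSet (ae_of_all _ fun y hy => ?_)).trans
          (setLIntegral_le_lintegral K _)
        rw [hfd1 n y hy w]
      refine (lintegral_weighted_le (x := fun y => ‖fderiv ℝ (bn n) y (w, 0) - g w y‖ₑ)
        (T := T n) (p := p) (κ := κ) (c := ofReal (L2 ^ (m - 1)))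
        ((hcd.measurable.sub (hgm w)).enorm.aemeasurable) (hTm n).aemeasurable hκ0 hκ1.le
        ofReal_ne_top ?_).trans ?_
      · rw [ae_restrict_iff' hK.measurableSet]; filter_upwards [hgK w, hvK, hu0] with y h1 h2 h3 hyK
        have hy1 := hKK1 hyK; have hu := h3 hy1; rw [h1 hy1]
        rcases le_or_gt (u y) L2 with hcase | hcase
        · refine le_add_right ?_
          rw [enorm_eq_ofReal_abs, ofReal_rpow_of_nonneg (abs_nonneg _) hp0.le,
            ← ofReal_mul (by positivity), mul_comm]
          refine ofReal_le_ofReal ?_; gcongr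
        · refine le_add_left ?_; have hz : H' (u y) = 0 := hH.eq_zero_of_ge _ (hLL2.trans hcase.le)
          rw [hz, zero_mul, sub_zero]
          have hmax : max (u y) ε = u y := max_eq_left ((hH.lt.le.trans hLL2).trans hcase.le)
          have hvy : v y = u y ^ σ := by rw [h2 hy1, hmax]
          have hvy0 : 0 ≤ v y := by rw [hvy]; positivity
          have hTy : ‖fderiv ℝ (bn n) y (w, 0)‖ₑ * ‖v y‖ₑ ≤ T n y := by
            rw [hfd n y, fderiv_convolution_apply (hmol n).contDiff (hks n) hbi.locallyIntegrable]
            refine enorm_integral_mul_le (l := L ^ σ) hvm (hdc n).measurable hgood ?_ hvy0; rw [hvy]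
            exact hL2σ _ hu hcase
          calc ofReal (|fderiv ℝ (bn n) y (w, 0)| ^ p * u y ^ (m - 1))
              = ‖fderiv ℝ (bn n) y (w, 0)‖ₑ ^ p * ‖v y‖ₑ ^ (p * κ) := by
                rw [enorm_eq_ofReal_abs, enorm_eq_ofReal_abs, abs_of_nonneg hvy0, hvy,
                  ofReal_rpow_of_nonneg (abs_nonneg _) hp0.le,
                  ofReal_rpow_of_nonneg (by positivity) (by positivity),
                  ← rpow_mul hu, hσκ, ← ofReal_mul (by positivity)]
            _ = (‖fderiv ℝ (bn n) y (w, 0)‖ₑ ^ p) ^ (1 - κ) *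
                ((‖fderiv ℝ (bn n) y (w, 0)‖ₑ * ‖v y‖ₑ) ^ p) ^ κ :=
                (rpow_interpolation hp0.le hκ0 hκ1.le).symm
            _ ≤ _ := by gcongr
      · have : 0 ≤ 1 - κ := by linarith
        gcongr; exact hTQ n
    have hlim : Tendsto (fun n => ofReal (L2 ^ (m - 1)) * J n + J n ^ (1 - κ) * Q ^ κ)
        atTop (𝓝 0) := by
      have h1 : Tendsto (fun n => J n ^ (1 - κ)) atTop (𝓝 0) := by
        have := (ENNReal.continuous_rpow_const (y := 1 - κ)).tendsto 0 |>.comp hJlim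
        rwa [zero_rpow_of_pos (by linarith)] at this
      have h2 := ENNReal.Tendsto.const_mul hJlim (a := ofReal (L2 ^ (m - 1))) (Or.inr ofReal_ne_top)
      have h3 := ENNReal.Tendsto.mul_const h1 (b := Q ^ κ)
        (Or.inr (rpow_ne_top_of_nonneg hκ0 hQtop))
      simpa using h2.add h3
    exact squeeze_ennreal hlim hbound
  have htime : Tendsto (fun n => ∫⁻ y in K, ofReal
        |fderiv ℝ (bn n) y (0, 1) - H' (u y) * D y|) atTop (𝓝 0) := by
    have h1 := tendsto_mollify hdm hdi le_rfl (by simpa using memLp_one_iff_integrable.2 hdi) hkc hks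
      (fun n => (hmol n).nonneg) (fun n => (hmol n).integral_eq_one) hrlim hsupp
    refine squeeze_ennreal h1 fun n => ?_
    refine (setLIntegral_mono_ae' hK.measurableSet ?_).trans (setLIntegral_le_lintegral K _)
    filter_upwards [hdK] with y hy hyK
    rw [hfd2 n y hyK, ← hy (hKK1 hyK), ENNReal.rpow_one, enorm_eq_ofReal_abs]
  -- almost everywhere convergence along a subsequence
  have hL1 := tendsto_mollify hbm hbi le_rfl (by simpa using memLp_one_iff_integrable.2 hbi) hkc hks
      (fun n => (hmol n).nonneg) (fun n => (hmol n).integral_eq_one) hrlim hsupp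
  simp only [ENNReal.rpow_one] at hL1
  have hbnm : ∀ n, Continuous fun y => ∫ ξ, k n ξ * b (y - ξ) := fun n =>
    ((hks n).contDiff_convolution_left (lsmul ℝ ℝ) (hmol n).contDiff
      hbi.locallyIntegrable).continuous
  have hmeas : TendstoInMeasure volume (fun n y => ∫ ξ, k n ξ * b (y - ξ)) atTop b := by
    refine tendstoInMeasure_of_tendsto_eLpNorm one_ne_zero
      (fun n => (hbnm n).aestronglyMeasurable) hbm.aestronglyMeasurable ?_
    simpa only [eLpNorm_one_eq_lintegral_enorm, Pi.sub_apply] using hL1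
  obtain ⟨ns, hns, hae⟩ := hmeas.exists_seq_tendsto_ae
  refine ⟨fun n => bn (ns n), fun n => hbnC _, fun n => hbnB _, ?_,
    fun w => (hspace w).comp hns.tendsto_atTop, htime.comp hns.tendsto_atTop⟩
  rw [ae_restrict_iff' hK.measurableSet]; filter_upwards [hae, hbK] with y h1 h2 hyK
  rw [h2 (hKK1 hyK)] at h1; have := h1.const_add (H L); rw [add_sub_cancel] at this; exact this

end Euclidean

section Lipschitz

lemma _root_.LocallyLipschitzOn.of_contDiffAt {E F : Type*} [NormedAddCommGroup E]
  [NormedSpace ℝ E] [NormedAddCommGroup F] [NormedSpace ℝ F] {f : E → F} {s : Set E}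
  (h : ∀ x ∈ s, ContDiffAt ℝ 1 f x) : LocallyLipschitzOn s f := by
  intro x hx; obtain ⟨K, t, ht, hK⟩ := (h x hx).exists_lipschitzOnWith
  exact ⟨K, t, mem_nhdsWithin_of_mem_nhds ht, hK⟩

lemma _root_.LocallyLipschitzOn.mul' {X : Type*} [PseudoEMetricSpace X] {f g : X → ℝ} {s : Set X}
  (hf : LocallyLipschitzOn s f) (hg : LocallyLipschitzOn s g) :
  LocallyLipschitzOn s (fun x => f x * g x) :=
  (LocallyLipschitzOn.of_contDiffAt (s := univ) (f := fun z : ℝ × ℝ => z.1 * z.2)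
    fun _ _ => (contDiffAt_fst.mul contDiffAt_snd)).comp_of_mapsTo (hf.prodMk' hg)
    fun _ _ => mem_univ _

lemma _root_.LocallyLipschitzOn.div' {X : Type*} [PseudoEMetricSpace X] {f g : X → ℝ} {s : Set X}
  (hf : LocallyLipschitzOn s f) (hg : LocallyLipschitzOn s g) (h0 : ∀ x ∈ s, g x ≠ 0) :
  LocallyLipschitzOn s (fun x => f x / g x) :=
  (LocallyLipschitzOn.of_contDiffAt (s := {z : ℝ × ℝ | z.2 ≠ 0}) (f := fun z : ℝ × ℝ => z.1 / z.2)
    fun _ hz => (contDiffAt_fst.div contDiffAt_snd hz)).comp_of_mapsTo (hf.prodMk' hg)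
    fun x hx => h0 x hx

lemma _root_.LocallyLipschitz.of_tsupport {X : Type*} [PseudoEMetricSpace X] {f : X → ℝ} {O : Set X}
  (hO : IsOpen O) (hf : LocallyLipschitzOn O f) (hs : tsupport f ⊆ O) : LocallyLipschitz f := by
  intro x; by_cases hx : x ∈ O
  · obtain ⟨K, t, ht, hK⟩ := hf hx; exact ⟨K, t, by rwa [hO.nhdsWithin_eq hx] at ht, hK⟩
  · have h1 : (tsupport f)ᶜ ∈ 𝓝 x := (isClosed_tsupport f).isOpen_compl.mem_nhds fun h => hx (hs h)
    refine ⟨0, _, h1, fun y hy z hz => ?_⟩; rw [zero_off hy, zero_off hz, edist_self]; exact zero_le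

lemma IsTestFunction.mul_locallyLipschitzOn {ζ ψ : Ϝ}
  (hζ : IsTestFunction ζ) {O : Set (M × ℝ)} (hO : IsOpen O) (hs : tsupport ζ ⊆ O)
  (hψ : LocallyLipschitzOn O ψ) : IsTestFunction (fun z => ζ z * ψ z) := by
  have h1 : tsupport (fun z => ζ z * ψ z) ⊆ tsupport ζ := tsupport_mul_subset_left
  refine ⟨LocallyLipschitz.of_tsupport hO ?_ (h1.trans hs), ?_, h1.trans hζ.tsupport_subset⟩
  · exact hζ.locallyLipschitz.locallyLipschitzOn.mul' hψ
  · exact hζ.hasCompactSupport.of_isClosed_subset (isClosed_tsupport _) h1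

end Lipschitz

lemma continuousOn_chartDensity (ha : Continuous a) (o : M) :
  ContinuousOn (chartDensity N a o) (chartDom N o) :=
  (ha.comp_continuousOn ((continuousOn_extChartAt_symm o).comp continuousOn_fst
    fun _ hy => hy.1)).mul
    ((contDiffOn_volDensity o).continuousOn.comp continuousOn_fst fun _ hy => hy.1)

lemma chartMeasure_eq (a : M → ℝ) (o : M) : chartMeasure N a o =
  (volume.restrict (chartDom N o)).withDensity fun y => ofReal (chartDensity N a o y) := rfl

lemma integral_eq_chart (ha : Continuous a) (o : M) {g : Ϝ} (hg : AEStronglyMeasurable g ϖ) (h0 : ∀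
  z ∉ chartRng N o, g z = 0) (hpos : ∀ y ∈ chartDom N o, g (Φ o y) ≠ 0 → 0 ≤ chartDensity N a o y) :
  ∫ z, g z ∂ϖ = ∫ y in chartDom N o, chartDensity N a o y * g (Φ o y) := by
  have hD := (isOpen_chartDom (N := N) o).measurableSet
  rw [← setIntegral_eq_integral_of_forall_compl_eq_zero h0, wstMeasure_restrict ha,
    integral_map (aemeasurable_chartPoint a o) (by
      rw [← wstMeasure_restrict ha]; exact hg.restrict), chartMeasure_eq,
    integral_withDensity_eq_integral_toReal_smul₀]
  · refine setIntegral_congr_fun hD fun y hy => ?_; by_cases h : g (Φ o y) = 0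
    · rw [h, smul_zero, mul_zero]
    · have := hpos y hy h; rw [ENNReal.toReal_ofReal this, smul_eq_mul]
  · exact ((continuousOn_chartDensity ha o).aemeasurable hD).ennreal_ofReal
  · exact ae_of_all _ fun y => ofReal_lt_top

lemma lintegral_eq_chart (ha : Continuous a) (o : M) {O : Set (M × ℝ)} (hO : MeasurableSet O) (hOr :
  O ⊆ chartRng N o) {g : M × ℝ → ℝ≥0∞} (hg : AEMeasurable g ((ϖ).restrict O)) : ∫⁻ z in O, g z ∂ϖ =
  ∫⁻ y in chartDom N o ∩ Φ o ⁻¹' O, ofReal (chartDensity N a o y) * g (Φ o y) := by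
  have hD := (isOpen_chartDom (N := N) o).measurableSet
  have hms : MeasurableSet (chartDom N o ∩ Φ o ⁻¹' O) :=
    (continuousOn_chartPoint o).measurableSet_inter_preimage hD hO
  have hg' : AEMeasurable (O.indicator g) ((chartMeasure N a o).map (Φ o)) := by
    rw [← wstMeasure_restrict ha]; exact ((aemeasurable_indicator_iff hO).2 hg).restrict
  have e1 : ∫⁻ z in O, g z ∂ϖ = ∫⁻ z, O.indicator g z ∂((ϖ).restrict (chartRng N o)) := by
    rw [lintegral_indicator hO, restrict_restrict hO, inter_eq_left.2 hOr]
  rw [e1, wstMeasure_restrict ha, lintegral_map' hg' (aemeasurable_chartPoint a o), chartMeasure_eq]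
  have hg2 := hg'.comp_aemeasurable (aemeasurable_chartPoint a o); rw [chartMeasure_eq] at hg2
  refine (lintegral_withDensity_eq_lintegral_mul₀'
    ((continuousOn_chartDensity ha o).aemeasurable hD).ennreal_ofReal hg2).trans ?_
  rw [← lintegral_indicator hms, ← lintegral_indicator hD]; refine lintegral_congr fun y => ?_
  by_cases hy : y ∈ chartDom N o
  · by_cases hyO : Φ o y ∈ O
    · rw [indicator_of_mem hy, indicator_of_mem (show y ∈ chartDom N o ∩ Φ o ⁻¹' O
        from ⟨hy, hyO⟩), Pi.mul_apply, comp_apply, indicator_of_mem hyO]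
    · rw [indicator_of_mem hy, indicator_of_notMem (show y ∉ chartDom N o ∩ Φ o ⁻¹' O
        from fun h => hyO h.2), Pi.mul_apply, comp_apply, indicator_of_notMem hyO, mul_zero]
  · rw [indicator_of_notMem hy, indicator_of_notMem fun h => hy h.1]

lemma locallyIntegrableOn_chart (ha : Continuous a) {o : M} {g : Ϝ} (hg : LocallyIntegrableOn g
  (spaceTime M) ϖ) {Ω : Set (Ξ × ℝ)} (hΩ : IsOpen Ω) (hΩd : Ω ⊆ chartDom N o) (hpos : ∀ y ∈ Ω, 0 <
  chartDensity N a o y) : LocallyIntegrableOn (fun y => g (Φ o y)) Ω := by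
  intro y hy; have hSo : IsOpen (spaceTime M) := isOpen_univ.prod isOpen_Ioi
  have hz : Φ o y ∈ spaceTime M := ⟨mem_univ _, (hΩd hy).2⟩
  obtain ⟨U, hU, hgU⟩ := hg _ hz; rw [hSo.nhdsWithin_eq hz] at hU
  obtain ⟨U', hU'U, hU'o, hzU'⟩ := _root_.mem_nhds_iff.1 hU; have hD := (isOpen_chartDom (N := N) o)
  set c := chartDensity N a o y / 2 with hc; have hc0 : 0 < c := by have := hpos y hy; positivity
  -- a neighbourhood on which the density is bounded below
  have hcont : ContinuousAt (chartDensity N a o) y :=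
    (continuousOn_chartDensity ha o).continuousAt (hD.mem_nhds (hΩd hy))
  have h1 : ∀ᶠ y' in 𝓝 y, c < chartDensity N a o y' :=
    hcont.eventually (Ioi_mem_nhds (by have := hpos y hy; rw [hc]; linarith))
  have hcp : ContinuousAt (Φ o) y := (continuousOn_chartPoint o).continuousAt (hD.mem_nhds (hΩd hy))
  have h2 : ∀ᶠ y' in 𝓝 y, Φ o y' ∈ U' := hcp.eventually (hU'o.mem_nhds hzU')
  obtain ⟨s, hs, hso, hys⟩ := _root_.mem_nhds_iff.1 ((h1.and h2).and (hΩ.mem_nhds hy))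
  refine ⟨s, mem_nhdsWithin_of_mem_nhds (hso.mem_nhds hys), ?_⟩
  have hsd : s ⊆ chartDom N o := fun y' hy' => hΩd (hs hy').2
  set O := chartRng N o ∩ pointChart N o ⁻¹' s with hO
  have hOo : IsOpen O := (continuousOn_pointChart o).isOpen_inter_preimage (isOpen_chartRng o) hso
  have hOs : chartDom N o ∩ Φ o ⁻¹' O = s := by
    ext y'; constructor
    · rintro ⟨h3, h4⟩; have := h4.2; rwa [mem_preimage, pointChart_chartPoint h3] at this
    · intro h3; have h5 := hsd h3
      exact ⟨h5, chartPoint_mem h5, by rwa [mem_preimage, pointChart_chartPoint h5]⟩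
  have hOU : O ⊆ U := fun z hz => by
    have := (hs hz.2).1.2; rw [chartPoint_pointChart hz.1] at this; exact hU'U this
  have hgO : IntegrableOn g O ϖ := hgU.mono_set hOU
  have key := lintegral_eq_chart ha o hOo.measurableSet inter_subset_left (g := fun z => ‖g z‖ₑ)
    hgO.aestronglyMeasurable.enorm
  rw [hOs] at key; refine ⟨?_, ?_⟩
  · -- measurability
    have hm1 : AEStronglyMeasurable (O.indicator g) ((chartMeasure N a o).map (Φ o)) := by
      rw [← wstMeasure_restrict ha]; exact ((aestronglyMeasurable_indicator_iff hOo.measurableSet).2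
        hgO.aestronglyMeasurable).restrict
    have hm2 := (hm1.comp_aemeasurable (aemeasurable_chartPoint a o)).mono_ac
      ((volume_restrict_absolutelyContinuous_chartMeasure ha o hso.measurableSet hsd
        (fun y' hy' => by
          have h3 : 0 < chartDensity N a o y' := hc0.trans (hs hy').1.1
          exact (pos_iff_pos_of_mul_pos h3).2 (volDensity_pos o (hsd hy').1))).trans
        Measure.absolutelyContinuous_restrict)
    refine hm2.congr ?_; filter_upwards [ae_restrict_mem hso.measurableSet] with y' hy'
    have : Φ o y' ∈ O := by rw [← hOs] at hy'; exact hy'.2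
    simp only [comp_apply, indicator_of_mem this]
  · have h3 : ∫⁻ y' in s, ofReal (chartDensity N a o y') * ‖g (Φ o y')‖ₑ < ⊤ := by
      rw [← key]; exact hgO.hasFiniteIntegral
    have h4 : ofReal c * ∫⁻ y' in s, ‖g (Φ o y')‖ₑ < ⊤ := by
      rw [← lintegral_const_mul' _ _ ofReal_ne_top]
      refine lt_of_le_of_lt (setLIntegral_mono' hso.measurableSet fun y' hy' => ?_) h3; gcongr
      exact (hs hy').1.1.le
    refine lt_of_not_ge fun hcon => ?_
    rw [top_le_iff.1 hcon, ENNReal.mul_top (by simpa using hc0)] at h4; exact lt_irrefl _ h4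

lemma locallyLipschitzOn_chartDensity (ha : LocallyLipschitz a) (o : M) :
  LocallyLipschitzOn (chartDom N o) (chartDensity N a o) := by
  refine LocallyLipschitzOn.mul' ?_ ?_
  · exact ha.locallyLipschitzOn (s := univ) |>.comp_of_mapsTo
      ((locallyLipschitzOn_chart_symm o).comp_of_mapsTo
        LipschitzWith.prod_fst.locallyLipschitz.locallyLipschitzOn fun _ hy => hy.1)
      fun _ _ => mem_univ _
  · refine LocallyLipschitzOn.comp_of_mapsTo (t := (ϰ o).target)
      (f := Prod.fst) (g := volDensity N o) ?_
      LipschitzWith.prod_fst.locallyLipschitz.locallyLipschitzOn fun _ hy => hy.1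
    exact LocallyLipschitzOn.of_contDiffAt fun y hy => ((contDiffOn_volDensity o).contDiffAt
      ((isOpen_chartTarget o).mem_nhds hy)).of_le (by simp)

/-- A test function with prescribed chart representation. -/
lemma exists_testFunction_of_chart (o : M) {Ω : Set (Ξ × ℝ)} (hΩ : IsOpen Ω) (hΩd : Ω ⊆ chartDom N
  o) {g : Ξ × ℝ → ℝ} (hg : LocallyLipschitzOn Ω g) (hgc : HasCompactSupport g) (hgs : tsupport g ⊆
  Ω) : ∃ η : Ϝ, IsTestFunction η ∧ (∀ y ∈ Ω, η (Φ o y) = g y) ∧ tsupport η ⊆ Φ o '' tsupport g := by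
  classical
  set O := chartRng N o ∩ pointChart N o ⁻¹' Ω with hO
  have hOo : IsOpen O := (continuousOn_pointChart o).isOpen_inter_preimage (isOpen_chartRng o) hΩ
  set η : Ϝ := O.indicator fun z => g (pointChart N o z) with hη
  have hcomp : IsCompact (Φ o '' tsupport g) :=
    IsCompact.image_of_continuousOn hgc ((continuousOn_chartPoint o).mono (hgs.trans hΩd))
  have hts : tsupport η ⊆ Φ o '' tsupport g := by
    refine closure_minimal (fun z hz => ?_) hcomp.isClosed; have hzO : z ∈ O := by
      by_contra h
      exact hz (indicator_of_notMem h _)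
    rw [Function.mem_support, hη, indicator_of_mem hzO] at hz
    exact ⟨pointChart N o z, subset_tsupport _ hz, chartPoint_pointChart hzO.1⟩
  have hcO : Φ o '' tsupport g ⊆ O := by
    rintro _ ⟨y, hy, rfl⟩; have := hΩd (hgs hy)
    exact ⟨chartPoint_mem this, by rw [mem_preimage, pointChart_chartPoint this]; exact hgs hy⟩
  refine ⟨η, ⟨LocallyLipschitz.of_tsupport hOo ?_ (hts.trans hcO), ?_, ?_⟩, ?_, hts⟩
  · have h1 : LocallyLipschitzOn O (g ∘ pointChart N o) := hg.comp_of_mapsTo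
      ((locallyLipschitzOn_pointChart o).mono inter_subset_left) fun z hz => hz.2
    intro z hz; obtain ⟨K, t, ht, hK⟩ := h1 hz
    refine ⟨K, t ∩ O, inter_mem ht self_mem_nhdsWithin, fun x hx y hy => ?_⟩
    rw [hη, indicator_of_mem hx.2, indicator_of_mem hy.2]; exact hK hx.1 hy.1
  · exact hcomp.of_isClosed_subset (isClosed_tsupport _) hts
  · intro z hz; exact ⟨mem_univ _, (hcO (hts hz)).1.2⟩
  · intro y hy; have hyd := hΩd hy; rw [hη, indicator_of_mem, pointChart_chartPoint hyd]
    exact ⟨chartPoint_mem hyd, by rwa [mem_preimage, pointChart_chartPoint hyd]⟩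

lemma IsWeakTimeDeriv.hasWeakDirDeriv (ha : LocallyLipschitz a) {u D : Ϝ} (hD : IsWeakTimeDeriv N a
  u D) (hu : AEMeasurable u (stMeasure N M)) {o : M} {Ω : Set (Ξ × ℝ)} (hΩ : IsOpen Ω) (hΩd : Ω ⊆
  chartDom N o) (hpos : ∀ y ∈ Ω, 0 < chartDensity N a o y) {δ : ℝ} (hδ : 0 < δ) (hloc :
  LocallyIntegrableOn (fun y => max (u (Φ o y)) δ) Ω) : HasWeakDirDeriv Ω (fun y => max (u (Φ o y))
  δ) ({y | δ < u (Φ o y)}.indicator fun y => D (Φ o y)) (0, 1) := by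
  have hac : Continuous a := ha.continuous; obtain ⟨hDloc, hDint⟩ := hD δ hδ
  refine ⟨hloc, locallyIntegrableOn_chart hac hDloc hΩ hΩd hpos, fun η hη hηc hηΩ => ?_⟩
  have hgl : LocallyLipschitzOn Ω fun y => η y / chartDensity N a o y :=
    LocallyLipschitzOn.div' (LocallyLipschitzOn.of_contDiffAt fun y _ =>
      (hη.contDiffAt).of_le (by simp)) ((locallyLipschitzOn_chartDensity ha o).mono hΩd)
      fun y hy => (hpos y hy).ne'
  have hgt : tsupport (fun y => η y / chartDensity N a o y) ⊆ tsupport η := by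
    refine closure_mono fun y hy => ?_; rw [Function.mem_support] at hy ⊢
    exact fun h => hy (by rw [h, zero_div])
  obtain ⟨ζ, hζ, hζv, hζs⟩ := exists_testFunction_of_chart o hΩ hΩd hgl
    (hηc.of_isClosed_subset (isClosed_tsupport _) hgt) (hgt.trans hηΩ)
  have hζs' : tsupport ζ ⊆ Φ o '' tsupport η := hζs.trans (image_mono hgt)
  have hζr : ∀ z ∉ chartRng N o, z ∉ tsupport ζ := fun z hz h => by
    obtain ⟨y, hy, rfl⟩ := hζs' h; exact hz (chartPoint_mem (hΩd (hηΩ hy)))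
  have hζΩ : ∀ y ∈ chartDom N o, y ∉ tsupport η → Φ o y ∉ tsupport ζ := fun y hy hyη h => by
      obtain ⟨y', hy', h'⟩ := hζs' h; have := congrArg (pointChart N o) h'
      rw [pointChart_chartPoint (hΩd (hηΩ hy')), pointChart_chartPoint hy] at this
      exact hyη (this ▸ hy')
  have hdz : ∀ z, z ∉ tsupport ζ → ∂ₜ ζ z = 0 := fun z hz => by
    have h1 : ∀ᶠ w in 𝓝 z, ζ w = 0 := by
      filter_upwards [(isClosed_tsupport ζ).isOpen_compl.mem_nhds hz] with w hw; exact zero_off hw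
    have h2 : Tendsto (fun t : ℝ => (z.1, t)) (𝓝 z.2) (𝓝 z) :=
      (Continuous.prodMk_right z.1).tendsto z.2
    have h3 : (fun t => ζ (z.1, t)) =ᶠ[𝓝 z.2] fun _ => 0 := h2.eventually h1
    rw [h3.deriv_eq, deriv_const]
  have hd : ∀ y ∈ Ω, deriv (fun t => ζ ((Φ o y).1, t)) (Φ o y).2 =
      fderiv ℝ η y (0, 1) / chartDensity N a o y := fun y hy => by
    have h1 : (fun t => ζ ((Φ o y).1, t)) =ᶠ[𝓝 y.2] fun t => η (y.1, t) / chartDensity N a o y := by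
      have h2 : Tendsto (fun t : ℝ => (y.1, t)) (𝓝 y.2) (𝓝 y) :=
        (Continuous.prodMk_right y.1).tendsto y.2
      filter_upwards [h2.eventually (hΩ.mem_nhds hy)] with t ht; exact hζv (y.1, t) ht
    have h3 : HasDerivAt (fun t => η (y.1, t)) (fderiv ℝ η y (0, 1)) y.2 := by
      have h4 : HasDerivAt (fun t : ℝ => (y.1, t)) ((0 : Ξ), (1 : ℝ)) y.2 :=
        (hasDerivAt_const _ _).prodMk (hasDerivAt_id _)
      exact (hη.differentiable (by simp) y).hasFDerivAt.comp_hasDerivAt y.2 h4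
    exact h1.deriv_eq.trans (h3.div_const _).deriv
  have hfd : ∀ y ∉ tsupport η, fderiv ℝ η y (0, 1) = 0 := fun y hy => by
    rw [zero_off fun h => hy (tsupport_fderiv_subset ℝ h)]; rfl
  have key := hDint ζ hζ; have hum : AEStronglyMeasurable (fun z => max (u z) δ) ϖ :=
    ((hu.mono_ac (wstMeasure_absolutelyContinuous hac)).max aemeasurable_const).aestronglyMeasurable
  have hdm : AEStronglyMeasurable (fun z => ∂ₜ ζ z) ϖ := by
    have := aestronglyMeasurable_deriv_slice (N := N) hac isOpen_univ
      (hζ.locallyLipschitz.locallyLipschitzOn (s := univ))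
    rwa [restrict_univ] at this
  have hDm : AEStronglyMeasurable ({z | δ < u z}.indicator D) ϖ := by
    have := hDloc.aestronglyMeasurable; rwa [wstMeasure_restrict_spaceTime] at this
  have hm1 : AEStronglyMeasurable (fun z => max (u z) δ * ∂ₜ ζ z) ϖ := hum.mul hdm
  have hm2 : AEStronglyMeasurable (fun z => {z | δ < u z}.indicator D z * ζ z)
      ϖ := hDm.mul hζ.locallyLipschitz.continuous.aestronglyMeasurable
  rw [integral_eq_chart hac o hm1, integral_eq_chart hac o hm2] at key
  · rw [← setIntegral_eq_integral_of_forall_compl_eq_zero (s := chartDom N o),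
      ← setIntegral_eq_integral_of_forall_compl_eq_zero (s := chartDom N o)
        (f := fun y => {y | δ < u (Φ o y)}.indicator (fun y => D (Φ o y)) y * η y)]
    · refine Eq.trans ?_ (key.trans ?_)
      · refine setIntegral_congr_fun (isOpen_chartDom o).measurableSet fun y hy => ?_; beta_reduce
        by_cases hyη : y ∈ tsupport η
        · rw [hd y (hηΩ hyη)]; have := (hpos y (hηΩ hyη)).ne'; field_simp
        · rw [hfd y hyη, hdz _ (hζΩ y hy hyη), mul_zero, mul_zero]
      · congr 1; refine setIntegral_congr_fun (isOpen_chartDom o).measurableSet fun y hy => ?_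
        by_cases hyη : y ∈ tsupport η
        · rw [hζv y (hηΩ hyη)]; have := (hpos y (hηΩ hyη)).ne'
          have e : {y | δ < u (Φ o y)}.indicator (fun y => D (Φ o y)) y =
            {z | δ < u z}.indicator D (Φ o y) := rfl
          rw [e]; field_simp
        · rw [zero_off hyη, zero_off (hζΩ y hy hyη), mul_zero, mul_zero, mul_zero]
    · intro y hy; rw [zero_off fun h => hy (hΩd (hηΩ h)), mul_zero]
    · intro y hy; rw [hfd y fun h => hy (hΩd (hηΩ h)), mul_zero]
  · intro z hz; rw [zero_off (hζr z hz), mul_zero]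
  · intro y hy h; by_cases hyη : y ∈ tsupport η
    · exact (hpos y (hηΩ hyη)).le
    · exact absurd (by rw [zero_off (hζΩ y hy hyη), mul_zero]) h
  · intro z hz; rw [hdz z (hζr z hz), mul_zero]
  · intro y hy h; by_cases hyη : y ∈ tsupport η
    · exact (hpos y (hηΩ hyη)).le
    · exact absurd (by rw [hdz _ (hζΩ y hy hyη), mul_zero]) h

lemma _root_.HasWeakDirDeriv.mono {F : Type*} [NormedAddCommGroup F] [NormedSpace ℝ F]
  [MeasureSpace F] {U U' : Set F} {w g : F → ℝ} {v : F} (h : HasWeakDirDeriv U w g v)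
  (hU : U' ⊆ U) : HasWeakDirDeriv U' w g v :=
  ⟨h.locInt.mono_set hU, h.locInt_deriv.mono_set hU, fun η h1 h2 h3 =>
    h.integral_eq η h1 h2 (h3.trans hU)⟩

lemma lintegral_le_chart (ha : Continuous a) (o : M) {O : Set (M × ℝ)} (hO : MeasurableSet O) (hOr :
  O ⊆ chartRng N o) (g : M × ℝ → ℝ≥0∞) : ∫⁻ z in O, g z ∂ϖ ≤ ∫⁻ y in chartDom N o ∩ Φ o ⁻¹' O,
  ofReal (chartDensity N a o y) * g (Φ o y) := by
  have hD := (isOpen_chartDom (N := N) o).measurableSet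
  have hms : MeasurableSet (chartDom N o ∩ Φ o ⁻¹' O) :=
    (continuousOn_chartPoint o).measurableSet_inter_preimage hD hO
  have hm : AEMeasurable (fun y => ofReal (chartDensity N a o y))
      (volume.restrict (chartDom N o)) :=
    ((continuousOn_chartDensity ha o).aemeasurable hD).ennreal_ofReal
  have e1 : ∫⁻ z in O, g z ∂ϖ = ∫⁻ z, O.indicator g z ∂((ϖ).restrict (chartRng N o)) := by
    rw [lintegral_indicator hO, restrict_restrict hO, inter_eq_left.2 hOr]
  rw [e1, wstMeasure_restrict ha]; refine (lintegral_map_le _ _).trans ?_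
  rw [chartMeasure_eq, withDensity_congr_ae hm.ae_eq_mk]
  refine (lintegral_withDensity_le_lintegral_mul _ hm.measurable_mk _).trans (le_of_eq ?_)
  have e2 : ∫⁻ y in chartDom N o, (hm.mk * fun y => O.indicator g (Φ o y)) y =
      ∫⁻ y in chartDom N o, ofReal (chartDensity N a o y) * O.indicator g (Φ o y) := by
    refine lintegral_congr_ae ?_; filter_upwards [hm.ae_eq_mk] with y hy; rw [Pi.mul_apply, hy]
  rw [e2, ← lintegral_indicator hms, ← lintegral_indicator hD]; refine lintegral_congr fun y => ?_
  by_cases hy : y ∈ chartDom N o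
  · by_cases hyO : Φ o y ∈ O
    · rw [indicator_of_mem hy, indicator_of_mem (show y ∈ chartDom N o ∩ Φ o ⁻¹' O
        from ⟨hy, hyO⟩), indicator_of_mem hyO]
    · rw [indicator_of_mem hy, indicator_of_notMem (show y ∉ chartDom N o ∩ Φ o ⁻¹' O
        from fun h => hyO h.2), indicator_of_notMem hyO, mul_zero]
  · rw [indicator_of_notMem hy, indicator_of_notMem fun h => hy h.1]

lemma norm_le_sum_inner_coordVec {o : M} {y : Ξ} (hy : y ∈ (ϰ o).target) {C : ℝ} (hC0 : 0 ≤ C) (hC :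
  ∀ v, ‖v‖ ≤ C * ‖coordVec N o v y‖) (X : Τ ((ϰ o).symm y)) : ‖X‖ ≤ C * ∑ i, |(inner ℝ X (coordVec N
  o (ϗ i) y) : ℝ)| := by
  obtain ⟨w, rfl⟩ := exists_coordVec_eq o hy X; set X := coordVec N o w y with hX
  rcases eq_or_lt_of_le (norm_nonneg X) with h0 | h0
  · rw [← h0]; exact mul_nonneg hC0 (Finset.sum_nonneg fun _ _ => abs_nonneg _)
  · have h1 : ‖X‖ * ‖X‖ = ∑ i, w i * inner ℝ X (coordVec N o (ϗ i) y) := by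
      rw [← real_inner_self_eq_norm_mul_norm]
      have h2 : X = ∑ i, w i • coordVec N o (ϗ i) y := coordVec_eq_sum o w y
      conv_lhs => rw [show (inner ℝ X X : ℝ) = inner ℝ X (∑ i, w i •
        coordVec N o (ϗ i) y) from congrArg (inner ℝ X) h2]
      rw [inner_sum]; exact sum_congr rfl fun i _ => inner_smul_right _ _ _
    have h3 : ‖X‖ * ‖X‖ ≤ ‖w‖ * ∑ i, |(inner ℝ X (coordVec N o (ϗ i) y) : ℝ)| := by
      rw [h1, Finset.mul_sum]; refine Finset.sum_le_sum fun i _ => (le_abs_self _).trans ?_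
      rw [abs_mul]
      exact mul_le_mul_of_nonneg_right (by simpa using PiLp.norm_apply_le w i) (abs_nonneg _)
    have h4 := hC w; have h5 : 0 ≤ ∑ i, |(inner ℝ X (coordVec N o (ϗ i) y) : ℝ)| :=
      Finset.sum_nonneg fun _ _ => abs_nonneg _
    refine le_of_mul_le_mul_right ?_ h0
    calc ‖X‖ * ‖X‖ ≤ _ := h3
      _ ≤ (C * ‖X‖) * _ := by gcongr
      _ = _ := by ring

lemma IsWeakSolutionWith.chartSolution (hu : IsWeakSolutionWith N a V f p q m u Z D) (ha :
  LocallyLipschitz a) {o : M} {B : Set Ξ} (hB : IsOpen B) (hBt : B ⊆ (ϰ o).target) (hBa : ∀ y ∈ B, 0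
  < a ((ϰ o).symm y)) {C : ℝ} (hC0 : 0 < C) (hC : ∀ y ∈ B, ∀ v, ‖coordVec N o v y‖ ≤ C * ‖v‖) :
  ChartSolution (B ×ˢ Ioi 0) p m (fun y => u (Φ o y)) (fun y => D (Φ o y)) (fun w y => (inner ℝ (Z
  (Φ o y)) (coordVec N o w y.1) : ℝ)) (fun y => C * ‖Z (Φ o y)‖) := by
  have hΩ : IsOpen (B ×ˢ Ioi (0 : ℝ)) := hB.prod isOpen_Ioi
  have hΩd : B ×ˢ Ioi (0 : ℝ) ⊆ chartDom N o := prod_mono hBt Subset.rfl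
  have hpos : ∀ y ∈ B ×ˢ Ioi (0 : ℝ), 0 < chartDensity N a o y := fun y hy =>
    mul_pos (hBa _ hy.1) (volDensity_pos o (hBt hy.1))
  have hle : volume.restrict (B ×ˢ Ioi (0 : ℝ)) ≤ volume.restrict (chartDom N o) :=
    restrict_mono hΩd le_rfl
  have hm : AEMeasurable (fun y => u (Φ o y)) (volume.restrict (B ×ˢ Ioi (0 : ℝ))) :=
    ((aestronglyMeasurable_chart hu.aemeasurable.aestronglyMeasurable o).mono_measure hle).aemeasurable
  have hn : ∀ᵐ y ∂(volume.restrict (B ×ˢ Ioi (0 : ℝ))), 0 ≤ u (Φ o y) :=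
    ae_mono hle (ae_chart_of_ae hu.nonneg o)
  have hs : ∀ δ : ℝ, 0 < δ → ∀ w, HasWeakDirDeriv (B ×ˢ Ioi (0 : ℝ))
      (fun y => max (u (Φ o y)) δ) ({y | δ < u (Φ o y)}.indicator
        fun y => (inner ℝ (Z (Φ o y)) (coordVec N o w y.1) : ℝ)) (w, 0) :=
    fun δ hδ w => (hu.isWeakGradient.truncation δ hδ o w).mono fun y hy =>
      ⟨hBt hy.1, hBa _ hy.1, hy.2⟩
  refine ⟨fun w => ⟨hm, hn, fun δ hδ => hs δ hδ w⟩, ⟨hm, hn, fun δ hδ => ?_⟩, fun y => by positivity,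
    fun w => ?_, locallyIntegrableOn_chart ha.continuous hu.locInt_pow hΩ hΩd hpos, ?_⟩
  · exact hu.isWeakTimeDeriv.hasWeakDirDeriv ha hu.aemeasurable hΩ hΩd hpos hδ (hs δ hδ 0).locInt
  · filter_upwards [ae_restrict_mem hΩ.measurableSet] with y hy
    refine (abs_real_inner_le_norm _ _).trans ?_
    calc _ ≤ ‖Z (Φ o y)‖ * (C * ‖w‖) := by gcongr; exact hC _ hy.1 w
      _ = _ := by ring
  · have h1 := locallyIntegrableOn_chart ha.continuous hu.locInt_gradient hΩ hΩd hpos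
    have h2 := h1.smul (C ^ p); refine h2.congr (Eventually.of_forall fun y => ?_)
    simp only [Pi.smul_apply, smul_eq_mul]; rw [mul_rpow hC0.le (norm_nonneg _), mul_assoc]

lemma IsWeakSolutionWith.exists_localApprox_of_pos (hu : IsWeakSolutionWith N a V f p q m u Z D)
  (hun : ∀ z, 0 ≤ u z) (ha : LocallyLipschitz a) (hp : 1 < p) (hm : 1 ≤ m) {ε L B : ℝ} {H H' : ℝ →
  ℝ} (hH : IsCutoff ε L B H H') {z0 : M × ℝ} (hz0 : z0 ∈ spaceTime M) (haz : 0 < a z0.1) : ∃ O,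
  IsOpen O ∧ z0 ∈ O ∧ O ⊆ spaceTime M ∧ ∃ ψ, LocalApprox N a p m u D Z H H' B O ψ := by
  have hac : Continuous a := ha.continuous; set o := z0.1 with ho; set y0 := ϰ o o with hy0
  have hy0t : y0 ∈ (ϰ o).target := mem_extChartAt_target o
  have hop : IsOpen ((ϰ o).target ∩ (ϰ o).symm ⁻¹' {x | 0 < a x}) :=
    (continuousOn_extChartAt_symm o).isOpen_inter_preimage (isOpen_chartTarget o)
      (isOpen_lt continuous_const hac)
  obtain ⟨ρ, hρ, hρs⟩ := nhds_basis_closedBall.mem_iff.1 (hop.mem_nhds (show y0 ∈ _ from ⟨hy0t, by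
      change 0 < a ((ϰ o).symm y0); rw [hy0, extChartAt_to_inv]; exact haz⟩))
  have hρt : closedBall y0 ρ ⊆ (ϰ o).target := fun y hy => (hρs hy).1
  obtain ⟨C, hC0, hC⟩ := exists_norm_coordVec_bounds o (isCompact_closedBall y0 ρ) hρt
  have hbc : ball y0 ρ ⊆ closedBall y0 ρ := ball_subset_closedBall
  have hcs := hu.chartSolution ha isOpen_ball (hbc.trans hρt)
    (fun y hy => (hρs (hbc hy)).2) hC0 fun y hy v => (hC y (hbc hy) v).1
  have ht0 : 0 < z0.2 := hz0.2
  set K : Set (Ξ × ℝ) := closedBall y0 (ρ / 2) ×ˢ Icc (z0.2 / 2) (2 * z0.2) with hK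
  have hKc : IsCompact K := (isCompact_closedBall _ _).prod isCompact_Icc
  have hKΩ : K ⊆ ball y0 ρ ×ˢ Ioi 0 := prod_mono
    (closedBall_subset_ball (by linarith)) fun t ht => lt_of_lt_of_le (by linarith) ht.1
  have hKd : K ⊆ chartDom N o := hKΩ.trans (prod_mono (hbc.trans hρt) Subset.rfl)
  obtain ⟨b, hb, hb0, hbt, hbg, hbd⟩ := hcs.exists_approx hp hm
    (isOpen_ball.prod isOpen_Ioi) hKc hKΩ hH
  set I : Set (Ξ × ℝ) := ball y0 (ρ / 2) ×ˢ Ioo (z0.2 / 2) (2 * z0.2) with hI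
  have hIK : I ⊆ K := prod_mono ball_subset_closedBall Ioo_subset_Icc_self
  set O := chartRng N o ∩ pointChart N o ⁻¹' I with hO
  have hOo : IsOpen O := (continuousOn_pointChart o).isOpen_inter_preimage (isOpen_chartRng o)
    (isOpen_ball.prod isOpen_Ioo)
  have hpre : chartDom N o ∩ Φ o ⁻¹' O ⊆ K := fun y hy => by
    have := hy.2.2; rw [mem_preimage, pointChart_chartPoint hy.1] at this; exact hIK this
  have hpm : MeasurableSet (chartDom N o ∩ Φ o ⁻¹' O) :=
    (isOpen_chartDom_inter_preimage o hOo).measurableSet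
  obtain ⟨Cd, hCd⟩ := hKc.exists_bound_of_continuousOn
    ((continuousOn_chartDensity (N := N) hac o).mono hKd)
  have hle : ∀ (g : M × ℝ → ℝ≥0∞) (g' : Ξ × ℝ → ℝ≥0∞),
      (∀ y ∈ chartDom N o, y ∈ K → g (Φ o y) ≤ g' y) →
      ∫⁻ z in O, g z ∂ϖ ≤ ofReal Cd * ∫⁻ y in K, g' y := fun g g' h => by
    refine (lintegral_le_chart hac o hOo.measurableSet inter_subset_left g).trans ?_
    rw [← lintegral_const_mul' _ _ ofReal_ne_top]
    refine (setLIntegral_mono' hpm fun y hy => ?_).trans (lintegral_mono_set hpre)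
    exact mul_le_mul' (ofReal_le_ofReal ((le_abs_self _).trans (hCd y (hpre hy))))
      (h y hy.1 (hpre hy))
  have hdiff : ∀ n, ∀ y ∈ chartDom N o,
      (fun y => b n (pointChart N o (Φ o y))) =ᶠ[𝓝 y] b n := fun n y hy => by
    filter_upwards [(isOpen_chartDom o).mem_nhds hy] with y' hy'; rw [pointChart_chartPoint hy']
  have hdb : ∀ n y, DifferentiableAt ℝ (b n) y := fun n y => (hb n).differentiable (by simp) y
  refine ⟨O, hOo, ⟨⟨mem_extChartAt_source o, ht0⟩, ?_⟩, fun z hz => ⟨mem_univ _, hz.1.2⟩,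
    fun n z => b n (pointChart N o z), ⟨fun n => ?_, fun n z => (hb0 n _).1, fun n z => (hb0 n _).2,
      ?_, ?_, ?_⟩⟩
  · exact ⟨mem_ball_self (by linarith), by change z0.2 / 2 < z0.2; linarith,
      by change z0.2 < 2 * z0.2; linarith⟩
  · exact (LocallyLipschitzOn.of_contDiffAt (s := univ) fun y _ =>
      ((hb n).contDiffAt).of_le (by simp)).comp_of_mapsTo
      ((locallyLipschitzOn_pointChart o).mono inter_subset_left) fun _ _ => mem_univ _
  · have h1 : ∀ᵐ y ∂(volume.restrict (chartDom N o)), Φ o y ∈ O →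
        Tendsto (fun n => b n (pointChart N o (Φ o y))) atTop (𝓝 (H (u (Φ o y)))) := by
      rw [ae_restrict_iff' hKc.measurableSet] at hbt
      rw [ae_restrict_iff' (isOpen_chartDom o).measurableSet]
      filter_upwards [hbt] with y hy hyd hyO; simp only [pointChart_chartPoint hyd]
      exact hy (hpre ⟨hyd, hyO⟩)
    have h2 := ae_restrict_of_ae_chart hac (P := fun z => z ∈ O →
      Tendsto (fun n => b n (pointChart N o z)) atTop (𝓝 (H (u z)))) h1
    have h3 := ae_mono (restrict_mono (inter_subset_left (t := pointChart N o ⁻¹' I))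
      (le_refl ϖ)) h2
    filter_upwards [h3, ae_restrict_mem hOo.measurableSet] with z h4 h5 using h4 h5
  · have hN := fun i : Fin N => hbg (ϗ i)
    have hsum := tendsto_finsetSum Finset.univ fun i _ => hN i
    simp only [Finset.sum_const_zero] at hsum
    set c := C ^ p * ((Finset.univ : Finset (Fin N)).card : ℝ) ^ (p - 1) with hc
    have hlim := ENNReal.Tendsto.const_mul (a := ofReal Cd * ofReal c) hsum
      (Or.inr (mul_ne_top ofReal_ne_top ofReal_ne_top))
    rw [mul_zero] at hlim; refine squeeze_ennreal hlim fun n => ?_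
    refine (hle _ (fun y => ofReal c * ∑ i : Fin N, ofReal
      (|fderiv ℝ (b n) y (ϗ i, 0) - H' (u (Φ o y)) *
        (inner ℝ (Z (Φ o y)) (coordVec N o (ϗ i) y.1) : ℝ)| ^ p
          * u (Φ o y) ^ (m - 1))) fun y hyd hyK => ?_).trans ?_
    · rw [← ENNReal.ofReal_sum_of_nonneg fun i _ => ?_, ← ofReal_mul (by positivity)]
      · refine ofReal_le_ofReal ?_
        have h1 := norm_le_sum_inner_coordVec (hKd hyK).1 hC0.le (fun v =>
          (hC y.1 (closedBall_subset_closedBall (by linarith) hyK.1) v).2)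
          (rgrad N (fun x => b n (pointChart N o (x, (Φ o y).2)))
            (Φ o y).1 - H' (u (Φ o y)) • Z (Φ o y))
        have h2 : ∀ i : Fin N, (inner ℝ (rgrad N (fun x => b n (pointChart N o
            (x, (Φ o y).2))) (Φ o y).1 - H' (u (Φ o y)) • Z (Φ o y)) (coordVec N o (ϗ i) y.1) : ℝ) =
            fderiv ℝ (b n) y (ϗ i, 0) - H' (u (Φ o y)) *
              inner ℝ (Z (Φ o y)) (coordVec N o (ϗ i) y.1) := by
          intro i
          refine (inner_sub_left _ _ _).trans (congrArg₂ (· - ·) ?_ (real_inner_smul_left _ _ _))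
          exact (inner_rgrad_slice (ψ := fun z => b n (pointChart N o z)) hyd
            ((hdiff n y hyd).differentiableAt_iff.2 (hdb n y)) _).trans
            (by rw [(hdiff n y hyd).fderiv_eq])
        have h3 := rpow_le_rpow (norm_nonneg _) (h1.trans_eq (congrArg (C * ·)
          (sum_congr rfl fun i _ => congrArg abs (h2 i)))) (by linarith : (0 : ℝ) ≤ p)
        rw [mul_rpow hC0.le (Finset.sum_nonneg fun _ _ => abs_nonneg _)] at h3
        have h4 := h3.trans (mul_le_mul_of_nonneg_left
          (rpow_sum_le_const_mul_sum_rpow Finset.univ _ hp.le) (by positivity))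
        rw [← sum_mul, ← mul_assoc, hc, mul_assoc (C ^ p)]
        exact mul_le_mul_of_nonneg_right h4 (rpow_nonneg (hun _) _)
      · exact mul_nonneg (by positivity) (rpow_nonneg (hun _) _)
    · rw [lintegral_const_mul' _ _ ofReal_ne_top, lintegral_finsetSum', mul_assoc]; intro i _
      have hr : volume.restrict K ≤ volume.restrict (ball y0 ρ ×ˢ Ioi 0) := restrict_mono hKΩ le_rfl
      have hu1 := (hcs.time.aemeasurable).mono_measure hr
      have h5 : AEMeasurable (fun y => H' (u (Φ o y)) * (inner ℝ (Z (Φ o y))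
          (coordVec N o (ϗ i) y.1) : ℝ)) (volume.restrict K) := by
        have h6 := (((hcs.space (ϗ i)).truncation ε
          hH.pos).locInt_deriv.aestronglyMeasurable.mono_measure hr).aemeasurable
        refine ((hH.continuous.measurable.comp_aemeasurable hu1).mul h6).congr
          (Eventually.of_forall fun y => ?_)
        by_cases h : ε < u (Φ o y)
        · simp [h]
        · simp [h, hH.eq_zero_of_le _ (not_lt.1 h)]
      have h7 : Measurable fun y => fderiv ℝ (b n) y (ϗ i, 0) :=
        (continuous_fderiv_apply_const (hb n) _).measurable
      exact (((h7.aemeasurable.sub h5).norm.pow_const p).mul (hu1.pow_const _)).ennreal_ofReal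
  · have hlim := ENNReal.Tendsto.const_mul (a := ofReal Cd) hbd (Or.inr ofReal_ne_top)
    rw [mul_zero] at hlim; refine squeeze_ennreal hlim fun n => hle _ _ fun y hyd hyK => ofReal_le_ofReal ?_
    have h1 := (deriv_slice (ψ := fun z => b n (pointChart N o z))
      ((hdiff n y hyd).differentiableAt_iff.2 (hdb n y))).deriv
    rw [(hdiff n y hyd).fderiv_eq] at h1; beta_reduce at h1; rw [h1]
    exact mul_le_of_le_one_left (abs_nonneg _) (min_le_right _ _)

lemma add_rpow_le {x y p : ℝ} (hx : 0 ≤ x) (hy : 0 ≤ y) (hp : 0 ≤ p) :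
  (x + y) ^ p ≤ 2 ^ p * (x ^ p + y ^ p) := by
  have h1 : x + y ≤ 2 * max x y := by linarith [le_max_left x y, le_max_right x y]
  have h2 := rpow_le_rpow (by positivity) h1 hp
  rw [mul_rpow zero_le_two (le_max_of_le_left hx)] at h2
  refine h2.trans (mul_le_mul_of_nonneg_left ?_ (by positivity))
  rcases max_choice x y with h | h <;> rw [h]
  · exact le_add_of_nonneg_right (by positivity)
  · exact le_add_of_nonneg_left (by positivity)

lemma tendsto_lintegral_ofReal_zero {X : Type*} [MeasurableSpace X] {ν : Measure X} {F G b : ℕ → X →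
  ℝ} {Q : X → ℝ} {c C : ℝ} (hc : 0 ≤ c) (hle : ∀ k, ∀ᵐ z ∂ν, F k z ≤ c * G k z + b k z * Q z) (hG :
  Tendsto (fun k => ∫⁻ z, ofReal (G k z) ∂ν) atTop (𝓝 0)) (hb : ∀ k, AEMeasurable (b k) ν) (hbC : ∀
  k z, |b k z| ≤ C) (hb0 : ∀ᵐ z ∂ν, Tendsto (fun k => b k z) atTop (𝓝 0)) (hQ : Integrable Q ν) :
  Tendsto (fun k => ∫⁻ z, ofReal (F k z) ∂ν) atTop (𝓝 0) := by
  have hm : ∀ k, AEMeasurable (fun z => ofReal (b k z * Q z)) ν := fun k =>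
    ((hb k).mul hQ.1.aemeasurable).ennreal_ofReal
  have h1 : Tendsto (fun k => ∫⁻ z, ofReal (b k z * Q z) ∂ν) atTop (𝓝 0) := by
    have h2 := tendsto_lintegral_of_dominated_convergence'
      (F := fun k z => ofReal (b k z * Q z)) (f := fun _ => 0) (μ := ν)
      (fun z => ofReal C * ‖Q z‖ₑ) hm
      (fun k => ae_of_all _ fun z => ?_) ?_ ?_
    · simpa using h2
    · beta_reduce; rw [← ofReal_norm, ← ofReal_mul ((abs_nonneg _).trans (hbC k z))]
      refine ofReal_le_ofReal ((le_abs_self _).trans ?_); rw [abs_mul, norm_eq_abs]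
      exact mul_le_mul_of_nonneg_right (hbC k z) (abs_nonneg _)
    · rw [lintegral_const_mul' _ _ ofReal_ne_top]; exact mul_ne_top ofReal_ne_top hQ.2.ne
    · filter_upwards [hb0] with z hz; have h3 := tendsto_ofReal (hz.mul_const (Q z)); simpa using h3
  have h3 := (ENNReal.Tendsto.const_mul (a := ofReal c) hG (Or.inr ofReal_ne_top)).add h1
  rw [mul_zero, add_zero] at h3; refine squeeze_ennreal h3 fun k => ?_
  rw [← lintegral_const_mul' _ _ ofReal_ne_top, ← lintegral_add_right' _ (hm k)]
  refine lintegral_mono_ae ?_; filter_upwards [hle k] with z hz; rw [← ofReal_mul hc]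
  exact (ofReal_le_ofReal hz).trans ENNReal.ofReal_add_le

lemma exists_subseq_tendsto_of_lintegral_rpow {X : Type*} [MeasurableSpace X] {ν : Measure X} {w : ℕ
  → X → ℝ} {u : X → ℝ} {s : ℝ} (hs : 0 < s) (hw : ∀ k, AEMeasurable (w k) ν) (hu : AEMeasurable u ν)
  (h : Tendsto (fun k => ∫⁻ z, ofReal (|w k z - u z| ^ s) ∂ν) atTop (𝓝 0)) : ∃ ns : ℕ → ℕ,
  StrictMono ns ∧ ∀ᵐ z ∂ν, Tendsto (fun k => w (ns k) z) atTop (𝓝 (u z)) := by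
  have h1 : TendstoInMeasure ν (fun k z => |w k z - u z| ^ s) atTop (fun _ => (0 : ℝ)) := by
    refine tendstoInMeasure_of_tendsto_eLpNorm (p := 1) one_ne_zero (fun k =>
      (((hw k).sub hu).norm.pow_const s).aestronglyMeasurable) aestronglyMeasurable_const ?_
    refine h.congr fun k => ?_; rw [eLpNorm_one_eq_lintegral_enorm]
    refine lintegral_congr fun z => ?_
    rw [Pi.sub_apply, sub_zero, ← ofReal_norm, norm_of_nonneg (by positivity)]
  obtain ⟨ns, hns, hae⟩ := h1.exists_seq_tendsto_ae; refine ⟨ns, hns, ?_⟩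
  filter_upwards [hae] with z hz; have h2 := hz.rpow_const (p := 1 / s) (Or.inr (by positivity))
  rw [zero_rpow (by positivity)] at h2
  refine tendsto_iff_norm_sub_tendsto_zero.2 (h2.congr fun k => ?_)
  rw [← rpow_mul (abs_nonneg _), mul_one_div_cancel hs.ne', rpow_one, norm_eq_abs]

lemma IsCutoff.contDiff {ε L B : ℝ} {H H' : ℝ → ℝ} (hH : IsCutoff ε L B H H') : ContDiff ℝ 1 H := by
  have : deriv H = H' := funext fun s => (hH.hasDerivAt s).deriv
  exact contDiff_one_iff_deriv.2 ⟨fun s => (hH.hasDerivAt s).differentiableAt, this ▸ hH.continuous⟩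

lemma IsWeakSolutionWith.exists_localApprox_of_zero (hu : IsWeakSolutionWith N a V f p q m u Z D)
  (hun : ∀ z, 0 ≤ u z) (ha : LocallyLipschitz a) (hp : 1 < p) (hm : 1 ≤ m) {ε L B : ℝ} {H H' : ℝ →
  ℝ} (hH : IsCutoff ε L B H H') {z0 : M × ℝ} (hz0 : z0 ∈ spaceTime M) (haz : a z0.1 = 0) : ∃ O,
  IsOpen O ∧ z0 ∈ O ∧ O ⊆ spaceTime M ∧ ∃ ψ, LocalApprox N a p m u D Z H H' B O ψ := by
  have hac : Continuous a := ha.continuous; have hB : 0 ≤ B := (hH.nonneg 0).trans (hH.le 0)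
  have hSo : IsOpen (spaceTime M) := isOpen_univ.prod isOpen_Ioi
  obtain ⟨O1, hO1, w, hw, hwt⟩ := hu.isWeightedLimit z0 hz0 haz
  obtain ⟨O2, hO2, hI2⟩ := hu.locInt_gradient z0 hz0; obtain ⟨O3, hO3, hI3⟩ := hu.locInt_time z0 hz0
  rw [hSo.nhdsWithin_eq hz0] at hO2 hO3; obtain ⟨O, hOs, hOo, hzO⟩ := _root_.mem_nhds_iff.1
    (inter_mem (inter_mem hO1 (hSo.mem_nhds hz0)) (inter_mem hO2 hO3))
  set ν := (ϖ).restrict O with hν; have hIg : Integrable (fun z => ‖Z z‖ ^ p * u z ^ (m - 1)) ν :=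
    hI2.mono_set fun z hz => (hOs hz).2.1
  have hIt : Integrable (fun z => |u z * D z|) ν :=
    (hI3.mono_set fun z hz => (hOs hz).2.2 : IntegrableOn _ O _).abs
  have hum : AEMeasurable u ν :=
    (hu.aemeasurable.mono_ac (wstMeasure_absolutelyContinuous hac)).restrict
  have hle : ∀ {F : ℕ → Ϝ}, (∀ k z, F k z ≤ |w k z - u z| ^ (p + m - 1)
          + ‖∇ (w k) z - Z z‖ ^ p * u z ^ (m - 1)
          + u z * |∂ₜ (w k) z - D z|) →
      Tendsto (fun k => ∫⁻ z, ofReal (F k z) ∂ν) atTop (𝓝 0) := fun {F} hF =>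
    squeeze_ennreal hwt fun k => (lintegral_mono_set fun z hz => (hOs hz).1.1).trans
        (lintegral_mono fun z => ofReal_le_ofReal (hF k z))
  have hn1 : ∀ k z, 0 ≤ |w k z - u z| ^ (p + m - 1) := fun k z => by positivity
  have hn2 : ∀ k z, 0 ≤ ‖∇ (w k) z - Z z‖ ^ p * u z ^ (m - 1) :=
    fun k z => mul_nonneg (by positivity) (rpow_nonneg (hun z) _)
  have hn3 : ∀ k z, 0 ≤ u z * |∂ₜ (w k) z - D z| := fun k z => mul_nonneg (hun z) (abs_nonneg _)
  have hwm : ∀ k, AEMeasurable (w k) ν := fun k => (hw k).continuous.aemeasurable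
  obtain ⟨ns, hns, hae⟩ := exists_subseq_tendsto_of_lintegral_rpow (s := p + m - 1)
    (by linarith) hwm hum (hle fun k z => by linarith [hn2 k z, hn3 k z])
  have hlw : ∀ k, LocallyLipschitzOn univ (w k) := fun k => (hw k).locallyLipschitzOn
  have hds : ∀ k, ∀ᵐ z ∂ν, MDifferentiableAt (𝓡 N) 𝓘(ℝ, ℝ) (fun x => w k (x, z.2)) z.1 ∧
      DifferentiableAt ℝ (fun t => w k (z.1, t)) z.2 := fun k => by
    filter_upwards [ae_restrict_of_ae (ae_differentiable_slices (N := N) hac isOpen_univ (hlw k))]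
      with z hz using hz (mem_univ _)
  have hbm : ∀ k, AEMeasurable (fun z => |H' (w (ns k) z) - H' (u z)|) ν := fun k =>
    (((hH.continuous.measurable.comp_aemeasurable (hwm _))).sub
      (hH.continuous.measurable.comp_aemeasurable hum)).norm
  have hb1 : ∀ k z, |H' (w (ns k) z) - H' (u z)| ≤ 2 * B := fun k z => by
    have h1 := hH.abs_le (w (ns k) z); have h2 := hH.abs_le (u z); rw [abs_le] at h1 h2 ⊢
    constructor <;> linarith
  have hbt : ∀ᵐ z ∂ν, Tendsto (fun k => |H' (w (ns k) z) - H' (u z)|) atTop (𝓝 0) := by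
    filter_upwards [hae] with z hz
    have := (((hH.continuous.tendsto (u z)).comp hz).sub_const (H' (u z))).abs; simpa using this
  refine ⟨O, hOo, hzO, fun z hz => (hOs hz).1.2, fun k z => H (w (ns k) z),
    ⟨fun k => ?_, fun k z => hH.nonneg _, fun k z => hH.le _, ?_, ?_, ?_⟩⟩
  · exact (LocallyLipschitzOn.of_contDiffAt (s := univ) fun s _ =>
      hH.contDiff.contDiffAt).comp_of_mapsTo ((hlw _).mono (subset_univ _)) fun _ _ => mem_univ _
  · filter_upwards [hae] with z hz; exact (hH.hasDerivAt (u z)).continuousAt.tendsto.comp hz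
  · refine tendsto_lintegral_ofReal_zero (c := 2 ^ p * B ^ p) (C := 2 ^ p * (2 * B) ^ p)
      (G := fun k z => ‖∇ (w (ns k)) z - Z z‖ ^ p * u z ^ (m - 1))
      (b := fun k z => 2 ^ p * |H' (w (ns k) z) - H' (u z)| ^ p) (by positivity) (fun k => ?_)
      ((hle (F := fun k z => ‖∇ (w k) z - Z z‖ ^ p * u z ^ (m - 1))
        fun k z => by linarith [hn1 k z, hn3 k z]).comp hns.tendsto_atTop)
      (fun k => ((hbm k).pow_const p).const_mul _) (fun k z => ?_) ?_ hIg
    · filter_upwards [hds (ns k)] with z hz; rw [rgrad_comp hz.1 (hH.hasDerivAt _)]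
      set X := ∇ (w (ns k)) z with hX; have h1 : ‖H' (w (ns k) z) • X - H' (u z) • Z z‖ ≤
          B * ‖X - Z z‖ + |H' (w (ns k) z) - H' (u z)| * ‖Z z‖ := by
        have h2 : H' (w (ns k) z) • X - H' (u z) • Z z = H' (w (ns k) z) • (X - Z z) +
          (H' (w (ns k) z) - H' (u z)) • Z z := by rw [smul_sub, sub_smul]; abel
        rw [h2]; refine (norm_add_le _ _).trans ?_
        rw [norm_smul, norm_smul, norm_eq_abs, norm_eq_abs]; gcongr; exact hH.abs_le _
      have h3 := (rpow_le_rpow (norm_nonneg _) h1 (by linarith)).trans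
        (add_rpow_le (p := p) (by positivity) (by positivity) (by linarith))
      rw [mul_rpow hB (norm_nonneg _), mul_rpow (abs_nonneg _) (norm_nonneg _)] at h3
      refine (mul_le_mul_of_nonneg_right h3 (rpow_nonneg (hun z) _)).trans (le_of_eq ?_); ring
    · rw [abs_of_nonneg (by positivity)]; gcongr; exact hb1 k z
    · filter_upwards [hbt] with z hz
      have := (hz.rpow_const (p := p) (Or.inr (by linarith))).const_mul (2 ^ p)
      rwa [zero_rpow (by linarith), mul_zero] at this
  · refine tendsto_lintegral_ofReal_zero (c := B) (C := 2 * B)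
      (G := fun k z => u z * |∂ₜ (w (ns k)) z - D z|)
      (b := fun k z => |H' (w (ns k) z) - H' (u z)|) hB (fun k => ?_)
      ((hle (F := fun k z => u z * |∂ₜ (w k) z - D z|)
        fun k z => by linarith [hn1 k z, hn2 k z]).comp hns.tendsto_atTop)
      hbm (fun k z => by rw [abs_abs]; exact hb1 k z) hbt hIt
    filter_upwards [hds (ns k)] with z hz
    have h0 : deriv (fun t => H (w (ns k) (z.1, t))) z.2 = H' (w (ns k) z) * ∂ₜ (w (ns k)) z :=
      (HasDerivAt.comp z.2 (hH.hasDerivAt (w (ns k) (z.1, z.2))) hz.2.hasDerivAt).deriv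
    rw [h0]; set X := ∂ₜ (w (ns k)) z with hX; have h1 : |H' (w (ns k) z) * X - H' (u z) * D z| ≤
        B * |X - D z| + |H' (w (ns k) z) - H' (u z)| * |D z| := by
      have h2 : H' (w (ns k) z) * X - H' (u z) * D z = H' (w (ns k) z) * (X - D z) +
          (H' (w (ns k) z) - H' (u z)) * D z := by ring
      rw [h2]; refine (abs_add_le _ _).trans ?_; rw [abs_mul, abs_mul]; gcongr; exact hH.abs_le _
    calc _ ≤ u z * (B * |X - D z| + |H' (w (ns k) z) - H' (u z)| * |D z|) := by
          gcongr
          · exact hun z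
          · exact min_le_left _ _
      _ = _ := by rw [abs_mul, abs_of_nonneg (hun z)]; ring

lemma wstMeasure_restrict_neg (hac : Continuous a) : (ϖ).restrict {z | a z.1 < 0} = 0 := by
  rw [Measure.restrict_eq_zero]
  have h1 : {z : M × ℝ | a z.1 < 0} = {x | a x < 0} ×ˢ univ := by ext; simp
  have hms : MeasurableSet {x | a x < 0} := hac.measurable measurableSet_Iio
  rw [h1, wstMeasure, Measure.prod_prod, withDensity_apply _ hms]
  have : ∫⁻ x in {x | a x < 0}, ofReal (a x) ∂(riemannianVolume N M) = 0 := by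
    rw [setLIntegral_congr_fun (g := fun _ => 0) hms fun x hx =>
      ENNReal.ofReal_of_nonpos (le_of_lt hx)]
    simp
  rw [this, zero_mul]

lemma IsWeakSolutionWith.exists_localApprox (hu : IsWeakSolutionWith N a V f p q m u Z D) (hun : ∀
  z, 0 ≤ u z) (ha : LocallyLipschitz a) (hp : 1 < p) (hm : 1 ≤ m) {ε L B : ℝ} {H H' : ℝ → ℝ} (hH :
  IsCutoff ε L B H H') {z0 : M × ℝ} (hz0 : z0 ∈ spaceTime M) : ∃ O, IsOpen O ∧ z0 ∈ O ∧ O ⊆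
  spaceTime M ∧ ∃ ψ, LocalApprox N a p m u D Z H H' B O ψ := by
  rcases lt_trichotomy (a z0.1) 0 with h | h | h
  · have hB : 0 ≤ B := (hH.nonneg 0).trans (hH.le 0); have hac : Continuous a := ha.continuous
    refine ⟨spaceTime M ∩ {z | a z.1 < 0}, (isOpen_univ.prod isOpen_Ioi).inter
      (isOpen_lt (hac.comp continuous_fst) continuous_const), ⟨hz0, h⟩, inter_subset_left,
      fun _ _ => 0, ?_⟩
    have h0 : (ϖ).restrict (spaceTime M ∩ {z | a z.1 < 0}) = 0 := by
      rw [Measure.restrict_eq_zero]; exact measure_mono_null inter_subset_right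
        (Measure.restrict_eq_zero.1 (wstMeasure_restrict_neg hac))
    exact ⟨fun _ => (LocallyLipschitz.const 0).locallyLipschitzOn, fun _ _ => le_rfl, fun _ _ => hB,
      by rw [h0]; simp, by simp [h0], by simp [h0]⟩
  · exact hu.exists_localApprox_of_zero hun ha hp hm hH hz0 h
  · exact hu.exists_localApprox_of_pos hun ha hp hm hH hz0 h

lemma IsWeakSolutionWith.max_zero (hu : IsWeakSolutionWith N a V f p q m u Z D)
  (hac : Continuous a) : IsWeakSolutionWith N a V f p q m (fun z => max (u z) 0) Z D := by
  have hae : ∀ᵐ z ∂(stMeasure N M), max (u z) 0 = u z := by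
    filter_upwards [hu.nonneg] with z hz using max_eq_left hz
  have hae' : ∀ᵐ z ∂ϖ, max (u z) 0 = u z := (wstMeasure_absolutelyContinuous hac).ae_le hae
  have hmax : ∀ {δ : ℝ}, 0 < δ → ∀ s : ℝ, max (max s 0) δ = max s δ := fun {δ} hδ s => by
    rw [max_assoc, max_eq_right hδ.le]
  have hind : ∀ {δ : ℝ}, 0 < δ → ∀ s : ℝ, (δ < max s 0) = (δ < s) := fun {δ} hδ s => by
    rw [lt_max_iff]; exact propext (or_iff_left (not_lt.2 hδ.le))
  have hloc : ∀ {g h : Ϝ}, (∀ z, max (u z) 0 = u z → g z = h z) →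
      LocallyIntegrableOn g (spaceTime M) ϖ →
      LocallyIntegrableOn h (spaceTime M) ϖ := fun h1 h2 =>
    h2.congr (ae_restrict_of_ae (hae'.mono fun z hz => h1 z hz))
  refine ⟨hu.aemeasurable.max aemeasurable_const, ae_of_all _ fun z => le_max_right _ _,
    ⟨fun δ hδ x v => ?_, ?_⟩, fun δ hδ => ?_, fun z hz haz => ?_,
    hloc (fun z hz => by rw [hz]) hu.locInt_potential, hloc (fun z hz => by rw [hz]) hu.locInt_pow,
    hloc (fun z hz => by rw [hz]) hu.locInt_gradient, hloc (fun z hz => by rw [hz]) hu.locInt_time,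
    fun ψ hψ hψ0 => ?_⟩
  · simp only [hmax hδ, hind hδ]; exact hu.isWeakGradient.truncation δ hδ x v
  · filter_upwards [hu.isWeakGradient.eq_zero, hae] with z h1 h2 h3; exact h1 (h2.symm.trans h3)
  · simp only [hmax hδ, hind hδ]; exact hu.isWeakTimeDeriv δ hδ
  · obtain ⟨O, hO, w, hw, hwt⟩ := hu.isWeightedLimit z hz haz
    refine ⟨O, hO, w, hw, hwt.congr fun k => lintegral_congr_ae (ae_restrict_of_ae ?_)⟩
    filter_upwards [hae'] with z h; rw [h]
  · have h1 := hu.inequality ψ hψ hψ0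
    have e1 : ∫ z, ψ z * max (u z) 0 ^ q * V z ∂ϖ = ∫ z, ψ z * u z ^ q * V z ∂ϖ :=
      integral_congr_ae (hae'.mono fun z hz => by beta_reduce; rw [hz])
    have e2 : ∫ z, (inner ℝ (∇ ψ z) (Z z) : ℝ) * max (u z) 0 ^ (m - 1)
        * ‖Z z‖ ^ (p - 2) * f ‖Z z‖ ∂ϖ =
        ∫ z, 𝔣 ψ z ∂ϖ :=
      integral_congr_ae (hae'.mono fun z hz => by beta_reduce; rw [hz])
    have e3 : ∫ z, ∂ₜ ψ z * max (u z) 0 ∂ϖ = ∫ z, ∂ₜ ψ z * u z ∂ϖ :=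
      integral_congr_ae (hae'.mono fun z hz => by beta_reduce; rw [hz])
    rw [e1, e2, e3]; exact h1

lemma _root_.MeasureTheory.LocallyIntegrableOn.integrable_mul_of_bound {X : Type*} [TopologicalSpace
  X] [T2Space X] [MeasurableSpace X] [BorelSpace X] {μ : Measure X} {f k : X → ℝ} {S K : Set X} {C :
  ℝ} (hf : LocallyIntegrableOn f S μ) (hK : IsCompact K) (hKS : K ⊆ S) (hk : AEStronglyMeasurable k
  μ) (hkC : ∀ z, |k z| ≤ C) (hk0 : ∀ z ∉ K, k z = 0) : Integrable (fun z => f z * k z) μ := by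
  have h1 : IntegrableOn f K μ := hf.integrableOn_compact_subset hKS hK
  refine IntegrableOn.integrable_of_forall_notMem_eq_zero (s := K) ?_ fun z hz => by
    rw [hk0 z hz, mul_zero]
  have h2 : IntegrableOn (fun z => k z * f z) K μ :=
    h1.bdd_mul hk.restrict (ae_of_all _ fun z => hkC z)
  exact h2.congr (ae_of_all _ fun z => mul_comm _ _)

lemma rgrad_add {g h : M → ℝ} {x : M} (hg : MDifferentiableAt (𝓡 N) 𝓘(ℝ, ℝ) g x)
  (hh : MDifferentiableAt (𝓡 N) 𝓘(ℝ, ℝ) h x) :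
  rgrad N (fun x => g x + h x) x = rgrad N g x + rgrad N h x := by
  refine ext_inner_right ℝ fun w => ?_; rw [inner_add_left, inner_rgrad, inner_rgrad, inner_rgrad]
  have h1 := (hg.hasMFDerivAt.add hh.hasMFDerivAt).mfderiv
  have h2 : mfderiv (𝓡 N) 𝓘(ℝ, ℝ) (fun x => g x + h x) x w = _ := congrArg (fun L => L w) h1
  rw [h2]
  rfl

/-- The slices of `ψ` have derivatives bounded by a local Lipschitz constant. -/
lemma norm_slices_le {ψ : Ϝ} {t : Set (M × ℝ)} {C : NNReal} (hψ : LipschitzOnWith C ψ t) {z : M × ℝ}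
  (ht : t ∈ 𝓝 z) : ‖∇ ψ z‖ ≤ C ∧ |deriv (fun s => ψ (z.1, s)) z.2| ≤ C := by
  have hz := mem_of_mem_nhds ht; constructor
  · refine norm_rgrad_le C.2 fun C' hC' => ?_
    have h2 : Tendsto (fun x : M => (x, z.2)) (𝓝 z.1) (𝓝 z) :=
      (Continuous.prodMk_left z.2).tendsto z.1
    filter_upwards [h2.eventually ht] with x hx; have h3 := hψ.dist_le_mul _ hx _ hz
    rw [Prod.dist_eq, dist_self, max_eq_left dist_nonneg, dist_eq] at h3
    exact h3.trans (mul_le_mul_of_nonneg_right hC'.le dist_nonneg)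
  · refine norm_deriv_le_of_lip' (f := fun s : ℝ => ψ (z.1, s)) (x₀ := z.2) C.2 ?_
    have h2 : Tendsto (fun s : ℝ => (z.1, s)) (𝓝 z.2) (𝓝 z) :=
      (Continuous.prodMk_right z.1).tendsto z.2
    filter_upwards [h2.eventually ht] with s hs; have h3 := hψ.dist_le_mul _ hs _ hz
    rw [Prod.dist_eq, dist_self, max_eq_right dist_nonneg] at h3; exact h3

lemma slices_eq_zero_of_notMem {ψ : Ϝ} {z : M × ℝ} (hz : z ∉ tsupport ψ) :
  ∇ ψ z = 0 ∧ deriv (fun s => ψ (z.1, s)) z.2 = 0 := by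
  have h := norm_slices_le (N := N) (ψ := ψ) (C := 0) (t := (tsupport ψ)ᶜ) (fun x hx y hy => by
    rw [zero_off hx, zero_off hy, edist_self]
    exact zero_le) ((isClosed_tsupport ψ).isOpen_compl.mem_nhds hz)
  exact ⟨norm_le_zero_iff.1 h.1, abs_nonpos_iff.1 h.2⟩

variable (N) in
lemma IsTestFunction.exists_bound {ψ : Ϝ} (hψ : IsTestFunction ψ) : ∃ C : ℝ, 0 ≤ C ∧ ∀ z, |ψ z| ≤ C
  ∧ ‖∇ ψ z‖ ≤ C ∧ |deriv (fun s => ψ (z.1, s)) z.2| ≤ C := by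
  obtain ⟨C1, hC1⟩ := hψ.hasCompactSupport.exists_bound_of_continuousOn
    hψ.locallyLipschitz.continuous.continuousOn
  obtain ⟨C2, hC2⟩ : ∃ C2 : ℝ, ∀ z ∈ tsupport ψ,
      ‖∇ ψ z‖ ≤ C2 ∧ |deriv (fun s => ψ (z.1, s)) z.2| ≤ C2 := by
    refine hψ.hasCompactSupport.isCompact.induction_on (p := fun s => ∃ C2 : ℝ, ∀ z ∈ s,
      ‖∇ ψ z‖ ≤ C2 ∧ |deriv (fun s => ψ (z.1, s)) z.2| ≤ C2)
      ⟨0, fun z hz => hz.elim⟩ (fun s t hst ⟨C, hC⟩ => ⟨C, fun z hz => hC z (hst hz)⟩) ?_ ?_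
    · rintro s t ⟨C, hC⟩ ⟨C', hC'⟩; refine ⟨max C C', fun z hz => hz.elim (fun h => ?_) fun h => ?_⟩
      · exact ⟨(hC z h).1.trans (le_max_left _ _), (hC z h).2.trans (le_max_left _ _)⟩
      · exact ⟨(hC' z h).1.trans (le_max_right _ _), (hC' z h).2.trans (le_max_right _ _)⟩
    · intro z _; obtain ⟨C, t, ht, hC⟩ := hψ.locallyLipschitz z
      refine ⟨interior t, mem_nhdsWithin_of_mem_nhds (interior_mem_nhds.2 ht), C, fun w hw => ?_⟩
      exact norm_slices_le hC (mem_interior_iff_mem_nhds.1 hw)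
  refine ⟨max (max C1 C2) 0, le_max_right _ _, fun z => ?_⟩; by_cases hz : z ∈ tsupport ψ
  · have h1 : C1 ≤ max (max C1 C2) 0 := (le_max_left _ _).trans (le_max_left _ _)
    have h2 : C2 ≤ max (max C1 C2) 0 := (le_max_right _ _).trans (le_max_left _ _)
    exact ⟨(hC1 z hz).trans h1, (hC2 z hz).1.trans h2, (hC2 z hz).2.trans h2⟩
  · have h1 := slices_eq_zero_of_notMem (N := N) hz
    rw [zero_off hz, h1.1, h1.2, norm_zero, abs_zero]
    exact ⟨le_max_right _ _, le_max_right _ _, le_max_right _ _⟩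

namespace RegularSolution

lemma K_nonneg (h : Ϟ) : 0 ≤ K := (h.flux_nonneg 0 le_rfl).trans (h.flux_le 0 le_rfl)

lemma aemeasurable (h : Ϟ) : AEMeasurable u ϖ :=
  h.sol.aemeasurable.mono_ac (wstMeasure_absolutelyContinuous h.lip.continuous)

lemma isChartMeasurable (h : Ϟ) : IsChartMeasurable N univ Z :=
  h.sol.isWeakGradient.isChartMeasurable h.weight_pos h.sol.nonneg

lemma aemeasurable_norm (h : Ϟ) : AEMeasurable (fun z => ‖Z z‖) ϖ := by
  have := (h.isChartMeasurable.norm h.lip.continuous isOpen_univ).aemeasurable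
  rwa [restrict_univ] at this

lemma aestronglyMeasurable_inner (h : Ϟ) {ψ : Ϝ} (hψ : LocallyLipschitz ψ) :
  AEStronglyMeasurable (fun z => (inner ℝ (∇ ψ z) (Z z) : ℝ)) ϖ := by
  have := (isChartMeasurable_rgrad isOpen_univ
    (hψ.locallyLipschitzOn (s := univ))).inner h.lip.continuous isOpen_univ h.isChartMeasurable
  rwa [restrict_univ] at this

lemma aestronglyMeasurable_deriv (h : Ϟ) {ψ : Ϝ} (hψ : LocallyLipschitz ψ) :
  AEStronglyMeasurable (fun z => ∂ₜ ψ z) ϖ := by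
  have := aestronglyMeasurable_deriv_slice (N := N) h.lip.continuous isOpen_univ
    (hψ.locallyLipschitzOn (s := univ))
  rwa [restrict_univ] at this

lemma aemeasurable_coeff (h : Ϟ) : AEMeasurable (fun z => f ‖Z z‖) ϖ :=
  h.measurable_flux.comp_aemeasurable h.aemeasurable_norm

lemma locInt_u (h : Ϟ) : LocallyIntegrableOn u (spaceTime M) ϖ := by
  have := isLocallyFiniteMeasure_wstMeasure (N := N) h.lip.continuous
  refine (locallyIntegrableOn_one_add h.sol.locInt_pow).mono h.aemeasurable.aestronglyMeasurable
    (ae_of_all _ fun z => ?_)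
  have := h.nonneg z; rw [norm_of_nonneg this, norm_of_nonneg (by positivity)]
  exact le_one_add_rpow this (by linarith [h.p_gt, h.m_ge])

lemma locInt_flux (h : Ϟ) :
  LocallyIntegrableOn (fun z => ‖Z z‖ ^ (p - 1) * u z ^ (m - 1)) (spaceTime M) ϖ := by
  have := isLocallyFiniteMeasure_wstMeasure (N := N) h.lip.continuous; have hp := h.p_gt
  have hm := h.m_ge
  refine ((locallyIntegrableOn_one_add h.sol.locInt_pow).add h.sol.locInt_gradient).mono
    ((h.aemeasurable_norm.pow_const _).mul (h.aemeasurable.pow_const _)).aestronglyMeasurable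
    (ae_of_all _ fun z => ?_)
  have hu := h.nonneg z; simp only [Pi.add_apply]
  rw [norm_of_nonneg (by positivity), norm_of_nonneg (by positivity)]
  have h1 : ‖Z z‖ ^ (p - 1) ≤ 1 + ‖Z z‖ ^ p := by
    rcases le_total ‖Z z‖ 1 with h2 | h2
    · have := rpow_le_one (norm_nonneg _) h2 (by linarith : 0 ≤ p - 1)
      have := rpow_nonneg (norm_nonneg (Z z)) p; linarith
    · have := rpow_le_rpow_of_exponent_le h2 (by linarith : p - 1 ≤ p); linarith
  have h3 : u z ^ (m - 1) ≤ 1 + u z ^ (p + m - 1) := by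
    rcases le_total (u z) 1 with h2 | h2
    · have := rpow_le_one hu h2 (by linarith : 0 ≤ m - 1); have := rpow_nonneg hu (p + m - 1)
      linarith
    · have := rpow_le_rpow_of_exponent_le h2 (by linarith : m - 1 ≤ p + m - 1); linarith
  have h4 := rpow_nonneg hu (m - 1); nlinarith

lemma norm_mul_rpow_eq (h : Ϟ) (z : M × ℝ) : ‖Z z‖ * ‖Z z‖ ^ (p - 2) ≤ ‖Z z‖ ^ (p - 1) := by
  rcases eq_or_lt_of_le (norm_nonneg (Z z)) with h0 | h0
  · rw [← h0, zero_mul]; exact rpow_nonneg le_rfl _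
  · rw [← rpow_one_add' h0.le (by linarith [h.p_gt])]; ring_nf; rfl

lemma sq_norm_mul_rpow_eq (h : Ϟ) (z : M × ℝ) : ‖Z z‖ ^ 2 * ‖Z z‖ ^ (p - 2) = ‖Z z‖ ^ p := by
  rcases eq_or_lt_of_le (norm_nonneg (Z z)) with h0 | h0
  · rw [← h0, zero_rpow (x := p) (by linarith [h.p_gt])]; simp
  · rw [← rpow_natCast, ← rpow_add h0]; norm_num

lemma abs_inner_flux_le (h : Ϟ) (z : M × ℝ) (X : Τ z.1) : |(inner ℝ X (Z z) : ℝ) * u z ^ (m - 1) *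
  ‖Z z‖ ^ (p - 2) * f ‖Z z‖| ≤ K * ‖X‖ * (‖Z z‖ ^ (p - 1) * u z ^ (m - 1)) := by
  have hu := h.nonneg z; have h1 := abs_real_inner_le_norm X (Z z)
  have h2 := h.flux_nonneg _ (norm_nonneg (Z z)); have h3 := h.flux_le _ (norm_nonneg (Z z))
  have h4 := h.norm_mul_rpow_eq z
  rw [abs_mul, abs_mul, abs_mul, abs_of_nonneg h2, abs_of_nonneg (rpow_nonneg hu _),
    abs_of_nonneg (rpow_nonneg (norm_nonneg _) _)]
  calc _ ≤ ‖X‖ * ‖Z z‖ * u z ^ (m - 1) * ‖Z z‖ ^ (p - 2) * K := by gcongr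
    _ = K * ‖X‖ * ((‖Z z‖ * ‖Z z‖ ^ (p - 2)) * u z ^ (m - 1)) := by ring
    _ ≤ _ := by gcongr; exact mul_nonneg h.K_nonneg (norm_nonneg _)

end RegularSolution

section Cutoff
variable {H H' : ℝ → ℝ} {ε L B : ℝ}

/-- The integrand of the time term after splitting `u = max u 1 + min u 1 - 1`. -/
def timeIntegrand (H H' : ℝ → ℝ) (s : ℝ) : ℝ := (Ioi 1).indicator H s - H' s * min s 1

lemma IsCutoff.B_nonneg (hH : IsCutoff ε L B H H') : 0 ≤ B := (hH.nonneg 0).trans (hH.le 0)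

lemma IsCutoff.continuous_self (hH : IsCutoff ε L B H H') : Continuous H :=
  continuous_iff_continuousAt.2 fun s => (hH.hasDerivAt s).continuousAt

lemma IsCutoff.abs_self_le (hH : IsCutoff ε L B H H') (s : ℝ) : |H s| ≤ B := by
  rw [abs_of_nonneg (hH.nonneg s)]; exact hH.le s

lemma IsCutoff.abs_mul_min_le (hH : IsCutoff ε L B H H') (s : ℝ) : |H' s * min s 1| ≤ B := by
  rcases le_or_gt s ε with h | h
  · rw [hH.eq_zero_of_le s h, zero_mul, abs_zero]; exact hH.B_nonneg
  · have h1 : 0 ≤ min s 1 := le_min (hH.pos.trans h).le zero_le_one; rw [abs_mul, abs_of_nonneg h1]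
    calc _ ≤ B * 1 := mul_le_mul (hH.abs_le s) (min_le_right _ _) h1 hH.B_nonneg
      _ = B := mul_one B

lemma IsCutoff.abs_timeIntegrand_le (hH : IsCutoff ε L B H H') (s : ℝ) :
  |timeIntegrand H H' s| ≤ 2 * B := by
  have h2 : |(Ioi 1).indicator H s| ≤ B := by
    by_cases h : s ∈ Ioi 1
    · rw [indicator_of_mem h]; exact hH.abs_self_le s
    · rw [indicator_of_notMem h, abs_zero]; exact hH.B_nonneg
  have := abs_sub ((Ioi 1).indicator H s) (H' s * min s 1); unfold timeIntegrand
  linarith [hH.abs_mul_min_le s]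

lemma IsCutoff.timeIntegrand_eq_zero (hH : IsCutoff ε L B H H') {s : ℝ} (hs : s ≤ min ε 1) :
  timeIntegrand H H' s = 0 := by
  rw [timeIntegrand, hH.eq_zero_of_le s (hs.trans (min_le_left _ _)),
    indicator_of_notMem (by simpa using hs.trans (min_le_right _ _))]
  simp

lemma IsCutoff.continuousWithinAt_timeIntegrand (hH : IsCutoff ε L B H H') (s : ℝ) :
  ContinuousWithinAt (timeIntegrand H H') (Iic s) s := by
  have hc : Continuous fun s => H' s * min s 1 :=
    hH.continuous.mul (continuous_id.min continuous_const)
  refine ContinuousWithinAt.sub ?_ hc.continuousWithinAt; rcases le_or_gt s 1 with h | h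
  · refine (continuousWithinAt_const (b := (0 : ℝ))).congr (fun x hx => ?_) ?_
    · exact indicator_of_notMem (by simpa using (hx : x ≤ s).trans h) _
    · exact indicator_of_notMem (by simpa using h) _
  · refine (hH.continuous_self.continuousAt.congr ?_).continuousWithinAt
    filter_upwards [Ioi_mem_nhds h] with x hx; rw [indicator_of_mem hx]

lemma IsCutoff.integral_timeIntegrand (hH : IsCutoff ε L B H H') {s : ℝ} (hs : 0 ≤ s) :
  ∫ x in (0 : ℝ)..s, timeIntegrand H H' x = (∫ x in (0 : ℝ)..s, H x) - H s * min s 1 := by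
  have hHc := hH.continuous_self
  have hG : ∀ x, HasDerivAt (fun s => ∫ x in (0 : ℝ)..s, H x) (H x) x := fun x =>
    (hHc.integral_hasStrictDerivAt 0 x).hasDerivAt
  have hlow : ∀ s, 0 ≤ s → s ≤ 1 → IntervalIntegrable (timeIntegrand H H') volume 0 s ∧
      ∫ x in (0 : ℝ)..s, timeIntegrand H H' x = (∫ x in (0 : ℝ)..s, H x) - H s * s := by
    intro s hs0 hs1; have he : ∀ x ∈ uIoc 0 s, -(H' x * x) = timeIntegrand H H' x := fun x hx => by
      rw [uIoc_of_le hs0] at hx; have : x ≤ 1 := hx.2.trans hs1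
      rw [timeIntegrand, indicator_of_notMem (by simpa using this), min_eq_left this, zero_sub]
    have hc : Continuous fun x => -(H' x * x) := (hH.continuous.mul continuous_id).neg
    refine ⟨(hc.intervalIntegrable 0 s).congr he, ?_⟩
    rw [← intervalIntegral.integral_congr_ae (ae_of_all _ he), integral_eq_sub_of_hasDerivAt
        (f := fun s => (∫ x in (0 : ℝ)..s, H x) - H s * s) (fun x _ => ?_)
        (hc.intervalIntegrable _ _)]
    · simp
    · exact ((hG x).sub ((hH.hasDerivAt x).mul (hasDerivAt_id' x))).congr_deriv (by ring)
  rcases le_total s 1 with h | h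
  · rw [(hlow s hs h).2, min_eq_left h]
  · have he : ∀ x ∈ uIoc 1 s, H x - H' x = timeIntegrand H H' x := fun x hx => by
      rw [uIoc_of_le h] at hx
      rw [timeIntegrand, indicator_of_mem (mem_Ioi.2 hx.1), min_eq_right hx.1.le, mul_one]
    have hc : Continuous fun x => H x - H' x := hHc.sub hH.continuous
    rw [← integral_add_adjacent_intervals (hlow 1 zero_le_one le_rfl).1
      ((hc.intervalIntegrable 1 s).congr he), (hlow 1 zero_le_one le_rfl).2, min_eq_right h,
      ← intervalIntegral.integral_congr_ae (ae_of_all _ he),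
      integral_eq_sub_of_hasDerivAt
        (f := fun s => (∫ x in (0 : ℝ)..s, H x) - H s) (fun x _ => (hG x).sub (hH.hasDerivAt x))
        (hc.intervalIntegrable _ _)]
    ring

end Cutoff

namespace RegularSolution

lemma integrable_mul_deriv (h : Ϟ) {g : Ϝ} (hg : LocallyIntegrableOn g (spaceTime M) ϖ) {ζ : Ϝ} (hζ
  : IsTestFunction ζ) : Integrable (fun z => g z * ∂ₜ ζ z) ϖ := by
  obtain ⟨C, hC0, hC⟩ := hζ.exists_bound N
  exact hg.integrable_mul_of_bound hζ.hasCompactSupport hζ.tsupport_subset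
    (h.aestronglyMeasurable_deriv hζ.locallyLipschitz) (fun z => (hC z).2.2)
    fun z hz => (slices_eq_zero_of_notMem (N := N) hz).2

lemma integrable_deriv (h : Ϟ) {ζ : Ϝ} (hζ : IsTestFunction ζ) :
  Integrable (fun z => ∂ₜ ζ z) ϖ := by
  have := isLocallyFiniteMeasure_wstMeasure (N := N) h.lip.continuous
  simpa using h.integrable_mul_deriv ((locallyIntegrable_const (1 : ℝ)).locallyIntegrableOn _) hζ

lemma truncation_time (h : Ϟ) {ζ : Ϝ} (hζ : IsTestFunction ζ) {δ : ℝ} (hδ : 0 < δ) :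
  Integrable ({z | δ < u z}.indicator fun z => D z * ζ z) ϖ ∧
  ∫ z, max (u z) δ * ∂ₜ ζ z ∂ϖ = - ∫ z, {z | δ < u z}.indicator (fun z => D z * ζ z) z ∂ϖ := by
  obtain ⟨h1, h2⟩ := h.sol.isWeakTimeDeriv δ hδ
  have he : ({z | δ < u z}.indicator fun z => D z * ζ z) =
      fun z => {z | δ < u z}.indicator D z * ζ z := funext fun z => by
    by_cases hz : z ∈ {z | δ < u z}
    · rw [indicator_of_mem hz, indicator_of_mem hz]
    · rw [indicator_of_notMem hz, indicator_of_notMem hz, zero_mul]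
  rw [he]
  exact ⟨h1.integrable_mul hζ.locallyLipschitz.continuous hζ.hasCompactSupport hζ.tsupport_subset,
    h2 ζ hζ⟩

lemma integral_deriv_eq_zero (h : Ϟ) {ζ : Ϝ} (hζ : IsTestFunction ζ) : ∫ z, ∂ₜ ζ z ∂ϖ = 0 :=
  integral_eq_zero_of_truncation h.aemeasurable (ae_of_all _ h.nonneg) (h.integrable_deriv hζ)
    (h.integrable_mul_deriv h.locInt_u hζ) (h.truncation_time hζ one_pos).1
    fun _ hδ => (h.truncation_time hζ hδ).2

lemma min_one_bound (h : Ϟ) (z : M × ℝ) : 0 ≤ min (u z) 1 ∧ min (u z) 1 ≤ 1 :=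
  ⟨le_min (h.nonneg z) zero_le_one, min_le_right _ _⟩

lemma aemeasurable_min (h : Ϟ) :
  AEMeasurable (fun z => min (u z) 1) ϖ := h.aemeasurable.min aemeasurable_const

lemma integral_deriv_mul_self (h : Ϟ) {ζ : Ϝ} (hζ : IsTestFunction ζ) : ∫ z, ∂ₜ ζ z * u z ∂ϖ = - ∫
  z, {z | 1 < u z}.indicator (fun z => D z * ζ z) z ∂ϖ + ∫ z, min (u z) 1 * ∂ₜ ζ z ∂ϖ := by
  have hi1 := h.integrable_deriv hζ; have hi2 := h.integrable_mul_deriv h.locInt_u hζ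
  have hi3 : Integrable (fun z => min (u z) 1 * ∂ₜ ζ z) ϖ :=
    hi1.bdd_mul (c := 1) h.aemeasurable_min.aestronglyMeasurable (ae_of_all _ fun z => by
      rw [norm_of_nonneg (h.min_one_bound z).1]; exact (h.min_one_bound z).2)
  have hi4 : Integrable (fun z => max (u z) 1 * ∂ₜ ζ z) ϖ := by
    refine ((hi2.add hi1).sub hi3).congr (ae_of_all _ fun z => ?_)
    simp only [Pi.add_apply, Pi.sub_apply]
    linear_combination -(∂ₜ ζ z) * (max_add_min (u z) 1)
  rw [← (h.truncation_time hζ one_pos).2, ← integral_add hi4 hi3]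
  have e : ∫ z, ∂ₜ ζ z * u z ∂ϖ = ∫ z, ∂ₜ ζ z * u z ∂ϖ + ∫ z, ∂ₜ ζ z ∂ϖ := by
    rw [h.integral_deriv_eq_zero hζ, add_zero]
  have hi5 : Integrable (fun z => ∂ₜ ζ z * u z) ϖ := hi2.congr (ae_of_all _ fun z => mul_comm _ _)
  rw [e, ← integral_add hi5 hi1]; refine integral_congr_ae (ae_of_all _ fun z => ?_); beta_reduce
  linear_combination -(∂ₜ ζ z) * (max_add_min (u z) 1)

lemma integral_timeIntegrand_mul (h : Ϟ) {ζ : Ϝ} (hζ : IsTestFunction ζ) {ε L B : ℝ} {H H' : ℝ → ℝ}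
  (hH : IsCutoff ε L B H H') : ∫ z, ((∫ x in (0 : ℝ)..u z, H x) - H (u z) * min (u z) 1) * ∂ₜ ζ z ∂ϖ
  = - ∫ z, timeIntegrand H H' (u z) * (D z * ζ z) ∂ϖ := by
  have hε : 0 < min ε 1 := lt_min hH.pos one_pos
  have h1 := integral_comp_mul_eq_of_truncation h.aemeasurable (ae_of_all _ h.nonneg) hε
    (h.integrable_deriv hζ) (h.integrable_mul_deriv h.locInt_u hζ) (h.truncation_time hζ hε).1
    (fun _ hδ => (h.truncation_time hζ hδ).2) (g := timeIntegrand H H') (Γ := fun _ => 2 * B)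
    (fun s hs => hH.timeIntegrand_eq_zero hs) (fun s _ => hH.continuousWithinAt_timeIntegrand s)
    (fun s _ _ => hH.abs_timeIntegrand_le s) ?_ ?_
  · rw [← h1]; refine integral_congr_ae (ae_of_all _ fun z => ?_); beta_reduce
    rw [hH.integral_timeIntegrand (h.nonneg z)]
  · refine ((h.integrable_mul_deriv h.locInt_u hζ).const_mul (2 * B)).congr
      (ae_of_all _ fun z => ?_)
    beta_reduce; ring
  · refine ((h.truncation_time hζ hε).1.const_mul (2 * B)).congr (ae_of_all _ fun z => ?_)
    exact (indicator_const_mul {z | min ε 1 < u z} (fun z => D z * ζ z) (2 * B) z).symm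

end RegularSolution

section Abstract
variable {X : Type*} [MeasurableSpace X] {ν : Measure X}

lemma tendsto_integral_zero_of_lintegral {E : ℕ → X → ℝ} {b : ℕ → ℝ≥0∞} (hE : ∀ k, ∫⁻ z, ‖E k z‖ₑ ∂ν
  ≤ b k) (hb : Tendsto b atTop (𝓝 0)) : Tendsto (fun k => ∫ z, E k z ∂ν) atTop (𝓝 0) := by
  rw [tendsto_zero_iff_enorm_tendsto_zero]
  exact squeeze_ennreal hb fun k => (enorm_integral_le_lintegral_enorm _).trans (hE k)

lemma lintegral_mul_rpow_le {U Y w : X → ℝ} {p : ℝ} (hp : 1 < p) (hU : ∀ z, 0 ≤ U z) (hY : ∀ z, 0 ≤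
  Y z) (hw : ∀ z, 0 ≤ w z) (hUm : AEMeasurable U ν) (hYm : AEMeasurable Y ν) (hwm : AEMeasurable w
  ν) : ∫⁻ z, ofReal (U z * (Y z ^ (p - 1) * w z)) ∂ν ≤ (∫⁻ z, ofReal (U z ^ p * w z) ∂ν) ^ (1 / p) *
  (∫⁻ z, ofReal (Y z ^ p * w z) ∂ν) ^ (1 / (p / (p - 1))) := by
  have hp0 : 0 < p := by linarith
  have hc : p.HolderConjugate (p / (p - 1)) := Real.HolderConjugate.conjExponent hp
  have hq0 : 0 < p / (p - 1) := div_pos hp0 (by linarith)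
  have key := ENNReal.lintegral_mul_le_Lp_mul_Lq ν hc (f := fun z => ofReal (U z * w z ^ (1 / p)))
    (g := fun z => ofReal (Y z ^ (p - 1) * w z ^ (1 / (p / (p - 1)))))
    (hUm.mul (hwm.pow_const _)).ennreal_ofReal
    ((hYm.pow_const _).mul (hwm.pow_const _)).ennreal_ofReal
  refine le_of_eq_of_le ?_ (key.trans_eq ?_)
  · refine lintegral_congr fun z => ?_
    have h1 : w z ^ (1 / p) * w z ^ (1 / (p / (p - 1))) = w z := by
      rw [← rpow_add' (hw z)]
      · rw [one_div, one_div, hc.inv_add_inv_eq_one, rpow_one]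
      · rw [one_div, one_div, hc.inv_add_inv_eq_one]; exact one_ne_zero
    rw [Pi.mul_apply, ← ofReal_mul (mul_nonneg (hU z) (rpow_nonneg (hw z) _))]; congr 1
    calc _ = U z * (Y z ^ (p - 1) * (w z ^ (1 / p) * w z ^ (1 / (p / (p - 1))))) := by rw [h1]
      _ = _ := by ring
  · congr 2
    · refine lintegral_congr fun z => ?_
      rw [ofReal_rpow_of_nonneg (mul_nonneg (hU z) (rpow_nonneg (hw z) _)) hp0.le,
        mul_rpow (hU z) (rpow_nonneg (hw z) _), ← rpow_mul (hw z),
        one_div_mul_cancel hp0.ne', rpow_one]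
    · refine lintegral_congr fun z => ?_; have h2 := rpow_nonneg (hY z) (p - 1)
      rw [ofReal_rpow_of_nonneg (mul_nonneg h2 (rpow_nonneg (hw z) _)) hq0.le,
        mul_rpow h2 (rpow_nonneg (hw z) _), ← rpow_mul (hw z),
        one_div_mul_cancel hq0.ne', rpow_one, ← rpow_mul (hY z),
        mul_div_cancel₀ p (by linarith : p - 1 ≠ 0)]

end Abstract

namespace RegularSolution

lemma integrable_flux (h : Ϟ) {ζ : Ϝ} (hζ : IsTestFunction ζ) : Integrable (fun z => 𝔣 ζ z) ϖ := by
  obtain ⟨C, hC0, hC⟩ := hζ.exists_bound N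
  refine IntegrableOn.integrable_of_forall_notMem_eq_zero (s := tsupport ζ) ?_ fun z hz => by
    rw [(slices_eq_zero_of_notMem hz).1]; simp
  have h1 := (h.locInt_flux.integrableOn_compact_subset hζ.tsupport_subset
    hζ.hasCompactSupport).const_mul (K * C)
  refine h1.mono' ((((h.aestronglyMeasurable_inner hζ.locallyLipschitz).mul
    (h.aemeasurable.pow_const _).aestronglyMeasurable).mul
    (h.aemeasurable_norm.pow_const _).aestronglyMeasurable).mul
    h.aemeasurable_coeff.aestronglyMeasurable).restrict (ae_of_all _ fun z => ?_)
  refine (h.abs_inner_flux_le z _).trans ?_; have hu := h.nonneg z; have := h.K_nonneg; gcongr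
  exact (hC z).2.1

lemma integrable_energy (h : Ϟ) {ζ : Ϝ} (hζ : IsTestFunction ζ) :
  Integrable (fun z => ζ z * ϵ z) ϖ := by
  have h1 := h.sol.locInt_gradient.integrable_mul hζ.locallyLipschitz.continuous
    hζ.hasCompactSupport hζ.tsupport_subset
  have h2 := h1.bdd_mul (c := K) h.aemeasurable_coeff.aestronglyMeasurable (ae_of_all _ fun z => by
    rw [norm_of_nonneg (h.flux_nonneg _ (norm_nonneg _))]; exact h.flux_le _ (norm_nonneg _))
  exact h2.congr (ae_of_all _ fun z => by beta_reduce; ring)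

lemma integrable_potential (h : Ϟ) {ζ : Ϝ} (hζ : IsTestFunction ζ) :
  Integrable (fun z => ζ z * (u z ^ q * V z)) ϖ :=
  (h.sol.locInt_potential.integrable_mul hζ.locallyLipschitz.continuous
    hζ.hasCompactSupport hζ.tsupport_subset).congr (ae_of_all _ fun _ => mul_comm _ _)

lemma integrable_comp_mul (h : Ϟ) {G : ℝ → ℝ} (hG : Measurable G) {B : ℝ} (hB : ∀ s, 0 ≤ s → |G s| ≤
  B) {W : Ϝ} (hW : Integrable W ϖ) : Integrable (fun z => G (u z) * W z) ϖ :=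
  hW.bdd_mul (hG.comp_aemeasurable h.aemeasurable).aestronglyMeasurable
    (ae_of_all _ fun z => hB _ (h.nonneg z))

lemma integrable_primitive_mul (h : Ϟ) {G : ℝ → ℝ} {B : ℝ}
  (hG : Continuous G) (hB : ∀ s, 0 ≤ s → |G s| ≤ B) {ζ : Ϝ} (hζ : IsTestFunction ζ) :
  Integrable (fun z => (∫ x in (0 : ℝ)..u z, G x) * ∂ₜ ζ z) ϖ := by
  have hc : Continuous fun s => ∫ x in (0 : ℝ)..s, G x :=
    continuous_iff_continuousAt.2 fun x => (hG.integral_hasStrictDerivAt 0 x).hasDerivAt.continuousAt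
  refine ((h.integrable_mul_deriv h.locInt_u hζ).norm.const_mul B).mono'
    ((hc.measurable.comp_aemeasurable h.aemeasurable).aestronglyMeasurable.mul
      (h.aestronglyMeasurable_deriv hζ.locallyLipschitz)) (ae_of_all _ fun z => ?_)
  rw [norm_mul, norm_mul, ← mul_assoc]
  have h1 := norm_integral_le_of_norm_le_const (a := 0) (b := u z) (f := G)
    (C := B) fun x hx => by rw [uIoc_of_le (h.nonneg z)] at hx; exact hB x hx.1.le
  rw [sub_zero] at h1; exact mul_le_mul_of_nonneg_right h1 (norm_nonneg _)

lemma slices_mul (h : Ϟ) {O : Set (M × ℝ)}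
  (hO : IsOpen O) {ψ ζ : Ϝ} (hψ : LocallyLipschitzOn O ψ) (hζ : LocallyLipschitz ζ) :
  ∀ᵐ z ∂ϖ, z ∈ O → rgrad N (fun x => ζ (x, z.2) * ψ (x, z.2)) z.1 = ψ z • ∇ ζ z + ζ z • ∇ ψ z ∧
    deriv (fun t => ζ (z.1, t) * ψ (z.1, t)) z.2 = ψ z * ∂ₜ ζ z + ζ z * ∂ₜ ψ z := by
  filter_upwards [ae_differentiable_slices (N := N) h.lip.continuous hO hψ,
    ae_differentiable_slices (N := N) h.lip.continuous isOpen_univ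
      (hζ.locallyLipschitzOn (s := univ))] with z h1 h2 hz
  obtain ⟨h3, h4⟩ := h1 hz; obtain ⟨h5, h6⟩ := h2 (mem_univ _); refine ⟨rgrad_mul h5 h3, ?_⟩
  refine (h6.hasDerivAt.mul h4.hasDerivAt).deriv.trans ?_; change _ * ψ z + ζ z * _ = _; ring

variable {ε L B : ℝ} {H H' : ℝ → ℝ} {O : Set (M × ℝ)} {ψ : ℕ → M × ℝ → ℝ} {ζ : M × ℝ → ℝ}

lemma tendsto_integral_flux_error (h : Ϟ) (hH : IsCutoff ε L B H H') (hO : IsOpen O) (hψ :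
  LocalApprox N a p m u D Z H H' B O ψ) (hζ : IsTestFunction ζ) (hζO : tsupport ζ ⊆ O) : Tendsto
  (fun k => ∫ z, ((inner ℝ (rgrad N (fun x => ζ (x, z.2) * ψ k (x, z.2)) z.1) (Z z) : ℝ) * u z ^ (m
  - 1) * ‖Z z‖ ^ (p - 2) * f ‖Z z‖ - O.indicator (ψ k) z * (𝔣 ζ z) - H' (u z) * (ζ z * ϵ z)) ∂ϖ)
  atTop (𝓝 0) := by
  have hp := h.p_gt; have hac : Continuous a := h.lip.continuous
  obtain ⟨C, hC0, hC⟩ := hζ.exists_bound N; have hKn := h.K_nonneg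
  set X : ℕ → (z : M × ℝ) → Τ z.1 := fun k z => ∇ (ψ k) z - H' (u z) • Z z with hX
  set S := tsupport ζ with hS; have hSm : MeasurableSet S := (isClosed_tsupport ζ).measurableSet
  have hXm : ∀ k, AEMeasurable (fun z => ‖X k z‖) ((ϖ).restrict S) := fun k => by
    have hc : AEStronglyMeasurable (fun z => H' (u z)) (stMeasure N M) :=
      (hH.continuous.measurable.comp_aemeasurable h.sol.aemeasurable).aestronglyMeasurable
    exact ((((isChartMeasurable_rgrad hO (hψ.lip k)).sub
      ((h.isChartMeasurable.mono (subset_univ O)).smul hc)).norm hac hO).mono_measure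
      (restrict_mono hζO le_rfl)).aemeasurable
  set b : ℕ → ℝ≥0∞ := fun k => ofReal (C * K) *
    ((∫⁻ z in S, ofReal (‖X k z‖ ^ p * u z ^ (m - 1)) ∂ϖ) ^ (1 / p) *
      (∫⁻ z in S, ofReal (‖Z z‖ ^ p * u z ^ (m - 1)) ∂ϖ) ^ (1 / (p / (p - 1)))) with hb
  have hfin : ∫⁻ z in S, ofReal (‖Z z‖ ^ p * u z ^ (m - 1)) ∂ϖ ≠ ⊤ := by
    have h1 : IntegrableOn (fun z => ‖Z z‖ ^ p * u z ^ (m - 1)) S ϖ :=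
      h.sol.locInt_gradient.integrableOn_compact_subset hζ.tsupport_subset hζ.hasCompactSupport
    exact h1.lintegral_lt_top.ne
  have hbt : Tendsto b atTop (𝓝 0) := by
    have h1 : Tendsto (fun k => ∫⁻ z in S, ofReal (‖X k z‖ ^ p * u z ^ (m - 1)) ∂ϖ) atTop (𝓝 0) :=
      squeeze_ennreal hψ.grad fun k => lintegral_mono_set hζO
    have h2 := h1.ennrpow_const (1 / p); rw [zero_rpow_of_pos (by positivity)] at h2
    have h3 := ENNReal.Tendsto.mul_const (b := (∫⁻ z in S, ofReal
      (‖Z z‖ ^ p * u z ^ (m - 1)) ∂ϖ) ^ (1 / (p / (p - 1)))) h2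
      (Or.inr (rpow_ne_top_of_nonneg
        (div_nonneg zero_le_one (div_nonneg (by linarith) (by linarith))) hfin))
    have h4 := ENNReal.Tendsto.const_mul (a := ofReal (C * K)) h3 (Or.inr ofReal_ne_top)
    rw [zero_mul, mul_zero] at h4; exact h4
  refine tendsto_integral_zero_of_lintegral (b := b) (fun k => ?_) hbt
  have hae : ∀ᵐ z ∂ϖ, ‖(inner ℝ (rgrad N (fun x => ζ (x, z.2) * ψ k (x, z.2)) z.1)
        (Z z) : ℝ) * u z ^ (m - 1) * ‖Z z‖ ^ (p - 2) * f ‖Z z‖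
      - O.indicator (ψ k) z * (𝔣 ζ z)
      - H' (u z) * (ζ z * ϵ z)‖ₑ ≤
      S.indicator (fun z => ofReal (C * K) *
        ofReal (‖X k z‖ * (‖Z z‖ ^ (p - 1) * u z ^ (m - 1)))) z := by
    filter_upwards [h.slices_mul hO (hψ.lip k) hζ.locallyLipschitz] with z hz; by_cases hzS : z ∈ S
    · have hzO := hζO hzS
      rw [indicator_of_mem hzS, indicator_of_mem hzO, (hz hzO).1, inner_add_left,
        real_inner_smul_left, real_inner_smul_left, ← h.sq_norm_mul_rpow_eq,
        ← real_inner_self_eq_norm_sq, ← ofReal_mul (by positivity), ← ofReal_norm]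
      refine ofReal_le_ofReal ?_; have h2 := h.abs_inner_flux_le z (X k z)
      rw [hX, inner_sub_left, real_inner_smul_left] at h2
      set R := u z ^ (m - 1) * ‖Z z‖ ^ (p - 2) * f ‖Z z‖ with hR
      have e : ∀ A1 A2 A3 : ℝ, (ψ k z * A1 + ζ z * A2) * u z ^ (m - 1) * ‖Z z‖ ^ (p - 2) * f ‖Z z‖
          - ψ k z * (A1 * u z ^ (m - 1) * ‖Z z‖ ^ (p - 2) * f ‖Z z‖)
          - H' (u z) * (ζ z * (A3 * ‖Z z‖ ^ (p - 2) * u z ^ (m - 1) * f ‖Z z‖)) =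
          ζ z * ((A2 - H' (u z) * A3) * u z ^ (m - 1) * ‖Z z‖ ^ (p - 2) * f ‖Z z‖) := by
        intros; ring
      rw [e, norm_mul]
      calc _ ≤ C * (K * ‖X k z‖ * (‖Z z‖ ^ (p - 1) * u z ^ (m - 1))) :=
            mul_le_mul (hC z).1 h2 (abs_nonneg _) hC0
        _ = _ := by ring
    · have h1 : z ∉ tsupport fun z => ζ z * ψ k z := fun h' => hzS (tsupport_mul_subset_left h')
      have h2 := (slices_eq_zero_of_notMem (N := N) h1).1
      rw [h2, (slices_eq_zero_of_notMem (N := N) hzS).1, zero_off hzS]; simp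
  refine (lintegral_mono_ae hae).trans ?_
  rw [lintegral_indicator hSm, lintegral_const_mul' _ _ ofReal_ne_top, hb]
  exact mul_le_mul_right (lintegral_mul_rpow_le hp (fun z => norm_nonneg _)
    (fun z => norm_nonneg _) (fun z => rpow_nonneg (h.nonneg z) _) (hXm k)
    h.aemeasurable_norm.restrict (h.aemeasurable.pow_const _).restrict) _

lemma tendsto_integral_time_error (h : Ϟ) (hO : IsOpen O) (hψ : LocalApprox N a p m u D Z H H' B O
  ψ) (hζ : IsTestFunction ζ) (hζO : tsupport ζ ⊆ O) : Tendsto (fun k => ∫ z, (min (u z) 1 * deriv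
  (fun t => ζ (z.1, t) * ψ k (z.1, t)) z.2 - O.indicator (ψ k) z * (min (u z) 1 * ∂ₜ ζ z) - H' (u z)
  * min (u z) 1 * (D z * ζ z)) ∂ϖ) atTop (𝓝 0) := by
  obtain ⟨C, hC0, hC⟩ := hζ.exists_bound N
  have hbt := ENNReal.Tendsto.const_mul (a := ofReal C) hψ.time (Or.inr ofReal_ne_top)
  rw [mul_zero] at hbt; refine tendsto_integral_zero_of_lintegral (fun k => ?_) hbt
  rw [← lintegral_const_mul' _ _ ofReal_ne_top, ← lintegral_indicator hO.measurableSet]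
  refine lintegral_mono_ae ?_
  filter_upwards [h.slices_mul hO (hψ.lip k) hζ.locallyLipschitz] with z hz
  by_cases hzS : z ∈ tsupport ζ
  · have hzO := hζO hzS
    rw [indicator_of_mem hzO, indicator_of_mem hzO, (hz hzO).2, ← ofReal_mul hC0, ← ofReal_norm]
    refine ofReal_le_ofReal ?_
    have e : ∀ A1 A2 : ℝ, min (u z) 1 * (ψ k z * A1 + ζ z * A2) - ψ k z * (min (u z) 1 * A1) -
        H' (u z) * min (u z) 1 * (D z * ζ z) = ζ z * (min (u z) 1 * (A2 - H' (u z) * D z)) := by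
      intros; ring
    rw [e, norm_mul, norm_mul, norm_of_nonneg (h.min_one_bound z).1]
    exact mul_le_mul_of_nonneg_right (hC z).1 (mul_nonneg (h.min_one_bound z).1 (abs_nonneg _))
  · have h1 : z ∉ tsupport fun z => ζ z * ψ k z := fun h' => hzS (tsupport_mul_subset_left h')
    have h2 := (slices_eq_zero_of_notMem (N := N) h1).2
    rw [h2, (slices_eq_zero_of_notMem (N := N) hzS).2, zero_off hzS]; simp

lemma integral_testIntegrand_nonneg_of_localApprox (h : Ϟ) (hH : IsCutoff ε L B H H') (hO : IsOpen
  O) (hψ : LocalApprox N a p m u D Z H H' B O ψ) (hζ : IsTestFunction ζ) (hζ0 : ∀ z, 0 ≤ ζ z) (hζO :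
  tsupport ζ ⊆ O) : 0 ≤ ∫ z, testIntegrand N V f p q m u Z H H' ζ z ∂ϖ := by
  have hB := hH.B_nonneg; set fl : (Ϝ) → Ϝ := fun ζ z => 𝔣 ζ z with hfl
  set dt : (Ϝ) → Ϝ := fun ζ z => ∂ₜ ζ z with hdt; set G : Ϝ := fun z => ϵ z with hG
  set Ψ : ℕ → Ϝ := fun k => O.indicator (ψ k) with hΨ
  set T : ℕ → Ϝ := fun k z => ζ z * ψ k z with hT
  have hTt : ∀ k, IsTestFunction (T k) := fun k => hζ.mul_locallyLipschitzOn hO hζO (hψ.lip k)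
  have hTΨ : ∀ k z, T k z = Ψ k z * ζ z := fun k z => by
    by_cases hz : z ∈ O
    · rw [hΨ, hT]; beta_reduce; rw [indicator_of_mem hz, mul_comm]
    · rw [hT]; beta_reduce; rw [zero_off fun h' => hz (hζO h'), zero_mul, mul_zero]
  have hΨB : ∀ k z, |Ψ k z| ≤ B := fun k z => by
    by_cases hz : z ∈ O
    · rw [hΨ]; beta_reduce; rw [indicator_of_mem hz, abs_of_nonneg (hψ.nonneg k z)]; exact hψ.le k z
    · rw [hΨ]; beta_reduce; rw [indicator_of_notMem hz, abs_zero]; exact hB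
  have hΨm : ∀ k, AEStronglyMeasurable (Ψ k) ϖ := fun k =>
    (aestronglyMeasurable_indicator_iff hO.measurableSet).2
      ((hψ.lip k).continuousOn.aestronglyMeasurable hO.measurableSet)
  have hconv := (ae_restrict_iff' hO.measurableSet).1 hψ.tendsto
  have hΨi : ∀ k W, Integrable W ϖ → Integrable (fun z => Ψ k z * W z) ϖ := fun k W hW =>
    hW.bdd_mul (hΨm k) (ae_of_all _ fun z => hΨB k z)
  have hlim : ∀ W, Integrable W ϖ → (∀ z ∉ tsupport ζ, W z = 0) →
      Tendsto (fun k => ∫ z, Ψ k z * W z ∂ϖ) atTop (𝓝 (∫ z, H (u z) * W z ∂ϖ)) := fun W hW hW0 => by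
    refine tendsto_integral_of_dominated_convergence (fun z => B * ‖W z‖)
      (fun k => (hΨi k W hW).aestronglyMeasurable) (hW.norm.const_mul B)
      (fun k => ae_of_all _ fun z => ?_) ?_
    · rw [norm_mul]; exact mul_le_mul_of_nonneg_right (hΨB k z) (norm_nonneg _)
    · filter_upwards [hconv] with z hz; by_cases hzS : z ∈ tsupport ζ
      · have hzO := hζO hzS; refine Tendsto.mul_const _ ((hz hzO).congr fun k => ?_)
        rw [hΨ]; beta_reduce; rw [indicator_of_mem hzO]
      · simp only [hW0 z hzS, mul_zero]; exact tendsto_const_nhds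
  have hHm : Measurable H := hH.continuous_self.measurable
  have hH'm : Measurable H' := hH.continuous.measurable; have hif := h.integrable_flux hζ
  have hiG := h.integrable_energy hζ; have hip := h.integrable_potential hζ
  have hid : Integrable (fun z => min (u z) 1 * dt ζ z) ϖ :=
    h.integrable_comp_mul (G := fun s => min s 1) (B := 1) (measurable_id.min measurable_const)
      (fun s hs => by rw [abs_of_nonneg (le_min hs zero_le_one)]; exact min_le_right _ _)
      (h.integrable_deriv hζ)
  have hidT : ∀ k, Integrable (fun z => min (u z) 1 * dt (T k) z) ϖ := fun k =>
    h.integrable_comp_mul (G := fun s => min s 1) (B := 1) (measurable_id.min measurable_const)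
      (fun s hs => by rw [abs_of_nonneg (le_min hs zero_le_one)]; exact min_le_right _ _)
      (h.integrable_deriv (hTt k))
  have hiD1 := (h.truncation_time hζ one_pos).1
  have hiD : Integrable (fun z => H' (u z) * min (u z) 1 * (D z * ζ z)) ϖ := by
    have h1 := h.integrable_comp_mul (G := fun s => H' s * min s 1)
      (hH'm.mul (measurable_id.min measurable_const)) (B := B)
      (fun s _ => hH.abs_mul_min_le s) (h.truncation_time hζ hH.pos).1
    refine h1.congr (ae_of_all _ fun z => ?_); beta_reduce; by_cases hz : ε < u z
    · rw [indicator_of_mem (show z ∈ {z | ε < u z} from hz)]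
    · rw [hH.eq_zero_of_le _ (not_lt.1 hz)]; simp
  have hiH'G := h.integrable_comp_mul hH'm (fun s _ => hH.abs_le s) hiG
  have l1 := hlim _ hip fun z hz => by rw [zero_off hz, zero_mul]
  have l2 := hlim _ hif fun z hz => by rw [(slices_eq_zero_of_notMem hz).1]; simp
  have l3 := hlim _ hid fun z hz => by
    rw [hdt]; beta_reduce; rw [(slices_eq_zero_of_notMem (N := N) hz).2, mul_zero]
  have l4 := hlim _ hiD1 fun z hz => by
    rw [indicator_apply_eq_zero]; intro; rw [zero_off hz, mul_zero]
  have l5 := h.tendsto_integral_flux_error hH hO hψ hζ hζO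
  have l6 := h.tendsto_integral_time_error hO hψ hζ hζO
  have key : ∀ k, ∫ z, Ψ k z * (ζ z * (u z ^ q * V z)) ∂ϖ ≤
      (∫ z, (fl (T k) z - Ψ k z * fl ζ z - H' (u z) * (ζ z * G z)) ∂ϖ + ∫ z, Ψ k z * fl ζ z ∂ϖ
        + ∫ z, H' (u z) * (ζ z * G z) ∂ϖ)
      + ∫ z, Ψ k z * {z | 1 < u z}.indicator (fun z => D z * ζ z) z ∂ϖ
      - (∫ z, (min (u z) 1 * dt (T k) z - Ψ k z * (min (u z) 1 * dt ζ z)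
          - H' (u z) * min (u z) 1 * (D z * ζ z)) ∂ϖ
        + ∫ z, Ψ k z * (min (u z) 1 * dt ζ z) ∂ϖ
        + ∫ z, H' (u z) * min (u z) 1 * (D z * ζ z) ∂ϖ) := fun k => by
    have h1 := h.sol.inequality (T k) (hTt k) fun z => mul_nonneg (hζ0 z) (hψ.nonneg k z)
    rw [h.integral_deriv_mul_self (hTt k)] at h1
    have hs1 : Integrable (fun z => fl (T k) z - Ψ k z * fl ζ z) ϖ :=
      (h.integrable_flux (hTt k)).sub (hΨi k _ hif)
    have hs2 : Integrable (fun z => min (u z) 1 * dt (T k) z - Ψ k z * (min (u z) 1 * dt ζ z))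
      ϖ := (hidT k).sub (hΨi k _ hid)
    have e1 : ∫ z, T k z * u z ^ q * V z ∂ϖ = ∫ z, Ψ k z * (ζ z * (u z ^ q * V z)) ∂ϖ :=
      integral_congr_ae (ae_of_all _ fun z => by beta_reduce; rw [hTΨ]; ring)
    have e2 : ∫ z, {z | 1 < u z}.indicator (fun z => D z * T k z) z ∂ϖ =
        ∫ z, Ψ k z * {z | 1 < u z}.indicator (fun z => D z * ζ z) z ∂ϖ :=
      integral_congr_ae (ae_of_all _ fun z => by
        beta_reduce; by_cases hz : z ∈ {z | 1 < u z}
        · rw [indicator_of_mem hz, indicator_of_mem hz, hTΨ]; ring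
        · rw [indicator_of_notMem hz, indicator_of_notMem hz, mul_zero])
    rw [integral_sub hs1 hiH'G, integral_sub (h.integrable_flux (hTt k)) (hΨi k _ hif),
      integral_sub hs2 hiD, integral_sub (hidT k) (hΨi k _ hid), ← e1, ← e2]
    linarith [h1]
  have hfin := le_of_tendsto_of_tendsto' l1
    (((((l5.add l2).add_const _).add l4).sub ((l6.add l3).add_const _))) key
  have hiP := h.integrable_primitive_mul hH.continuous_self (fun s _ => hH.abs_self_le s) hζ
  have hiHm : Integrable (fun z => H (u z) * (min (u z) 1 * dt ζ z)) ϖ :=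
    h.integrable_comp_mul hHm (fun s _ => hH.abs_self_le s) hid
  have hiHD : Integrable (fun z => H (u z) * {z | 1 < u z}.indicator (fun z => D z * ζ z) z)
      ϖ := h.integrable_comp_mul hHm (fun s _ => hH.abs_self_le s) hiD1
  have ht := h.integral_timeIntegrand_mul hζ hH
  have e3 : ∫ z, ((∫ x in (0 : ℝ)..u z, H x) - H (u z) * min (u z) 1) * dt ζ z ∂ϖ =
      ∫ z, (∫ x in (0 : ℝ)..u z, H x) * dt ζ z ∂ϖ - ∫ z, H (u z) * (min (u z) 1 * dt ζ z) ∂ϖ := by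
    rw [← integral_sub hiP hiHm]
    exact integral_congr_ae (ae_of_all _ fun z => by beta_reduce; ring)
  have e4 : ∫ z, timeIntegrand H H' (u z) * (D z * ζ z) ∂ϖ =
      ∫ z, H (u z) * {z | 1 < u z}.indicator (fun z => D z * ζ z) z ∂ϖ -
        ∫ z, H' (u z) * min (u z) 1 * (D z * ζ z) ∂ϖ := by
    rw [← integral_sub hiHD hiD]; refine integral_congr_ae (ae_of_all _ fun z => ?_); beta_reduce
    rw [timeIntegrand]; by_cases hz : 1 < u z
    · rw [indicator_of_mem (show u z ∈ Ioi 1 from hz),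
        indicator_of_mem (show z ∈ {z | 1 < u z} from hz)]; ring
    · rw [indicator_of_notMem (show u z ∉ Ioi 1 from hz),
        indicator_of_notMem (show z ∉ {z | 1 < u z} from hz)]; ring
  rw [e4] at ht; have ht' := e3.symm.trans ht
  have hiHf : Integrable (fun z => H (u z) * fl ζ z) ϖ :=
    h.integrable_comp_mul hHm (fun s _ => hH.abs_self_le s) hif
  have hiHp := h.integrable_comp_mul hHm (fun s _ => hH.abs_self_le s) hip
  have e5 : ∫ z, testIntegrand N V f p q m u Z H H' ζ z ∂ϖ = _ :=
    (integral_sub ((hiHf.add hiH'G).sub hiP) hiHp).trans (congrArg (· - _)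
      ((integral_sub (hiHf.add hiH'G) hiP).trans (congrArg (· - _) (integral_add hiHf hiH'G))))
  rw [e5]; linarith [hfin, ht']

variable {H H' : ℝ → ℝ} {ε L B : ℝ}

lemma integrable_testIntegrand (h : Ϟ) (hH : Continuous H) (hH' : Measurable H') (hB : ∀ s, 0 ≤ s →
  |H s| ≤ B) (hB' : ∀ s, 0 ≤ s → |H' s| ≤ B) {ζ : Ϝ} (hζ : IsTestFunction ζ) : Integrable
  (testIntegrand N V f p q m u Z H H' ζ) ϖ :=
  (((h.integrable_comp_mul hH.measurable hB (h.integrable_flux hζ)).add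
    (h.integrable_comp_mul hH' hB' (h.integrable_energy hζ))).sub
    (h.integrable_primitive_mul hH hB hζ)).sub
    (h.integrable_comp_mul hH.measurable hB (h.integrable_potential hζ))

lemma integral_testIntegrand_add (h : Ϟ) (hH : Continuous H) (hH' : Measurable H') (hB : ∀ s, 0 ≤ s
  → |H s| ≤ B) (hB' : ∀ s, 0 ≤ s → |H' s| ≤ B) {ζ ξ : Ϝ} (hζ : IsTestFunction ζ) (hξ :
  IsTestFunction ξ) : ∫ z, testIntegrand N V f p q m u Z H H' (fun z => ζ z + ξ z) z ∂ϖ = ∫ z,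
  testIntegrand N V f p q m u Z H H' ζ z ∂ϖ + ∫ z, testIntegrand N V f p q m u Z H H' ξ z ∂ϖ := by
  rw [← integral_add (h.integrable_testIntegrand hH hH' hB hB' hζ)
    (h.integrable_testIntegrand hH hH' hB hB' hξ)]
  refine integral_congr_ae ?_
  filter_upwards [ae_differentiable_slices (N := N) h.lip.continuous isOpen_univ
      (hζ.locallyLipschitz.locallyLipschitzOn (s := univ)),
    ae_differentiable_slices (N := N) h.lip.continuous isOpen_univ
      (hξ.locallyLipschitz.locallyLipschitzOn (s := univ))] with z h1 h2
  obtain ⟨h3, h4⟩ := h1 (mem_univ _); obtain ⟨h5, h6⟩ := h2 (mem_univ _)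
  have e1 : deriv (fun t => ζ (z.1, t) + ξ (z.1, t)) z.2 = _ :=
    (h4.hasDerivAt.add h6.hasDerivAt).deriv
  simp only [testIntegrand]; rw [rgrad_add h3 h5, inner_add_left, e1]; ring

lemma integral_testIntegrand_nonneg (h : Ϟ) (hH : IsCutoff ε L B H H') {ζ : Ϝ} (hζ : IsTestFunction
  ζ) (hζ0 : ∀ z, 0 ≤ ζ z) : 0 ≤ ∫ z, testIntegrand N V f p q m u Z H H' ζ z ∂ϖ := by
  have key : ∃ U, IsOpen U ∧ tsupport ζ ⊆ U ∧ ∀ ξ : Ϝ, IsTestFunction ξ →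
      (∀ z, 0 ≤ ξ z) → tsupport ξ ⊆ U →
      0 ≤ ∫ z, testIntegrand N V f p q m u Z H H' ξ z ∂ϖ := by
    refine hζ.hasCompactSupport.isCompact.induction_on (p := fun s => ∃ U, IsOpen U ∧ s ⊆ U ∧
      ∀ ξ : Ϝ, IsTestFunction ξ → (∀ z, 0 ≤ ξ z) → tsupport ξ ⊆ U →
      0 ≤ ∫ z, testIntegrand N V f p q m u Z H H' ξ z ∂ϖ)
      ⟨∅, isOpen_empty, Subset.rfl, fun ξ _ _ h2 => ?_⟩
      (fun s t hst ⟨U, h1, h2, h3⟩ => ⟨U, h1, hst.trans h2, h3⟩) ?_ fun z hz => ?_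
    · have h0 : ∀ z, testIntegrand N V f p q m u Z H H' ξ z = 0 := fun z => by
        have hz : z ∉ tsupport ξ := fun h' => h2 h'
        rw [testIntegrand, (slices_eq_zero_of_notMem hz).1,
          (slices_eq_zero_of_notMem (N := N) hz).2, zero_off hz]
        simp
      simp [h0]
    · rintro s t ⟨U, hU, hsU, hU'⟩ ⟨W, hW, htW, hW'⟩
      refine ⟨U ∪ W, hU.union hW, union_subset_union hsU htW, fun ξ hξ hξ0 hξs => ?_⟩
      by_cases hne : (tsupport ξ \ W).Nonempty
      · have hc : IsCompact (tsupport ξ \ W) := hξ.hasCompactSupport.diff hW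
        obtain ⟨δ, hδ, hδU⟩ := hc.exists_cthickening_subset_open hU
          (fun z hz => (hξs hz.1).resolve_right hz.2)
        set d : Ϝ := fun z => infDist z (tsupport ξ \ W) with hd
        have hdl : LocallyLipschitz d := (lipschitz_infDist_pt _).locallyLipschitz
        set χ : Ϝ := fun z => min 1 (max 0 (2 - 2 / δ * d z)) with hχ
        have hχl : LocallyLipschitz χ := by
          have h1 : LocallyLipschitz fun x : ℝ => 2 - 2 / δ * x :=
            (contDiff_const.sub (contDiff_const.mul contDiff_id) : ContDiff ℝ 1 _).locallyLipschitz
          exact ((h1.comp hdl).const_max 0).const_min 1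
        have hχ0 : ∀ z, 0 ≤ χ z := fun z => le_min zero_le_one (le_max_left _ _)
        have hχ1 : ∀ z, χ z ≤ 1 := fun z => min_le_left _ _
        have hl1 : LocallyLipschitz fun z => 1 - χ z :=
          (contDiff_const.sub contDiff_id : ContDiff ℝ 1 fun x : ℝ => 1 - x).locallyLipschitz.comp hχl
        have ht1 := hξ.mul_locallyLipschitzOn isOpen_univ (subset_univ _)
          (hχl.locallyLipschitzOn (s := univ))
        have ht2 := hξ.mul_locallyLipschitzOn isOpen_univ (subset_univ _)
          (hl1.locallyLipschitzOn (s := univ))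
        have hdc : Continuous d := hdl.continuous
        have h1 := hU' _ ht1 (fun z => mul_nonneg (hξ0 z) (hχ0 z)) (by
          refine Subset.trans (closure_minimal (t := {z | d z ≤ δ}) (fun z hz => ?_)
            (isClosed_le hdc continuous_const)) ?_
          · by_contra hcon
            refine hz ?_; have h2 : 2 - 2 / δ * d z ≤ 0 := by
              rw [mem_ofPred_eq, not_le] at hcon
              have : 2 / δ * δ < 2 / δ * d z := mul_lt_mul_of_pos_left hcon (by positivity)
              rw [div_mul_cancel₀ _ hδ.ne'] at this; linarith
            have h3 : χ z = 0 := by rw [hχ]; simp [max_eq_left h2]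
            beta_reduce; rw [h3, mul_zero]
          · intro z hz
            exact hδU ((ENNReal.le_ofReal_iff_toReal_le (infEDist_ne_top hne) hδ.le).2 hz))
        have h2 := hW' _ ht2 (fun z => mul_nonneg (hξ0 z) (sub_nonneg.2 (hχ1 z))) (by
          have h3 : tsupport (fun z => ξ z * (1 - χ z)) ⊆ tsupport ξ ∩ {z | δ / 2 ≤ d z} := by
            refine subset_inter tsupport_mul_subset_left (closure_minimal (fun z hz => ?_)
              (isClosed_le continuous_const hdc))
            by_contra hcon
            refine hz ?_; rw [mem_ofPred_eq, not_le] at hcon; have h4 : 1 ≤ 2 - 2 / δ * d z := by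
              have : 2 / δ * d z < 2 / δ * (δ / 2) := mul_lt_mul_of_pos_left hcon (by positivity)
              rw [div_mul_div_cancel₀ hδ.ne', div_self two_ne_zero] at this; linarith
            have h5 : χ z = 1 := by
              rw [hχ]; beta_reduce; rw [max_eq_right (zero_le_one.trans h4), min_eq_left h4]
            beta_reduce; rw [h5, sub_self, mul_zero]
          intro z hz
          by_contra hcon
          have h4 := (h3 hz).2; have h5 : d z = 0 := infDist_zero_of_mem ⟨(h3 hz).1, hcon⟩
          rw [mem_ofPred_eq, h5] at h4; linarith)
        have h3 := h.integral_testIntegrand_add hH.continuous_self hH.continuous.measurable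
          (fun s _ => hH.abs_self_le s) (fun s _ => hH.abs_le s) ht1 ht2
        have e : (fun z => ξ z * χ z + ξ z * (1 - χ z)) = ξ := funext fun z => by ring
        rw [e] at h3; rw [h3]; exact add_nonneg h1 h2
      · rw [not_nonempty_iff_eq_empty, sdiff_eq_empty] at hne; exact hW' ξ hξ hξ0 hne
    · obtain ⟨O, hO, hzO, _, ψ, hψ⟩ := h.sol.exists_localApprox h.nonneg h.lip h.p_gt h.m_ge hH
        (hζ.tsupport_subset hz)
      exact ⟨O, mem_nhdsWithin_of_mem_nhds (hO.mem_nhds hzO), O, hO, Subset.rfl, fun ξ h1 h2 h3 =>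
        h.integral_testIntegrand_nonneg_of_localApprox hH hO hψ h1 h2 h3⟩
  obtain ⟨U, _, h1, h2⟩ := key; exact h2 ζ hζ hζ0 h1

end RegularSolution

section Power

/-- `(s⁺ + e)^(-α)`. -/
def negPow (α e s : ℝ) : ℝ := (max s 0 + e) ^ (-α)

/-- The derivative of `negPow` on `s > 0`. -/
def negPowDeriv (α e s : ℝ) : ℝ := -α * (max s 0 + e) ^ (-α - 1)

/-- A continuous cutoff, equal to `0` outside `[1 / (n + 2), n + 2]`. -/
def bandCutoff (n : ℕ) (s : ℝ) : ℝ := min 1 (max 0 ((n + 2) * s - 1)) * min 1 (max 0 (n + 2 - s))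

variable {α e : ℝ}

lemma continuous_add_rpow (he : 0 < e) (β : ℝ) : Continuous fun s : ℝ => (max s 0 + e) ^ β :=
  ((continuous_id.max continuous_const).add continuous_const).rpow_const fun s => Or.inl
    (ne_of_gt (add_pos_of_nonneg_of_pos (le_max_right s 0) he))

lemma continuous_negPow (he : 0 < e) : Continuous (negPow α e) := continuous_add_rpow he _

lemma continuous_negPowDeriv (he : 0 < e) : Continuous (negPowDeriv α e) :=
  continuous_const.mul (continuous_add_rpow he _)

lemma negPow_bounds (hα : 0 < α) (he : 0 < e) (s : ℝ) :
  0 ≤ negPow α e s ∧ negPow α e s ≤ e ^ (-α) := by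
  have := le_max_right s 0
  exact ⟨rpow_nonneg (by positivity) _, rpow_le_rpow_of_nonpos he (by linarith) (by linarith)⟩

lemma negPowDeriv_bounds (hα : 0 < α) (he : 0 < e) (s : ℝ) :
  negPowDeriv α e s ≤ 0 ∧ |negPowDeriv α e s| ≤ α * e ^ (-α - 1) := by
  have h0 := le_max_right s 0; have h1 : (max s 0 + e) ^ (-α - 1) ≤ e ^ (-α - 1) :=
    rpow_le_rpow_of_nonpos he (by linarith) (by linarith)
  have h2 : 0 ≤ (max s 0 + e) ^ (-α - 1) := rpow_nonneg (by positivity) _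
  rw [negPowDeriv, abs_mul, abs_neg, abs_of_pos hα, abs_of_nonneg h2]
  exact ⟨by nlinarith, by gcongr⟩

lemma integral_negPowDeriv (he : 0 < e) {s : ℝ} (hs : 0 ≤ s) :
  ∫ x in (0 : ℝ)..s, negPowDeriv α e x = negPow α e s - e ^ (-α) := by
  have h1 : ∫ x in (0 : ℝ)..s, negPowDeriv α e x = ∫ x in (0 : ℝ)..s, -α * (x + e) ^ (-α - 1) := by
    refine integral_congr fun x hx => ?_; rw [uIcc_of_le hs] at hx
    rw [negPowDeriv, max_eq_left hx.1]
  rw [h1, integral_eq_sub_of_hasDerivAt (f := fun x => (x + e) ^ (-α))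
    (fun x hx => ?_) ?_, negPow, max_eq_left hs, zero_add]
  · refine ContinuousOn.intervalIntegrable fun x hx => ContinuousAt.continuousWithinAt ?_
    rw [uIcc_of_le hs] at hx
    exact continuousAt_const.mul ((continuousAt_id.add continuousAt_const).rpow_const
      (Or.inl (ne_of_gt (add_pos_of_nonneg_of_pos hx.1 he))))
  · rw [uIcc_of_le hs] at hx; have := ((hasDerivAt_id' x).add_const e).rpow_const (p := -α)
      (Or.inl (ne_of_gt (by linarith [hx.1]) : x + e ≠ 0))
    exact this.congr_deriv (by ring)

lemma continuous_bandCutoff (n : ℕ) : Continuous (bandCutoff n) := by unfold bandCutoff; fun_prop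

lemma bandCutoff_bounds (n : ℕ) (s : ℝ) : 0 ≤ bandCutoff n s ∧ bandCutoff n s ≤ 1 :=
  ⟨mul_nonneg (le_min zero_le_one (le_max_left _ _)) (le_min zero_le_one (le_max_left _ _)),
    mul_le_one₀ (min_le_left _ _) (le_min zero_le_one (le_max_left _ _)) (min_le_left _ _)⟩

lemma eventually_bandCutoff_eq_one {s : ℝ} (hs : 0 < s) : ∀ᶠ n in atTop, bandCutoff n s = 1 := by
  obtain ⟨n0, hn0⟩ := exists_nat_ge (max (2 / s) s)
  filter_upwards [eventually_ge_atTop n0] with n hn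
  have h1 : (max (2 / s) s : ℝ) ≤ n := hn0.trans (by exact_mod_cast hn)
  have h2 : 2 / s ≤ n := (le_max_left _ _).trans h1; have h3 : s ≤ n := (le_max_right _ _).trans h1
  rw [div_le_iff₀ hs] at h2; have h4 : (1 : ℝ) ≤ (n + 2) * s - 1 := by nlinarith
  have h5 : (1 : ℝ) ≤ n + 2 - s := by linarith
  rw [bandCutoff, max_eq_right (by linarith), max_eq_right (by linarith), min_eq_left h4,
    min_eq_left h5, one_mul]

lemma isCutoff_band (hα : 0 < α) (he : 0 < e) (n : ℕ) : IsCutoff (1 / (n + 2)) (n + 2) (e ^ (-α) + α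
  * e ^ (-α - 1)) (fun s => e ^ (-α) + ∫ x in (0 : ℝ)..s, negPowDeriv α e x * bandCutoff n x) (fun s
  => negPowDeriv α e s * bandCutoff n s) := by
  have hc : Continuous fun s => negPowDeriv α e s * bandCutoff n s :=
    (continuous_negPowDeriv he).mul (continuous_bandCutoff n)
  have hn : (0 : ℝ) < n + 2 := by positivity
  have hz : ∀ s ≤ 1 / ((n : ℝ) + 2), negPowDeriv α e s * bandCutoff n s = 0 := fun s hs => by
    rw [le_div_iff₀ hn] at hs
    rw [bandCutoff, max_eq_left (by linarith), min_eq_right zero_le_one, zero_mul, mul_zero]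
  have hz' : ∀ s, (n : ℝ) + 2 ≤ s → negPowDeriv α e s * bandCutoff n s = 0 := fun s hs => by
    rw [bandCutoff, max_eq_left (by linarith : (n : ℝ) + 2 - s ≤ 0), min_eq_right zero_le_one,
      mul_zero, mul_zero]
  have hneg : ∀ s ≤ 0, ∫ x in (0 : ℝ)..s, negPowDeriv α e x * bandCutoff n x = 0 := fun s hs => by
    rw [integral_congr (g := fun _ => (0 : ℝ)) fun x hx => hz x ?_]
    · simp
    · rw [uIcc_of_ge hs] at hx; exact hx.2.trans (by positivity)
  have h0 : 0 < e ^ (-α) := rpow_pos_of_pos he _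
  have h0' : 0 < α * e ^ (-α - 1) := mul_pos hα (rpow_pos_of_pos he _)
  have hle : ∀ x, negPowDeriv α e x ≤ negPowDeriv α e x * bandCutoff n x := fun x => by
    nlinarith [(negPowDeriv_bounds hα he x).1, (bandCutoff_bounds n x).2]
  have hle' : ∀ x, negPowDeriv α e x * bandCutoff n x ≤ 0 := fun x =>
    mul_nonpos_of_nonpos_of_nonneg (negPowDeriv_bounds hα he x).1 (bandCutoff_bounds n x).1
  refine ⟨by positivity, ?_, fun s => ?_, hc, hz, hz', fun s hs => ?_, fun s => ?_, fun s => ?_,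
    fun s => ?_⟩
  · rw [div_lt_iff₀ hn]; have : (0 : ℝ) ≤ n := n.cast_nonneg; nlinarith
  · exact ((hc.integral_hasStrictDerivAt 0 s).hasDerivAt).const_add _
  · rw [← integral_add_adjacent_intervals (μ := volume)
      (hc.intervalIntegrable 0 (n + 2)) (hc.intervalIntegrable _ s), integral_congr (a := (n : ℝ) + 2)
      (g := fun _ => (0 : ℝ)) fun x hx => hz' x ?_]
    · simp
    · rw [uIcc_of_le hs] at hx; exact hx.1
  · rcases le_total s 0 with hs | hs
    · rw [hneg s hs, add_zero]; exact h0.le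
    · have h1 := intervalIntegral.integral_mono_on (μ := volume) hs
        ((continuous_negPowDeriv he).intervalIntegrable 0 s) (hc.intervalIntegrable 0 s)
        fun x _ => hle x
      rw [integral_negPowDeriv he hs] at h1; linarith [(negPow_bounds hα he s).1]
  · rcases le_total s 0 with hs | hs
    · rw [hneg s hs]; linarith
    · have h1 := intervalIntegral.integral_mono_on (μ := volume) hs (hc.intervalIntegrable 0 s)
        (intervalIntegrable_const (c := (0 : ℝ)) (μ := volume)) fun x _ => hle' x
      simp only [intervalIntegral.integral_zero] at h1; linarith
  · rw [abs_mul, abs_of_nonneg (bandCutoff_bounds n s).1]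
    have := mul_le_mul (negPowDeriv_bounds hα he s).2 (bandCutoff_bounds n s).2
      (bandCutoff_bounds n s).1 h0'.le
    linarith

lemma tendsto_band (hα : 0 < α) (he : 0 < e) {s : ℝ} (hs : 0 ≤ s) : Tendsto (fun n : ℕ => e ^ (-α) +
  ∫ x in (0 : ℝ)..s, negPowDeriv α e x * bandCutoff n x) atTop (𝓝 (negPow α e s)) := by
  have h1 : Tendsto (fun n : ℕ => ∫ x in (0 : ℝ)..s, negPowDeriv α e x * bandCutoff n x) atTop
      (𝓝 (∫ x in (0 : ℝ)..s, negPowDeriv α e x)) := by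
    refine tendsto_integral_filter_of_dominated_convergence
      (fun _ => α * e ^ (-α - 1)) (Eventually.of_forall fun n =>
        ((continuous_negPowDeriv he).mul (continuous_bandCutoff n)).aestronglyMeasurable)
      (Eventually.of_forall fun n => ae_of_all _ fun x _ => ?_) intervalIntegrable_const
      (ae_of_all _ fun x hx => ?_)
    · rw [norm_mul, norm_of_nonneg (bandCutoff_bounds n x).1]
      exact (mul_le_of_le_one_right (norm_nonneg _) (bandCutoff_bounds n x).2).trans
        (negPowDeriv_bounds hα he x).2
    · rw [uIoc_of_le hs] at hx; refine tendsto_const_nhds.congr' ?_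
      filter_upwards [eventually_bandCutoff_eq_one hx.1] with n hn; rw [hn, mul_one]
  have h2 := h1.const_add (e ^ (-α)); rwa [integral_negPowDeriv he hs, add_sub_cancel] at h2

end Power

namespace RegularSolution

lemma eq_zero_of_zero (h : Ϟ) : ∀ᵐ z ∂ϖ, u z = 0 → Z z = 0 :=
  (wstMeasure_absolutelyContinuous h.lip.continuous).ae_le h.sol.isWeakGradient.eq_zero

lemma integral_testIntegrand_negPow_nonneg (h : Ϟ) {α e : ℝ}
  (hα : 0 < α) (he : 0 < e) {ζ : Ϝ} (hζ : IsTestFunction ζ) (hζ0 : ∀ z, 0 ≤ ζ z) :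
  0 ≤ ∫ z, testIntegrand N V f p q m u Z (negPow α e) (negPowDeriv α e) ζ z ∂ϖ := by
  set B := e ^ (-α) + α * e ^ (-α - 1) with hBd; have hc := isCutoff_band hα he
  set H : ℕ → ℝ → ℝ := fun n s =>
    e ^ (-α) + ∫ x in (0 : ℝ)..s, negPowDeriv α e x * bandCutoff n x with hHd
  refine ge_of_tendsto' (tendsto_integral_of_dominated_convergence
    (fun z => B * ‖𝔣 ζ z‖ + B * ‖ζ z * ϵ z‖ + B * ‖u z * ∂ₜ ζ z‖ + B * ‖ζ z * (u z ^ q * V z)‖)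
    (fun n => (h.integrable_testIntegrand (hc n).continuous_self (hc n).continuous.measurable
      (fun s _ => (hc n).abs_self_le s) (fun s _ => (hc n).abs_le s) hζ).aestronglyMeasurable)
    (((((h.integrable_flux hζ).norm.const_mul B).add
      ((h.integrable_energy hζ).norm.const_mul B)).add
      ((h.integrable_mul_deriv h.locInt_u hζ).norm.const_mul B)).add
      ((h.integrable_potential hζ).norm.const_mul B))
    (fun n => ae_of_all _ fun z => ?_) ?_)
    fun n => h.integral_testIntegrand_nonneg (hc n) hζ hζ0
  · have h1 := norm_integral_le_of_norm_le_const (a := 0) (b := u z) (f := H n)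
      (C := B) fun x _ => (hc n).abs_self_le x
    rw [sub_zero] at h1
    refine (norm_sub_le _ _).trans (add_le_add ((norm_sub_le _ _).trans (add_le_add
      ((norm_add_le _ _).trans (add_le_add ?_ ?_)) ?_)) ?_) <;> rw [norm_mul]
    · exact mul_le_mul_of_nonneg_right ((hc n).abs_self_le _) (norm_nonneg _)
    · exact mul_le_mul_of_nonneg_right ((hc n).abs_le _) (norm_nonneg _)
    · rw [norm_mul, ← mul_assoc]; exact mul_le_mul_of_nonneg_right h1 (norm_nonneg _)
    · exact mul_le_mul_of_nonneg_right ((hc n).abs_self_le _) (norm_nonneg _)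
  · filter_upwards [h.eq_zero_of_zero] with z hz; have hu := h.nonneg z
    have l1 := tendsto_band hα he hu
    refine (((l1.mul_const _).add ?_).sub (Tendsto.mul_const _ ?_)).sub (l1.mul_const _)
    · rcases hu.eq_or_lt with h0 | h0
      · rw [hz h0.symm, norm_zero, zero_rpow (by linarith [h.p_gt])]; simp
      · refine tendsto_const_nhds.congr' ?_
        filter_upwards [eventually_bandCutoff_eq_one h0] with n hn; rw [hn, mul_one]
    · refine tendsto_integral_filter_of_dominated_convergence (fun _ => B)
        (Eventually.of_forall fun n => (hc n).continuous_self.aestronglyMeasurable)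
        (Eventually.of_forall fun n => ae_of_all _ fun x _ => (hc n).abs_self_le x)
        intervalIntegrable_const (ae_of_all _ fun x hx => ?_)
      rw [uIoc_of_le hu] at hx; exact tendsto_band hα he hx.1.le

end RegularSolution

section Real

lemma mul_rpow_sub_one_le {A B δ p : ℝ} (hA : 0 ≤ A) (hB : 0 ≤ B) (hδ : 0 < δ) (hp : 1 < p) :
  A * B ^ (p - 1) ≤ δ * B ^ p + δ ^ (1 - p) * A ^ p := by
  have e : ∀ x : ℝ, 0 ≤ x → x ^ p = x * x ^ (p - 1) := fun x hx => by
    rw [← rpow_one_add' hx (by linarith)]; ring_nf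
  have h0 : 0 ≤ δ ^ (1 - p) * A ^ p := by positivity
  rcases le_total A (δ * B) with h | h
  · rw [e B hB]; nlinarith [mul_le_mul_of_nonneg_right h (rpow_nonneg hB (p - 1))]
  · have h1 : B ≤ δ⁻¹ * A := by rw [inv_mul_eq_div, le_div_iff₀ hδ]; linarith
    have h2 := rpow_le_rpow hB h1 (by linarith : 0 ≤ p - 1)
    rw [mul_rpow (by positivity) hA, ← rpow_neg_one, ← rpow_mul hδ.le] at h2
    have h3 := mul_le_mul_of_nonneg_left h2 hA; rw [e A hA, show (1 : ℝ) - p = -1 * (p - 1) by ring]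
    nlinarith [mul_nonneg hδ.le (rpow_nonneg hB p)]

lemma weighted_young {p α b x ζ y U : ℝ} (hp : 1 < p) (hα : 0 < α) (hb : 0 < b) (hx : 0 ≤ x) (hζ : 0
  ≤ ζ) (hy : 0 ≤ y) (hU : 0 < U) : U ^ (-α) * (x * ζ ^ (1 - (1 - b) / p) * y ^ (p - 1)) ≤ α / 2 * (ζ
  * (U ^ (-α - 1) * y ^ p)) + (α / 2) ^ (1 - p) * (ζ ^ b * x ^ p * U ^ (p - 1 - α)) := by
  have hp0 : 0 < p := by linarith
  have key := mul_rpow_sub_one_le (A := x * ζ ^ (b / p)) (B := ζ ^ (1 / p) * (y / U))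
    (by positivity) (by positivity) (half_pos hα) hp
  rw [mul_rpow (by positivity) (by positivity), mul_rpow (by positivity) (by positivity),
    mul_rpow hx (by positivity), div_rpow hy hU.le, div_rpow hy hU.le,
    ← rpow_mul hζ, ← rpow_mul hζ, ← rpow_mul hζ, div_mul_cancel₀ b hp0.ne',
    one_div_mul_cancel hp0.ne', rpow_one] at key
  have e1 : ζ ^ (1 - (1 - b) / p) = ζ ^ (b / p) * ζ ^ (1 / p * (p - 1)) := by
    have h1 : b / p + 1 / p * (p - 1) = 1 - (1 - b) / p := by field_simp; ring
    have h2 : 0 ≤ 1 / p * (p - 1) := mul_nonneg (by positivity) (by linarith)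
    rw [← rpow_add' hζ (by positivity), h1]
  have e2 : U ^ (-α) = U ^ (p - 1 - α) / U ^ (p - 1) := by rw [← rpow_sub hU]; ring_nf
  have e3 : U ^ (-α - 1) = U ^ (p - 1 - α) / U ^ p := by rw [← rpow_sub hU]; ring_nf
  have h4 := mul_le_mul_of_nonneg_right key (rpow_nonneg hU.le (p - 1 - α)); rw [e1, e2, e3]
  refine le_of_eq_of_le (by ring) (h4.trans_eq (by ring))

lemma integral_negPow_le {α e s : ℝ} (hα : 0 < α) (hα' : α ≤ 1 / 2) (he : 0 < e) (hs : 0 ≤ s) :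
  ∫ x in (0 : ℝ)..s, negPow α e x ≤ 2 * s ^ (1 - α) := by
  have h1 : ∫ x in (0 : ℝ)..s, negPow α e x ≤ ∫ x in (0 : ℝ)..s, x ^ (-α) := by
    refine intervalIntegral.integral_mono_on_of_le_Ioo hs
      ((continuous_negPow he).intervalIntegrable 0 s)
      (intervalIntegral.intervalIntegrable_rpow' (by linarith)) fun x hx => ?_
    rw [negPow, max_eq_left hx.1.le]; exact rpow_le_rpow_of_nonpos hx.1 (by linarith) (by linarith)
  rw [integral_rpow (Or.inl (by linarith)), zero_rpow (by linarith), sub_zero,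
    show -α + 1 = 1 - α by ring] at h1
  refine h1.trans ?_; rw [div_le_iff₀ (by linarith)]; nlinarith [rpow_nonneg hs (1 - α)]

end Real

namespace RegularSolution

variable {b : ℝ} {ζ X T : M × ℝ → ℝ}

lemma flux_le_of_isControlled (h : Ϟ) (hζ : IsControlled N p b ζ X T) (z : M × ℝ) :
  (inner ℝ (∇ ζ z) (Z z) : ℝ) * u z ^ (m - 1) * ‖Z z‖ ^ (p - 2)
    * f ‖Z z‖ ≤ X z * ζ z ^ (1 - (1 - b) / p) * ‖Z z‖ ^ (p - 1) * (u z ^ (m - 1) * f ‖Z z‖) := by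
  have hu := h.nonneg z; have h1 := (real_inner_le_norm (∇ ζ z) (Z z)).trans
    (mul_le_mul_of_nonneg_right (hζ.grad z) (norm_nonneg _))
  have h2 := h.flux_nonneg _ (norm_nonneg (Z z)); have h3 : 0 ≤ X z * ζ z ^ (1 - (1 - b) / p) :=
    mul_nonneg (hζ.X_nonneg z) (rpow_nonneg (hζ.nonneg z) _)
  calc _ ≤ X z * ζ z ^ (1 - (1 - b) / p) * ‖Z z‖ * u z ^ (m - 1) * ‖Z z‖ ^ (p - 2) * f ‖Z z‖ := by
        gcongr
    _ = X z * ζ z ^ (1 - (1 - b) / p) * (‖Z z‖ * ‖Z z‖ ^ (p - 2)) * (u z ^ (m - 1) * f ‖Z z‖) := by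
        ring
    _ ≤ _ := by gcongr; exact h.norm_mul_rpow_eq z

lemma _root_.RiemannianParabolic.IsControlled.rpow_le (hζ : IsControlled N p b ζ X T) (hp : 1 < p)
  (hb : 0 ≤ b) (hb1 : b ≤ 1) (z : M × ℝ) : ζ z ^ (1 - (1 - b) / p) ≤ ζ z ^ b := by
  refine rpow_le_rpow_of_exponent_ge' (hζ.nonneg z) (hζ.le_one z) hb ?_
  have : (1 - b) / p ≤ 1 - b := div_le_self (by linarith) hp.le; linarith

lemma testIntegrand_add_le (h : Ϟ) (hζ : IsControlled N p b ζ X T) (hb : 0 < b) (hb1 : b ≤ 1) {α e :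
  ℝ} (hα : 0 < α) (hα' : α ≤ 1 / 2) (he : 0 < e) (z : M × ℝ) : testIntegrand N V f p q m u Z (negPow
  α e) (negPowDeriv α e) ζ z + (ζ z * ((u z + e) ^ (-α) * (u z ^ q * V z)) + α / 2 * (ζ z * ((u z +
  e) ^ (-α - 1) * ϵ z))) ≤ K * (α / 2) ^ (1 - p) * (ζ z ^ b * X z ^ p * (u z ^ (m - 1) * (u z + e) ^
  (p - 1 - α))) + 2 * (ζ z ^ b * T z * u z ^ (1 - α)) := by
  have hu := h.nonneg z; have hU : 0 < u z + e := by linarith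
  have hX := hζ.X_nonneg z; have hT := hζ.T_nonneg z; have hz := hζ.nonneg z
  have hf := h.flux_nonneg _ (norm_nonneg (Z z))
  have h1 := mul_le_mul_of_nonneg_left (h.flux_le_of_isControlled hζ z) (rpow_nonneg hU.le (-α))
  have h2 := mul_le_mul_of_nonneg_right (weighted_young h.p_gt hα hb hX hz (norm_nonneg (Z z)) hU)
    (mul_nonneg (rpow_nonneg hu (m - 1)) hf)
  have h3 : (α / 2) ^ (1 - p) * (ζ z ^ b * X z ^ p * (u z ^ (m - 1) * (u z + e) ^ (p - 1 - α))) *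
      f ‖Z z‖ ≤ (α / 2) ^ (1 - p) * (ζ z ^ b * X z ^ p * (u z ^ (m - 1) *
        (u z + e) ^ (p - 1 - α))) * K := by
    gcongr; exact h.flux_le _ (norm_nonneg _)
  have h4 : (∫ x in (0 : ℝ)..u z, negPow α e x) * -∂ₜ ζ z ≤
      2 * (ζ z ^ b * T z * u z ^ (1 - α)) := by
    have h5 : 0 ≤ ∫ x in (0 : ℝ)..u z, negPow α e x :=
      intervalIntegral.integral_nonneg hu fun x _ => (negPow_bounds hα he x).1
    calc _ ≤ (∫ x in (0 : ℝ)..u z, negPow α e x) * (T z * ζ z ^ b) :=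
          mul_le_mul_of_nonneg_left ((hζ.time z).trans
            (mul_le_mul_of_nonneg_left (hζ.rpow_le h.p_gt hb.le hb1 z) hT)) h5
      _ ≤ 2 * u z ^ (1 - α) * (T z * ζ z ^ b) :=
          mul_le_mul_of_nonneg_right (integral_negPow_le hα hα' he hu) (by positivity)
      _ = _ := by ring
  rw [testIntegrand, negPow, negPowDeriv, max_eq_left hu]; linarith

lemma _root_.RiemannianParabolic.IsControlled.exists_dominating (h : Ϟ) (hζ : IsControlled N p b ζ X
  T) (hb : 0 < b) {c α : ℝ} (hc : 0 ≤ c) (hα : 0 < α) (hα1 : α ≤ 1) (hαp : α < p - 1) : ∃ G : Ϝ,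
  Integrable G ϖ ∧ ∀ e, 0 ≤ e → e ≤ 1 → ∀ z, c * (ζ z ^ b * X z ^ p * (u z ^ (m - 1) * (u z + e) ^
  (p - 1 - α))) + 2 * (ζ z ^ b * T z * u z ^ (1 - α)) ≤ G z := by
  obtain ⟨B, hB0, hB⟩ : ∃ B, 0 ≤ B ∧ ∀ z, ζ z ≠ 0 → X z ≤ B ∧ T z ≤ B := by
    obtain ⟨B, hB⟩ := hζ.bound
    exact ⟨max B 0, le_max_right _ _, fun z hz => ⟨(hB z hz).1.trans (le_max_left _ _),
      (hB z hz).2.trans (le_max_left _ _)⟩⟩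
  have hm := h.m_ge; have hp := h.p_gt; have hpm : 0 ≤ p + m - 1 := by linarith
  have hloc : IntegrableOn (fun z => 2 ^ (p + m - 1) * (1 + u z ^ (p + m - 1))) (tsupport ζ) ϖ := by
    have := isLocallyFiniteMeasure_wstMeasure (N := N) h.lip.continuous
    have h2 : IntegrableOn (fun _ : M × ℝ => (1 : ℝ)) (tsupport ζ) ϖ :=
      integrableOn_const hζ.test.hasCompactSupport.measure_lt_top.ne
    exact (h2.add (h.sol.locInt_pow.integrableOn_compact_subset
      hζ.test.tsupport_subset hζ.test.hasCompactSupport)).const_mul _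
  refine ⟨(tsupport ζ).indicator fun z => (c * B ^ p + 2 * B) *
      (2 ^ (p + m - 1) * (1 + u z ^ (p + m - 1))),
    IntegrableOn.integrable_indicator (hloc.const_mul _) (isClosed_tsupport ζ).measurableSet,
    fun e he he1 z => ?_⟩
  have hu := h.nonneg z; by_cases h0 : ζ z = 0
  · rw [h0, zero_rpow hb.ne']; simp only [zero_mul, mul_zero, add_zero]
    refine indicator_nonneg (fun y _ => ?_) z; have := h.nonneg y; positivity
  rw [indicator_of_mem (subset_tsupport ζ h0)]; have hX := hζ.X_nonneg z; have hT := hζ.T_nonneg z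
  have hz := hζ.nonneg z; have h1 : ζ z ^ b ≤ 1 := rpow_le_one hz (hζ.le_one z) hb.le
  have h2 := add_rpow_le zero_le_one hu hpm; rw [one_rpow] at h2
  have h3 : u z ^ (1 - α) ≤ (1 + u z) ^ (p + m - 1) :=
    (rpow_le_rpow hu (by linarith) (by linarith)).trans
      (rpow_le_rpow_of_exponent_le (by linarith) (by linarith))
  have h4 : u z ^ (m - 1) * (u z + e) ^ (p - 1 - α) ≤ (1 + u z) ^ (p + m - 1) := by
    refine (mul_le_mul (rpow_le_rpow hu (by linarith : u z ≤ 1 + u z) (by linarith))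
      (rpow_le_rpow (by linarith) (by linarith : u z + e ≤ 1 + u z) (by linarith))
      (by positivity) (by positivity)).trans ?_
    rw [← rpow_add (by linarith)]; exact rpow_le_rpow_of_exponent_le (by linarith) (by linarith)
  have h5 : ζ z ^ b * X z ^ p ≤ 1 * B ^ p := mul_le_mul h1
    (rpow_le_rpow hX (hB z h0).1 (by linarith)) (by positivity) zero_le_one
  have h6 : ζ z ^ b * T z ≤ 1 * B := mul_le_mul h1 (hB z h0).2 hT zero_le_one
  calc _ ≤ c * (1 * B ^ p * (1 + u z) ^ (p + m - 1)) + 2 * (1 * B * (1 + u z) ^ (p + m - 1)) := by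
        gcongr
    _ = (c * B ^ p + 2 * B) * (1 + u z) ^ (p + m - 1) := by ring
    _ ≤ _ := by gcongr

/-- The a priori estimate obtained by testing the inequality with `ζ u ^ (-α)`. -/
lemma lintegral_le_of_isControlled (h : Ϟ) (hζ : IsControlled N p b ζ X T) (hb : 0 < b) (hb1 : b ≤
  1) {α : ℝ} (hα : 0 < α) (hα' : α ≤ 1 / 2) (hαp : α < p - 1) : ∫⁻ z, ofReal (ζ z * (u z ^ (q - α) *
  V z) + α / 2 * (ζ z * (u z ^ (-α - 1) * ϵ z))) ∂ϖ ≤ ∫⁻ z, ofReal (K * (α / 2) ^ (1 - p) * (ζ z ^ b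
  * X z ^ p * u z ^ (p + m - 2 - α)) + 2 * (ζ z ^ b * T z * u z ^ (1 - α))) ∂ϖ ∧ ∫⁻ z, ofReal (K *
  (α / 2) ^ (1 - p) * (ζ z ^ b * X z ^ p * u z ^ (p + m - 2 - α)) + 2 * (ζ z ^ b * T z * u z ^ (1 -
  α))) ∂ϖ ≠ ⊤ := by
  have hp := h.p_gt; have hm := h.m_ge
  have hc : 0 ≤ K * (α / 2) ^ (1 - p) := mul_nonneg h.K_nonneg (by positivity)
  obtain ⟨G, hG, hGb⟩ := hζ.exists_dominating h hb hc hα (by linarith) hαp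
  set c := K * (α / 2) ^ (1 - p)
  set R : ℝ → Ϝ := fun e z => c * (ζ z ^ b * X z ^ p * (u z ^ (m - 1) * (u z + e) ^ (p - 1 - α))) +
      2 * (ζ z ^ b * T z * u z ^ (1 - α)) with hR
  set L : ℝ → Ϝ := fun e z => ζ z * ((u z + e) ^ (-α) * (u z ^ q * V z)) +
    α / 2 * (ζ z * ((u z + e) ^ (-α - 1) * ϵ z)) with hL
  have hR0 : (fun z => c * (ζ z ^ b * X z ^ p * u z ^ (p + m - 2 - α)) +
      2 * (ζ z ^ b * T z * u z ^ (1 - α))) = R 0 := by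
    funext z; have : p + m - 2 - α = m - 1 + (p - 1 - α) := by ring
    rw [this, rpow_add' (h.nonneg z) (by linarith)]; simp only [hR, add_zero]
  have hRn : ∀ e, 0 ≤ e → ∀ z, 0 ≤ R e z := fun e he z => by
    have := h.nonneg z; have := hζ.nonneg z; have := hζ.X_nonneg z; have := hζ.T_nonneg z
    positivity
  have hζm := hζ.test.locallyLipschitz.continuous.measurable; have hum := h.aemeasurable
  have hRm : ∀ e, AEMeasurable (R e) ϖ := fun e =>
    (((((hζm.pow_const _).mul (hζ.X_meas.pow_const _)).aemeasurable.mul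
      ((hum.pow_const _).mul ((hum.add_const e).pow_const _))).const_mul c).add
      ((((hζm.pow_const _).mul hζ.T_meas).aemeasurable.mul (hum.pow_const _)).const_mul 2))
  have hRi : ∀ e, 0 ≤ e → e ≤ 1 → Integrable (R e) ϖ := fun e he he1 =>
    hG.mono' (hRm e).aestronglyMeasurable (ae_of_all _ fun z => by
      rw [norm_of_nonneg (hRn e he z)]; exact hGb e he he1 z)
  have hLm : ∀ e, AEMeasurable (L e) ϖ := fun e => by
    have h1 := ((hum.add_const e).pow_const (-α)).mul (h.integrable_potential hζ.test).aemeasurable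
    have h2 := ((hum.add_const e).pow_const (-α - 1)).mul (h.integrable_energy hζ.test).aemeasurable
    exact (h1.add (h2.const_mul (α / 2))).congr (ae_of_all _ fun z => by
      simp only [hL, Pi.add_apply, Pi.mul_apply]; ring)
  have hLn : ∀ e, 0 < e → ∀ᵐ z ∂ϖ, 0 ≤ L e z := fun e he => by
    filter_upwards [h.V_pos] with z hV; have := h.nonneg z; have := hζ.nonneg z
    have := h.flux_nonneg _ (norm_nonneg (Z z)); positivity
  have step : ∀ e, 0 < e → e ≤ 1 → ∫⁻ z, ofReal (L e z) ∂ϖ ≤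
      ∫⁻ z, ofReal (R e z) ∂ϖ := fun e he he1 => by
    set F := testIntegrand N V f p q m u Z (negPow α e) (negPowDeriv α e) ζ
    have hF : Integrable F ϖ := by
      refine h.integrable_testIntegrand (B := e ^ (-α) + α * e ^ (-α - 1)) (continuous_negPow he)
        (continuous_negPowDeriv he).measurable (fun s _ => ?_) (fun s _ => ?_) hζ.test
      · have h1 := negPow_bounds hα he s; rw [abs_of_nonneg h1.1]
        have : 0 ≤ α * e ^ (-α - 1) := by positivity
        linarith [h1.2]
      · have : 0 ≤ e ^ (-α) := by positivity
        linarith [(negPowDeriv_bounds hα he s).2]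
    have hF0 : 0 ≤ ∫ z, F z ∂ϖ := h.integral_testIntegrand_negPow_nonneg hα he hζ.test hζ.nonneg
    have hle : ∀ z, L e z ≤ R e z - F z := fun z =>
      le_sub_iff_add_le'.2 (h.testIntegrand_add_le hζ hb hb1 hα hα' he z)
    have hi := hRi e he.le he1
    calc _ ≤ ∫⁻ z, ofReal (R e z - F z) ∂ϖ := lintegral_mono fun z => ofReal_le_ofReal (hle z)
      _ = ofReal (∫ z, (R e z - F z) ∂ϖ) := (ofReal_integral_eq_lintegral_ofReal (hi.sub hF)
            ((hLn e he).mono fun z hz => hz.trans (hle z))).symm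
      _ ≤ ofReal (∫ z, R e z ∂ϖ) := ofReal_le_ofReal (by rw [integral_sub hi hF]; linarith)
      _ = _ := ofReal_integral_eq_lintegral_ofReal hi (ae_of_all _ (hRn e he.le))
  set e : ℕ → ℝ := fun n => 1 / ((n : ℝ) + 1) with hed
  have he : ∀ n, 0 < e n ∧ e n ≤ 1 := fun n => ⟨Nat.one_div_pos_of_nat, by
    rw [hed]; exact (div_le_one (by positivity)).2 (by linarith [n.cast_nonneg (α := ℝ)])⟩
  have het : Tendsto e atTop (𝓝 0) := tendsto_one_div_add_atTop_nhds_zero_nat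
  have hlim : ∀ x : ℝ, Tendsto (fun n => x + e n) atTop (𝓝 x) := fun x => by
    simpa using het.const_add x
  have hRlim : Tendsto (fun n => ∫⁻ z, ofReal (R (e n) z) ∂ϖ) atTop
      (𝓝 (∫⁻ z, ofReal (R 0 z) ∂ϖ)) := by
    refine tendsto_lintegral_of_dominated_convergence' (fun z => ofReal (G z))
      (fun n => (hRm _).ennreal_ofReal) (fun n => ae_of_all _ fun z =>
        ofReal_le_ofReal (hGb _ (he n).1.le (he n).2 z)) ?_ (ae_of_all _ fun z => ?_)
    · have := hG.lintegral_lt_top; exact this.ne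
    · refine tendsto_ofReal (Tendsto.add_const _ (Tendsto.const_mul _ (Tendsto.const_mul _
        (Tendsto.const_mul _ ?_))))
      rw [add_zero]; exact (hlim (u z)).rpow_const (Or.inr (by linarith))
  rw [funext fun z => congrArg ofReal (congrFun hR0 z)]; refine ⟨?_, ?_⟩
  · rw [← hRlim.liminf_eq]
    refine le_trans ?_ ((lintegral_liminf_le' fun n => (hLm (e n)).ennreal_ofReal).trans
      (liminf_le_liminf (Eventually.of_forall fun n => step _ (he n).1 (he n).2)))
    refine lintegral_mono_ae ?_; filter_upwards [h.eq_zero_of_zero] with z hz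
    refine le_of_eq (Tendsto.liminf_eq (tendsto_ofReal ?_)).symm
    rcases (h.nonneg z).eq_or_lt with h0 | h0
    · rw [hz h0.symm, norm_zero, zero_rpow (by linarith : p ≠ 0), ← h0, zero_mul, zero_mul,
        mul_zero, mul_zero, mul_zero, zero_rpow (by linarith [h.q_gt_one] : q - α ≠ 0),
        zero_mul, mul_zero, add_zero]
      refine tendsto_const_nhds.congr fun n => ?_; simp only [hL]
      rw [hz h0.symm, norm_zero, zero_rpow (by linarith : p ≠ 0), ← h0,
        zero_rpow (by linarith [h.q_gt_one] : q ≠ 0)]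
      simp
    · have e1 : u z ^ (q - α) * V z = u z ^ (-α) * (u z ^ q * V z) := by
        rw [← mul_assoc, ← rpow_add h0]; ring_nf
      rw [e1]; exact ((((hlim _).rpow_const (Or.inl h0.ne')).mul_const _).const_mul _).add
        (((((hlim _).rpow_const (Or.inl h0.ne')).mul_const _).const_mul _).const_mul _)
  · exact ((hRi 0 le_rfl zero_le_one).lintegral_lt_top).ne

end RegularSolution

section Abstract
variable {X : Type*} [MeasurableSpace X] {ν : Measure X}

lemma lintegral_weighted_holder {ζ Y u V : X → ℝ} {b β κ : ℝ} {A : Set X} (hA : MeasurableSet A) (hζ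
  : ∀ z, 0 ≤ ζ z ∧ ζ z ≤ 1) (hY : ∀ z, 0 ≤ Y z) (hYA : ∀ z ∉ A, Y z = 0) (hu : ∀ z, 0 ≤ u z) (hV :
  ∀ᵐ z ∂ν, 0 < V z) (hζm : AEMeasurable ζ ν) (hYm : AEMeasurable Y ν) (hum : AEMeasurable u ν) (hVm
  : AEMeasurable V ν) (hβ : 0 ≤ β) (hβκ : β < κ) (hb : β / κ ≤ b) : ∫⁻ z, ofReal (ζ z ^ b * Y z * u
  z ^ β) ∂ν ≤ (∫⁻ z in A, ofReal (ζ z * (u z ^ κ * V z)) ∂ν) ^ (β / κ) * (∫⁻ z in A, ofReal (Y z ^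
  (κ / (κ - β)) * V z ^ (-(β / (κ - β)))) ∂ν) ^ (1 - β / κ) := by
  have hκ : 0 < κ := by linarith
  have hd : 0 < κ - β := by linarith
  have hθ : 0 ≤ β / κ := by positivity
  have hθ1 : 0 ≤ 1 - β / κ := by rw [sub_nonneg, div_le_one hκ]; exact hβκ.le
  have e1 : ∫⁻ z, ofReal (ζ z ^ b * Y z * u z ^ β) ∂ν =
      ∫⁻ z in A, ofReal (ζ z ^ b * Y z * u z ^ β) ∂ν := by
    rw [← lintegral_indicator hA]; refine lintegral_congr fun z => ?_; by_cases hz : z ∈ A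
    · rw [indicator_of_mem hz]
    · rw [indicator_of_notMem hz, hYA z hz]; simp
  rw [e1]; refine le_trans (lintegral_mono_ae ?_) (lintegral_mul_norm_pow_le
    (hζm.mul ((hum.pow_const _).mul hVm)).ennreal_ofReal.restrict
    ((hYm.pow_const _).mul (hVm.pow_const _)).ennreal_ofReal.restrict hθ hθ1 (by ring))
  filter_upwards [ae_restrict_of_ae hV] with z hz; have h1 := hu z; have h2 := hY z
  have h3 := (hζ z).1; have i1 : κ / (κ - β) * (1 - β / κ) = 1 := by field_simp
  have i2 : -(β / (κ - β)) * (1 - β / κ) = -(β / κ) := by field_simp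
  simp only [Pi.mul_apply]; rw [ofReal_rpow_of_nonneg (by positivity) hθ,
    ofReal_rpow_of_nonneg (by positivity) hθ1, ← ofReal_mul (by positivity),
    mul_rpow h3 (by positivity), mul_rpow (by positivity) hz.le,
    mul_rpow (by positivity) (by positivity), ← rpow_mul h1, ← rpow_mul h2,
    ← rpow_mul hz.le, i1, i2, mul_div_cancel₀ β hκ.ne', rpow_one, rpow_neg hz.le]
  have h4 : V z ^ (β / κ) ≠ 0 := (rpow_pos_of_pos hz _).ne'; refine ofReal_le_ofReal ?_
  calc _ ≤ ζ z ^ (β / κ) * Y z * u z ^ β := by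
        gcongr ?_ * _ * _; exact rpow_le_rpow_of_exponent_ge' h3 (hζ z).2 hθ hb
    _ = _ := by field_simp

lemma ofReal_integral_le {g : X → ℝ} (hg : Integrable g ν) :
  ofReal (∫ z, g z ∂ν) ≤ ∫⁻ z, ofReal (g z) ∂ν := by
  rw [integral_eq_lintegral_pos_part_sub_lintegral_neg_part hg]
  refine (ofReal_le_ofReal (sub_le_self _ ENNReal.toReal_nonneg)).trans ENNReal.ofReal_toReal_le

lemma one_div_one_sub_exp_neg_le {α : ℝ} (hα : 0 < α) (hα1 : α ≤ 1) : (1 - exp (-α))⁻¹ ≤ 2 / α := by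
  have h1 := add_one_le_exp α; have h2 : exp (-α) ≤ 1 - α / 2 := by
    rw [exp_neg, inv_le_comm₀ (exp_pos _) (by linarith)]; refine le_trans ?_ h1
    rw [inv_le_iff_one_le_mul₀ (by linarith)]; nlinarith
  rw [inv_le_comm₀ (by linarith) (by positivity), inv_div]; linarith

lemma exists_dyadic {θ R t : ℝ} (hθ : 1 ≤ θ) (hR : 0 < R) (ht : R ^ θ ≤ t) :
  ∃ k : ℕ, (2 ^ k * (R / 2)) ^ θ < t ∧ t ≤ (2 * (2 ^ k * (R / 2))) ^ θ := by
  have hex : ∃ k : ℕ, t ≤ (2 * (2 ^ k * (R / 2))) ^ θ := by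
    have h1 : Tendsto (fun k : ℕ => ((2 : ℝ) ^ k * R) ^ θ) atTop atTop :=
      (tendsto_rpow_atTop (by linarith)).comp
        ((tendsto_pow_atTop_atTop_of_one_lt one_lt_two).atTop_mul_const hR)
    obtain ⟨k, hk⟩ := (h1.eventually_ge_atTop t).exists; exact ⟨k, hk.trans_eq (by ring_nf)⟩
  classical
  refine ⟨Nat.find hex, ?_, Nat.find_spec hex⟩
  rcases Nat.eq_zero_or_pos (Nat.find hex) with h0 | h0
  · rw [h0, pow_zero, one_mul]
    exact (rpow_lt_rpow (by positivity) (by linarith) (by linarith)).trans_le ht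
  · have h2 := not_le.1 (Nat.find_min hex (Nat.sub_lt h0 one_pos))
    obtain ⟨j, hj⟩ := Nat.exists_eq_succ_of_ne_zero h0.ne'; rw [hj] at h2 ⊢
    refine lt_of_eq_of_lt ?_ h2; rw [Nat.succ_sub_one, pow_succ]; ring_nf

lemma profile_term_le {θ γ S c C E R κ α : ℝ} (k : ℕ) (hC : 0 ≤ C) (hS : 0 ≤ S) (hc : 0 ≤ c) (hR : 2
  < R) (hα : α = (log R)⁻¹) (hα1 : α ≤ 1) (hd : c + S + 1 ≤ θ * κ * γ * log 2) (hE : θ * κ * γ * log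
  2 ≤ E) : ((((2 ^ k * (R / 2)) ^ θ / R ^ θ) ^ (-(κ * α)) / (2 ^ k * (R / 2)) ^ θ) ^ γ) * (C * (2 ^
  k * (R / 2)) ^ (θ * γ + c * α) * log (2 ^ k * (R / 2)) ^ S) ≤ C * exp (c + E) * α ^ (-S) * exp
  (-α) ^ k := by
  have hR0 : 0 < R := by linarith
  have hl : 0 < log R := log_pos (by linarith); have hα0 : 0 < α := by rw [hα]; positivity
  have hαl : α * log R = 1 := by rw [hα]; exact inv_mul_cancel₀ hl.ne'
  have hL : 0 < log 2 := log_pos one_lt_two; have hL1 : log 2 ≤ 1 := by linarith [log_two_lt_d9]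
  have hr : (0 : ℝ) < 2 ^ k * (R / 2) := by positivity
  set r : ℝ := 2 ^ k * (R / 2) with hrd; have hlr : log r = k * log 2 + log R - log 2 := by
    rw [hrd, log_mul (by positivity) (by positivity), log_pow, log_div hR0.ne' two_ne_zero]; ring
  have hk0 : (0 : ℝ) ≤ k := k.cast_nonneg; have hlr0 : 0 ≤ log r := by
    rw [hlr]; have := log_le_log two_pos hR.le; have : 0 ≤ k * log 2 := by positivity
    linarith
  have hlr1 : log r ≤ k + log R := by rw [hlr]; nlinarith
  have h1 : log r ^ S ≤ α ^ (-S) * exp (S * (α * k)) := by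
    calc log r ^ S ≤ (α⁻¹ * (1 + α * k)) ^ S := by
          refine rpow_le_rpow hlr0 (hlr1.trans_eq ?_) hS; field_simp; linarith
      _ = α ^ (-S) * (1 + α * k) ^ S := by
          rw [mul_rpow (by positivity) (by positivity), inv_rpow hα0.le, rpow_neg hα0.le]
      _ ≤ α ^ (-S) * (exp (α * k)) ^ S := by gcongr; linarith [add_one_le_exp (α * k)]
      _ = _ := by rw [← exp_mul]; ring_nf
  have h2 : ((r ^ θ / R ^ θ) ^ (-(κ * α)) / r ^ θ) ^ γ * r ^ (θ * γ + c * α) =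
      exp (-(θ * κ * γ * log 2) * α * (k - 1) + c * α * log r) := by
    rw [rpow_def_of_pos hr, rpow_def_of_pos hR0, ← exp_sub, ← exp_mul,
      ← exp_sub, ← exp_mul, rpow_def_of_pos hr, ← exp_add, hlr]
    ring_nf
  have h3 : -(θ * κ * γ * log 2) * α * (k - 1) + c * α * log r + S * (α * k) ≤
      c + E + k * (-α) := by
    set d := θ * κ * γ * log 2; have i1 : c * α * log r ≤ c * (α * k) + c := by
      calc c * α * log r ≤ c * α * (k + log R) := by gcongr
        _ = c * (α * k) + c * (α * log R) := by ring
        _ = _ := by rw [hαl, mul_one]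
    have i2 : (c + S + 1) * (α * k) ≤ d * (α * k) := by gcongr
    have i3 : d * α ≤ E := by nlinarith
    nlinarith
  calc _ = C * (((r ^ θ / R ^ θ) ^ (-(κ * α)) / r ^ θ) ^ γ * r ^ (θ * γ + c * α)) *
          log r ^ S := by ring
    _ ≤ C * (((r ^ θ / R ^ θ) ^ (-(κ * α)) / r ^ θ) ^ γ * r ^ (θ * γ + c * α)) *
          (α ^ (-S) * exp (S * (α * k))) := by
        gcongr
    _ = C * α ^ (-S) * exp (-(θ * κ * γ * log 2) * α * (k - 1) + c * α * log r
          + S * (α * k)) := by rw [h2, exp_add _ (S * (α * k))]; ring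
    _ ≤ C * α ^ (-S) * exp (c + E + k * (-α)) := by gcongr
    _ = _ := by rw [exp_add (c + E), exp_nat_mul]; ring

lemma lintegral_profile_le {w : X → ℝ} {W : X → ℝ≥0∞} (hw : Measurable w) {θ γ S c C E R R0 κ α : ℝ}
  (hθ : 1 ≤ θ) (hγ : 0 ≤ γ) (hκ : 0 ≤ κ) (hC : 0 ≤ C) (hS : 0 ≤ S) (hc : 0 ≤ c) (hRR : 1 < R0) (hR :
  2 * R0 < R) (hα : α = (log R)⁻¹) (hα1 : α ≤ 1) (hd : c + S + 1 ≤ θ * κ * γ * log 2) (hE : θ * κ *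
  γ * log 2 ≤ E) (hW : ∀ r, R0 < r → ∫⁻ z in {z | r ^ θ < w z ∧ w z ≤ (2 * r) ^ θ}, W z ∂ν ≤ ofReal
  (C * r ^ (θ * γ + c * α) * log r ^ S)) : ∫⁻ z in {z | R ^ θ ≤ w z}, ofReal (((w z / R ^ θ) ^ (-(κ
  * α)) / w z) ^ γ) * W z ∂ν ≤ ofReal (2 * C * exp (c + E) * α ^ (-S - 1)) := by
  have hR0 : 0 < R := by linarith
  have hl : 0 < log R := log_pos (by linarith); have hα0 : 0 < α := by rw [hα]; positivity
  have hexp : exp (-α) < 1 := by rw [← exp_zero]; exact exp_lt_exp.2 (by linarith)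
  set r : ℕ → ℝ := fun k => 2 ^ k * (R / 2)
  have hr0 : ∀ k, 0 < r k := fun k => by positivity
  have hrR : ∀ k, R0 < r k := fun k => by
    have : (1 : ℝ) ≤ 2 ^ k := one_le_pow₀ one_le_two
    show R0 < 2 ^ k * (R / 2)
    nlinarith
  set A : ℕ → Set X := fun k => {z | (r k) ^ θ < w z ∧ w z ≤ (2 * r k) ^ θ}
  have hAm : ∀ k, MeasurableSet (A k) := fun k =>
    (measurableSet_lt measurable_const hw).inter (measurableSet_le hw measurable_const)
  have hcov : {z | R ^ θ ≤ w z} ⊆ ⋃ k, A k := fun z hz => by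
    obtain ⟨k, hk⟩ := exists_dyadic hθ hR0 hz; exact mem_iUnion.2 ⟨k, hk⟩
  have hterm : ∀ k, ∫⁻ z in A k, ofReal (((w z / R ^ θ) ^ (-(κ * α)) / w z) ^ γ) * W z ∂ν ≤
      ofReal (C * exp (c + E) * α ^ (-S) * exp (-α) ^ k) := fun k => by
    refine le_trans ?_ (ofReal_le_ofReal (profile_term_le k hC hS hc (by linarith) hα hα1 hd hE))
    have hrk := hr0 k; rw [ofReal_mul (by positivity)]
    refine le_trans ?_ (mul_le_mul_right (hW _ (hrR k)) _)
    rw [← lintegral_const_mul' _ _ ofReal_ne_top]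
    refine setLIntegral_mono_ae' (hAm k) (ae_of_all _ fun z hz => ?_)
    refine mul_le_mul_left (ofReal_le_ofReal ?_) _
    have hz0 : 0 < (r k) ^ θ := rpow_pos_of_pos (hr0 k) _; have hz1 : 0 < w z := hz0.trans hz.1
    have hRθ : 0 < R ^ θ := rpow_pos_of_pos hR0 _
    refine rpow_le_rpow (by positivity) (div_le_div₀ (by positivity)
      (rpow_le_rpow_of_nonpos (by positivity) ?_ ?_) hz0 hz.1.le) hγ
    · exact div_le_div_of_nonneg_right hz.1.le hRθ.le
    · rw [neg_nonpos]; positivity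
  calc _ ≤ ∫⁻ z in ⋃ k, A k, ofReal (((w z / R ^ θ) ^ (-(κ * α)) / w z) ^ γ) * W z ∂ν :=
        lintegral_mono_set hcov
    _ ≤ ∑' k, ∫⁻ z in A k, ofReal (((w z / R ^ θ) ^ (-(κ * α)) / w z) ^ γ) * W z ∂ν :=
        lintegral_iUnion_le _ _
    _ ≤ ∑' k : ℕ, ofReal (C * exp (c + E) * α ^ (-S) * exp (-α) ^ k) := ENNReal.tsum_le_tsum hterm
    _ = ofReal (∑' k : ℕ, C * exp (c + E) * α ^ (-S) * exp (-α) ^ k) :=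
        (ENNReal.ofReal_tsum_of_nonneg (fun k => by positivity)
          ((summable_geometric_of_lt_one (by positivity) hexp).mul_left _)).symm
    _ ≤ _ := by
        rw [tsum_mul_left, tsum_geometric_of_lt_one (by positivity) hexp]
        refine ofReal_le_ofReal ?_; rw [rpow_sub_one hα0.ne']
        refine (mul_le_mul_of_nonneg_left (one_div_one_sub_exp_neg_le hα0 hα1)
          (by positivity)).trans_eq ?_
        ring

end Abstract

lemma flux_split {p m α b K x ζ y v g : ℝ} (hp : 1 < p) (hb : 0 < b) (hx : 0 ≤ x) (hζ : 0 ≤ ζ) (hy :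
  0 ≤ y) (hv : 0 < v) (hg : 0 ≤ g) (hgK : g ≤ K) : x * ζ ^ (1 - (1 - b) / p) * y ^ (p - 1) * (v ^ (m
  - 1) * g) ≤ (ζ * (v ^ (-α - 1) * (y ^ p * v ^ (m - 1) * g))) ^ ((p - 1) / p) * (K * (ζ ^ b * x ^ p
  * v ^ (p + m - 2 + α * (p - 1)))) ^ (1 / p) := by
  have hp0 : 0 < p := by linarith
  have hp1 : 0 < p - 1 := by linarith
  have hK : 0 ≤ K := hg.trans hgK
  have e1 : ζ ^ (1 - (1 - b) / p) = ζ ^ ((p - 1) / p) * (ζ ^ b) ^ (1 / p) := by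
    rw [← rpow_mul hζ, ← rpow_add' hζ (by positivity)]; congr 1; field_simp; ring
  have e2 : y ^ (p - 1) = (y ^ p) ^ ((p - 1) / p) := by
    rw [← rpow_mul hy, mul_div_cancel₀ _ hp0.ne']
  have e3 : x = (x ^ p) ^ (1 / p) := by rw [← rpow_mul hx, mul_one_div_cancel hp0.ne', rpow_one]
  have e4 : v ^ (m - 1) = (v ^ (-α - 1)) ^ ((p - 1) / p) * (v ^ (m - 1)) ^ ((p - 1) / p) *
      (v ^ (p + m - 2 + α * (p - 1))) ^ (1 / p) := by
    rw [← rpow_mul hv.le, ← rpow_mul hv.le, ← rpow_mul hv.le, ← rpow_add hv, ← rpow_add hv]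
    congr 1; field_simp; ring
  have e5 : g ≤ g ^ ((p - 1) / p) * K ^ (1 / p) := by
    calc g = g ^ ((p - 1) / p) * g ^ (1 / p) := by
          rw [← rpow_add' hg (by positivity), ← add_div, sub_add_cancel, div_self hp0.ne', rpow_one]
      _ ≤ _ := by gcongr
  rw [mul_rpow hζ (by positivity), mul_rpow (by positivity) (by positivity),
    mul_rpow (by positivity) hg, mul_rpow (by positivity) (by positivity),
    mul_rpow hK (by positivity), mul_rpow (by positivity) (by positivity),
    mul_rpow (by positivity) (by positivity)]
  calc _ ≤ x * ζ ^ (1 - (1 - b) / p) * y ^ (p - 1) * (v ^ (m - 1) *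
        (g ^ ((p - 1) / p) * K ^ (1 / p))) := by gcongr
    _ = _ := by
      rw [e1, e2]
      nth_rewrite 1 [e3]
      nth_rewrite 1 [e4]
      ring

namespace RegularSolution

variable {b : ℝ} {ζ X T : M × ℝ → ℝ}

/-- The estimate obtained by testing the inequality with `ζ`. -/
lemma lintegral_potential_le_of_isControlled (h : Ϟ) (hζ : IsControlled N p b ζ X T) (hb : 0 < b)
  (hb1 : b ≤ 1) (α : ℝ) : ∫⁻ z, ofReal (ζ z * (u z ^ q * V z)) ∂ϖ ≤ (∫⁻ z, ofReal (ζ z * (u z ^ (-α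
  - 1) * ϵ z)) ∂ϖ) ^ ((p - 1) / p) * (∫⁻ z, ofReal (K * (ζ z ^ b * X z ^ p * u z ^ (p + m - 2 + α *
  (p - 1)))) ∂ϖ) ^ (1 / p) + ∫⁻ z, ofReal (ζ z ^ b * T z * u z ^ (1 : ℝ)) ∂ϖ := by
  have hp := h.p_gt; have hp0 : 0 < p := by linarith
  have hζm := hζ.test.locallyLipschitz.continuous.measurable; have hum := h.aemeasurable
  have hi := h.sol.inequality ζ hζ.test hζ.nonneg
  have hpot : ∀ᵐ z ∂ϖ, 0 ≤ ζ z * (u z ^ q * V z) := h.V_pos.mono fun z hz =>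
    mul_nonneg (hζ.nonneg z) (mul_nonneg (rpow_nonneg (h.nonneg z) _) hz.le)
  have htime : Integrable (fun z => -(∂ₜ ζ z * u z)) ϖ :=
    ((h.integrable_mul_deriv h.locInt_u hζ.test).neg).congr (ae_of_all _ fun z => by
      simp only [Pi.neg_apply]; ring)
  rw [← ofReal_integral_eq_lintegral_ofReal (h.integrable_potential hζ.test) hpot]
  have h1 : ofReal (∫ z, ζ z * (u z ^ q * V z) ∂ϖ) ≤ ofReal (∫ z, 𝔣 ζ z ∂ϖ) +
      ofReal (∫ z, -(∂ₜ ζ z * u z) ∂ϖ) := by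
    refine (ofReal_le_ofReal ?_).trans ENNReal.ofReal_add_le; rw [integral_neg, ← sub_eq_add_neg]
    refine le_of_eq_of_le (integral_congr_ae (ae_of_all _ fun z => ?_)) hi; simp only [mul_assoc]
  refine h1.trans (add_le_add ((ofReal_integral_le (h.integrable_flux hζ.test)).trans ?_)
    ((ofReal_integral_le htime).trans (lintegral_mono fun z => ofReal_le_ofReal ?_)))
  · refine le_trans (lintegral_mono_ae ?_) (lintegral_mul_norm_pow_le (f := fun z => ofReal
        (ζ z * (u z ^ (-α - 1) * ϵ z)))
      (g := fun z => ofReal (K * (ζ z ^ b * X z ^ p * u z ^ (p + m - 2 + α * (p - 1)))))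
      (hζm.aemeasurable.mul ((hum.pow_const _).mul (((h.aemeasurable_norm.pow_const _).mul
        (hum.pow_const _)).mul h.aemeasurable_coeff))).ennreal_ofReal
      ((((hζm.pow_const _).mul (hζ.X_meas.pow_const _)).aemeasurable.mul
        (hum.pow_const _)).const_mul K).ennreal_ofReal
      (div_nonneg (by linarith) hp0.le) (by positivity) (by field_simp; ring))
    filter_upwards [h.eq_zero_of_zero] with z hz; have hz0 := hζ.nonneg z; have hX := hζ.X_nonneg z
    have hf := h.flux_nonneg _ (norm_nonneg (Z z)); have hK := h.K_nonneg
    rcases (h.nonneg z).eq_or_lt with h0 | h0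
    · rw [hz h0.symm, inner_zero_right]; simp
    · rw [ofReal_rpow_of_nonneg (by positivity) (div_nonneg (by linarith) hp0.le),
        ofReal_rpow_of_nonneg (by positivity) (by positivity),
        ← ofReal_mul (by positivity)]
      exact ofReal_le_ofReal ((h.flux_le_of_isControlled hζ z).trans
        (flux_split hp hb hX hz0 (norm_nonneg _) h0 hf (h.flux_le _ (norm_nonneg _))))
  · rw [rpow_one, ← neg_mul]; refine mul_le_mul_of_nonneg_right ((hζ.time z).trans ?_) (h.nonneg z)
    rw [mul_comm]; exact mul_le_mul_of_nonneg_right (hζ.rpow_le hp hb.le hb1 z) (hζ.T_nonneg z)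

end RegularSolution

section Profile

lemma hasDerivAt_max_rpow {s : ℝ} (hs : 1 < s) (x : ℝ) :
  HasDerivAt (fun x : ℝ => max x 0 ^ s) (s * max x 0 ^ (s - 1)) x := by
  rcases lt_trichotomy x 0 with h | rfl | h
  · rw [max_eq_right h.le, zero_rpow (by linarith), mul_zero]
    refine (hasDerivAt_const x (0 : ℝ)).congr_of_eventuallyEq ?_
    filter_upwards [Iio_mem_nhds h] with y hy
    rw [max_eq_right (le_of_lt hy), zero_rpow (by linarith)]
  · rw [max_self, zero_rpow (by linarith), mul_zero]; have h1 := hasDerivAt_abs_rpow 0 hs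
    rw [mul_zero, hasDerivAt_iff_isLittleO] at h1; rw [hasDerivAt_iff_isLittleO]
    refine (Asymptotics.IsBigO.of_bound 1 (Eventually.of_forall fun y => ?_)).trans_isLittleO h1
    rw [max_self, abs_zero, zero_rpow (by linarith), smul_zero, sub_zero, sub_zero, sub_zero,
      sub_zero, one_mul, norm_of_nonneg (by positivity), norm_of_nonneg (by positivity)]
    exact rpow_le_rpow (le_max_right _ _) (max_le (le_abs_self y) (abs_nonneg y)) (by linarith)
  · rw [max_eq_left h.le]; refine (hasDerivAt_rpow_const (Or.inl h.ne')).congr_of_eventuallyEq ?_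
    filter_upwards [Ioi_mem_nhds h] with y hy; rw [max_eq_left (le_of_lt hy)]

/-- A radial cutoff: `1` for `w ≤ σ`, decaying like a small power `η` of `w` beyond `σ`. -/
def profile (s η σ w : ℝ) : ℝ :=
  if w ≤ σ then 1 else max (1 - 2 * max (1 - (w / σ) ^ (-η)) 0 ^ (2 : ℝ)) 0 ^ s

/-- A bound of the logarithmic slope of `profile`. -/
def profileSlope (η σ w : ℝ) : ℝ := if σ ≤ w then η * ((w / σ) ^ (-η) / w) else 0

variable {s η σ w : ℝ}

lemma profile_bounds (hs : 0 ≤ s) (w : ℝ) : 0 ≤ profile s η σ w ∧ profile s η σ w ≤ 1 := by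
  unfold profile; split_ifs
  · exact ⟨zero_le_one, le_rfl⟩
  · have h1 : (0 : ℝ) ≤ 2 * max (1 - (w / σ) ^ (-η)) 0 ^ (2 : ℝ) := by positivity
    exact ⟨by positivity, rpow_le_one (le_max_right _ _) (max_le (by linarith) zero_le_one) hs⟩

lemma profileSlope_nonneg (hη : 0 ≤ η) (hσ : 0 < σ) (w : ℝ) : 0 ≤ profileSlope η σ w := by
  unfold profileSlope; split_ifs with h
  · have := hσ.trans_le h; positivity
  · exact le_rfl

lemma profileSlope_le (hη : 0 ≤ η) (hσ : 0 < σ) (w : ℝ) : profileSlope η σ w ≤ η / σ := by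
  unfold profileSlope; split_ifs with h
  · have h1 : (w / σ) ^ (-η) ≤ 1 :=
      rpow_le_one_of_one_le_of_nonpos ((one_le_div hσ).2 h) (by linarith)
    exact (mul_le_mul_of_nonneg_left (div_le_div₀ zero_le_one h1 hσ h) hη).trans_eq
      (mul_one_div _ _)
  · positivity

lemma measurable_profileSlope : Measurable (profileSlope η σ) :=
  Measurable.ite measurableSet_Ici (((measurable_id.div_const _).pow_const _ |>.div
    measurable_id).const_mul _) measurable_const

lemma le_of_profile_ne_zero (hs : 0 < s) (hη : 0 < η) (hσ : 0 < σ) (h : profile s η σ w ≠ 0) :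
  w ≤ σ * 4 ^ (1 / η) := by
  by_cases hw : w ≤ σ
  · exact hw.trans (le_mul_of_one_le_right hσ.le (one_le_rpow (by norm_num) (by positivity)))
  rw [profile, if_neg hw] at h
  push Not at hw
  set y := (w / σ) ^ (-η) with hy; have hw1 : 1 < w / σ := (one_lt_div hσ).2 hw
  have h1 : y ≤ 1 := rpow_le_one_of_one_le_of_nonpos hw1.le (by linarith)
  have h2 : 0 < 1 - 2 * max (1 - y) 0 ^ (2 : ℝ) := by
    by_contra h3
    rw [max_eq_right (not_lt.1 h3), zero_rpow hs.ne'] at h; exact h rfl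
  rw [max_eq_left (by linarith), rpow_two] at h2; have h3 : 1 / 4 < y := by nlinarith
  have h4 : (w / σ) ^ η ≤ 4 := by
    rw [hy, rpow_neg (by positivity), lt_inv_comm₀ (by norm_num) (by positivity)] at h3
    norm_num at h3; exact h3.le
  have h5 := rpow_le_rpow (by positivity) h4 (by positivity : 0 ≤ 1 / η)
  rwa [← rpow_mul (by positivity), mul_one_div_cancel hη.ne', rpow_one, div_le_iff₀ hσ,
    mul_comm] at h5

lemma exists_hasDerivAt_profile (hs : 1 < s) (hη : 0 < η) (hσ : 0 < σ) (w : ℝ) : ∃ k, HasDerivAt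
  (profile s η σ) k w ∧ |k| ≤ 4 * s * profileSlope η σ w * profile s η σ w ^ (1 - 1 / s) := by
  have hs0 : 0 < s := by linarith
  rcases lt_or_ge w σ with h | h
  · refine ⟨0, (hasDerivAt_const w (1 : ℝ)).congr_of_eventuallyEq ?_, ?_⟩
    · filter_upwards [Iio_mem_nhds h] with y hy; rw [profile, if_pos (le_of_lt hy)]
    · rw [abs_zero, profileSlope, if_neg (not_le.2 h)]; simp
  have hw : 0 < w := hσ.trans_le h; have heq : ∀ y, 0 < y → profile s η σ y =
      max (1 - 2 * max (1 - (y / σ) ^ (-η)) 0 ^ (2 : ℝ)) 0 ^ s := fun y hy => by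
    unfold profile; split_ifs with hyσ
    · have : 1 ≤ (y / σ) ^ (-η) := one_le_rpow_of_pos_of_le_one_of_nonpos (by positivity)
        ((div_le_one hσ).2 hyσ) (by linarith)
      rw [max_eq_right (by linarith : 1 - (y / σ) ^ (-η) ≤ 0), zero_rpow two_ne_zero, mul_zero,
        sub_zero, max_eq_left zero_le_one, one_rpow]
    · rfl
  have d1 : HasDerivAt (fun y : ℝ => 1 - (y / σ) ^ (-η)) (η * ((w / σ) ^ (-η) / w)) w := by
    refine ((((hasDerivAt_id' w).div_const σ).rpow_const (p := -η)
      (Or.inl (by positivity))).const_sub 1).congr_deriv ?_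
    rw [rpow_sub_one (by positivity)]; field_simp
  have d2 := ((((hasDerivAt_max_rpow one_lt_two _).comp w d1).const_mul 2).const_sub 1)
  have d3 := (hasDerivAt_max_rpow hs _).comp w d2; refine ⟨_, d3.congr_of_eventuallyEq ?_, ?_⟩
  · filter_upwards [Ioi_mem_nhds hw] with y hy; exact heq y hy
  · rw [heq w hw, profileSlope, if_pos h, ← rpow_mul (le_max_right _ _),
      show s * (1 - 1 / s) = s - 1 by field_simp]
    have h1 : (w / σ) ^ (-η) ≤ 1 :=
      rpow_le_one_of_one_le_of_nonpos ((one_le_div hσ).2 h) (by linarith)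
    have h0 : 0 < (w / σ) ^ (-η) := by positivity
    have h2 : max (1 - (w / σ) ^ (-η)) 0 ^ ((2 : ℝ) - 1) ≤ 1 := by
      rw [max_eq_left (by linarith)]; exact rpow_le_one (by linarith) (by linarith) (by norm_num)
    simp only [comp_apply]
    rw [abs_mul, abs_of_nonneg (by positivity), abs_neg, abs_of_nonneg (by positivity)]
    calc _ ≤ s * max (1 - 2 * max (1 - (w / σ) ^ (-η)) 0 ^ (2 : ℝ)) 0 ^ (s - 1) *
          (2 * (2 * 1 * (η * ((w / σ) ^ (-η) / w)))) := by gcongr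
      _ = _ := by ring

lemma locallyLipschitz_profile (hs : 1 < s) (hη : 0 < η) (hσ : 0 < σ) :
  LocallyLipschitz (profile s η σ) := by
  choose k hk hkb using exists_hasDerivAt_profile (s := s) hs hη hσ
  refine (lipschitzWith_of_nnnorm_deriv_le (C := (4 * s * (η / σ)).toNNReal)
    (fun x => (hk x).differentiableAt) fun x => ?_).locallyLipschitz
  rw [← NNReal.coe_le_coe, coe_nnnorm, (hk x).deriv, coe_toNNReal _ (by positivity)]
  have h1 := profile_bounds (η := η) (σ := σ) (by linarith : 0 ≤ s) x
  have h2 : profile s η σ x ^ (1 - 1 / s) ≤ 1 := rpow_le_one h1.1 h1.2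
    (by rw [sub_nonneg, div_le_one (by linarith)]; exact hs.le)
  have h3 := profileSlope_nonneg hη.le hσ x; refine (hkb x).trans ?_
  calc _ ≤ 4 * s * (η / σ) * 1 := by
        have := profileSlope_le hη.le hσ x; have := rpow_nonneg h1.1 (1 - 1 / s); gcongr
    _ = _ := mul_one _

end Profile

lemma norm_rgrad_comp_dist_le {Q : ℝ → ℝ} {Q' : ℝ} {o x : M} (hQ : HasDerivAt Q Q' (dist o x)) :
  ‖rgrad N (fun x => Q (dist o x)) x‖ ≤ |Q'| := by
  refine norm_rgrad_le (abs_nonneg _) fun C hC => ?_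
  have h1 : ∀ᶠ t in 𝓝 (dist o x), |Q t - Q (dist o x)| ≤ C * |t - dist o x| := by
    have h2 := (hasDerivAt_iff_isLittleO.1 hQ).bound (sub_pos.2 hC); filter_upwards [h2] with t ht
    rw [norm_eq_abs, norm_eq_abs, smul_eq_mul] at ht
    have h3 := abs_add_le (Q t - Q (dist o x) - (t - dist o x) * Q') ((t - dist o x) * Q')
    rw [sub_add_cancel, abs_mul] at h3; nlinarith
  have h4 : Continuous fun y => dist o y := continuous_const.dist continuous_id
  filter_upwards [h4.continuousAt.eventually h1] with y hy
  refine hy.trans (mul_le_mul_of_nonneg_left ?_ ((abs_nonneg _).trans hC.le))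
  have := abs_dist_sub_le y x o; rwa [dist_comm y, dist_comm x o] at this

/-- `r(x)^ϑ + t^υ`. -/
def gauge (o : M) (υ ϑ : ℝ) (z : M × ℝ) : ℝ := dist o z.1 ^ ϑ + z.2 ^ υ

/-- The cutoff function in space-time, vanishing for `t ≤ τ` and for large `gauge`. -/
def cutoff (o : M) (υ ϑ s η σ τ : ℝ) (z : M × ℝ) : ℝ :=
  smoothTransition (z.2 / τ - 1) * profile s η σ (gauge o υ ϑ z)

variable {o : M} {υ ϑ s η σ τ : ℝ}

local notation "ϙ" => gauge o υ ϑ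

lemma locallyLipschitz_gauge (h1 : 1 ≤ υ) (h2 : 1 ≤ ϑ) : LocallyLipschitz ϙ := by
  have e : ∀ θ : ℝ, 1 ≤ θ → LocallyLipschitz fun x : ℝ => x ^ θ := fun θ hθ =>
    (contDiff_rpow_const_of_le (n := 1) (by simpa using hθ)).locallyLipschitz
  exact ((e ϑ h2).comp ((LipschitzWith.dist_right o).comp
    LipschitzWith.prod_fst).locallyLipschitz).add
    ((e υ h1).comp LipschitzWith.prod_snd.locallyLipschitz)

lemma cutoff_support [CompleteSpace M] (h1 : 1 ≤ υ) (h2 : 1 ≤ ϑ) (hs : 0 < s) (hη : 0 < η)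
  (hσ : 0 < σ) (hτ : 0 < τ) {z : M × ℝ} (hz : cutoff o υ ϑ s η σ τ z ≠ 0) :
  dist o z.1 ≤ 1 + σ * 4 ^ (1 / η) ∧ τ ≤ z.2 ∧ z.2 ≤ 1 + σ * 4 ^ (1 / η) := by
  have h3 : τ ≤ z.2 := by
    by_contra h4
    refine hz ?_; rw [cutoff, smoothTransition.zero_of_nonpos, zero_mul]
    rw [sub_nonpos, div_le_one hτ]; exact (not_le.1 h4).le
  have h4 := le_of_profile_ne_zero hs hη hσ (right_ne_zero_of_mul hz)
  have e : ∀ θ t : ℝ, 1 ≤ θ → 0 ≤ t → t ≤ 1 + t ^ θ := fun θ t hθ h0 => by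
    rcases le_total t 1 with h | h
    · linarith [rpow_nonneg h0 θ]
    · linarith [self_le_rpow_of_one_le h hθ]
  have i1 : 0 ≤ dist o z.1 ^ ϑ := by positivity
  have i2 : 0 ≤ z.2 ^ υ := rpow_nonneg (hτ.le.trans h3) _; unfold gauge at h4
  exact ⟨by linarith [e ϑ (dist o z.1) h2 dist_nonneg], h3, by linarith [e υ z.2 h1 (hτ.le.trans h3)]⟩

lemma isControlled_cutoff [CompleteSpace M] {p b : ℝ} (h1 : 1 ≤ υ) (h2 : 1 ≤ ϑ) (hp : 1 < p) (hb : 0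
  ≤ b) (hb1 : b < 1) (hη : 0 < η) (hσ : 0 < σ) (hτ : 0 < τ) : IsControlled N p b (cutoff o υ ϑ (p /
  (1 - b)) η σ τ) (fun z => 4 * (p / (1 - b)) * ϑ * (profileSlope η σ (gauge o υ ϑ z) * dist o z.1 ^
  (ϑ - 1))) (fun z => 4 * (p / (1 - b)) * υ * (profileSlope η σ (gauge o υ ϑ z) * max z.2 0 ^ (υ -
  1))) := by
  set s := p / (1 - b) with hsd; have hb' : 0 < 1 - b := by linarith
  have hs : 1 < s := by rw [hsd, one_lt_div hb']; linarith
  have hs0 : 0 < s := by linarith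
  have hse : (1 - b) / p = 1 / s := by rw [hsd, one_div_div]
  have hl : 0 ≤ 1 - 1 / s := by rw [sub_nonneg, div_le_one hs0]; exact hs.le
  have hpb := profile_bounds (η := η) (σ := σ) hs0.le; have hA := smoothTransition.nonneg
  have hA1 := smoothTransition.le_one
  have hA2 : ∀ t, smoothTransition t ≤ smoothTransition t ^ (1 - 1 / s) := fun t => by
    have h0 : (0 : ℝ) < 1 / s := by positivity
    nth_rewrite 1 [← rpow_one (smoothTransition t)]
    exact rpow_le_rpow_of_exponent_ge' (hA t) (hA1 t) hl (by linarith)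
  have hP := profileSlope_nonneg hη.le hσ
  have hsup := fun z => cutoff_support (o := o) (z := z) h1 h2 hs0 hη hσ hτ
  set W := 1 + σ * 4 ^ (1 / η); have hg := locallyLipschitz_gauge (o := o) h1 h2
  have hτA : LocallyLipschitz fun t : ℝ => smoothTransition (t / τ - 1) :=
    (smoothTransition.contDiff (n := 1)).comp
      ((contDiff_id.div_const τ).sub contDiff_const) |>.locallyLipschitz
  set K := closedBall o W ×ˢ Icc τ W
  have hKc : IsCompact K := (isCompact_closedBall_of_complete (N := N) o W).prod isCompact_Icc
  have hts : tsupport (cutoff o υ ϑ s η σ τ) ⊆ K :=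
    closure_minimal (fun z hz => ⟨by rw [mem_closedBall, dist_comm]; exact (hsup z hz).1,
      (hsup z hz).2⟩) hKc.isClosed
  have key : ∀ (z : M × ℝ) (k d : ℝ), 0 ≤ d → |k| ≤ 4 * s * profileSlope η σ (gauge o υ ϑ z) *
      profile s η σ (gauge o υ ϑ z) ^ (1 - 1 / s) →
      smoothTransition (z.2 / τ - 1) * (|k| * d) ≤ 4 * s * (profileSlope η σ (gauge o υ ϑ z) * d) *
          cutoff o υ ϑ s η σ τ z ^ (1 - 1 / s) := fun z k d hd hk => by
    have h3 := hP (gauge o υ ϑ z); have h4 := (hpb (gauge o υ ϑ z)).1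
    rw [cutoff, mul_rpow (hA _) h4]
    calc _ ≤ smoothTransition (z.2 / τ - 1) ^ (1 - 1 / s) * ((4 * s *
          profileSlope η σ (gauge o υ ϑ z) * profile s η σ (gauge o υ ϑ z) ^ (1 - 1 / s)) * d) := by
          have := hA (z.2 / τ - 1); gcongr; exact hA2 _
      _ = _ := by ring
  refine ⟨⟨?_, HasCompactSupport.intro hKc fun z hz => ?_, fun z hz =>
      ⟨mem_univ _, hτ.trans_le (hts hz).2.1⟩⟩, fun z => mul_nonneg (hA _) (hpb _).1,
    fun z => mul_le_one₀ (hA1 _) (hpb _).1 (hpb _).2, fun z => ?_, fun z => ?_,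
    ?_, ?_, ⟨4 * s * (υ + ϑ) * (η / σ * (W ^ (υ - 1) + W ^ (ϑ - 1))), fun z hz => ?_⟩,
    fun z => ?_, fun z => ?_⟩
  · rw [← locallyLipschitzOn_univ]
    exact (hτA.comp LipschitzWith.prod_snd.locallyLipschitz).locallyLipschitzOn.mul'
      ((locallyLipschitz_profile hs hη hσ).comp hg).locallyLipschitzOn
  · by_contra h
    exact hz (hts (subset_tsupport _ h))
  · have := hP (gauge o υ ϑ z); positivity
  · have := hP (gauge o υ ϑ z); positivity
  · exact (((measurable_profileSlope.comp hg.continuous.measurable).mul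
      ((continuous_const.dist continuous_fst).measurable.pow_const _))).const_mul _
  · exact ((measurable_profileSlope.comp hg.continuous.measurable).mul
      ((measurable_snd.max measurable_const).pow_const _)).const_mul _
  · obtain ⟨i1, i2, i3⟩ := hsup z hz; have h3 := hP (gauge o υ ϑ z)
    have h4 := profileSlope_le hη.le hσ (gauge o υ ϑ z); have hW : 0 ≤ W := dist_nonneg.trans i1
    have j1 : dist o z.1 ^ (ϑ - 1) ≤ W ^ (ϑ - 1) := rpow_le_rpow dist_nonneg i1 (by linarith)
    have j2 : max z.2 0 ^ (υ - 1) ≤ W ^ (υ - 1) :=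
      rpow_le_rpow (le_max_right _ _) (max_le i3 hW) (by linarith)
    have j3 : 0 ≤ W ^ (υ - 1) := by positivity
    have j4 : 0 ≤ W ^ (ϑ - 1) := by positivity
    constructor <;> gcongr <;> linarith
  · obtain ⟨k, hk, hkb⟩ := exists_hasDerivAt_profile hs hη hσ (gauge o υ ϑ z)
    have h3 : HasDerivAt (fun r : ℝ => r ^ ϑ + z.2 ^ υ) (ϑ * dist o z.1 ^ (ϑ - 1))
      (dist o z.1) := (hasDerivAt_rpow_const (Or.inr h2)).add_const _
    have h4 := (HasDerivAt.comp (dist o z.1) (h₂ := profile s η σ) hk h3).const_mul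
      (smoothTransition (z.2 / τ - 1))
    refine (norm_rgrad_comp_dist_le (N := N) h4).trans ?_
    rw [hse, abs_mul, abs_mul, abs_of_nonneg (hA _),
      abs_of_nonneg (by positivity : 0 ≤ ϑ * dist o z.1 ^ (ϑ - 1))]
    exact (key z k _ (by positivity) hkb).trans_eq (by ring)
  · obtain ⟨k, hk, hkb⟩ := exists_hasDerivAt_profile hs hη hσ (gauge o υ ϑ z); rw [hse]
    rcases le_or_gt z.2 0 with h0 | h0
    · have h3 : (fun t => cutoff o υ ϑ s η σ τ (z.1, t)) =ᶠ[𝓝 z.2] fun _ => 0 := by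
        filter_upwards [Iio_mem_nhds (h0.trans_lt hτ)] with t ht
        by_contra h5
        exact absurd (hsup (z.1, t) h5).2.1 (not_le.2 ht)
      rw [h3.deriv_eq, deriv_const, neg_zero]; have := hP (gauge o υ ϑ z)
      have : 0 ≤ cutoff o υ ϑ s η σ τ z := mul_nonneg (hA _) (hpb _).1; positivity
    · have h3 : HasDerivAt (fun t : ℝ => dist o z.1 ^ ϑ + t ^ υ) (υ * z.2 ^ (υ - 1)) z.2 :=
        (hasDerivAt_rpow_const (Or.inr h1)).const_add _
      have h5 : HasDerivAt (fun t : ℝ => smoothTransition (t / τ - 1))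
          (deriv (fun t : ℝ => smoothTransition (t / τ - 1)) z.2) z.2 :=
        (((smoothTransition.contDiff (n := 1)).comp ((contDiff_id.div_const τ).sub
          contDiff_const)).differentiable one_ne_zero z.2).hasDerivAt
      have h6 := h5.mul (HasDerivAt.comp z.2 (h₂ := profile s η σ) hk h3)
      have h7 : 0 ≤ deriv (fun t : ℝ => smoothTransition (t / τ - 1)) z.2 :=
        Monotone.deriv_nonneg fun x y hxy => smoothTransition.monotone
          (sub_le_sub_right (div_le_div_of_nonneg_right hxy hτ.le) 1)
      rw [show deriv (fun t => cutoff o υ ϑ s η σ τ (z.1, t)) z.2 = _ from h6.deriv,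
        max_eq_left h0.le]
      refine le_trans ?_ ((key z k (υ * z.2 ^ (υ - 1)) (by positivity) hkb).trans_eq (by ring))
      have h8 := mul_nonneg h7 (hpb (gauge o υ ϑ z)).1
      have h9 : -(smoothTransition (z.2 / τ - 1) * (k * (υ * z.2 ^ (υ - 1)))) ≤
          smoothTransition (z.2 / τ - 1) * (|k| * (υ * z.2 ^ (υ - 1))) := by
        rw [← mul_neg, ← neg_mul]; have := hA (z.2 / τ - 1); gcongr; exact neg_le_abs k
      have h10 : 0 ≤ deriv (fun t : ℝ => smoothTransition (t / τ - 1)) z.2 *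
        (profile s η σ ∘ fun t => dist o z.1 ^ ϑ + t ^ υ) z.2 := h8
      linarith

lemma ae_mem_spaceTime (a : M → ℝ) : ∀ᵐ z ∂(wstMeasure N a), z ∈ spaceTime M := by
  rw [← wstMeasure_restrict_spaceTime]; exact ae_restrict_mem measurableSet_spaceTime

lemma lintegral_annulus_le (a : M → ℝ) (r : ℝ) (W : M × ℝ → ℝ≥0∞) :
  ∫⁻ z in {z | r ^ ϑ < ϙ z ∧ ϙ z ≤ (2 * r) ^ ϑ}, W z ∂(wstMeasure N a) ≤
    ∫⁻ z in parabolicBall o υ ϑ (2 * r) \ parabolicBall o υ ϑ r, W z ∂(wstMeasure N a) := by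
  refine lintegral_mono' (Measure.restrict_mono_ae ?_) le_rfl
  filter_upwards [ae_mem_spaceTime a] with z hz h
  exact ⟨⟨hz, h.2⟩, fun h' => absurd h'.2 (not_le.2 h.1)⟩

lemma RegularSolution.lintegral_borderline_le (h : Ϟ) (hVm : AEMeasurable V ϖ) {ζ g : Ϝ} (hζ : ∀ z,
  0 ≤ ζ z ∧ ζ z ≤ 1) (hζm : Measurable ζ) (hg : Measurable g) (hg0 : ∀ z, 0 ≤ g z) {k β b e γ S c C
  Γ R R0 κ α c1 y : ℝ} (h1 : 1 ≤ υ) (h2 : 1 ≤ ϑ) (hβ : 0 ≤ β) (hβk : β < k) (hb : β / k ≤ b) (he : 1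
  ≤ e) (hγ : γ = e * (k / (k - β))) (hγΓ : γ ≤ Γ) (hS : 0 ≤ S) (hc : 0 ≤ c) (hC : 0 ≤ C) (hRR : 1 <
  R0) (hR : 2 * R0 < R) (hα : α = (log R)⁻¹) (hα1 : α ≤ 1) (hκ : 2 * (c + S + 1) ≤ κ) (hcc : 0 ≤ c1)
  (hy : y ≤ ϑ * γ + c * α) (hHP : ∀ r, R0 < r → ∫⁻ z in parabolicBall o υ ϑ (2 * r) \ parabolicBall
  o υ ϑ r, ofReal (g z ^ γ * V z ^ (-(β / (k - β)))) ∂ϖ ≤ ofReal (C * r ^ y * log r ^ S)) : ∫⁻ z,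
  ofReal (ζ z ^ b * (c1 * (profileSlope (κ * α) (R ^ ϑ) (ϙ z) * g z)) ^ e * u z ^ β) ∂ϖ ≤ (∫⁻ z in
  {z | R ^ ϑ ≤ ϙ z}, ofReal (ζ z * (u z ^ k * V z)) ∂ϖ) ^ (β / k) * ofReal ((c1 * κ) ^ e * (1 + 2 *
  C * exp (c + ϑ * κ * Γ)) * α ^ (e - (S + 1) * (1 - β / k))) := by
  have hR0 : 0 < R := by linarith
  have hα0 : 0 < α := by rw [hα]; exact inv_pos.2 (log_pos (by linarith))
  have hk : 0 < k := by linarith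
  have hd : 0 < k - β := by linarith
  have hκ0 : 0 ≤ κ := by linarith
  have hRθ : 0 < R ^ ϑ := rpow_pos_of_pos hR0 _; have hL1 : log 2 ≤ 1 := by linarith [log_two_lt_d9]
  have hL2 : 1 / 2 ≤ log 2 := by linarith [log_two_gt_d9]
  have hγ1 : 1 ≤ γ := by
    rw [hγ]; exact one_le_mul_of_one_le_of_one_le he ((one_le_div hd).2 (by linarith))
  have hΓ : 0 ≤ Γ := by linarith
  have hP := profileSlope_nonneg (η := κ * α) (by positivity) hRθ
  have hgm := (locallyLipschitz_gauge (o := o) h1 h2).continuous.measurable; set w := ϙ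
  set Y : Ϝ := fun z => (c1 * (profileSlope (κ * α) (R ^ ϑ) (w z) * g z)) ^ e with hYd
  have hY0 : ∀ z, 0 ≤ c1 * (profileSlope (κ * α) (R ^ ϑ) (w z) * g z) := fun z =>
    mul_nonneg hcc (mul_nonneg (hP _) (hg0 z))
  have hθβ : 0 ≤ 1 - β / k := by rw [sub_nonneg, div_le_one hk]; exact hβk.le
  have hθβ1 : 1 - β / k ≤ 1 := by have : 0 ≤ β / k := by positivity
                                  linarith
  have hhold := lintegral_weighted_holder (ν := ϖ) (A := {z | R ^ ϑ ≤ w z})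
    (Y := Y) (measurableSet_le measurable_const hgm) hζ (fun z => rpow_nonneg (hY0 z) _)
    (fun z hz => by
      simp only [hYd]
      rw [profileSlope, if_neg (show ¬ R ^ ϑ ≤ w z from hz), zero_mul, mul_zero, zero_rpow (by linarith)])
    h.nonneg h.V_pos hζm.aemeasurable
    (((((measurable_profileSlope.comp hgm).mul hg).const_mul c1).pow_const e).aemeasurable)
    h.aemeasurable hVm hβ hβk hb
  refine hhold.trans (mul_le_mul_right ?_ _); have hprof := lintegral_profile_le (ν := ϖ) (w := w)
    (W := fun z => ofReal (g z ^ γ * V z ^ (-(β / (k - β))))) hgm (E := ϑ * κ * Γ) (γ := γ)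
    h2 (by linarith) hκ0 hC hS hc hRR hR hα hα1 (by
      calc c + S + 1 ≤ 1 * κ * 1 * (1 / 2) := by linarith
        _ ≤ ϑ * κ * γ * log 2 := by gcongr)
    (by
      calc ϑ * κ * γ * log 2 ≤ ϑ * κ * Γ * 1 := by gcongr
        _ = _ := mul_one _)
    (fun r hr => (lintegral_annulus_le a r _).trans ((hHP r hr).trans (ofReal_le_ofReal (by
      have h1 : (1 : ℝ) ≤ r := by linarith
      have := log_nonneg h1; gcongr))))
  set B := 2 * C * exp (c + ϑ * κ * Γ); have hB : 0 ≤ B := by positivity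
  have hYI : ∫⁻ z in {z | R ^ ϑ ≤ w z}, ofReal (Y z ^ (k / (k - β)) * V z ^ (-(β / (k - β)))) ∂ϖ ≤
      ofReal ((c1 * κ * α) ^ γ * (B * α ^ (-S - 1))) := by
    rw [ofReal_mul (by positivity)]; refine le_trans ?_ (mul_le_mul_right hprof _)
    rw [← lintegral_const_mul' _ _ ofReal_ne_top]
    refine setLIntegral_mono_ae' (measurableSet_le measurable_const hgm) (ae_of_all _ fun z hz => ?_)
    have hw0 : 0 < w z := hRθ.trans_le hz; have hgz := hg0 z
    rw [← ofReal_mul (by positivity), ← ofReal_mul (by positivity)]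
    refine le_of_eq (congrArg ofReal ?_); simp only [hYd]
    rw [← rpow_mul (hY0 z), ← hγ, profileSlope, if_pos (show R ^ ϑ ≤ w z from hz),
      show c1 * (κ * α * ((w z / R ^ ϑ) ^ (-(κ * α)) / w z) * g z) =
        c1 * κ * α * (((w z / R ^ ϑ) ^ (-(κ * α)) / w z) * g z) by ring,
      mul_rpow (by positivity) (by positivity), mul_rpow (by positivity) hgz]
    ring
  refine (ENNReal.rpow_le_rpow hYI hθβ).trans ?_; rw [ofReal_rpow_of_nonneg (by positivity) hθβ]
  refine ofReal_le_ofReal ?_; have e1 : γ * (1 - β / k) = e := by rw [hγ]; field_simp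
  rw [mul_rpow (by positivity) (by positivity), ← rpow_mul (by positivity), e1,
    mul_rpow (by positivity) (by positivity), mul_rpow hB (by positivity),
    ← rpow_mul hα0.le, rpow_sub hα0,
    show (-S - 1) * (1 - β / k) = -((S + 1) * (1 - β / k)) by ring, rpow_neg hα0.le]
  have e2 : B ^ (1 - β / k) ≤ 1 + B := by
    refine (rpow_le_rpow hB (by linarith : B ≤ 1 + B) hθβ).trans ?_
    exact (rpow_le_rpow_of_exponent_le (by linarith) hθβ1).trans_eq (rpow_one _)
  calc _ ≤ (c1 * κ) ^ e * α ^ e * ((1 + B) * (α ^ ((S + 1) * (1 - β / k)))⁻¹) := by gcongr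
    _ = _ := by ring

lemma max_one_le_of_le_mul_rpow {I C : ℝ≥0∞} {b : ℝ} (hI : I ≠ ⊤) (hC : 1 ≤ C)
  (hb : 0 < b) (hb1 : b < 1) (h : I ≤ C * max 1 I ^ b) : max 1 I ≤ C ^ (1 / (1 - b)) := by
  have hm1 : (1 : ℝ≥0∞) ≤ max 1 I := le_max_left _ _; have hmt : max 1 I ≠ ⊤ := by simp [hI]
  set y := max 1 I with hy; have hy0 : y ≠ 0 := (zero_lt_one.trans_le hm1).ne'
  have h1 : y ≤ C * y ^ b := max_le (one_le_mul hC (ENNReal.one_le_rpow hm1 hb)) h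
  have h2 : y ^ (1 - b) ≤ C := by
    rw [ENNReal.rpow_sub _ _ hy0 hmt, ENNReal.rpow_one]; exact ENNReal.div_le_of_le_mul h1
  have h3 := ENNReal.rpow_le_rpow h2 (by rw [one_div, inv_nonneg]; linarith : 0 ≤ 1 / (1 - b))
  rwa [← ENNReal.rpow_mul, mul_one_div_cancel (by linarith), ENNReal.rpow_one] at h3

lemma rpow_neg_mul_self_le {α x : ℝ} (hα : 0 < α) (hx : 0 ≤ x) : α ^ (-(x * α)) ≤ exp x := by
  rw [rpow_def_of_pos hα, exp_le_exp]; have h1 := add_one_le_exp (-log α)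
  rw [exp_neg, exp_log hα] at h1; have h2 : -log α * α ≤ 1 := by
    calc -log α * α ≤ α⁻¹ * α := by gcongr; linarith
      _ = 1 := inv_mul_cancel₀ hα.ne'
  nlinarith

namespace RegularSolution

local notation "Λ" α:max β:max R:max => ofPred fun z => R ^ β ≤ gauge o α β z

lemma lintegral_time_le_of_forall_pos (h : Ϟ) (hVm : AEMeasurable V ϖ) {A : Set (M × ℝ)} {θ x y C y'
  C0 r S ε0 : ℝ} (hr : 0 < r) (hee : 0 < ε0) (hA : ∀ ε, 0 < ε → ε < ε0 → ∫⁻ z in A, ofReal (z.2 ^ (θ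
  * (x - ε)) * V z ^ (-y + ε)) ∂ϖ ≤ ofReal (C * r ^ (y' + C0 * ε) * log r ^ S)) : ∫⁻ z in A, ofReal
  (z.2 ^ (θ * x) * V z ^ (-y)) ∂ϖ ≤ ofReal (C * r ^ y' * log r ^ S) := by
  set e : ℕ → ℝ := fun n => ε0 / 2 * (1 / ((n : ℝ) + 1))
  have het : Tendsto e atTop (𝓝 0) := by
    simpa [e] using (tendsto_one_div_add_atTop_nhds_zero_nat (𝕜 := ℝ)).const_mul (ε0 / 2)
  have he : ∀ n, 0 < e n ∧ e n < ε0 := fun n => by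
    have h1 : (1 : ℝ) / ((n : ℝ) + 1) ≤ 1 :=
      (div_le_one (by positivity)).2 (by linarith [n.cast_nonneg (α := ℝ)])
    have h2 : (0 : ℝ) < 1 / ((n : ℝ) + 1) := by positivity
    exact ⟨by positivity, by simp only [e]; nlinarith⟩
  have hlim : ∀ {t c d : ℝ}, 0 < t →
      Tendsto (fun n => t ^ (c + d * e n)) atTop (𝓝 (t ^ c)) := fun {t c d} ht => by
    have := (continuousAt_const_rpow (a := t) (b := c) ht.ne').tendsto; refine this.comp ?_
    simpa using (het.const_mul d).const_add c
  have hR := tendsto_ofReal ((((hlim hr (c := y') (d := C0)).const_mul C).mul_const (log r ^ S)))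
  rw [← hR.liminf_eq]; refine le_trans (lintegral_mono_ae ?_) ((lintegral_liminf_le' (fun n =>
    ((measurable_snd.pow_const (θ * (x - e n))).aemeasurable.mul
      (hVm.pow_const (-y + e n))).ennreal_ofReal.restrict)).trans
    (liminf_le_liminf (Eventually.of_forall fun n => hA _ (he n).1 (he n).2)))
  filter_upwards [ae_restrict_of_ae h.V_pos, ae_restrict_of_ae (ae_mem_spaceTime a)] with z h1 h2
  refine le_of_eq (Tendsto.liminf_eq (tendsto_ofReal (Tendsto.mul ?_ ?_))).symm
  · refine (hlim (c := θ * x) (d := -θ) h2.2).congr fun n => ?_; ring_nf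
  · refine (hlim (c := -y) (d := 1) h1).congr fun n => ?_; rw [one_mul]

set_option maxHeartbeats 1000000 in
lemma exists_borderline (h : Ϟ) (hVm : AEMeasurable V ϖ) (hHP : HP2 N o a V p q m) {b : ℝ} (hb1 : (p
  + m - 2 + (q - p - m + 2) / 2) / q ≤ b) (hb2 : 1 / q ≤ b) : ∃ υ ϑ κ B : ℝ, 1 ≤ υ ∧ 1 ≤ ϑ ∧ 0 < κ ∧
  0 ≤ B ∧ ∀ c1, 0 ≤ c1 → ∀ᶠ R in atTop, ∀ (ζ : Ϝ) (α : ℝ), Measurable ζ → (∀ z, 0 ≤ ζ z ∧ ζ z ≤ 1) →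
  α = (log R)⁻¹ → ∫⁻ z, ofReal (ζ z ^ b * (c1 * (profileSlope (κ * α) (R ^ ϑ) (gauge o υ ϑ z) * dist
  o z.1 ^ (ϑ - 1))) ^ p * u z ^ (p + m - 2 - α)) ∂ϖ ≤ (∫⁻ z in Λ υ ϑ R, ofReal (ζ z * (u z ^ (q - α)
  * V z)) ∂ϖ) ^ ((p + m - 2 - α) / (q - α)) * ofReal ((c1 * κ) ^ p * B * (α ^ (p - 1) * exp (1 / (q
  - 1)))) ∧ ∫⁻ z, ofReal (ζ z ^ b * (c1 * (profileSlope (κ * α) (R ^ ϑ) (gauge o υ ϑ z) * max z.2 0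
  ^ (υ - 1))) * u z ^ (1 - α)) ∂ϖ ≤ (∫⁻ z in Λ υ ϑ R, ofReal (ζ z * (u z ^ (q - α) * V z)) ∂ϖ) ^ ((1
  - α) / (q - α)) * ofReal (c1 * κ * B * exp (1 / (q - 1))) ∧ ∫⁻ z, ofReal (ζ z ^ b * (c1 *
  (profileSlope (κ * α) (R ^ ϑ) (gauge o υ ϑ z) * dist o z.1 ^ (ϑ - 1))) ^ p * u z ^ (p + m - 2 + α
  * (p - 1))) ∂ϖ ≤ (∫⁻ z in Λ υ ϑ R, ofReal (ζ z * (u z ^ q * V z)) ∂ϖ) ^ ((p + m - 2 + α * (p - 1))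
  / q) * ofReal ((c1 * κ) ^ p * B * α ^ (p - 1)) ∧ ∫⁻ z, ofReal (ζ z ^ b * (c1 * (profileSlope (κ *
  α) (R ^ ϑ) (gauge o υ ϑ z) * max z.2 0 ^ (υ - 1))) * u z ^ (1 : ℝ)) ∂ϖ ≤ (∫⁻ z in Λ υ ϑ R, ofReal
  (ζ z * (u z ^ q * V z)) ∂ϖ) ^ (1 / q) * ofReal (c1 * κ * B) := by
  obtain ⟨υ, ϑ, C0, C, R0, ε0, h1, h2, hC0, hC, hRR, hee, hHP⟩ := hHP; have hp := h.p_gt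
  have hm := h.m_ge; have hq := h.q_gt; have hq1 := h.q_gt_one
  obtain ⟨d, hd⟩ := @exists_eq _ (q - p - m + 2)
  rw [← hd] at hb1; simp only [← hd] at hHP; have hd0 : 0 < d := by linarith
  have hpm : 0 < p + m - 2 := by linarith
  have hq0 : 0 < q := by linarith
  have hp0 : 0 < p := by linarith
  have hq10 : 0 < q - 1 := by linarith
  have hp10 : 0 < p - 1 := by linarith
  have hS1 : 0 ≤ 1 / (q - 1) := by positivity
  have hS2 : 0 ≤ (p + m - 2) / d := by positivity
  obtain ⟨c, hcd⟩ := @exists_eq _ ((C0 + ϑ * p) * (1 / (q - 1) + 1 / d + 2 * q * (p - 1) / d ^ 2))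
  have hc : 0 ≤ c := by rw [hcd]; positivity
  obtain ⟨κ, hκd⟩ := @exists_eq _ (2 * (c + 1 / (q - 1) + (p + m - 2) / d + 1))
  have hκ : 0 < κ := by rw [hκd]; positivity
  obtain ⟨Γ, hΓ⟩ := @exists_eq _ (q / (q - 1) + 2 * (p * q / d))
  refine ⟨υ, ϑ, κ, 1 + 2 * C * exp (c + ϑ * κ * Γ), h1, h2, hκ, by positivity, fun c1 hcc => ?_⟩
  have hlog : Tendsto (fun R : ℝ => (log R)⁻¹) atTop (𝓝 0) :=
    tendsto_inv_atTop_zero.comp tendsto_log_atTop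
  filter_upwards [eventually_gt_atTop (2 * R0), hlog.eventually_lt_const one_pos,
    hlog.eventually_lt_const hp10, hlog.eventually_lt_const (by positivity : 0 < ε0 * (q - 1)),
    hlog.eventually_lt_const (by positivity : 0 < ε0 * d),
    hlog.eventually_lt_const (by positivity : 0 < d / 2 / (p - 1)),
    hlog.eventually_lt_const (by positivity : 0 < ε0 / (2 * q * (p - 1) / d ^ 2))]
    with R hR hα1 hαp hα3 hα4 hα5 hα6 ζ α hζm hζ hα
  rw [← hα] at hα1 hαp hα3 hα4 hα5 hα6
  have hα0 : 0 < α := by rw [hα]; exact inv_pos.2 (log_pos (by linarith))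
  rw [lt_div_iff₀ hp10] at hα5; rw [lt_div_iff₀ (by positivity)] at hα6
  obtain ⟨α', hα'⟩ := @exists_eq _ (α * (p - 1))
  rw [← hα'] at hα5; have hα'0 : 0 < α' := by rw [hα']; positivity
  have hdα : 0 < d - α' := by linarith
  obtain ⟨ε, hε⟩ := @exists_eq _ (q * α' / (d * (d - α')))
  have hε0 : 0 < ε := by rw [hε]; positivity
  have hεα : ε ≤ α * (2 * q * (p - 1) / d ^ 2) := by
    rw [hε, ← mul_div_assoc, div_le_div_iff₀ (by positivity) (by positivity), hα']
    have : d ≤ 2 * (d - α * (p - 1)) := by rw [← hα']; linarith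
    calc q * (α * (p - 1)) * d ^ 2 = q * (α * (p - 1)) * d * d := by ring
      _ ≤ q * (α * (p - 1)) * d * (2 * (d - α * (p - 1))) := by gcongr
      _ = _ := by ring
  have hqd : q / d + ε = q / (d - α') := by rw [hε]; field_simp; ring
  have hS2q : (p + m - 2) / d + 1 = q / d := by field_simp; linarith
  have hS1q : 1 / (q - 1) + 1 = q / (q - 1) := by field_simp; ring
  have hθp : 0 ≤ C0 + ϑ * p := by positivity
  have hcx : ∀ {x}, x ≤ (1 / (q - 1) + 1 / d + 2 * q * (p - 1) / d ^ 2) * α →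
      (C0 + ϑ * p) * x ≤ c * α := fun hx => by rw [hcd, mul_assoc]; gcongr
  have h3 : 0 ≤ 1 / d * α := by positivity
  have h4 : 0 ≤ 2 * q * (p - 1) / d ^ 2 * α := by positivity
  have h5 : 0 ≤ 1 / (q - 1) * α := by positivity
  have hc1 := hcx (x := α / (q - 1)) (by rw [div_eq_mul_one_div, mul_comm]; linarith)
  have hc2 := hcx (x := α / d) (by rw [div_eq_mul_one_div, mul_comm]; linarith)
  have hc3 := hcx (x := ε) (by linarith); have hpθε : 0 ≤ ϑ * p * ε := by positivity
  have hpq : 0 ≤ p * q / d := by positivity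
  have hqq : 0 ≤ q / (q - 1) := by positivity
  have hκ1 : 2 * (c + 1 / (q - 1) + 1) ≤ κ := by linarith
  have hκ2 : 2 * (c + (p + m - 2) / d + 1) ≤ κ := by linarith
  have hgX : Measurable fun z : M × ℝ => dist o z.1 ^ (ϑ - 1) :=
    (continuous_const.dist continuous_fst).measurable.pow_const _
  have hgT : Measurable fun z : M × ℝ => max z.2 0 ^ (υ - 1) :=
    (measurable_snd.max measurable_const).pow_const _
  have hgX0 : ∀ z : M × ℝ, 0 ≤ dist o z.1 ^ (ϑ - 1) := fun z => by positivity
  have hgT0 : ∀ z : M × ℝ, 0 ≤ max z.2 0 ^ (υ - 1) := fun z => by positivity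
  have hx : α ^ (-(1 / (q - α) * α)) ≤ exp (1 / (q - 1)) := by
    refine (rpow_neg_mul_self_le hα0 (one_div_nonneg.2 (by linarith))).trans (exp_le_exp.2 ?_)
    gcongr
  have hB : 0 ≤ 1 + 2 * C * exp (c + ϑ * κ * Γ) := by positivity
  have hqα : q - α ≠ 0 := by linarith
  have hX1 := h.lintegral_borderline_le hVm hζ hζm hgX hgX0 (k := q - α) (β := p + m - 2 - α)
    (e := p) (γ := p * (q / d - α / d)) (S := (p + m - 2) / d) (Γ := Γ)
    (y := p * q / d * ϑ + C0 * (α / d)) h1 h2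
    (by linarith) (by linarith)
    (le_trans (by rw [div_le_div_iff₀ (by linarith) hq0]; nlinarith) hb1) hp.le
    (by rw [show q - α - (p + m - 2 - α) = d by rw [hd]; ring]; ring)
    (by have : 0 ≤ p * (α / d) := by positivity
        rw [hΓ]; linarith [show p * (q / d - α / d) = p * q / d - p * (α / d) by ring])
    hS2 hc hC.le hRR hR hα hα1.le hκ2 hcc
    (by linarith [show ϑ * (p * (q / d - α / d)) = p * q / d * ϑ - ϑ * p * (α / d) by ring])
    (fun r hr => by
      refine le_of_eq_of_le (lintegral_congr fun z => ?_)
        (hHP r hr (α / d) (by positivity) ((div_lt_iff₀ hd0).2 hα4)).2.1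
      rw [← rpow_mul dist_nonneg, show q - α - (p + m - 2 - α) = d by rw [hd]; ring]; ring_nf)
  have hT1 := h.lintegral_borderline_le hVm hζ hζm hgT hgT0 (k := q - α) (β := 1 - α)
    (e := 1) (γ := q / (q - 1) - α / (q - 1)) (S := 1 / (q - 1)) (Γ := Γ)
    (y := q / (q - 1) * ϑ + C0 * (α / (q - 1))) h1 h2
    (by linarith) (by linarith)
    (le_trans (by rw [div_le_div_iff₀ (by linarith) hq0]; nlinarith) hb2) le_rfl
    (by rw [show q - α - (1 - α) = q - 1 by ring]; ring)
    (by have : 0 ≤ α / (q - 1) := by positivity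
        rw [hΓ]; linarith)
    hS1 hc hC.le hRR hR hα hα1.le hκ1 hcc
    (by have : ϑ * (α / (q - 1)) ≤ ϑ * p * (α / (q - 1)) := by
          gcongr; exact le_mul_of_one_le_right (by linarith) hp.le
        linarith)
    (fun r hr => by
      refine le_of_eq_of_le (lintegral_congr_ae ((ae_restrict_of_ae (ae_mem_spaceTime a)).mono
        fun z hz => ?_))
        (hHP r hr (α / (q - 1)) (by positivity) ((div_lt_iff₀ hq10).2 hα3)).1
      beta_reduce; rw [max_eq_left (le_of_lt hz.2), ← rpow_mul (le_of_lt hz.2),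
        show q - α - (1 - α) = q - 1 by ring]
      ring_nf)
  have hX2 := h.lintegral_borderline_le hVm hζ hζm hgX hgX0 (k := q) (β := p + m - 2 + α')
    (e := p) (γ := p * (q / d + ε)) (S := (p + m - 2) / d) (Γ := Γ)
    (y := p * q / d * ϑ + C0 * ε) h1 h2
    (by linarith) (by linarith)
    (le_trans (by gcongr) hb1) hp.le
    (by rw [show q - (p + m - 2 + α') = d - α' by rw [hd]; ring, hqd])
    (by have h3 : q / (d - α') ≤ q / (d / 2) := by gcongr; linarith
        have h4 := mul_le_mul_of_nonneg_left h3 hp0.le; rw [hqd, hΓ]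
        linarith [show p * (q / (d / 2)) = 2 * (p * q / d) by ring])
    hS2 hc hC.le hRR hR hα hα1.le hκ2 hcc
    (by linarith [show ϑ * (p * (q / d + ε)) = p * q / d * ϑ + ϑ * p * ε by ring])
    (fun r hr => by
      refine le_of_eq_of_le (lintegral_congr fun z => ?_) (hHP r hr ε hε0 (hεα.trans_lt hα6)).2.2
      have e1 : (p + m - 2 + α') / (q - (p + m - 2 + α')) = (p + m - 2) / d + ε := by
        have e2 : p + m - 2 = q - d := by rw [hd]; ring
        rw [e2, show q - (q - d + α') = d - α' by ring, hε]; field_simp; ring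
      rw [← rpow_mul dist_nonneg, e1]; ring_nf)
  have hT2 := h.lintegral_borderline_le hVm hζ hζm hgT hgT0 (k := q) (β := 1)
    (e := 1) (γ := q / (q - 1)) (S := 1 / (q - 1)) (Γ := Γ)
    (y := q / (q - 1) * ϑ) h1 h2 zero_le_one hq1 hb2 le_rfl (one_mul _).symm
    (by rw [hΓ]; linarith) hS1 hc hC.le hRR hR hα hα1.le hκ1 hcc
    (by have := mul_nonneg hc hα0.le; linarith)
    (fun r hr => by
      refine le_of_eq_of_le (lintegral_congr_ae ((ae_restrict_of_ae (ae_mem_spaceTime a)).mono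
        fun z hz => ?_))
        (h.lintegral_time_le_of_forall_pos hVm (by linarith) hee
          fun ε h3 h4 => (hHP r hr ε h3 h4).1)
      beta_reduce; rw [max_eq_left (le_of_lt hz.2), ← rpow_mul (le_of_lt hz.2)])
  refine ⟨?_, ?_, ?_, ?_⟩
  · refine hX1.trans (mul_le_mul_right (ofReal_le_ofReal ?_) _)
    rw [hS2q, show p - q / d * (1 - (p + m - 2 - α) / (q - α)) = p - 1 + -(1 / (q - α) * α) by
      field_simp; rw [hd]; ring, rpow_add hα0]
    gcongr
  · simp only [rpow_one] at hT1; refine hT1.trans (mul_le_mul_right (ofReal_le_ofReal ?_) _)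
    rw [hS1q, show 1 - q / (q - 1) * (1 - (1 - α) / (q - α)) = -(1 / (q - α) * α) by
      field_simp; ring]
    gcongr
  · rw [← hα']; refine hX2.trans (mul_le_mul_right (ofReal_le_ofReal ?_) _)
    rw [hS2q, show p - q / d * (1 - (p + m - 2 + α') / q) = p - 1 + α' / d by
      field_simp; rw [hd]; ring]
    exact mul_le_mul_of_nonneg_left (rpow_le_rpow_of_exponent_ge hα0 hα1.le
      (by have : 0 ≤ α' / d := by positivity
          linarith)) (by positivity)
  · rw [hS1q, show 1 - q / (q - 1) * (1 - 1 / q) = 0 by field_simp; ring, rpow_zero, mul_one] at hT2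
    simpa only [rpow_one] using hT2

variable {b : ℝ} {ζ X T : M × ℝ → ℝ}

/-- The estimate `lintegral_le_of_isControlled` closes up if its right-hand side is controlled by
powers less than one of its left-hand side. -/
lemma bounds_of_isControlled (h : Ϟ) (hζ : IsControlled N p b ζ X T) (hb : 0 < b) (hb1 : b < 1) {α
  DX DT β1 β2 : ℝ} (hα : 0 < α) (hα' : α ≤ 1 / 2) (hαp : α < p - 1) (hDX : 0 ≤ DX) (hDT : 0 ≤ DT)
  (hβ1 : β1 ≤ b) (hβ2 : β2 ≤ b) {I : ℝ≥0∞} (hI : I = ∫⁻ z, ofReal (ζ z * (u z ^ (q - α) * V z)) ∂ϖ)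
  (hX : ∫⁻ z, ofReal (ζ z ^ b * X z ^ p * u z ^ (p + m - 2 - α)) ∂ϖ ≤ max 1 I ^ β1 * ofReal (DX * α
  ^ (p - 1))) (hT : ∫⁻ z, ofReal (ζ z ^ b * T z * u z ^ (1 - α)) ∂ϖ ≤ max 1 I ^ β2 * ofReal DT) {C :
  ℝ≥0∞} (hC : C = ofReal (1 + (K * 2 ^ (p - 1) * DX + 2 * DT))) : max 1 I ≤ C ^ (1 / (1 - b)) ∧
  ofReal (α / 2) * ∫⁻ z, ofReal (ζ z * (u z ^ (-α - 1) * ϵ z)) ∂ϖ ≤ C * (C ^ (1 / (1 - b))) ^ b :=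
  by
  have hK := h.K_nonneg; obtain ⟨h1, h2⟩ := h.lintegral_le_of_isControlled hζ hb hb1.le hα hα' hαp
  have hnn : 0 ≤ K * (α / 2) ^ (1 - p) := by positivity
  have hm1 : (1 : ℝ≥0∞) ≤ max 1 I := le_max_left _ _
  have hζm := hζ.test.locallyLipschitz.continuous.measurable; have hum := h.aemeasurable
  have hrhs : ∫⁻ z, ofReal (K * (α / 2) ^ (1 - p) *
      (ζ z ^ b * X z ^ p * u z ^ (p + m - 2 - α)) + 2 * (ζ z ^ b * T z * u z ^ (1 - α)))
        ∂ϖ ≤ C * max 1 I ^ b := by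
    have e1 : ∀ z, ofReal (K * (α / 2) ^ (1 - p) *
        (ζ z ^ b * X z ^ p * u z ^ (p + m - 2 - α)) + 2 * (ζ z ^ b * T z * u z ^ (1 - α))) =
        ofReal (K * (α / 2) ^ (1 - p)) * ofReal (ζ z ^ b * X z ^ p * u z ^ (p + m - 2 - α)) +
        ofReal 2 * ofReal (ζ z ^ b * T z * u z ^ (1 - α)) := fun z => by
      have := h.nonneg z; have := hζ.nonneg z; have := hζ.X_nonneg z; have := hζ.T_nonneg z
      rw [ofReal_add (by positivity) (by positivity), ofReal_mul hnn, ofReal_mul zero_le_two]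
    have hmX : AEMeasurable (fun z => ofReal (K * (α / 2) ^ (1 - p)) *
        ofReal (ζ z ^ b * X z ^ p * u z ^ (p + m - 2 - α))) ϖ :=
      (((hζm.pow_const _).mul (hζ.X_meas.pow_const _)).aemeasurable.mul
        (hum.pow_const _)).ennreal_ofReal.const_mul _
    rw [lintegral_congr e1, lintegral_add_left' hmX,
      lintegral_const_mul' _ _ ofReal_ne_top, lintegral_const_mul' _ _ ofReal_ne_top]
    calc _ ≤ ofReal (K * (α / 2) ^ (1 - p)) * (max 1 I ^ b * ofReal (DX * α ^ (p - 1))) +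
          ofReal 2 * (max 1 I ^ b * ofReal DT) := by
          refine add_le_add (mul_le_mul_right ?_ _) (mul_le_mul_right ?_ _)
          · exact hX.trans (mul_le_mul_left (ENNReal.rpow_le_rpow_of_exponent_le hm1 hβ1) _)
          · exact hT.trans (mul_le_mul_left (ENNReal.rpow_le_rpow_of_exponent_le hm1 hβ2) _)
      _ = ofReal (K * 2 ^ (p - 1) * DX + 2 * DT) * max 1 I ^ b := by
          have e2 : K * 2 ^ (p - 1) * DX = K * (α / 2) ^ (1 - p) * (DX * α ^ (p - 1)) := by
            have h0 : α ^ (p - 1) ≠ 0 := (rpow_pos_of_pos hα _).ne'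
            rw [div_rpow hα.le zero_le_two, ← neg_sub p 1, rpow_neg hα.le, rpow_neg zero_le_two]
            field_simp
          rw [ofReal_add (by positivity) (by positivity), e2, ofReal_mul hnn,
            ofReal_mul zero_le_two, add_mul]
          ring
      _ ≤ _ := by rw [hC]; exact mul_le_mul_left (ofReal_le_ofReal (by linarith)) _
  have hsplit : ∀ᵐ z ∂ϖ, 0 ≤ ζ z * (u z ^ (q - α) * V z) ∧ 0 ≤ ζ z * (u z ^ (-α - 1) * ϵ z) := by
    filter_upwards [h.V_pos] with z hV; have := h.nonneg z; have := hζ.nonneg z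
    have := h.flux_nonneg _ (norm_nonneg (Z z)); exact ⟨by positivity, by positivity⟩
  have hI1 := hI.trans_le (lintegral_mono_ae (hsplit.mono fun z hz => ofReal_le_ofReal
    (le_add_of_nonneg_right (mul_nonneg (half_pos hα).le hz.2))))
  have hJ1 : ofReal (α / 2) * ∫⁻ z, ofReal (ζ z * (u z ^ (-α - 1) * ϵ z)) ∂ϖ ≤ C * max 1 I ^ b := by
    rw [← lintegral_const_mul' _ _ ofReal_ne_top]
    refine (lintegral_mono_ae (hsplit.mono fun z hz => ?_)).trans (h1.trans hrhs)
    rw [← ofReal_mul (half_pos hα).le]; exact ofReal_le_ofReal (le_add_of_nonneg_left hz.1)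
  have hC1 : 1 ≤ C := by
    rw [hC, ← ofReal_one]; refine ofReal_le_ofReal ?_
    have : 0 ≤ K * 2 ^ (p - 1) * DX + 2 * DT := by positivity
    linarith
  have key := max_one_le_of_le_mul_rpow (ne_top_of_le_ne_top h2 (hI1.trans h1)) hC1 hb hb1
    (hI1.trans (h1.trans hrhs))
  exact ⟨key, hJ1.trans (by gcongr)⟩

lemma exists_estimates [CompleteSpace M] (h : Ϟ) (hVm : AEMeasurable V ϖ) (hHP : HP2 N o a V p q m)
  : ∃ (υ ϑ : ℝ) (C : ℝ≥0∞) (ζ : ℝ → Ϝ), 1 ≤ υ ∧ 1 ≤ ϑ ∧ C ≠ ⊤ ∧ (∀ z ∈ spaceTime M, ∀ᶠ R in atTop, ζ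
  R z = 1) ∧ ∀ᶠ R in atTop, Measurable (ζ R) ∧ ∫⁻ z, ofReal (ζ R z * (u z ^ (q - (log R)⁻¹) * V z))
  ∂ϖ ≤ C ∧ (∫⁻ z in Λ υ ϑ R, ofReal (u z ^ q * V z) ∂ϖ ≤ 1 → ∫⁻ z, ofReal (ζ R z * (u z ^ q * V z))
  ∂ϖ ≤ C * (∫⁻ z in Λ υ ϑ R, ofReal (u z ^ q * V z) ∂ϖ) ^ ((p + m - 2) / q * (1 / p)) + C * (∫⁻ z in
  Λ υ ϑ R, ofReal (u z ^ q * V z) ∂ϖ) ^ (1 / q)) := by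
  have hp := h.p_gt; have hm := h.m_ge; have hq := h.q_gt; have hq1 := h.q_gt_one
  have hK := h.K_nonneg; have hq0 : 0 < q := by linarith
  have hp0 : 0 < p := by linarith
  have hp10 : 0 < p - 1 := by linarith
  obtain ⟨b, hbd⟩ := @exists_eq _ (max ((p + m - 2 + (q - p - m + 2) / 2) / q) (1 / q))
  have hb1 : (p + m - 2 + (q - p - m + 2) / 2) / q ≤ b := hbd ▸ le_max_left _ _
  have hb2 : 1 / q ≤ b := hbd ▸ le_max_right _ _
  have hb0 : 0 < b := lt_of_lt_of_le (by positivity) hb2; have hb : b < 1 := by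
    rw [hbd]; exact max_lt ((div_lt_one hq0).2 (by linarith)) ((div_lt_one hq0).2 hq1)
  clear hbd; obtain ⟨υ, ϑ, κ, B, h1, h2, hκ, hB, hbor⟩ := h.exists_borderline hVm hHP hb1 hb2
  obtain ⟨s, hs⟩ := @exists_eq _ (p / (1 - b))
  have hs0 : 0 < s := by rw [hs]; exact div_pos hp0 (by linarith)
  have hθ1 : 0 ≤ 4 * s * υ := by positivity
  have hθ2 : 0 ≤ 4 * s * ϑ := by positivity
  obtain ⟨DX, hDXd⟩ := @exists_eq _ ((4 * s * ϑ * κ) ^ p * B)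
  obtain ⟨DT, hDTd⟩ := @exists_eq _ (4 * s * υ * κ * B)
  have hDX : 0 ≤ DX := by rw [hDXd]; positivity
  have hDT : 0 ≤ DT := by rw [hDTd]; positivity
  obtain ⟨E, hE⟩ := @exists_eq _ (exp (1 / (q - 1))); have hE0 : 0 ≤ E := by rw [hE]; positivity
  obtain ⟨C, hC⟩ := @exists_eq _ (ofReal (1 + (K * 2 ^ (p - 1) * (DX * E) + 2 * (DT * E))))
  have hCt : C ≠ ⊤ := by rw [hC]; exact ofReal_ne_top
  obtain ⟨M1, hM1⟩ := @exists_eq _ (C ^ (1 / (1 - b))); have hM1t : M1 ≠ ⊤ := by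
    rw [hM1]; exact rpow_ne_top_of_nonneg (by rw [one_div, inv_nonneg]; linarith) hCt
  obtain ⟨M2, hM2⟩ := @exists_eq _ ((2 * (C * M1 ^ b)) ^ ((p - 1) / p) * ofReal (K * DX) ^ (1 / p))
  have hM2t : M2 ≠ ⊤ := by
    rw [hM2]; exact mul_ne_top (rpow_ne_top_of_nonneg (by positivity)
      (mul_ne_top ENNReal.ofNat_ne_top (mul_ne_top hCt (rpow_ne_top_of_nonneg hb0.le hM1t))))
      (rpow_ne_top_of_nonneg (by positivity) ofReal_ne_top)
  refine ⟨υ, ϑ, M1 + M2 + ofReal DT,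
    fun R => cutoff o υ ϑ s (κ * (log R)⁻¹) (R ^ ϑ) (1 / R), h1, h2,
    by simp [hM1t, hM2t], fun z hz => ?_, ?_⟩
  · have hz2 : 0 < z.2 := hz.2
    filter_upwards [eventually_gt_atTop 0, eventually_ge_atTop (2 / z.2),
      (tendsto_rpow_atTop (by linarith : 0 < ϑ)).eventually_ge_atTop (gauge o υ ϑ z)]
      with R hR0 hR hRg
    rw [div_le_iff₀ hz2] at hR
    rw [cutoff, profile, if_pos hRg, mul_one, smoothTransition.one_of_one_le]
    rw [div_div_eq_mul_div, div_one]; linarith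
  have hlog : Tendsto (fun R : ℝ => (log R)⁻¹) atTop (𝓝 0) :=
    tendsto_inv_atTop_zero.comp tendsto_log_atTop
  filter_upwards [eventually_gt_atTop 1, hbor _ hθ1, hbor _ hθ2,
    hlog.eventually_lt_const (by norm_num : (0 : ℝ) < 1 / 2), hlog.eventually_lt_const hp10]
    with R hR1 hbT hbX hα2 hαp
  obtain ⟨α, hα⟩ := @exists_eq _ ((log R)⁻¹)
  rw [← hα] at hα2 hαp ⊢; have hR0 : 0 < R := by linarith
  have hα0 : 0 < α := by rw [hα]; exact inv_pos.2 (log_pos hR1)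
  have hctl := isControlled_cutoff (N := N) (o := o) (η := κ * α) (σ := R ^ ϑ) (τ := 1 / R)
    h1 h2 hp hb0.le hb (by positivity) (rpow_pos_of_pos hR0 _) (by positivity)
  rw [← hs] at hctl; set ζ := cutoff o υ ϑ s (κ * α) (R ^ ϑ) (1 / R)
  have hζm : Measurable ζ := hctl.test.locallyLipschitz.continuous.measurable
  have hζ : ∀ z, 0 ≤ ζ z ∧ ζ z ≤ 1 := fun z => ⟨hctl.nonneg z, hctl.le_one z⟩
  obtain ⟨hX1, -, hX2, -⟩ := hbX ζ α hζm hζ hα; obtain ⟨-, hT1, -, hT2⟩ := hbT ζ α hζm hζ hα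
  rw [← hDXd, ← hE] at hX1; rw [← hDTd, ← hE] at hT1; rw [← hDXd] at hX2; rw [← hDTd] at hT2
  obtain ⟨I, hI⟩ := @exists_eq _ (∫⁻ z, ofReal (ζ z * (u z ^ (q - α) * V z)) ∂ϖ)
  have hIle := (setLIntegral_le_lintegral (Λ υ ϑ R)
    fun z => ofReal (ζ z * (u z ^ (q - α) * V z))).trans
    (hI.symm.le.trans (le_max_right 1 I))
  have hqα : 0 < q - α := by linarith
  obtain ⟨hm1, hJ⟩ := h.bounds_of_isControlled hctl hb0 hb (DX := DX * E) (DT := DT * E)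
    (β1 := (p + m - 2 - α) / (q - α)) (β2 := (1 - α) / (q - α)) hα0 hα2.le hαp (by positivity)
    (by positivity)
    (le_trans (by rw [div_le_div_iff₀ hqα hq0]; nlinarith) hb1)
    (le_trans (by rw [div_le_div_iff₀ hqα hq0]; nlinarith) hb2) hI
    (hX1.trans (mul_le_mul' (ENNReal.rpow_le_rpow hIle (div_nonneg (by linarith) hqα.le))
      (le_of_eq (by ring_nf))))
    (hT1.trans (mul_le_mul' (ENNReal.rpow_le_rpow hIle (div_nonneg (by linarith) hqα.le)) le_rfl))
    hC
  rw [← hM1] at hm1 hJ; refine ⟨hζm, hI.symm.le.trans (((le_max_right _ _).trans hm1).trans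
    (le_add_right (le_add_right le_rfl))), fun hT1 => ?_⟩
  have hTle : ∫⁻ z in Λ υ ϑ R, ofReal (ζ z * (u z ^ q * V z))
      ∂ϖ ≤ ∫⁻ z in Λ υ ϑ R, ofReal (u z ^ q * V z)
      ∂ϖ := by
    refine lintegral_mono_ae ((ae_restrict_of_ae h.V_pos).mono fun z hz =>
      ofReal_le_ofReal (mul_le_of_le_one_left ?_ (hζ z).2))
    exact mul_nonneg (rpow_nonneg (h.nonneg z) _) hz.le
  set Δ := ∫⁻ z in Λ υ ϑ R, ofReal (u z ^ q * V z) ∂ϖ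
  refine (h.lintegral_potential_le_of_isControlled hctl hb0 hb.le α).trans (add_le_add ?_ ?_)
  · set J := ∫⁻ z, ofReal (ζ z * (u z ^ (-α - 1) * ϵ z)) ∂ϖ; have hp' : 0 ≤ 1 / p := by positivity
    have hp'' : 0 ≤ (p - 1) / p := by positivity
    have hJ2 : ofReal α * J ≤ 2 * (C * M1 ^ b) := by
      calc ofReal α * J = 2 * (ofReal (α / 2) * J) := by
            rw [← mul_assoc, ← ENNReal.ofReal_ofNat, ← ofReal_mul zero_le_two,
              mul_div_cancel₀ _ two_ne_zero]
        _ ≤ _ := by gcongr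
    have e1 : ∫⁻ z, ofReal (K * (ζ z ^ b * (4 * s * ϑ * (profileSlope (κ * α) (R ^ ϑ)
        (gauge o υ ϑ z) * dist o z.1 ^ (ϑ - 1))) ^ p * u z ^ (p + m - 2 + α * (p - 1))))
        ∂ϖ ≤
        ofReal α ^ (p - 1) * (ofReal (K * DX) * Δ ^ ((p + m - 2) / q)) := by
      rw [lintegral_congr fun z => ofReal_mul hK, lintegral_const_mul' _ _ ofReal_ne_top]
      calc _ ≤ ofReal K * (Δ ^ ((p + m - 2) / q) * ofReal (DX * α ^ (p - 1))) := by
            gcongr; refine hX2.trans (mul_le_mul_left ?_ _)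
            have h3 : 0 ≤ α * (p - 1) := by positivity
            refine (ENNReal.rpow_le_rpow hTle (div_nonneg (by linarith) hq0.le)).trans
              (ENNReal.rpow_le_rpow_of_exponent_ge hT1 ?_)
            gcongr; linarith
        _ = _ := by rw [ENNReal.ofReal_rpow_of_pos hα0, ofReal_mul hDX, ofReal_mul hK]; ring
    calc J ^ ((p - 1) / p) * _ ≤ J ^ ((p - 1) / p) * (ofReal α ^ (p - 1) *
          (ofReal (K * DX) * Δ ^ ((p + m - 2) / q))) ^ (1 / p) := by
          gcongr
      _ = (ofReal α * J) ^ ((p - 1) / p) * ofReal (K * DX) ^ (1 / p) *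
          Δ ^ ((p + m - 2) / q * (1 / p)) := by
          rw [mul_rpow_of_nonneg _ _ hp', mul_rpow_of_nonneg _ _ hp',
            mul_rpow_of_nonneg _ _ hp'', ← ENNReal.rpow_mul, ← ENNReal.rpow_mul,
            mul_one_div (p - 1)]
          ring
      _ ≤ M2 * Δ ^ ((p + m - 2) / q * (1 / p)) := by rw [hM2]; gcongr
      _ ≤ _ := by gcongr; exact le_add_right le_add_self
  · refine hT2.trans ?_; rw [mul_comm]
    exact mul_le_mul' le_add_self (ENNReal.rpow_le_rpow hTle (by positivity))

end RegularSolution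

/-- Fatou's lemma along a real parameter. -/
lemma lintegral_le_of_tendsto_real {X : Type*} [MeasurableSpace X] {ν : Measure X} {F : ℝ → X →
  ℝ≥0∞} {g : X → ℝ≥0∞} {c : ℝ → ℝ≥0∞} {c' : ℝ≥0∞} (hF : ∀ᵐ z ∂ν, Tendsto (fun R => F R z) atTop (𝓝
  (g z))) (hm : ∀ᶠ R in atTop, AEMeasurable (F R) ν ∧ ∫⁻ z, F R z ∂ν ≤ c R) (hc : Tendsto c atTop (𝓝
  c')) : ∫⁻ z, g z ∂ν ≤ c' := by
  obtain ⟨R0, h⟩ := eventually_atTop.1 hm; have ht : Tendsto (fun n : ℕ => R0 + n) atTop atTop :=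
    tendsto_atTop_add_const_left _ _ tendsto_natCast_atTop_atTop
  have hR : ∀ n : ℕ, R0 ≤ R0 + n := fun n => le_add_of_nonneg_right n.cast_nonneg
  calc ∫⁻ z, g z ∂ν = ∫⁻ z, liminf (fun n : ℕ => F (R0 + n) z) atTop ∂ν :=
        lintegral_congr_ae (hF.mono fun z hz => (hz.comp ht).liminf_eq.symm)
    _ ≤ liminf (fun n : ℕ => ∫⁻ z, F (R0 + n) z ∂ν) atTop :=
        lintegral_liminf_le' fun n => (h _ (hR n)).1
    _ ≤ liminf (fun n : ℕ => c (R0 + n)) atTop :=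
        liminf_le_liminf (Eventually.of_forall fun n => (h _ (hR n)).2)
    _ = c' := (hc.comp ht).liminf_eq

lemma tendsto_lintegral_gauge_ge {W : M × ℝ → ℝ≥0∞} (hθ2 : 1 ≤ ϑ) (hθ1 : 1 ≤ υ)
  (hW : AEMeasurable W ϖ) (hWt : ∫⁻ z, W z ∂ϖ ≠ ⊤) :
  Tendsto (fun R : ℝ => ∫⁻ z in {z | R ^ ϑ ≤ ϙ z}, W z ∂ϖ) atTop (𝓝 0) := by
  have hg : Continuous ϙ :=
    ((continuous_const.dist continuous_fst).rpow_const fun _ => Or.inr (by linarith)).add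
      (continuous_snd.rpow_const fun _ => Or.inr (by linarith))
  have hms : ∀ R : ℝ, MeasurableSet {z : M × ℝ | R ^ ϑ ≤ ϙ z} := fun R =>
    measurableSet_le measurable_const hg.measurable
  simp_rw [← lintegral_indicator (hms _)]
  rw [← lintegral_zero (μ := ϖ)]; refine tendsto_lintegral_filter_of_dominated_convergence' W
    (Eventually.of_forall fun R => hW.indicator (hms R))
    (Eventually.of_forall fun R => ae_of_all _ fun z => indicator_le_self _ W z) hWt
    (ae_of_all _ fun z => ?_)
  refine (tendsto_const_nhds (x := (0 : ℝ≥0∞))).congr' ?_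
  filter_upwards [(tendsto_rpow_atTop (by linarith : 0 < ϑ)).eventually_gt_atTop (ϙ z)] with R hR
  exact (indicator_of_notMem (s := {z | R ^ ϑ ≤ ϙ z}) (fun h' => absurd h' (not_le.2 hR)) W).symm

lemma RegularSolution.ae_eq_zero [CompleteSpace M] (h : Ϟ) (hVm : AEMeasurable V ϖ) (hHP : HP2 N o a
  V p q m) : ∀ᵐ z ∂ϖ, u z = 0 := by
  have hp := h.p_gt; have hm := h.m_ge; have hq1 := h.q_gt_one
  obtain ⟨υ, ϑ, C, ζ, hθ1, hθ2, hC, hζ, hR⟩ := h.exists_estimates hVm hHP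
  have hum := h.aemeasurable; have hζ' : ∀ᵐ z ∂ϖ, Tendsto (fun R => ζ R z) atTop (𝓝 1) := by
    filter_upwards [ae_mem_spaceTime a] with z hz
    exact tendsto_const_nhds.congr' ((hζ z hz).mono fun _ h' => h'.symm)
  have hfin : ∫⁻ z, ofReal (u z ^ q * V z) ∂ϖ ≤ C := by
    refine lintegral_le_of_tendsto_real (c := fun _ => C)
      (F := fun R z => ofReal (ζ R z * (u z ^ (q - (log R)⁻¹) * V z))) ?_ ?_
      tendsto_const_nhds
    · filter_upwards [hζ'] with z hz; refine tendsto_ofReal ?_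
      have hl : Tendsto (fun R => q - (log R)⁻¹) atTop (𝓝 q) := by
        simpa using (tendsto_inv_atTop_zero.comp tendsto_log_atTop).const_sub q
      simpa using hz.mul (((tendsto_const_nhds (x := u z)).rpow hl (Or.inr (by linarith))).mul_const (V z))
    · filter_upwards [hR] with R hR
      exact ⟨(hR.1.aemeasurable.mul ((hum.pow_const _).mul hVm)).ennreal_ofReal, hR.2.1⟩
  have hT := tendsto_lintegral_gauge_ge (o := o) hθ2 hθ1
    ((hum.pow_const q).mul hVm).ennreal_ofReal (hfin.trans_lt hC.lt_top).ne
  have hpow : ∀ {s : ℝ}, 0 < s → Tendsto (fun R : ℝ => C * (∫⁻ z in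
      {z | R ^ ϑ ≤ gauge o υ ϑ z}, ofReal (u z ^ q * V z) ∂ϖ) ^ s)
      atTop (𝓝 0) := fun {s} hs => by
    have := ENNReal.Tendsto.const_mul
      (((ENNReal.continuous_rpow_const (y := s)).tendsto 0).comp hT) (Or.inr hC)
    simpa [zero_rpow_of_pos hs] using this
  have hsum := (hpow (s := (p + m - 2) / q * (1 / p))
    (mul_pos (div_pos (by linarith) (by linarith)) (by positivity))).add
    (hpow (s := 1 / q) (by positivity))
  rw [add_zero] at hsum; have hzero : ∫⁻ z, ofReal (u z ^ q * V z) ∂ϖ ≤ 0 := by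
    refine lintegral_le_of_tendsto_real
      (F := fun R z => ofReal (ζ R z * (u z ^ q * V z))) ?_ ?_ hsum
    · filter_upwards [hζ'] with z hz; simpa using tendsto_ofReal (hz.mul_const (u z ^ q * V z))
    · filter_upwards [hR, hT.eventually_le_const one_pos] with R hR hT1
      exact ⟨(hR.1.aemeasurable.mul ((hum.pow_const _).mul hVm)).ennreal_ofReal, hR.2.2 hT1⟩
  have h0 := (lintegral_eq_zero_iff' ((hum.pow_const q).mul hVm).ennreal_ofReal).1
    (nonpos_iff_eq_zero.1 hzero)
  filter_upwards [h0, h.V_pos] with z hz hV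
  by_contra hne
  exact absurd (ENNReal.ofReal_eq_zero.1 hz) (not_le.2 (mul_pos (rpow_pos_of_pos
    ((h.nonneg z).lt_of_ne' hne) _) hV))

end RiemannianParabolic

end

theorem theorem2 {N : ℕ} {M : Type*} [MetricSpace M] [SecondCountableTopology M]
    [ChartedSpace (EuclideanSpace ℝ (Fin N)) M] [IsManifold (𝓡 N) ∞ M]
    [RiemannianBundle (fun x : M ↦ TangentSpace (𝓡 N) x)]
    [IsContMDiffRiemannianBundle (𝓡 N) ∞ (EuclideanSpace ℝ (Fin N))
      (fun x : M ↦ TangentSpace (𝓡 N) x)]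
    [IsRiemannianManifold (𝓡 N) M] [CompleteSpace M] [NoncompactSpace M]
    [MeasurableSpace M] [BorelSpace M]
    (x₀ : M) (p q m K : ℝ) (hp : 1 < p) (hm : 1 ≤ m) (hq : max (p + m - 2) 1 < q) (hK : 0 < K)
    (V : M × ℝ → ℝ)
    (hV_pos : ∀ᵐ z ∂(RiemannianParabolic.stMeasure N M), 0 < V z)
    (hV_loc : LocallyIntegrableOn V (RiemannianParabolic.spaceTime M)
      (RiemannianParabolic.stMeasure N M))
    (f : ℝ → ℝ) (hf_meas : Measurable f) (hf : ∀ s, 0 ≤ s → 0 ≤ f s ∧ f s ≤ K)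
    (a : M → ℝ) (ha_lip : LocallyLipschitz a)
    (ha_pos : ∀ᵐ x ∂(RiemannianParabolic.riemannianVolume N M), 0 < a x)
    (hHP2 : RiemannianParabolic.HP2 N x₀ a V p q m)
    (u : M × ℝ → ℝ) (hu : RiemannianParabolic.IsWeakSolution N a V f p q m u) :
    ∀ᵐ z ∂(RiemannianParabolic.stMeasure N M), u z = 0 := by
  obtain ⟨Z, D, hu⟩ := hu
  have hac := RiemannianParabolic.wstMeasure_absolutelyContinuous (N := N) ha_lip.continuous
  have hVm := hV_loc.aestronglyMeasurable.aemeasurable.mono_ac (hac.restrict _)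
  rw [RiemannianParabolic.wstMeasure_restrict_spaceTime] at hVm
  have h : RiemannianParabolic.RegularSolution N a V f p q m K (fun z => max (u z) 0) Z D :=
    ⟨hu.max_zero ha_lip.continuous, fun z => le_max_right _ _, ha_lip, ha_pos, hp, hm,
      (le_max_left _ _).trans_lt hq, (le_max_right _ _).trans_lt hq, hf_meas,
      fun s hs => (hf s hs).1, fun s hs => (hf s hs).2, hac.ae_le hV_pos⟩
  have h0 := (RiemannianParabolic.stMeasure_absolutelyContinuous ha_lip.continuous ha_pos).ae_le
    (h.ae_eq_zero hVm hHP2)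
  filter_upwards [h0, hu.nonneg] with z h1 h2
  rwa [max_eq_left h2] at h1
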